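/- **Setting.** Let $\nu\ge1$, $s_0=[\frac{\nu+1}2]+2$, $\tau>0$, $\alpha\in(0,1)$, $\varrho=6\tau+4$, $\beta=\varrho+1$, $\Lambda=2\tau+2+\varrho$, $\tau_0>\nu-1$. Write $\langle x\rangle=\max\{1,|x|\}$, $\langle\ell,h\rangle=\max\{1,|\ell|,|h|\}$ ($|\ell|$ Euclidean). Let $q\in C^\infty(\mathbb T,\mathbb R)$, and let $(\psi_j)_{j\in\mathbb Z}$ be an orthonormal basis of $L^2(\mathbb T)$ with $(-\partial_{xx}+q)\psi_j=\lambda_j^2\psi_j$, $\lambda_j>0$, $(\lambda_j^2-j^2-\frac1{2\pi}\int_{\mathbb T} q)_j\in\ell^2(\mathbb Z)$ and $\lambda_j\neq\lambda_k$ if $|j|\ne|k|$; put $B\psi_j=\lambda_j\psi_j$. Let $v\in H^S(\mathbb T^{\nu}\times\mathbb T,\mathbb R)$ with $\int_{\mathbb T^\nu} v(\varphi,x)\,d\varphi=0$, and let $\chi$ be an even nonnegative smooth cut-off with $\chi=0$ on $|\xi|\le\frac13$, $\chi=1$ on $|\xi|\ge\frac23$ and $\chi'>0$ on $(\frac13,\frac23)$.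 Let $M\ge1$, $\gamma,\gamma_0\in(0,1)$, $R_M=\{\omega\in\mathbb R^\nu: M\le|\omega|\le 2M\}$. Operators $A(\varphi)$ are identified with their matrices $A_j^k(\ell)$ in the basis $e^{i\ell\cdot\varphi}\psi_j(x)$; $[n]=\{n,-n\}$, $A_{[n]}^{[m]}(\ell)=(A_j^k(\ell))_{j\in[n],k\in[m]}$, $\langle D\rangle\psi_j=\langle j\rangle\psi_j$, $\bar A u=\overline{A\bar u}$, and $|A|_s^2=\sum_{h\in\mathbb N_0,\ell\in\mathbb Z^\nu}\langle\ell,h\rangle^{2s}\sup_{|n-m|=h}\|A_{[n]}^{[m]}(\ell)\|_{HS}^2$. For a family $f(\omega)$, $\omega\in R_M$, and a norm $|\cdot|$, set $|f|^{\rm Lip}=\sup_\omega|f(\omega)|+\frac{\gamma}{M^\alpha}\sup_{\omega_1\ne\omega_2}\frac{|f(\omega_1)-f(\omega_2)|}{|\omega_1-\omega_2|}$. For $\mathbf A=\begin{pmatrix}A^d&A^o\\-\overline{A^o}&-\overline{A^d}\end{pmatrix}$, $|\mathbf A|^{\rm Lip}_{s,a,b}$ is the sum of the distinct terms among $|\langle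 D\rangle^{a}A^d|_s^{\rm Lip}$, $|A^d\langle D\rangle^{a}|_s^{\rm Lip}$, $|\langle D\rangle^{b}A^o|_s^{\rm Lip}$, $|A^o\langle D\rangle^{b}|_s^{\rm Lip}$ and $|\langle D\rangle^{\varsigma}A^\delta\langle D\rangle^{-\varsigma}|_s^{\rm Lip}$, $\varsigma\in\{\pm a,\pm b,0\}$, $\delta\in\{d,o\}$; $\mathbf A$ is Hamiltonian if $(A^d)^*=A^d$ and $(A^o)^*=\overline{A^o}$. The initial Hamiltonian (the one after the Magnus normal form) is $\mathbf H^{(0)}=\begin{pmatrix}B&0\\0&-B\end{pmatrix}+\mathbf V^{(0)}(\omega;\omega t)$, $V^{d,(0)}=i[Y,B]+2YBY$, $V^{o,(0)}=-i(YB+BY)+2YBY$, where $Y(\omega;\varphi)=\sum_\ell \frac{\chi(\omega\cdot\ell\,\langle\ell\rangle^{\tau_0}/(\gamma_0M))}{i\,\omega\cdot\ell}\,\tfrac12B^{-1/2}\hat v(\ell,\cdot)B^{-1/2}e^{i\ell\cdot\varphi}$ (zero for $\omega\cdot\ell=0$). That a $\varphi$-dependent invertible $\Phi$ conjugates $\mathbf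 H$ to $\mathbf H'$ means $\Phi^{-1}(-i\omega\cdot\partial_\varphi+\mathbf H)\Phi=-i\omega\cdot\partial_\varphi+\mathbf H'$ as operators on $L^2(\mathbb T^{\nu+1})^2$. Given $N_0$, let $N_{-1}=1$, $N_p=N_0^{(3/2)^p}$. For self-adjoint blocks $H_{[n]}$ let $G^\pm_{\ell,n,m}X=(\omega\cdot\ell)X+H_{[n]}X\pm XH_{[m]}$, and $\Omega_0=\{\omega\in R_M:|\omega\cdot\ell|\ge\gamma_0M\langle\ell\rangle^{-\tau_0}\ \forall\ell\neq0\}$. **Theorem.** There is $N_0=N_0(\nu,\tau,\alpha)\in\mathbb N$, a $\sigma>0$ depending only on $\nu,\tau,\alpha,\tau_0$, and a constant $C>0$ that does not depend on $v,S,\chi,M,\gamma,\gamma_0$, such that, if $S\ge s_0+\sigma$, there is $K>0$ independent of $M,\gamma,\gamma_0$ for which the following holds. Assume $$C\,N_0^{\Lambda}\,\frac{M^\alpha}{\gamma}\,|\mathbf V^{(0)}|^{\rm Lip}_{s_0+\beta,\alpha,0}\le1 .$$ 1. *(KAM iteration)* There are, for $p\ge0$ and $\omega\in R_M$, block diagonal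 self-adjoint $H_0^{(p)}(\omega)=\mathrm{diag}_n\{(H_0^{(p)})_{[n]}\}$, $H_0^{(0)}=B$, and Hamiltonian $\mathbf V^{(p)}$, $\mathbf X^{(p)}$, starting from $\mathbf V^{(0)}$, with $(H_0^{(p+1)})_{[n]}=(H_0^{(p)})_{[n]}+(V^{d,(p)})_{[n]}^{[n]}(0)$, such that $\mathbf X^{(p)}$ has only frequencies $|\ell|\le N_p$, $(X^{d,(p)})_{[n]}^{[n]}(0)=0$ and, for $\omega\in\Omega_{p+1}$, $\mathbf X^{(p)}$ solves the homological equation $-i[\mathbf X^{(p)},\mathbf H_0^{(p)}]+\omega\cdot\partial_\varphi\mathbf X^{(p)}+\Pi_{|\ell|\le N_p}\mathbf V^{(p)}=\mathbf H_0^{(p+1)}-\mathbf H_0^{(p)}$ and $e^{i\mathbf X^{(p)}}$ conjugates $\mathbf H^{(p)}=\mathbf H^{(p)}_0+\mathbf V^{(p)}$ to $\mathbf H^{(p+1)}$, where $\mathbf H_0^{(p)}=\begin{pmatrix}H_0^{(p)}&0\\0&-\overline{H_0^{(p)}}\end{pmatrix}$. Here $\Omega_{p+1}$ is the set of $\omega\in\Omega_p$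 such that, with $H=H_0^{(p)}(\omega)$, $\|(G^\pm_{\ell,n,m})^{-1}\|\le \frac{2N_p^\tau}{\gamma}\frac{M^\alpha}{\langle n\pm m\rangle^\alpha}$ for all $|\ell|\le N_p$, $n,m\in\mathbb N_0$ (with $(\ell,n,m)\ne(0,n,n)$ for the sign $-$). Moreover, for all $p$ and $n$, $\langle n\rangle^\alpha\|(H_0^{(p)}-H_0^{(0)})_{[n]}\|_{HS}^{\rm Lip}\le K(\gamma_0M)^{-1}$, $\langle n\rangle^\alpha\|(H_0^{(p+1)}-H_0^{(p)})_{[n]}\|_{HS}^{\rm Lip}\le K(\gamma_0M)^{-1}N_{p-1}^{-\varrho}$, $|\mathbf V^{(p)}|^{\rm Lip}_{s_0,\alpha,0}\le N_{p-1}^{-\varrho}|\mathbf V^{(0)}|^{\rm Lip}_{s_0+\beta,\alpha,0}$, $|\mathbf V^{(p)}|^{\rm Lip}_{s_0+\beta,\alpha,0}\le N_{p-1}|\mathbf V^{(0)}|^{\rm Lip}_{s_0+\beta,\alpha,0}$, $|\mathbf X^{(p)}|^{\rm Lip}_{s_0,\alpha,\alpha}\le K\frac{M^\alpha}{\gamma}N_p^{2\tau+1}N_{p-1}^{-\varrho}|\mathbf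 V^{(0)}|^{\rm Lip}_{s_0+\beta,\alpha,0}$. 2. *(Convergence)* For every $\omega\in R_M$ the maps $\mathcal W_0=\mathrm{Id}$, $\mathcal W_p=e^{i\mathbf X^{(0)}}\circ\cdots\circ e^{i\mathbf X^{(p-1)}}$ converge in $\mathcal L(H^r(\mathbb T^{\nu+1})\times H^r(\mathbb T^{\nu+1}))$, for all $r\in[0,s_0]$, to an invertible $\varphi$-dependent operator $\mathcal W_\infty(\omega)$, and for all $p\ge 0$ $$\|\mathcal W_\infty^{\pm1}-\mathcal W_p^{\pm1}\|_{\mathcal L(H^r\times H^r)}\le K\,\frac{M^\alpha}{\gamma}\,(\gamma_0M)^{-1}N_p^{2\tau+1}N_{p-1}^{-\varrho}.$$ 3. *(Final blocks)* There is a block diagonal self-adjoint $H_0^{(\infty)}(\omega)$, $\omega\in R_M$, with $\sup_n\langle n\rangle^\alpha\|(H_0^{(\infty)}-H_0^{(p)})_{[n]}\|^{\rm Lip}_{HS}\le K(\gamma_0M)^{-1}N_{p-1}^{-\varrho}$ for all $p\ge0$. 4. *(Reducibility)* Let $\Omega_\infty$ be the set of $\omega\in\Omega_0$ such that, with $H=H_0^{(\infty)}(\omega)$,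 $\|(G^\pm_{\ell,n,m})^{-1}\|\le\frac{\langle\ell\rangle^\tau}{\gamma}\frac{M^\alpha}{\langle n\pm m\rangle^\alpha}$ for all $\ell,n,m$ (with $(\ell,n,m)\neq(0,n,n)$ for the sign $-$). Then $\Omega_\infty\subseteq\bigcap_p\Omega_p$, and for $\omega\in\Omega_\infty$ the map $\mathcal W_\infty(\omega)$ conjugates $\mathbf H^{(0)}$ to the time-independent operator $\mathbf H_0^{(\infty)}(\omega)=\begin{pmatrix}H_0^{(\infty)}&0\\0&-\overline{H_0^{(\infty)}}\end{pmatrix}$. 5. *(Eigenvalues)* For all $\omega\in R_M$, $n\in\mathbb N_0$ the eigenvalues $\lambda_{n,-}^{(\infty)}(\omega)\le\lambda_{n,+}^{(\infty)}(\omega)$ of the block $(H_0^{(\infty)}(\omega))_{[n]}$ are real and positive, and $\sup_n\langle n\rangle^\alpha|\lambda^{(\infty)}_{n,\pm}-\lambda_{n,\pm}|^{\rm Lip}\le K(\gamma_0M)^{-1}$, where $\lambda_{n,-}\le\lambda_{n,+}$ are $\lambda_n,\lambda_{-n}$ in increasing order (both equal to $\lambda_n$ if $\lambda_n=\lambda_{-n}$).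 -/

import Mathlib

open scoped ENNReal ComplexConjugate

noncomputable section

namespace KAM

/-! ### Spaces -/

instance twoPiPos : Fact (0 < 2 * Real.pi) := ⟨Real.two_pi_pos⟩

/-- The one-dimensional torus `ℝ / 2πℤ`. -/
abbrev Circ : Type := AddCircle (2 * Real.pi)

/-- `L²(𝕋)`, with respect to the normalized Lebesgue measure. -/
abbrev L2x : Type :=
  MeasureTheory.Lp ℂ 2 (AddCircle.haarAddCircle : MeasureTheory.Measure Circ)

/-- `L²(𝕋^ν × 𝕋)`: the element `u` is the function `u(φ,x) = ∑_ℓ u_ℓ(x) e^{iℓ·φ}`. -/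
abbrev L2 (ν : ℕ) : Type := lp (fun _ : Fin ν → ℤ => L2x) 2

/-- Frequency vectors. -/
abbrev Freq (ν : ℕ) : Type := EuclideanSpace ℝ (Fin ν)

/-- `ω · ℓ`. -/
def dot {ν : ℕ} (ω : Freq ν) (ℓ : Fin ν → ℤ) : ℝ := ∑ i, ω i * (ℓ i : ℝ)

/-- The Euclidean norm `|ℓ|` of an integer vector. -/
def absZ {ν : ℕ} (ℓ : Fin ν → ℤ) : ℝ := Real.sqrt (∑ i, (ℓ i : ℝ) ^ 2)

/-- `⟨x⟩ = max {1, |x|}`. -/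
def br (x : ℝ) : ℝ := max 1 |x|

/-- `⟨ℓ, h⟩ = max {1, |ℓ|, |h|}`. -/
def br2 {ν : ℕ} (ℓ : Fin ν → ℤ) (h : ℤ) : ℝ := max 1 (max (absZ ℓ) |(h : ℝ)|)

/-- The closed annulus `M ≤ |ω| ≤ 2M`. -/
def annulus (ν : ℕ) (M : ℝ) : Set (Freq ν) := {ω | M ≤ ‖ω‖ ∧ ‖ω‖ ≤ 2 * M}

/-- The threshold regularity `s₀ = [(ν+1)/2] + 2`. -/
def sZero (ν : ℕ) : ℕ := (ν + 1) / 2 + 2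

/-- The Sobolev norm `‖u‖_r` (through the exponential basis), `∞` if `u ∉ H^r(𝕋^{ν+1})`. -/
def sobNorm {ν : ℕ} (r : ℝ) (u : L2 ν) : ℝ≥0∞ :=
  (∑' a : (Fin ν → ℤ) × ℤ, ENNReal.ofReal (br2 a.1 a.2 ^ (2 * r)) *
    ‖fourierCoeff (u a.1 : Circ → ℂ) a.2‖ₑ ^ 2) ^ (1 / 2 : ℝ)

/-- The norm of `H^r × H^r`. -/
def sobNorm2 {ν : ℕ} (r : ℝ) (u : L2 ν × L2 ν) : ℝ≥0∞ :=
  (sobNorm r u.1 ^ 2 + sobNorm r u.2 ^ 2) ^ (1 / 2 : ℝ)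

/-- For `r ≥ 0`, the operator norm in `𝓛(H^r × H^r)` of (the restriction to `H^r × H^r` of) an
operator on `L² × L²`; it is `∞` if there is no bound. -/
def opNorm {ν : ℕ} (r : ℝ) (T : (L2 ν × L2 ν) →L[ℂ] (L2 ν × L2 ν)) : ℝ≥0∞ :=
  sInf {C : ℝ≥0∞ | ∀ u, sobNorm2 r u ≠ ⊤ → sobNorm2 r (T u) ≤ C * sobNorm2 r u}

/-- The norm `sup_{ω ∈ R} N(f(ω)) + w · sup_{ω₁ ≠ ω₂} N(f(ω₁) - f(ω₂)) / |ω₁ - ω₂|`. -/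
def lipNorm {ν : ℕ} {X : Type*} [Sub X] (R : Set (Freq ν)) (w : ℝ) (N : X → ℝ≥0∞)
    (f : Freq ν → X) : ℝ≥0∞ :=
  (⨆ ω ∈ R, N (f ω)) +
    ENNReal.ofReal w * ⨆ ω₁ ∈ R, ⨆ ω₂ ∈ R, ⨆ _ : ω₁ ≠ ω₂, N (f ω₁ - f ω₂) / ‖ω₁ - ω₂‖ₑ

/-! ### The Schrödinger operator -/

/-- `ψ` is an orthonormal basis of `L²(𝕋)` of eigenfunctions of `L_q = -∂_xx + q` with positive
eigenvalues `lam j ^ 2 = j² + ⟨q⟩ + d(j)`, `d ∈ ℓ²(ℤ)`, and eigenfunctions of different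
blocks `{ψ_n, ψ_{-n}}` belong to different eigenvalues. -/
structure IsEigenbasis (q : Circ → ℝ) (ψ : HilbertBasis ℤ ℂ L2x) (lam : ℤ → ℝ) : Prop where
  pos : ∀ j, 0 < lam j
  eigen : ∀ j, ∃ f : Circ → ℂ, (ψ j : Circ → ℂ) =ᵐ[AddCircle.haarAddCircle] f ∧
    ContDiff ℝ 2 (fun x : ℝ => f (x : Circ)) ∧
    ∀ x : ℝ, -(iteratedDeriv 2 (fun y : ℝ => f (y : Circ)) x) + (q (x : Circ) : ℂ) * f (x : Circ)
      = ((lam j ^ 2 : ℝ) : ℂ) * f (x : Circ)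
  asymp : Summable fun j : ℤ =>
    (lam j ^ 2 - (j : ℝ) ^ 2 - ∫ x, q x ∂(AddCircle.haarAddCircle : MeasureTheory.Measure Circ)) ^ 2
  sep : ∀ j k : ℤ, j.natAbs ≠ k.natAbs → lam j ≠ lam k

/-! ### Matrices of operators in the eigenfunction basis -/

/-- The coefficient `u^{ℓ,j}` of `u = ∑ u^{ℓ,j} e^{iℓ·φ} ψ_j(x)`. -/
def coef {ν : ℕ} (ψ : HilbertBasis ℤ ℂ L2x) (u : L2 ν) (ℓ : Fin ν → ℤ) (j : ℤ) : ℂ :=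
  ψ.repr (u ℓ) j

/-- Matrices `A j k = A_j^k` of `φ`-independent operators. -/
abbrev Mat : Type := ℤ → ℤ → ℂ

/-- Matrices `A ℓ j k = A_j^k(ℓ)` of `φ`-dependent operators `A(φ) = ∑_ℓ A(ℓ) e^{iℓ·φ}`. -/
abbrev Op (ν : ℕ) : Type := (Fin ν → ℤ) → Mat

/-- The index block `[n] = {n, -n}`. -/
def blk (n : ℕ) : Finset ℤ := {(n : ℤ), -(n : ℤ)}

/-- The diagonal block `A_{[n]}^{[n]}`. -/
def block (A : Mat) (n : ℕ) : Matrix (blk n) (blk n) ℂ := Matrix.of fun a b => A a b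

/-- The squared Hilbert–Schmidt norm of `A_{[n]}^{[m]}`. -/
def hsSq (A : Mat) (n m : ℕ) : ℝ≥0∞ := ∑ j ∈ blk n, ∑ k ∈ blk m, ‖A j k‖ₑ ^ 2

/-- The Hilbert–Schmidt norm of `A_{[n]}^{[n]}`. -/
def hsBlock (n : ℕ) (A : Mat) : ℝ≥0∞ := (hsSq A n n) ^ (1 / 2 : ℝ)

/-- The matrix of `Ā u = conj (A (conj u))`. With `conj ψ_k = ∑_j c j k • ψ_j`, the coefficients
`c j k` vanish unless `j`, `k` are in the same block (a block spans an `L_q`-invariant space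
which is stable under conjugation), so the sums run over blocks. -/
def conjMat (ψ : HilbertBasis ℤ ℂ L2x) (A : Mat) : Mat := fun j k =>
  ∑ j₁ ∈ blk j.natAbs, ∑ k₁ ∈ blk k.natAbs,
    (∫ x, conj ((ψ j : Circ → ℂ) x) * conj ((ψ j₁ : Circ → ℂ) x) ∂AddCircle.haarAddCircle) *
      conj (A j₁ k₁) *
      conj (∫ x, conj ((ψ k₁ : Circ → ℂ) x) * conj ((ψ k : Circ → ℂ) x) ∂AddCircle.haarAddCircle)

/-- The matrix of the conjugate of a `φ`-dependent operator. -/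
def conjOp {ν : ℕ} (ψ : HilbertBasis ℤ ℂ L2x) (A : Op ν) : Op ν := fun ℓ => conjMat ψ (A (-ℓ))

/-- The matrix of `⟨D⟩^a A ⟨D⟩^b`. -/
def weighted {ν : ℕ} (a b : ℝ) (A : Op ν) : Op ν := fun ℓ j k =>
  ((br j ^ a : ℝ) : ℂ) * A ℓ j k * ((br k ^ b : ℝ) : ℂ)

/-- The `s`-decay norm `|A|_s`. -/
def decayNorm {ν : ℕ} (s : ℝ) (A : Op ν) : ℝ≥0∞ :=
  (∑' a : ℕ × (Fin ν → ℤ), ENNReal.ofReal (br2 a.2 a.1 ^ (2 * s)) *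
    ⨆ n : ℕ, ⨆ m : ℕ, ⨆ _ : ((m : ℤ) - n).natAbs = a.1, hsSq (A a.2) n m) ^ (1 / 2 : ℝ)

/-- The bounded operator `T` on `L²(𝕋^{ν+1})` acts by the matrix `A`. -/
def Realizes {ν : ℕ} (ψ : HilbertBasis ℤ ℂ L2x) (A : Op ν) (T : L2 ν →L[ℂ] L2 ν) : Prop :=
  ∀ (u : L2 ν) (ℓ : Fin ν → ℤ) (j : ℤ),
    HasSum (fun a : (Fin ν → ℤ) × ℤ => A (ℓ - a.1) j a.2 * coef ψ u a.1 a.2) (coef ψ (T u) ℓ j)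

open Classical in
/-- The bounded operator on `L²(𝕋^{ν+1})` with matrix `A` (zero if there is none). -/
def toCLM {ν : ℕ} (ψ : HilbertBasis ℤ ℂ L2x) (A : Op ν) : L2 ν →L[ℂ] L2 ν :=
  if h : ∃ T, Realizes ψ A T then h.choose else 0

/-- An operator matrix `(A^d, A^o; -conj A^o, -conj A^d)`, given by its first row. -/
structure OpMat (ν : ℕ) where
  d : Op ν
  o : Op ν

instance {ν : ℕ} : Sub (OpMat ν) := ⟨fun A B => ⟨A.d - B.d, A.o - B.o⟩⟩

/-- The operator matrix `(A^d, A^o; -conj A^o, -conj A^d)` acting on `L² × L²`. -/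
def OpMat.toCLM {ν : ℕ} (ψ : HilbertBasis ℤ ℂ L2x) (A : OpMat ν) :
    (L2 ν × L2 ν) →L[ℂ] (L2 ν × L2 ν) :=
  ((KAM.toCLM ψ A.d).comp (ContinuousLinearMap.fst ℂ (L2 ν) (L2 ν)) +
      (KAM.toCLM ψ A.o).comp (ContinuousLinearMap.snd ℂ (L2 ν) (L2 ν))).prod
    (-((KAM.toCLM ψ (conjOp ψ A.o)).comp (ContinuousLinearMap.fst ℂ (L2 ν) (L2 ν)) +
      (KAM.toCLM ψ (conjOp ψ A.d)).comp (ContinuousLinearMap.snd ℂ (L2 ν) (L2 ν))))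

/-- The Hamiltonian structure `(A^d)^* = A^d`, `(A^o)^* = conj A^o`. -/
def OpMat.IsHam {ν : ℕ} (ψ : HilbertBasis ℤ ℂ L2x) (A : OpMat ν) : Prop :=
  ∀ ℓ j k, conj (A.d (-ℓ) k j) = A.d ℓ j k ∧ conj (A.o (-ℓ) k j) = conjOp ψ A.o ℓ j k

open Classical in
/-- The terms `⟨D⟩^a A^δ ⟨D⟩^b` that enter the norm of `𝓜_s(α, β)`; `true` stands for `δ = d` and
`false` for `δ = o`. Being a finite set, it lists repeated terms once. -/
def decayTerms (α β : ℝ) : Finset (Bool × ℝ × ℝ) :=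
  {(true, α, 0), (true, 0, α), (false, β, 0), (false, 0, β)} ∪
    (({α, -α, β, -β, 0} : Finset ℝ) ×ˢ (Finset.univ : Finset Bool)).image
      fun c => (c.2, c.1, -c.1)

/-- The norm `|A|_{s,α,β}^{Lip(w)}` of a family `A(ω)`, `ω ∈ R`. -/
def matNorm {ν : ℕ} (R : Set (Freq ν)) (w s α β : ℝ) (A : Freq ν → OpMat ν) : ℝ≥0∞ :=
  ∑ c ∈ decayTerms α β,
    lipNorm R w (decayNorm s)
      (fun ω => weighted c.2.1 c.2.2 (if c.1 then (A ω).d else (A ω).o))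

/-! ### The Hamiltonian after the Magnus normal form -/

/-- The `ℓ`-th Fourier coefficient in `φ` of `v(φ,x)`. -/
def fourierPhi {ν : ℕ} (v : (Fin ν → Circ) → Circ → ℝ) (ℓ : Fin ν → ℤ) (x : Circ) : ℂ :=
  ∫ φ : Fin ν → Circ, (∏ i, fourier (-(ℓ i)) (φ i)) * (v φ x : ℂ)
    ∂(MeasureTheory.Measure.pi fun _ => AddCircle.haarAddCircle)

/-- A continuous real function on `𝕋^ν × 𝕋` of class `H^S`, with zero average in `φ`. -/
structure IsDriving {ν : ℕ} (S : ℝ) (v : (Fin ν → Circ) → Circ → ℝ) : Prop where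
  cont : Continuous fun a : (Fin ν → Circ) × Circ => v a.1 a.2
  sob : Summable fun a : (Fin ν → ℤ) × ℤ =>
    br2 a.1 a.2 ^ (2 * S) * ‖fourierCoeff (fourierPhi v a.1) a.2‖ ^ 2
  mean : ∀ x, ∫ φ, v φ x ∂(MeasureTheory.Measure.pi fun _ : Fin ν =>
    (AddCircle.haarAddCircle : MeasureTheory.Measure Circ)) = 0

/-- Even, nonnegative smooth cut-off functions, `0` for `|ξ| ≤ 1/3` and `1` for `|ξ| ≥ 2/3`,
increasing in between. -/
structure IsCutoff (χ : ℝ → ℝ) : Prop where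
  smooth : ContDiff ℝ ((⊤ : ℕ∞) : WithTop ℕ∞) χ
  even : ∀ ξ, χ (-ξ) = χ ξ
  nonneg : ∀ ξ, 0 ≤ χ ξ
  zero : ∀ ξ, |ξ| ≤ 1 / 3 → χ ξ = 0
  one : ∀ ξ, 2 / 3 ≤ |ξ| → χ ξ = 1
  deriv_pos : ∀ ξ ∈ Set.Ioo (1 / 3 : ℝ) (2 / 3), 0 < deriv χ ξ

/-- The matrix of `½ B^{-1/2} V(φ) B^{-1/2}`, where `B = √L_q` and `V(φ)` is the multiplication
by `v(φ, ·)`. -/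
def drivingOp {ν : ℕ} (ψ : HilbertBasis ℤ ℂ L2x) (lam : ℤ → ℝ)
    (v : (Fin ν → Circ) → Circ → ℝ) : Op ν := fun ℓ j k =>
  ((1 / 2 * lam j ^ (-(1 / 2) : ℝ) * lam k ^ (-(1 / 2) : ℝ) : ℝ) : ℂ) *
    ∫ x, fourierPhi v ℓ x * (ψ k : Circ → ℂ) x * conj ((ψ j : Circ → ℂ) x)
      ∂AddCircle.haarAddCircle

/-- The generator `Y(ω; φ)` of the Magnus transformation, extended to all `ω` by the cut-off:
it solves `ω·∂_φ Y = ½ B^{-1/2} V B^{-1/2}` for Diophantine `ω`. -/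
def magnusY {ν : ℕ} (ψ : HilbertBasis ℤ ℂ L2x) (lam : ℤ → ℝ) (v : (Fin ν → Circ) → Circ → ℝ)
    (χ : ℝ → ℝ) (γ₀ τ₀ M : ℝ) (ω : Freq ν) : Op ν := fun ℓ j k =>
  (χ (dot ω ℓ / (γ₀ * M * br (absZ ℓ) ^ (-τ₀))) : ℂ) / (Complex.I * (dot ω ℓ : ℂ)) *
    drivingOp ψ lam v ℓ j k

/-- The matrix of `Y B Y`. -/
def sandwich {ν : ℕ} (lam : ℤ → ℝ) (Y : Op ν) : Op ν := fun ℓ j k =>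
  ∑' a : (Fin ν → ℤ) × ℤ, Y (ℓ - a.1) j a.2 * (lam a.2 : ℂ) * Y a.1 a.2 k

/-- The perturbation `V^{(0)}(ω; φ)` after the Magnus transformation:
`V^d = i[Y,B] + 2YBY` and `V^o = -i(YB + BY) + 2YBY`. -/
def magnusV {ν : ℕ} (ψ : HilbertBasis ℤ ℂ L2x) (lam : ℤ → ℝ) (v : (Fin ν → Circ) → Circ → ℝ)
    (χ : ℝ → ℝ) (γ₀ τ₀ M : ℝ) (ω : Freq ν) : OpMat ν where
  d := fun ℓ j k =>
    Complex.I * ((lam k - lam j : ℝ) : ℂ) * magnusY ψ lam v χ γ₀ τ₀ M ω ℓ j k +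
      2 * sandwich lam (magnusY ψ lam v χ γ₀ τ₀ M ω) ℓ j k
  o := fun ℓ j k =>
    -Complex.I * ((lam k + lam j : ℝ) : ℂ) * magnusY ψ lam v χ γ₀ τ₀ M ω ℓ j k +
      2 * sandwich lam (magnusY ψ lam v χ γ₀ τ₀ M ω) ℓ j k

/-- The matrix of `B = √L_q`. -/
def diagMat (lam : ℤ → ℝ) : Mat := fun j k => if j = k then (lam j : ℂ) else 0

/-- `f = (-i ω·∂_φ + 𝐇₀ + 𝐕(φ)) u`, where `𝐇₀ = diag(H, -conj H)` with `H` block diagonal and `𝐕` is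
bounded; the domain consists of all `u` for which the right-hand side is in `L² × L²`.
This is the generator, on functions of `(φ,x)`, of the equation `i ∂_t u = (𝐇₀ + 𝐕(ωt)) u`. -/
def IsImage {ν : ℕ} (ψ : HilbertBasis ℤ ℂ L2x) (ω : Freq ν) (H : Mat)
    (V : (L2 ν × L2 ν) →L[ℂ] (L2 ν × L2 ν)) (u f : L2 ν × L2 ν) : Prop :=
  ∀ ℓ j,
    coef ψ f.1 ℓ j = (dot ω ℓ : ℂ) * coef ψ u.1 ℓ j +
      (∑ k ∈ blk j.natAbs, H j k * coef ψ u.1 ℓ k) + coef ψ (V u).1 ℓ j ∧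
    coef ψ f.2 ℓ j = (dot ω ℓ : ℂ) * coef ψ u.2 ℓ j -
      (∑ k ∈ blk j.natAbs, conjMat ψ H j k * coef ψ u.2 ℓ k) + coef ψ (V u).2 ℓ j

/-- The time dependent change of coordinates `Φ` conjugates `𝐇₀ + 𝐕` to `𝐇₀' + 𝐕'`, that is
`Φ⁻¹ (-i ω·∂_φ + 𝐇₀ + 𝐕) Φ = -i ω·∂_φ + 𝐇₀' + 𝐕'` (with the domains). -/
def Conjugates {ν : ℕ} (ψ : HilbertBasis ℤ ℂ L2x) (ω : Freq ν)
    (Φ : (L2 ν × L2 ν) →L[ℂ] (L2 ν × L2 ν))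
    (H : Mat) (V : (L2 ν × L2 ν) →L[ℂ] (L2 ν × L2 ν))
    (H' : Mat) (V' : (L2 ν × L2 ν) →L[ℂ] (L2 ν × L2 ν)) : Prop :=
  ∀ u f, IsImage ψ ω H V (Φ u) (Φ f) ↔ IsImage ψ ω H' V' u f

/-- `W` is given by a `φ`-dependent operator: it commutes with multiplication by `e^{im·φ}`. -/
def IsPhiDependent {ν : ℕ} (W : (L2 ν × L2 ν) →L[ℂ] (L2 ν × L2 ν)) : Prop :=
  ∀ (m : Fin ν → ℤ) (u u' : L2 ν × L2 ν),
    (∀ ℓ, u'.1 ℓ = u.1 (ℓ - m) ∧ u'.2 ℓ = u.2 (ℓ - m)) →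
      ∀ ℓ, (W u').1 ℓ = (W u).1 (ℓ - m) ∧ (W u').2 ℓ = (W u).2 (ℓ - m)

/-! ### Non-resonance conditions -/

/-- The operator `G^±_{ℓ,n,m} X = (ω·ℓ) X + H_{[n]}^{[n]} X ± X H_{[m]}^{[m]}`, `ε = ±1`. -/
def gOp {ν : ℕ} (ω : Freq ν) (H : Mat) (ε : ℤ) (ℓ : Fin ν → ℤ) (n m : ℕ)
    (X : Matrix (blk n) (blk m) ℂ) : Matrix (blk n) (blk m) ℂ :=
  (dot ω ℓ : ℂ) • X + block H n * X + (ε : ℂ) • (X * block H m)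

/-- The Hilbert–Schmidt norm of a finite matrix. -/
def hs {ι κ : Type*} [Fintype ι] [Fintype κ] (X : Matrix ι κ ℂ) : ℝ :=
  Real.sqrt (∑ i, ∑ k, ‖X i k‖ ^ 2)

/-- `G^±_{ℓ,n,m}` is invertible and its inverse has operator norm at most `c`. -/
def GInvBound {ν : ℕ} (ω : Freq ν) (H : Mat) (ε : ℤ) (ℓ : Fin ν → ℤ) (n m : ℕ) (c : ℝ) : Prop :=
  Function.Bijective (gOp ω H ε ℓ n m) ∧ ∀ X, hs X ≤ c * hs (gOp ω H ε ℓ n m X)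

/-- The index sets `𝓘^+` (all triples) and `𝓘^-` (triples other than `(0,n,n)`). -/
def IsIndex {ν : ℕ} (ε : ℤ) (ℓ : Fin ν → ℤ) (n m : ℕ) : Prop :=
  ε = 1 ∨ (ε = -1 ∧ ¬ (ℓ = 0 ∧ n = m))

/-- The Diophantine set `Ω₀`. -/
def omegaZero (ν : ℕ) (γ₀ τ₀ M : ℝ) : Set (Freq ν) :=
  {ω | ω ∈ annulus ν M ∧ ∀ ℓ : Fin ν → ℤ, ℓ ≠ 0 → γ₀ * M / br (absZ ℓ) ^ τ₀ ≤ |dot ω ℓ|}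

/-- The scales `N_{-1} = 1` and `N_p = N₀^{(3/2)^p}` for `p ≥ 0`. -/
def scale (N₀ : ℕ) (p : ℤ) : ℝ := if p < 0 then 1 else (N₀ : ℝ) ^ ((3 / 2 : ℝ) ^ p)

/-- The decreasing sets `Ω_p` of the non-resonance conditions on the normal forms `H p`. -/
def omegaSeq {ν : ℕ} (γ₀ τ₀ γ τ α M : ℝ) (N₀ : ℕ) (H : ℕ → Freq ν → Mat) : ℕ → Set (Freq ν)
  | 0 => omegaZero ν γ₀ τ₀ M
  | p + 1 => {ω | ω ∈ omegaSeq γ₀ τ₀ γ τ α M N₀ H p ∧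
      ∀ (ε : ℤ) (ℓ : Fin ν → ℤ) (n m : ℕ), IsIndex ε ℓ n m → absZ ℓ ≤ scale N₀ p →
        GInvBound ω (H p ω) ε ℓ n m
          (2 * scale N₀ p ^ τ / γ * (M ^ α / br ((n : ℝ) + ε * m) ^ α))}

/-- The set `Ω_∞` of the non-resonance conditions on the final blocks. -/
def omegaInf {ν : ℕ} (γ₀ τ₀ γ τ α M : ℝ) (H : Freq ν → Mat) : Set (Freq ν) :=
  {ω | ω ∈ omegaZero ν γ₀ τ₀ M ∧
    ∀ (ε : ℤ) (ℓ : Fin ν → ℤ) (n m : ℕ), IsIndex ε ℓ n m →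
      GInvBound ω (H ω) ε ℓ n m (br (absZ ℓ) ^ τ / γ * (M ^ α / br ((n : ℝ) + ε * m) ^ α))}

/-! ### The KAM iteration -/

/-- `ϱ = 6τ + 4`. -/
def rho (τ : ℝ) : ℝ := 6 * τ + 4

/-- `β = ϱ + 1`. -/
def beta (τ : ℝ) : ℝ := rho τ + 1

/-- `W_p = e^{i𝐗^{(0)}} ∘ ⋯ ∘ e^{i𝐗^{(p-1)}}`. -/
def flow {ν : ℕ} (ψ : HilbertBasis ℤ ℂ L2x) (X : ℕ → OpMat ν) :
    ℕ → ((L2 ν × L2 ν) →L[ℂ] (L2 ν × L2 ν))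
  | 0 => 1
  | p + 1 => flow ψ X p * NormedSpace.exp (Complex.I • (X p).toCLM ψ)

/-- `W_p⁻¹ = e^{-i𝐗^{(p-1)}} ∘ ⋯ ∘ e^{-i𝐗^{(0)}}`. -/
def flowInv {ν : ℕ} (ψ : HilbertBasis ℤ ℂ L2x) (X : ℕ → OpMat ν) :
    ℕ → ((L2 ν × L2 ν) →L[ℂ] (L2 ν × L2 ν))
  | 0 => 1
  | p + 1 => NormedSpace.exp (-(Complex.I • (X p).toCLM ψ)) * flowInv ψ X p

/-- The KAM iteration started at `𝐇^{(0)} = diag(B, -B) + 𝐕⁰`: normal forms `H p`, remainders `V p`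
and generators `X p`. On the set `Ω_{p+1}` the generator `X p` is the solution of the homological
equation with frequencies `|ℓ| ≤ N_p`, and `e^{i𝐗^{(p)}}` conjugates `𝐇^{(p)}` to `𝐇^{(p+1)}`;
all objects are extended to the whole annulus. The constant `K` is the one in the estimates. -/
structure IsKAMIteration {ν : ℕ} (ψ : HilbertBasis ℤ ℂ L2x) (lam : ℤ → ℝ)
    (γ₀ τ₀ γ τ α M : ℝ) (N₀ : ℕ) (K : ℝ) (V₀ : Freq ν → OpMat ν)
    (H : ℕ → Freq ν → Mat) (V X : ℕ → Freq ν → OpMat ν) : Prop where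
  H_zero : ∀ ω, H 0 ω = diagMat lam
  V_zero : V 0 = V₀
  H_blockDiag : ∀ p : ℕ, ∀ ω ∈ annulus ν M, ∀ j k : ℤ, j.natAbs ≠ k.natAbs → H p ω j k = 0
  H_selfAdjoint : ∀ p : ℕ, ∀ ω ∈ annulus ν M, ∀ n, (block (H p ω) n).IsHermitian
  H_succ : ∀ p : ℕ, ∀ ω ∈ annulus ν M, ∀ j k : ℤ, j.natAbs = k.natAbs →
    H (p + 1) ω j k = H p ω j k + (V p ω).d 0 j k
  H_est₀ : ∀ p n : ℕ, ENNReal.ofReal (br n ^ α) *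
    lipNorm (annulus ν M) (γ / M ^ α) (hsBlock n) (fun ω => H p ω - H 0 ω) ≤
      ENNReal.ofReal (K * (γ₀ * M)⁻¹)
  H_est : ∀ p n : ℕ, ENNReal.ofReal (br n ^ α) *
    lipNorm (annulus ν M) (γ / M ^ α) (hsBlock n) (fun ω => H (p + 1) ω - H p ω) ≤
      ENNReal.ofReal (K * (γ₀ * M)⁻¹ * scale N₀ ((p : ℤ) - 1) ^ (-rho τ))
  V_ham : ∀ p : ℕ, ∀ ω ∈ annulus ν M, (V p ω).IsHam ψ
  V_low : ∀ p : ℕ, matNorm (annulus ν M) (γ / M ^ α) (sZero ν) α 0 (V p) ≤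
    ENNReal.ofReal (scale N₀ ((p : ℤ) - 1) ^ (-rho τ)) *
      matNorm (annulus ν M) (γ / M ^ α) (sZero ν + beta τ) α 0 V₀
  V_high : ∀ p : ℕ, matNorm (annulus ν M) (γ / M ^ α) (sZero ν + beta τ) α 0 (V p) ≤
    ENNReal.ofReal (scale N₀ ((p : ℤ) - 1)) *
      matNorm (annulus ν M) (γ / M ^ α) (sZero ν + beta τ) α 0 V₀
  X_ham : ∀ p : ℕ, ∀ ω ∈ annulus ν M, (X p ω).IsHam ψ
  X_est : ∀ p : ℕ, matNorm (annulus ν M) (γ / M ^ α) (sZero ν) α α (X p) ≤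
    ENNReal.ofReal (K * (M ^ α / γ) * scale N₀ p ^ (2 * τ + 1) *
      scale N₀ ((p : ℤ) - 1) ^ (-rho τ)) *
      matNorm (annulus ν M) (γ / M ^ α) (sZero ν + beta τ) α 0 V₀
  X_supp : ∀ p : ℕ, ∀ ω ∈ annulus ν M, ∀ ℓ, scale N₀ p < absZ ℓ →
    (X p ω).d ℓ = 0 ∧ (X p ω).o ℓ = 0
  X_diag : ∀ p : ℕ, ∀ ω ∈ annulus ν M, ∀ j k : ℤ, j.natAbs = k.natAbs → (X p ω).d 0 j k = 0
  hom_d : ∀ p : ℕ, ∀ ω ∈ omegaSeq γ₀ τ₀ γ τ α M N₀ H (p + 1), ∀ ℓ, absZ ℓ ≤ scale N₀ p → ∀ j k : ℤ,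
    Complex.I * ((dot ω ℓ : ℂ) * (X p ω).d ℓ j k
        + ∑ i ∈ blk j.natAbs, H p ω j i * (X p ω).d ℓ i k
        - ∑ i ∈ blk k.natAbs, (X p ω).d ℓ j i * H p ω i k)
      = (if ℓ = 0 ∧ j.natAbs = k.natAbs then (V p ω).d 0 j k else 0) - (V p ω).d ℓ j k
  hom_o : ∀ p : ℕ, ∀ ω ∈ omegaSeq γ₀ τ₀ γ τ α M N₀ H (p + 1), ∀ ℓ, absZ ℓ ≤ scale N₀ p → ∀ j k : ℤ,
    Complex.I * ((dot ω ℓ : ℂ) * (X p ω).o ℓ j k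
        + ∑ i ∈ blk j.natAbs, H p ω j i * (X p ω).o ℓ i k
        + ∑ i ∈ blk k.natAbs, (X p ω).o ℓ j i * conjMat ψ (H p ω) i k)
      = -(V p ω).o ℓ j k
  conjugation : ∀ p : ℕ, ∀ ω ∈ omegaSeq γ₀ τ₀ γ τ α M N₀ H (p + 1),
    Conjugates ψ ω (NormedSpace.exp (Complex.I • (X p ω).toCLM ψ))
      (H p ω) ((V p ω).toCLM ψ) (H (p + 1) ω) ((V (p + 1) ω).toCLM ψ)

end KAM

end

noncomputable section

namespace KAM

open Finset (single_le_sum mem_univ sum_sub_distrib mem_insert mem_singleton sum_le_card_nsmul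
  sum_le_sum sum_insert mul_sum sum_coe_sort sum_mul sum_comm sum_congr sum_add_distrib univ
  mem_union mem_image mem_product HasAntidiagonal range sum_range_succ Icc mem_Icc)
open ENNReal (ofReal ofReal_mul ofReal_ne_top ofReal_le_ofReal tsum_prod' ofReal_tsum_of_nonneg
  ofReal_pow tsum_le_tsum mul_ne_top pow_ne_top rpow_natCast Lp_add_le rpow_ofNat sum_le_tsum
  tsum_comm tsum_add continuous_rpow_const ofNat_ne_top ofReal_one add_ne_top toReal_ofNat
  toReal_mono toReal_mul toReal_nonneg ofReal_add ofReal_le_one ofReal_le_ofReal_iff one_le_ofReal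
  ofReal_ofNat ofReal_toReal)
open Real (rpow_nonneg rpow_add rpow_le_rpow_of_exponent_le mul_rpow rpow_le_rpow
  rpow_le_rpow_of_nonpos rpow_mul rpow_neg rpow_two norm_of_nonneg norm_eq_abs sq_sqrt one_le_rpow
  rpow_pos_of_pos rpow_one rpow_le_one_of_one_le_of_nonpos rpow_neg_one one_rpow pi dist_eq
  rpow_add_one)
open Prod (fst_sub snd_sub fst_zero snd_zero fst_add snd_add smul_fst smul_snd)
open Filter (Eventually Tendsto atTop)
open Function (Injective Bijective invFun Periodic)
open AddCircle (haarAddCircle coe_period coe_add)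
open Matrix (map_apply one_apply_eq frobeniusNormedAddCommGroup frobeniusNormedSpace smul_mul trace
  conjTranspose_mul transpose_mul conjTranspose_conjTranspose conjTranspose conjTranspose_smul
  of_apply one_apply_ne)
open Complex (conj_conj continuous_conj mul_conj normSq_eq_norm_sq conj_ofReal conj_I norm_real
  ofReal_sub ofReal_zero norm_I I_mul_I star_def ofReal_neg norm_intCast div_I abs_re_le_norm sub_re
  ofReal_re conj_eq_iff_re)
open RCLike (norm_conj inner_apply)
open Nat (cast_zero cast_nonneg)
open HilbertBasis (repr_apply_apply repr_self)
open ContinuousLinearMap (comp_apply opNorm_le_bound apply_apply prodₗᵢ)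
open NormedSpace (exp exp_zero)
open MeasureTheory (integral_congr_ae MemLp Lp Integrable integral_finsetSum)

local notation "𝕀" n:max => Fin n → ℤ
local notation "𝕁" n:max => (Fin n → ℤ) × ℤ
local notation "𝔏" n:max => (L2 n × L2 n) →L[ℂ] (L2 n × L2 n)
local notation "𝔹" => HilbertBasis ℤ ℂ L2x
local notation "𝐍" p:max => scale 16 (p : ℤ)
local notation "𝐍₋" p:max => scale 16 ((p : ℤ) - 1)

variable {ν : ℕ} {R : Set (Freq ν)} {w : ℝ} {q : Circ → ℝ} {ψ : 𝔹} {lam : ℤ → ℝ}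
  {γ τ α M e b₁ C γ₀ τ₀ : ℝ} {V₀ : Freq ν → OpMat ν}

local notation "dn₀" => decayNorm (sZero ν)
local notation "mN" => matNorm R w
local notation "mN₀" => matNorm R w (sZero ν)
local notation "mA" => matNorm (annulus ν M) (γ / M ^ α)
local notation "lA" => lipNorm (annulus ν M) (γ / M ^ α)
local notation "SmoothPot" => ContDiff ℝ ((⊤ : ℕ∞) : WithTop ℕ∞) (fun x : ℝ => q (x : Circ))
local notation "EB" => IsEigenbasis q ψ lam

/-! ### Brackets -/

lemma absZ_eq_norm (ℓ : 𝕀 ν) : absZ ℓ = ‖(WithLp.toLp 2 fun i => (ℓ i : ℝ) : EuclideanSpace ℝ (Fin ν))‖ := by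
  simp [absZ, EuclideanSpace.norm_eq]

lemma absZ_nonneg (ℓ : 𝕀 ν) : 0 ≤ absZ ℓ := Real.sqrt_nonneg _

lemma absZ_add_le (ℓ ℓ' : 𝕀 ν) : absZ (ℓ + ℓ') ≤ absZ ℓ + absZ ℓ' := by
  simp only [absZ_eq_norm]
  refine le_trans (le_of_eq ?_) (norm_add_le _ _)
  congr 1
  ext i
  simp

@[simp] lemma absZ_neg (ℓ : 𝕀 ν) : absZ (-ℓ) = absZ ℓ := by simp [absZ]

@[simp] lemma absZ_zero : absZ (0 : 𝕀 ν) = 0 := by simp [absZ]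

lemma abs_le_absZ (ℓ : 𝕀 ν) (i : Fin ν) : |(ℓ i : ℝ)| ≤ absZ ℓ := by
  rw [absZ]
  apply Real.le_sqrt_of_sq_le
  rw [sq_abs]
  exact single_le_sum (f := fun i => (ℓ i : ℝ) ^ 2) (fun _ _ => sq_nonneg _) (mem_univ i)

lemma dot_eq_inner (ω : Freq ν) (ℓ : 𝕀 ν) :
    dot ω ℓ = inner ℝ (WithLp.toLp 2 fun i => (ℓ i : ℝ) : EuclideanSpace ℝ (Fin ν)) ω := by
  simp [dot, PiLp.inner_apply]

lemma abs_dot_le (ω : Freq ν) (ℓ : 𝕀 ν) : |dot ω ℓ| ≤ ‖ω‖ * absZ ℓ := by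
  rw [dot_eq_inner, absZ_eq_norm, mul_comm]
  exact abs_real_inner_le_norm _ _

lemma dot_sub_left (ω₁ ω₂ : Freq ν) (ℓ : 𝕀 ν) : dot (ω₁ - ω₂) ℓ = dot ω₁ ℓ - dot ω₂ ℓ := by
  simp [dot, sub_mul, sum_sub_distrib]

lemma dot_sub_right (ω : Freq ν) (ℓ ℓ' : 𝕀 ν) : dot ω (ℓ - ℓ') = dot ω ℓ - dot ω ℓ' := by
  simp [dot, mul_sub, sum_sub_distrib]

@[simp] lemma dot_neg (ω : Freq ν) (ℓ : 𝕀 ν) : dot ω (-ℓ) = -dot ω ℓ := by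
  simp [dot]

lemma one_le_br (x : ℝ) : 1 ≤ br x := le_max_left _ _
lemma br_pos (x : ℝ) : 0 < br x := zero_lt_one.trans_le (one_le_br x)
lemma abs_le_br (x : ℝ) : |x| ≤ br x := le_max_right _ _
@[simp] lemma br_neg (x : ℝ) : br (-x) = br x := by simp [br]
@[simp] lemma br_abs (x : ℝ) : br |x| = br x := by simp [br]

lemma br_add_le (x y : ℝ) : br (x + y) ≤ br x + br y := by
  refine max_le ?_ ?_
  · linarith [one_le_br x, one_le_br y]
  · linarith [abs_add_le x y, abs_le_br x, abs_le_br y]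

lemma br_add_le_mul (x y : ℝ) : br (x + y) ≤ 2 * (br x * br y) := by
  refine (br_add_le x y).trans ?_
  nlinarith [one_le_br x, one_le_br y]

lemma one_le_br2 (ℓ : 𝕀 ν) (h : ℤ) : 1 ≤ br2 ℓ h := le_max_left _ _
lemma br2_pos (ℓ : 𝕀 ν) (h : ℤ) : 0 < br2 ℓ h := zero_lt_one.trans_le (one_le_br2 ℓ h)
lemma absZ_le_br2 (ℓ : 𝕀 ν) (h : ℤ) : absZ ℓ ≤ br2 ℓ h :=
  (le_max_left _ _).trans (le_max_right _ _)
lemma abs_le_br2 (ℓ : 𝕀 ν) (h : ℤ) : |(h : ℝ)| ≤ br2 ℓ h :=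
  (le_max_right _ _).trans (le_max_right _ _)

lemma br_le_br2 (ℓ : 𝕀 ν) (h : ℤ) : br h ≤ br2 ℓ h :=
  max_le (one_le_br2 _ _) (abs_le_br2 _ _)

lemma br_absZ_le_br2 (ℓ : 𝕀 ν) (h : ℤ) : br (absZ ℓ) ≤ br2 ℓ h :=
  max_le (one_le_br2 _ _) (by rw [abs_of_nonneg (absZ_nonneg ℓ)]; exact absZ_le_br2 _ _)

lemma br2_add_le (ℓ ℓ' : 𝕀 ν) (h h' : ℤ) : br2 (ℓ + ℓ') (h + h') ≤ br2 ℓ h + br2 ℓ' h' := by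
  refine max_le ?_ (max_le ?_ ?_)
  · linarith [one_le_br2 ℓ h, one_le_br2 ℓ' h']
  · linarith [absZ_add_le ℓ ℓ', absZ_le_br2 ℓ h, absZ_le_br2 ℓ' h']
  · push_cast
    linarith [abs_add_le (h : ℝ) h', abs_le_br2 ℓ' h', abs_le_br2 ℓ h]

/-- The weight `⟨ℓ, h⟩^s`. -/
def wt (s : ℝ) (z : 𝕁 ν) : ℝ≥0∞ := ofReal (br2 z.1 z.2 ^ s)

lemma wt_mul (s t : ℝ) (z : 𝕁 ν) : wt s z * wt t z = wt (s + t) z := by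
  rw [wt, wt, wt, ← ofReal_mul (rpow_nonneg (br2_pos _ _).le _), rpow_add (br2_pos _ _)]

@[simp] lemma wt_zero (z : 𝕁 ν) : wt 0 z = 1 := by simp [wt]

lemma wt_ne_top (s : ℝ) (z : 𝕁 ν) : wt s z ≠ ⊤ := ofReal_ne_top

lemma wt_mono {s t : ℝ} (h : s ≤ t) (z : 𝕁 ν) : wt s z ≤ wt t z :=
  ofReal_le_ofReal (rpow_le_rpow_of_exponent_le (one_le_br2 _ _) h)

lemma one_le_wt {s : ℝ} (h : 0 ≤ s) (z : 𝕁 ν) : 1 ≤ wt s z := by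
  rw [← wt_zero z]; exact wt_mono h z

lemma wt_sq (s : ℝ) (z : 𝕁 ν) : wt s z ^ 2 = wt (2 * s) z := by
  rw [sq, wt_mul, two_mul]

lemma wt_le_max {s : ℝ} (h : 0 ≤ s) (y z : 𝕁 ν) : wt s y ≤ ofReal (2 ^ s) * max (wt s (y - z)) (wt s z) := by
  have key : br2 y.1 y.2 ≤ 2 * max (br2 (y - z).1 (y - z).2) (br2 z.1 z.2) := by
    have := br2_add_le (y - z).1 z.1 (y - z).2 z.2
    simp only [fst_sub, snd_sub, sub_add_cancel] at this ⊢
    rcases le_total (br2 (y.1 - z.1) (y.2 - z.2)) (br2 z.1 z.2) with h | h <;> simp [h] <;> linarith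
  have h1 : br2 y.1 y.2 ^ s ≤ 2 ^ s * max (br2 (y - z).1 (y - z).2) (br2 z.1 z.2) ^ s := by
    rw [← mul_rpow (by norm_num) ((br2_pos _ _).le.trans (le_max_left _ _))]
    exact rpow_le_rpow (br2_pos _ _).le key h
  refine (ofReal_le_ofReal h1).trans ?_
  rw [ofReal_mul (by positivity)]
  gcongr
  rcases le_total (br2 (y - z).1 (y - z).2) (br2 z.1 z.2) with h' | h'
  · rw [max_eq_right h']; exact le_max_right _ _
  · rw [max_eq_left h']; exact le_max_left _ _

lemma wt_le_add {s : ℝ} (h : 0 ≤ s) (y z : 𝕁 ν) : wt s y ≤ ofReal (2 ^ s) * (wt s (y - z) + wt s z) :=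
  (wt_le_max h y z).trans (by gcongr; exact max_le le_self_add le_add_self)

lemma tsum_prod_fin (f : ℤ → ℝ≥0∞) (n : ℕ) : ∑' x : Fin n → ℤ, ∏ i, f (x i) = (∑' k, f k) ^ n := by
  induction n with
  | zero => simp
  | succ n ih =>
    rw [← (Fin.consEquiv fun _ : Fin (n + 1) => ℤ).tsum_eq, tsum_prod']
    simp only [Fin.consEquiv_apply, Fin.prod_univ_succ, Fin.cons_zero, Fin.cons_succ]
    simp_rw [ENNReal.tsum_mul_left, ih, ENNReal.tsum_mul_right]
    ring

lemma tsum_br_ne_top {e : ℝ} (he : 1 < e) : ∑' k : ℤ, ofReal (br k ^ (-e)) ≠ ⊤ := by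
  have h1 : Summable fun k : ℤ => |(k : ℝ)| ^ (-e) := Real.summable_abs_int_rpow he
  have h2 : Summable fun k : ℤ => br k ^ (-e) := by
    refine (summable_congr_cofinite ?_).1 h1
    filter_upwards [(Set.finite_singleton (0 : ℤ)).compl_mem_cofinite] with k hk
    have : (1 : ℝ) ≤ |(k : ℝ)| := by
      have : (1 : ℤ) ≤ |k| := Int.one_le_abs (by simpa using hk)
      exact_mod_cast this
    simp [br, this]
  rw [← ofReal_tsum_of_nonneg (fun k => rpow_nonneg (br_pos _).le _) h2]
  exact ofReal_ne_top

lemma tsum_wt_ne_top {t : ℝ} (ht : (ν : ℝ) + 1 < t) : ∑' z : 𝕁 ν, wt (-t) z ≠ ⊤ := by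
  set e := t / (ν + 1) with he
  have hν : (0 : ℝ) < ν + 1 := by positivity
  have he1 : 1 < e := by rw [he, lt_div_iff₀ hν]; linarith
  have hte : t = e * ν + e := by rw [he]; field_simp
  have key : ∀ z : 𝕁 ν, wt (-t) z ≤ (∏ i, ofReal (br (z.1 i) ^ (-e))) * ofReal (br z.2 ^ (-e)) := by
    intro z
    have hb := br2_pos z.1 z.2
    have hi : ∀ i, ofReal (br2 z.1 z.2 ^ (-e)) ≤ ofReal (br (z.1 i) ^ (-e)) := by
      intro i
      apply ofReal_le_ofReal
      apply rpow_le_rpow_of_nonpos (br_pos _) _ (by linarith)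
      exact max_le (one_le_br2 _ _) ((abs_le_absZ _ _).trans (absZ_le_br2 _ _))
    have h2 : ofReal (br2 z.1 z.2 ^ (-e)) ≤ ofReal (br z.2 ^ (-e)) := by
      apply ofReal_le_ofReal
      exact rpow_le_rpow_of_nonpos (br_pos _) (br_le_br2 _ _) (by linarith)
    have h3 : wt (-t) z = (∏ _i : Fin ν, ofReal (br2 z.1 z.2 ^ (-e))) * ofReal (br2 z.1 z.2 ^ (-e)) := by
      rw [Finset.prod_const, Finset.card_univ, Fintype.card_fin,
        ← ofReal_pow (by positivity), ← ofReal_mul (by positivity), wt]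
      congr 1
      rw [← Real.rpow_natCast, ← rpow_mul hb.le, ← rpow_add hb]
      congr 1
      rw [hte]; ring
    rw [h3]
    exact mul_le_mul' (Finset.prod_le_prod' fun i _ => hi i) h2
  refine ne_top_of_le_ne_top ?_ (tsum_le_tsum key)
  rw [tsum_prod']
  simp_rw [ENNReal.tsum_mul_left, ENNReal.tsum_mul_right]
  rw [tsum_prod_fin (fun k : ℤ => ofReal (br k ^ (-e)))]
  exact mul_ne_top (pow_ne_top (tsum_br_ne_top he1)) (tsum_br_ne_top he1)

/-! ### Square summable families in `ℝ≥0∞` -/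

section L2
variable {ι κ : Type*}

/-- The `ℓ²` norm of a family of extended nonnegative reals. -/
def l2 (f : ι → ℝ≥0∞) : ℝ≥0∞ := (∑' i, f i ^ 2) ^ (1 / 2 : ℝ)

lemma rpow_half_sq (x : ℝ≥0∞) : (x ^ (1 / 2 : ℝ)) ^ 2 = x := by
  rw [← rpow_natCast, ← ENNReal.rpow_mul]; norm_num

lemma sq_rpow_half (x : ℝ≥0∞) : (x ^ 2) ^ (1 / 2 : ℝ) = x := by
  rw [← rpow_natCast, ← ENNReal.rpow_mul]; norm_num

lemma rpow_half_le_iff (x c : ℝ≥0∞) : x ^ (1 / 2 : ℝ) ≤ c ↔ x ≤ c ^ 2 := by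
  conv_lhs => rw [← sq_rpow_half c]
  exact ENNReal.rpow_le_rpow_iff (by norm_num)

lemma sq_le_sq_iff' (x y : ℝ≥0∞) : x ^ 2 ≤ y ^ 2 ↔ x ≤ y := by
  rw [← rpow_half_le_iff, sq_rpow_half]

lemma l2_sq (f : ι → ℝ≥0∞) : l2 f ^ 2 = ∑' i, f i ^ 2 := rpow_half_sq _

lemma l2_le_iff (f : ι → ℝ≥0∞) (c : ℝ≥0∞) : l2 f ≤ c ↔ ∑' i, f i ^ 2 ≤ c ^ 2 :=
  rpow_half_le_iff _ _

lemma l2_mono {f g : ι → ℝ≥0∞} (h : ∀ i, f i ≤ g i) : l2 f ≤ l2 g := by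
  rw [l2_le_iff, l2_sq]
  exact tsum_le_tsum fun i => pow_le_pow_left₀ (zero_le) (h i) 2

lemma le_l2 (f : ι → ℝ≥0∞) (i : ι) : f i ≤ l2 f := by
  rw [← sq_le_sq_iff', l2_sq]
  exact ENNReal.le_tsum i

lemma l2_const_mul (c : ℝ≥0∞) (f : ι → ℝ≥0∞) : l2 (fun i => c * f i) = c * l2 f := by
  rw [l2, l2]
  simp_rw [mul_pow, ENNReal.tsum_mul_left]
  rw [ENNReal.mul_rpow_of_nonneg _ _ (by norm_num), sq_rpow_half]

lemma l2_comp_equiv (e : κ ≃ ι) (f : ι → ℝ≥0∞) : l2 (fun k => f (e k)) = l2 f := by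
  rw [l2, l2, e.tsum_eq (fun i => f i ^ 2)]

lemma l2_add_le (f g : ι → ℝ≥0∞) : l2 (fun i => f i + g i) ≤ l2 f + l2 g := by
  rw [l2_le_iff, ENNReal.tsum_eq_iSup_sum]
  refine iSup_le fun s => ?_
  rw [← rpow_half_le_iff]
  have h := Lp_add_le s f g (p := 2) (by norm_num)
  simp only [rpow_ofNat] at h
  refine h.trans (add_le_add ?_ ?_)
  · exact ENNReal.rpow_le_rpow (sum_le_tsum s) (by norm_num)
  · exact ENNReal.rpow_le_rpow (sum_le_tsum s) (by norm_num)

lemma tsum_mul_le_l2 (f g : ι → ℝ≥0∞) : ∑' i, f i * g i ≤ l2 f * l2 g := by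
  rw [ENNReal.tsum_eq_iSup_sum]
  refine iSup_le fun s => ?_
  have h := ENNReal.inner_le_Lp_mul_Lq s f g Real.HolderConjugate.two_two
  simp only [rpow_ofNat] at h
  refine h.trans (mul_le_mul' ?_ ?_)
  · exact ENNReal.rpow_le_rpow (sum_le_tsum s) (by norm_num)
  · exact ENNReal.rpow_le_rpow (sum_le_tsum s) (by norm_num)

/-- The Schur test. -/
lemma l2_schur (k : ι → κ → ℝ≥0∞) (C : ℝ≥0∞) (h₁ : ∀ y, ∑' z, k y z ≤ C) (h₂ : ∀ z, ∑' y, k y z ≤ C) (f : κ → ℝ≥0∞) :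
    l2 (fun y => ∑' z, k y z * f z) ≤ C * l2 f := by
  rw [l2_le_iff, mul_pow, l2_sq]
  have h : ∀ y, (∑' z, k y z * f z) ^ 2 ≤ C * ∑' z, k y z * f z ^ 2 := by
    intro y
    have hcs := tsum_mul_le_l2 (fun z => k y z ^ (1 / 2 : ℝ)) (fun z => k y z ^ (1 / 2 : ℝ) * f z)
    have he : ∀ z, k y z ^ (1 / 2 : ℝ) * (k y z ^ (1 / 2 : ℝ) * f z) = k y z * f z := by
      intro z
      rw [← mul_assoc, ← sq, rpow_half_sq]
    simp_rw [he] at hcs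
    refine (pow_le_pow_left₀ (zero_le) hcs 2).trans ?_
    rw [mul_pow, l2_sq, l2_sq]
    simp_rw [mul_pow, rpow_half_sq]
    gcongr
    exact h₁ y
  calc ∑' y, (∑' z, k y z * f z) ^ 2 ≤ ∑' y, C * ∑' z, k y z * f z ^ 2 := tsum_le_tsum h
    _ = C * ∑' z, (∑' y, k y z) * f z ^ 2 := by
      rw [ENNReal.tsum_mul_left, tsum_comm]
      simp_rw [ENNReal.tsum_mul_right]
    _ ≤ C * ∑' z, C * f z ^ 2 := by
      gcongr with z
      exact h₂ z
    _ = C ^ 2 * ∑' z, f z ^ 2 := by rw [ENNReal.tsum_mul_left, ← mul_assoc, sq]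

end L2

/-! ### Convolutions -/

/-- The convolution over `ℤ^ν × ℤ`. -/
def conv (a b : 𝕁 ν → ℝ≥0∞) (y : 𝕁 ν) : ℝ≥0∞ := ∑' z, a (y - z) * b z

/-- The weighted `ℓ²` norm. -/
def wnorm (s : ℝ) (a : 𝕁 ν → ℝ≥0∞) : ℝ≥0∞ := l2 fun z => wt s z * a z

lemma conv_comm (a b : 𝕁 ν → ℝ≥0∞) : conv a b = conv b a := by
  funext y
  rw [conv, conv, ← (Equiv.subLeft y).tsum_eq]
  simp [mul_comm]

lemma l2_conv_le (a b : 𝕁 ν → ℝ≥0∞) : l2 (conv a b) ≤ (∑' z, a z) * l2 b := by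
  refine l2_schur (fun y z => a (y - z)) _ (fun y => ?_) (fun z => ?_) b
  · exact ((Equiv.subLeft y).tsum_eq a).le
  · exact ((Equiv.subRight z).tsum_eq a).le

/-- The `ℓ²` norm of `⟨·⟩^{-s₀}`. -/
def sobConst (ν : ℕ) : ℝ≥0∞ := l2 fun z : 𝕁 ν => wt (-(sZero ν : ℝ)) z

lemma two_sZero (ν : ℕ) : (ν : ℝ) + 3 < 2 * sZero ν := by
  have : ν + 3 < 2 * sZero ν := by unfold sZero; omega
  exact_mod_cast this

lemma sobConst_ne_top (ν : ℕ) : sobConst ν ≠ ⊤ := by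
  unfold sobConst l2
  simp_rw [wt_sq]
  refine ENNReal.rpow_ne_top_of_nonneg (by norm_num) ?_
  have h := tsum_wt_ne_top (ν := ν) (t := 2 * sZero ν) (by linarith [two_sZero ν])
  simpa [mul_neg] using h

lemma tsum_le_wnorm (a : 𝕁 ν → ℝ≥0∞) : ∑' z, a z ≤ sobConst ν * wnorm (sZero ν) a := by
  refine le_trans (le_of_eq ?_) (tsum_mul_le_l2 _ _)
  refine tsum_congr fun z => ?_
  rw [← mul_assoc, wt_mul]; simp

lemma wnorm_mono_right {s : ℝ} {a b : 𝕁 ν → ℝ≥0∞} (h : ∀ z, a z ≤ b z) : wnorm s a ≤ wnorm s b :=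
  l2_mono fun z => mul_le_mul' le_rfl (h z)

/-- The tame estimate for convolutions. -/
lemma wnorm_conv_le {s : ℝ} (hs : 0 ≤ s) (a b : 𝕁 ν → ℝ≥0∞) : wnorm s (conv a b) ≤ ofReal (2 ^ s) * sobConst ν *
      (wnorm s a * wnorm (sZero ν) b + wnorm (sZero ν) a * wnorm s b) := by
  have h : ∀ y, wt s y * conv a b y ≤ ofReal (2 ^ s) *
      (conv (fun z => wt s z * a z) b y + conv a (fun z => wt s z * b z) y) := by
    intro y
    simp only [conv]
    rw [← tsum_add, ← ENNReal.tsum_mul_left, ← ENNReal.tsum_mul_left]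
    refine tsum_le_tsum fun z => ?_
    calc wt s y * (a (y - z) * b z) ≤ (ofReal (2 ^ s) * (wt s (y - z) + wt s z)) * (a (y - z) * b z) := by
          gcongr; exact wt_le_add hs y z
      _ = _ := by ring
  refine (l2_mono h).trans ?_
  rw [l2_const_mul, mul_assoc]
  gcongr
  refine (l2_add_le _ _).trans ?_
  rw [mul_add]
  refine add_le_add ?_ ?_
  · change l2 (conv (fun z => wt s z * a z) b) ≤ _
    rw [conv_comm]
    refine (l2_conv_le _ _).trans ?_
    calc (∑' z, b z) * wnorm s a ≤ (sobConst ν * wnorm (sZero ν) b) * wnorm s a := by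
          gcongr; exact tsum_le_wnorm b
      _ = _ := by ring
  · refine (l2_conv_le _ _).trans ?_
    calc (∑' z, a z) * wnorm s b ≤ (sobConst ν * wnorm (sZero ν) a) * wnorm s b := by
          gcongr; exact tsum_le_wnorm a
      _ = _ := by ring

/-- Convolution operators with `s₀`-decay act on the weighted spaces of order `0 ≤ r ≤ s₀`. -/
lemma wnorm_conv_le_of_le {r : ℝ} (hr : 0 ≤ r) (hr' : r ≤ sZero ν) (a f : 𝕁 ν → ℝ≥0∞) :
    wnorm r (conv a f) ≤ 2 * ofReal (2 ^ (sZero ν : ℝ)) * sobConst ν * (wnorm (sZero ν) a * wnorm r f) := by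
  set S : ℝ := (sZero ν : ℝ) with hS
  have hk : ∀ y z : 𝕁 ν, wt r y ≤ ofReal (2 ^ S) * ((1 + wt S (y - z) * wt (-S) z) * wt r z) := by
    intro y z
    refine (wt_le_max hr y z).trans ?_
    gcongr
    · norm_num
    · refine max_le ?_ ?_
      · rcases le_total (br2 (y - z).1 (y - z).2) (br2 z.1 z.2) with h | h
        · refine le_trans ?_ (mul_le_mul' le_self_add le_rfl)
          rw [one_mul]
          exact ofReal_le_ofReal (rpow_le_rpow (br2_pos _ _).le h hr)
        · refine le_trans ?_ (mul_le_mul' le_add_self le_rfl)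
          rw [mul_assoc, wt_mul]
          have : wt (-S + r) (y - z) ≤ wt (-S + r) z :=
            ofReal_le_ofReal (rpow_le_rpow_of_nonpos (br2_pos _ _) h (by linarith))
          calc wt r (y - z) = wt S (y - z) * wt (-S + r) (y - z) := by rw [wt_mul]; ring_nf
            _ ≤ _ := by gcongr
      · refine le_trans ?_ (mul_le_mul' le_self_add le_rfl)
        rw [one_mul]
  have h : ∀ y, wt r y * conv a f y ≤ ofReal (2 ^ S) * (conv a (fun z => wt r z * f z) y +
        conv (fun z => wt S z * a z) (fun z => wt (-S) z * (wt r z * f z)) y) := by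
    intro y
    simp only [conv]
    rw [← tsum_add, ← ENNReal.tsum_mul_left, ← ENNReal.tsum_mul_left]
    refine tsum_le_tsum fun z => ?_
    calc wt r y * (a (y - z) * f z) ≤ (ofReal (2 ^ S) * ((1 + wt S (y - z) * wt (-S) z) * wt r z)) *
          (a (y - z) * f z) := by
          gcongr; exact hk y z
      _ = _ := by ring
  refine (l2_mono h).trans ?_
  rw [l2_const_mul]
  have e : ∀ A B C D : ℝ≥0∞, 2 * A * B * (C * D) = A * (B * (C * D) + B * (C * D)) := by
    intro A B C D; ring
  rw [e]
  gcongr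
  refine (l2_add_le _ _).trans (add_le_add ?_ ?_)
  · refine (l2_conv_le _ _).trans ?_
    calc (∑' z, a z) * wnorm r f ≤ (sobConst ν * wnorm S a) * wnorm r f := by
          gcongr; exact tsum_le_wnorm a
      _ = _ := by ring
  · change l2 (conv _ _) ≤ _
    rw [conv_comm]
    refine (l2_conv_le _ _).trans ?_
    have := tsum_mul_le_l2 (fun z : 𝕁 ν => wt (-S) z) (fun z => wt r z * f z)
    calc _ ≤ (sobConst ν * wnorm r f) * wnorm S a := by
          gcongr
          exacts [this, le_rfl]
      _ = _ := by ring


/-! ### The decay norm -/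

lemma mem_blk {j : ℤ} {n : ℕ} : j ∈ blk n ↔ j.natAbs = n := by
  simp only [blk, mem_insert, mem_singleton]
  omega

lemma self_mem_blk (j : ℤ) : j ∈ blk j.natAbs := mem_blk.2 rfl

lemma card_blk_le (n : ℕ) : (blk n).card ≤ 2 := Finset.card_le_two

lemma enorm_sq_le_hsSq (A : Mat) {j k : ℤ} {n m : ℕ} (hj : j ∈ blk n) (hk : k ∈ blk m) : ‖A j k‖ₑ ^ 2 ≤ hsSq A n m := by
  refine le_trans ?_ (single_le_sum (f := fun j => ∑ k ∈ blk m, ‖A j k‖ₑ ^ 2) (fun _ _ => zero_le) hj)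
  exact single_le_sum (f := fun k => ‖A j k‖ₑ ^ 2) (fun _ _ => zero_le) hk

lemma hsSq_le_of_forall (A : Mat) {n m : ℕ} {c : ℝ≥0∞}
    (h : ∀ j ∈ blk n, ∀ k ∈ blk m, ‖A j k‖ₑ ≤ c) : hsSq A n m ≤ (2 * c) ^ 2 := by
  have h1 : ∀ j ∈ blk n, ∑ k ∈ blk m, ‖A j k‖ₑ ^ 2 ≤ 2 * c ^ 2 := by
    intro j hj
    refine (sum_le_card_nsmul _ _ (c ^ 2) fun k hk => ?_).trans ?_
    · exact pow_le_pow_left₀ zero_le (h j hj k hk) 2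
    · rw [nsmul_eq_mul]; gcongr; exact_mod_cast card_blk_le m
  refine (sum_le_card_nsmul _ _ _ h1).trans ?_
  rw [nsmul_eq_mul, mul_pow]
  calc ((blk n).card : ℝ≥0∞) * (2 * c ^ 2) ≤ 2 * (2 * c ^ 2) := by
        gcongr; exact_mod_cast card_blk_le n
    _ = 2 ^ 2 * c ^ 2 := by ring

lemma hsSq_rpow_half_add_le (A B : Mat) (n m : ℕ) : (hsSq (A + B) n m) ^ (1 / 2 : ℝ) ≤
      (hsSq A n m) ^ (1 / 2 : ℝ) + (hsSq B n m) ^ (1 / 2 : ℝ) := by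
  have h := Lp_add_le (blk n ×ˢ blk m) (fun x => ‖A x.1 x.2‖ₑ) (fun x => ‖B x.1 x.2‖ₑ) (p := 2) (by norm_num)
  simp only [rpow_ofNat, Finset.sum_product] at h
  refine le_trans (ENNReal.rpow_le_rpow ?_ (by norm_num)) h
  refine sum_le_sum fun j _ => sum_le_sum fun k _ => ?_
  exact pow_le_pow_left₀ zero_le (enorm_add_le _ _) 2

lemma continuous_hsSq (n m : ℕ) : Continuous fun A : Mat => hsSq A n m := by
  unfold hsSq
  refine continuous_finsetSum _ fun j _ => continuous_finsetSum _ fun k _ => ?_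
  exact (ENNReal.continuous_pow 2).comp (continuous_enorm.comp ((continuous_apply k).comp (continuous_apply j)))

/-- Countably subadditive functionals. -/
def CSub {X : Type*} [AddCommMonoid X] [TopologicalSpace X] (N : X → ℝ≥0∞) : Prop :=
  ∀ (ι : Type) (A : ι → X) (S : X), HasSum A S → N S ≤ ∑' i, N (A i)

lemma csub_of_lowerSemicontinuous {X : Type*} [AddCommMonoid X] [TopologicalSpace X]
    {N : X → ℝ≥0∞} (h0 : N 0 = 0) (hadd : ∀ A B, N (A + B) ≤ N A + N B)
    (hlsc : LowerSemicontinuous N) : CSub N := by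
  classical
  intro ι A S hS
  have hfin : ∀ F : Finset ι, N (∑ i ∈ F, A i) ≤ ∑ i ∈ F, N (A i) := by
    intro F
    induction F using Finset.induction_on with
    | empty => simp [h0]
    | insert a F ha ih =>
      rw [sum_insert ha, sum_insert ha]
      exact (hadd _ _).trans (add_le_add le_rfl ih)
  exact (hlsc.isClosed_preimage (∑' i, N (A i))).mem_of_tendsto hS
    (Eventually.of_forall fun F => (hfin F).trans (sum_le_tsum F))

lemma csub_hsBlock (n : ℕ) : CSub (hsBlock n) := by
  refine csub_of_lowerSemicontinuous ?_ (fun A B => hsSq_rpow_half_add_le A B n n) ?_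
  · simp [hsBlock, hsSq]
  · exact (continuous_rpow_const.comp (continuous_hsSq n n)).lowerSemicontinuous

/-- The supremum of the squared norms of the blocks at distance `h`. -/
def profile (A : Op ν) (a : ℕ × (𝕀 ν)) : ℝ≥0∞ :=
  ⨆ n : ℕ, ⨆ m : ℕ, ⨆ _ : ((m : ℤ) - n).natAbs = a.1, hsSq (A a.2) n m

lemma decayNorm_eq_l2 (s : ℝ) (A : Op ν) : decayNorm s A = l2 fun a : ℕ × (𝕀 ν) => wt s (a.2, (a.1 : ℤ)) *
      (profile A a) ^ (1 / 2 : ℝ) := by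
  rw [decayNorm, l2]
  congr 1
  refine tsum_congr fun a => ?_
  rw [mul_pow, rpow_half_sq, wt_sq]
  rfl

lemma hsSq_le_profile (A : Op ν) (ℓ : 𝕀 ν) (n m : ℕ) : hsSq (A ℓ) n m ≤ profile A (((m : ℤ) - n).natAbs, ℓ) :=
  le_iSup_of_le n (le_iSup_of_le m (le_iSup_of_le rfl le_rfl))

lemma decayNorm_mono_exp {s t : ℝ} (h : s ≤ t) (A : Op ν) : decayNorm s A ≤ decayNorm t A := by
  rw [decayNorm_eq_l2, decayNorm_eq_l2]
  exact l2_mono fun a => mul_le_mul' (wt_mono h _) le_rfl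

lemma decayNorm_le_of_block {s : ℝ} {c : ℝ≥0∞} {A B : Op ν} (h : ∀ ℓ n m, hsSq (A ℓ) n m ≤ c ^ 2 * hsSq (B ℓ) n m) :
    decayNorm s A ≤ c * decayNorm s B := by
  rw [decayNorm_eq_l2, decayNorm_eq_l2, ← l2_const_mul]
  refine l2_mono fun a => ?_
  rw [mul_left_comm]
  gcongr
  rw [rpow_half_le_iff, mul_pow, rpow_half_sq]
  refine iSup_le fun n => iSup_le fun m => iSup_le fun hnm => (h a.2 n m).trans ?_
  gcongr
  refine (hsSq_le_profile B a.2 n m).trans ?_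
  rw [hnm]

lemma decayNorm_le_of_entry {s : ℝ} {c : ℝ≥0∞} {A B : Op ν} (h : ∀ ℓ j k, ‖A ℓ j k‖ₑ ≤ c * ‖B ℓ j k‖ₑ) :
    decayNorm s A ≤ c * decayNorm s B := by
  refine decayNorm_le_of_block fun ℓ n m => ?_
  rw [hsSq, hsSq, mul_sum]
  refine sum_le_sum fun j _ => ?_
  rw [mul_sum]
  refine sum_le_sum fun k _ => ?_
  rw [← mul_pow]
  exact pow_le_pow_left₀ zero_le (h ℓ j k) 2

lemma hsSq_rpow_half_le_decayNorm {s : ℝ} (hs : 0 ≤ s) (A : Op ν) (ℓ : 𝕀 ν) (n m : ℕ) :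
    (hsSq (A ℓ) n m) ^ (1 / 2 : ℝ) ≤ decayNorm s A := by
  rw [decayNorm_eq_l2]
  refine le_trans ?_ (le_l2 _ (((m : ℤ) - n).natAbs, ℓ))
  refine le_trans ?_ (mul_le_mul' (one_le_wt hs _) le_rfl)
  rw [one_mul]
  exact ENNReal.rpow_le_rpow (hsSq_le_profile A ℓ n m) (by norm_num)

lemma enorm_le_decayNorm {s : ℝ} (hs : 0 ≤ s) (A : Op ν) (ℓ : 𝕀 ν) (j k : ℤ) : ‖A ℓ j k‖ₑ ≤ decayNorm s A := by
  refine le_trans ?_ (hsSq_rpow_half_le_decayNorm hs A ℓ j.natAbs k.natAbs)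
  rw [← sq_le_sq_iff', rpow_half_sq]
  exact enorm_sq_le_hsSq _ (self_mem_blk j) (self_mem_blk k)

lemma decayNorm_zero (s : ℝ) : decayNorm s (0 : Op ν) = 0 := by
  have := decayNorm_le_of_entry (s := s) (c := 0) (A := (0 : Op ν)) (B := 0) (by simp)
  simpa using this

lemma decayNorm_add_le (s : ℝ) (A B : Op ν) : decayNorm s (A + B) ≤ decayNorm s A + decayNorm s B := by
  rw [decayNorm_eq_l2, decayNorm_eq_l2, decayNorm_eq_l2]
  refine le_trans (l2_mono fun a => ?_) (l2_add_le _ _)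
  rw [← mul_add]
  gcongr
  rw [rpow_half_le_iff]
  refine iSup_le fun n => iSup_le fun m => iSup_le fun hnm => ?_
  rw [← rpow_half_le_iff]
  refine (hsSq_rpow_half_add_le (A a.2) (B a.2) n m).trans ?_
  obtain ⟨h, ℓ⟩ := a
  subst hnm
  gcongr <;> exact hsSq_le_profile _ _ _ _

lemma lowerSemicontinuous_decayNorm (s : ℝ) : LowerSemicontinuous (decayNorm s : Op ν → ℝ≥0∞) := by
  refine Continuous.comp_lowerSemicontinuous (g := fun x : ℝ≥0∞ => x ^ (1 / 2 : ℝ))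
    continuous_rpow_const ?_ (ENNReal.monotone_rpow_of_nonneg (by norm_num))
  refine lowerSemicontinuous_tsum fun a => ?_
  refine Continuous.comp_lowerSemicontinuous (g := fun x : ℝ≥0∞ => ofReal (br2 a.2 a.1 ^ (2 * s)) * x)
    (ENNReal.continuous_const_mul ofReal_ne_top) ?_
    (fun x y h => mul_le_mul' le_rfl h)
  refine lowerSemicontinuous_iSup fun n => lowerSemicontinuous_iSup fun m =>
    lowerSemicontinuous_iSup fun _ => ?_
  exact ((continuous_hsSq n m).comp (continuous_apply a.2)).lowerSemicontinuous

lemma csub_decayNorm (s : ℝ) : CSub (decayNorm s : Op ν → ℝ≥0∞) :=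
  csub_of_lowerSemicontinuous (decayNorm_zero s) (decayNorm_add_le s) (lowerSemicontinuous_decayNorm s)

lemma decayNorm_le_of_support {s b N : ℝ} (hN : 0 < N) (hb : 0 ≤ b) {A : Op ν} (h : ∀ ℓ, absZ ℓ ≤ N → A ℓ = 0) :
    decayNorm s A ≤ ofReal (N ^ (-b)) * decayNorm (s + b) A := by
  rw [decayNorm_eq_l2, decayNorm_eq_l2, ← l2_const_mul]
  refine l2_mono fun a => ?_
  by_cases ha : absZ a.2 ≤ N
  · have : profile A a = 0 := by simp [profile, h _ ha, hsSq]
    simp [this]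
  · rw [← mul_assoc]
    gcongr
    rw [wt, wt, ← ofReal_mul (by positivity)]
    apply ofReal_le_ofReal
    have hNb : N ≤ br2 a.2 a.1 := (not_le.1 ha).le.trans (absZ_le_br2 _ _)
    rw [rpow_add (br2_pos _ _), rpow_neg hN.le, mul_comm (br2 a.2 a.1 ^ s), ← mul_assoc]
    refine le_mul_of_one_le_left (rpow_nonneg (br2_pos _ _).le _) ?_
    rw [inv_mul_eq_div, one_le_div (by positivity)]
    exact rpow_le_rpow hN.le hNb hb

/-- The largest entry at block distance `h`. -/
def ent (A : Op ν) (z : 𝕁 ν) : ℝ≥0∞ :=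
  ⨆ j : ℤ, ⨆ k : ℤ, ⨆ _ : |(|j| - |k|)| = |z.2|, ‖A z.1 j k‖ₑ

lemma le_ent (A : Op ν) (ℓ : 𝕀 ν) (j k : ℤ) : ‖A ℓ j k‖ₑ ≤ ent A (ℓ, |j| - |k|) :=
  le_iSup_of_le j (le_iSup_of_le k (le_iSup_of_le rfl le_rfl))

lemma ent_congr (A : Op ν) (ℓ : 𝕀 ν) {h h' : ℤ} (hh : |h| = |h'|) : ent A (ℓ, h) = ent A (ℓ, h') := by
  simp only [ent, hh]

lemma decayNorm_le_wnorm_ent (s : ℝ) (A : Op ν) : decayNorm s A ≤ 2 * wnorm s (ent A) := by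
  rw [decayNorm_eq_l2, wnorm, ← l2_const_mul]
  have hinj : Injective fun a : ℕ × (𝕀 ν) => (a.2, (a.1 : ℤ)) := by
    intro a b h
    simp only [Prod.mk.injEq, Nat.cast_inj] at h
    exact Prod.ext h.2 h.1
  rw [l2_le_iff, l2_sq]
  refine le_trans (tsum_le_tsum fun a => ?_) (ENNReal.tsum_comp_le_tsum_of_injective hinj _)
  rw [sq_le_sq_iff', mul_left_comm]
  gcongr
  rw [rpow_half_le_iff]
  refine iSup_le fun n => iSup_le fun m => iSup_le fun hnm => hsSq_le_of_forall _ ?_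
  intro j hj k hk
  refine (le_ent A a.2 j k).trans (ent_congr A _ ?_).le
  rw [mem_blk] at hj hk
  rw [← hnm]
  simp only [Int.abs_eq_natAbs]
  omega

lemma tsum_natAbs_le (g : ℕ → ℝ≥0∞) : ∑' h : ℤ, g h.natAbs ≤ 2 * ∑' n, g n := by
  have h := (ENNReal.summable (f := g)).hasSum.int_rec (ENNReal.summable (f := fun n => g (n + 1))).hasSum
  have he : (fun t : ℤ => (Int.rec g (fun n => g (n + 1)) t : ℝ≥0∞)) = fun t => g t.natAbs := by
    funext t
    cases t <;> rfl
  rw [he] at h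
  rw [h.tsum_eq, two_mul]
  refine add_le_add le_rfl ?_
  exact ENNReal.tsum_comp_le_tsum_of_injective (add_left_injective 1) g

lemma wnorm_ent_le (s : ℝ) (A : Op ν) : wnorm s (ent A) ≤ 2 * decayNorm s A := by
  rw [wnorm, l2_le_iff, mul_pow, decayNorm_eq_l2, l2_sq, tsum_prod', tsum_prod',
    tsum_comm (α := ℕ), ← ENNReal.tsum_mul_left]
  refine tsum_le_tsum fun ℓ => ?_
  have h1 : ∀ h : ℤ, (wt s (ℓ, h) * ent A (ℓ, h)) ^ 2 ≤
      (fun n : ℕ => (wt s (ℓ, (n : ℤ)) * profile A (n, ℓ) ^ (1 / 2 : ℝ)) ^ 2) h.natAbs := by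
    intro h
    simp only
    rw [sq_le_sq_iff']
    refine mul_le_mul' ?_ ?_
    · simp [wt, br2]
    · refine iSup_le fun j => iSup_le fun k => iSup_le fun hjk => ?_
      rw [← sq_le_sq_iff', rpow_half_sq]
      refine (enorm_sq_le_hsSq _ (self_mem_blk j) (self_mem_blk k)).trans ?_
      refine (hsSq_le_profile A ℓ _ _).trans (le_of_eq ?_)
      congr 2
      simp only [Int.abs_eq_natAbs] at hjk
      omega
  refine (tsum_le_tsum h1).trans ((tsum_natAbs_le
    (fun n : ℕ => (wt s (ℓ, (n : ℤ)) * profile A (n, ℓ) ^ (1 / 2 : ℝ)) ^ 2)).trans ?_)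
  exact mul_le_mul' (by norm_num) le_rfl

/-- The matrix of a product of operators. -/
def opMul (A B : Op ν) : Op ν := fun ℓ j k =>
  ∑' a : 𝕁 ν, A (ℓ - a.1) j a.2 * B a.1 a.2 k

lemma conv_even (A B : Op ν) (ℓ : 𝕀 ν) {h h' : ℤ} (hh : |h| = |h'|) :
    conv (ent A) (ent B) (ℓ, h) = conv (ent A) (ent B) (ℓ, h') := by
  rcases abs_eq_abs.1 hh with rfl | rfl
  · rfl
  · rw [conv, conv, ← ((Equiv.refl (𝕀 ν)).prodCongr (Equiv.neg ℤ)).tsum_eq]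
    refine tsum_congr fun z => ?_
    congr 1
    · refine ent_congr A _ ?_
      simp only [Equiv.prodCongr_apply, Prod.map_snd, Equiv.neg_apply]
      rw [← abs_neg]; congr 1; ring
    · exact ent_congr B _ (by simp)

lemma tsum_opMul_le (A B : Op ν) (ℓ : 𝕀 ν) (j k : ℤ) : ∑' a : 𝕁 ν, ‖A (ℓ - a.1) j a.2 * B a.1 a.2 k‖ₑ ≤
      2 * conv (ent A) (ent B) (ℓ, |j| - |k|) := by
  set G : 𝕁 ν → ℝ≥0∞ := fun a =>
    ent A (ℓ - a.1, |j| - a.2) * ent B (a.1, a.2 - |k|) with hG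
  have h1 : ∀ a : 𝕁 ν, ‖A (ℓ - a.1) j a.2 * B a.1 a.2 k‖ₑ ≤ G a + G (a.1, -a.2) := by
    intro a
    rw [enorm_mul]
    have h := mul_le_mul' (le_ent A (ℓ - a.1) j a.2) (le_ent B a.1 a.2 k)
    refine h.trans ?_
    rcases abs_choice a.2 with h | h
    · rw [h]; exact le_self_add
    · rw [h]; exact le_add_self
  refine (tsum_le_tsum h1).trans ?_
  rw [tsum_add, two_mul]
  have h2 : ∑' a, G a = conv (ent A) (ent B) (ℓ, |j| - |k|) := by
    rw [conv, ← ((Equiv.refl (𝕀 ν)).prodCongr (Equiv.addRight |k|)).tsum_eq]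
    refine tsum_congr fun z => ?_
    simp only [hG, Equiv.prodCongr_apply, Prod.map, Equiv.refl_apply, Equiv.coe_addRight, add_sub_cancel_right]
    congr 2
    exact Prod.ext rfl (by simp; ring)
  have h3 : ∑' a : 𝕁 ν, G (a.1, -a.2) = ∑' a, G a :=
    ((Equiv.refl (𝕀 ν)).prodCongr (Equiv.neg ℤ)).tsum_eq G
  rw [h3, h2]

lemma ent_opMul_le (A B : Op ν) (z : 𝕁 ν) : ent (opMul A B) z ≤ 2 * conv (ent A) (ent B) z := by
  refine iSup_le fun j => iSup_le fun k => iSup_le fun h => ?_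
  refine enorm_tsum_le_tsum_enorm.trans ((tsum_opMul_le A B z.1 j k).trans ?_)
  rw [conv_even A B z.1 h]

/-- The constant in the product estimate. -/
def mulConst (ν : ℕ) (s : ℝ) : ℝ≥0∞ := 16 * ofReal (2 ^ s) * sobConst ν

lemma mulConst_ne_top (ν : ℕ) (s : ℝ) : mulConst ν s ≠ ⊤ :=
  mul_ne_top (mul_ne_top (by simp) ofReal_ne_top) (sobConst_ne_top ν)

lemma decayNorm_opMul_le {s : ℝ} (hs : 0 ≤ s) (A B : Op ν) : decayNorm s (opMul A B) ≤ mulConst ν s *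
      (decayNorm s A * dn₀ B + dn₀ A * decayNorm s B) := by
  refine (decayNorm_le_wnorm_ent s _).trans ?_
  refine (mul_le_mul' le_rfl (wnorm_mono_right (ent_opMul_le A B))).trans ?_
  have h1 : wnorm s (fun z => 2 * conv (ent A) (ent B) z) = 2 * wnorm s (conv (ent A) (ent B)) := by
    rw [wnorm, wnorm, ← l2_const_mul]
    simp_rw [mul_left_comm]
  rw [h1]
  have h2 := wnorm_conv_le hs (ent A) (ent B)
  have h3 : wnorm s (conv (ent A) (ent B)) ≤ ofReal (2 ^ s) * sobConst ν * ((2 * decayNorm s A) * (2 * dn₀ B) +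
        (2 * dn₀ A) * (2 * decayNorm s B)) := by
    refine h2.trans ?_
    gcongr <;> exact wnorm_ent_le _ _
  refine (mul_le_mul' le_rfl (mul_le_mul' le_rfl h3)).trans (le_of_eq ?_)
  rw [mulConst]
  ring

lemma conv_ent_ne_top {A B : Op ν} (hA : dn₀ A ≠ ⊤) (hB : dn₀ B ≠ ⊤) (y : 𝕁 ν) : conv (ent A) (ent B) y ≠ ⊤ := by
  have h : ∀ C : Op ν, dn₀ C ≠ ⊤ → l2 (ent C) ≠ ⊤ := by
    intro C hC
    refine ne_top_of_le_ne_top (mul_ne_top ofNat_ne_top hC) (le_trans ?_ (wnorm_ent_le _ C))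
    refine l2_mono fun z => ?_
    calc ent C z = 1 * ent C z := (one_mul _).symm
      _ ≤ _ := mul_le_mul' (one_le_wt (by positivity) z) le_rfl
  refine ne_top_of_le_ne_top (mul_ne_top (h A hA) (h B hB)) ?_
  refine (tsum_mul_le_l2 (fun z => ent A (y - z)) (ent B)).trans (le_of_eq ?_)
  congr 1
  exact l2_comp_equiv (Equiv.subLeft y) (ent A)

lemma summable_opMul {A B : Op ν} (hA : dn₀ A ≠ ⊤) (hB : dn₀ B ≠ ⊤) (ℓ : 𝕀 ν) (j k : ℤ) :
    Summable fun a : 𝕁 ν => A (ℓ - a.1) j a.2 * B a.1 a.2 k :=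
  Summable.of_enorm (ne_top_of_le_ne_top (mul_ne_top ofNat_ne_top (conv_ent_ne_top hA hB _)) (tsum_opMul_le A B ℓ j k))

lemma opMul_sub_sub {A A' B B' : Op ν} (hA : dn₀ A ≠ ⊤) (hA' : dn₀ A' ≠ ⊤) (hB : dn₀ B ≠ ⊤) (hB' : dn₀ B' ≠ ⊤) :
    opMul A B - opMul A' B' = opMul (A - A') B + opMul A' (B - B') := by
  funext ℓ j k
  have e1 : opMul (A - A') B ℓ j k = opMul A B ℓ j k - opMul A' B ℓ j k := by
    simp only [opMul]
    rw [← (summable_opMul hA hB ℓ j k).tsum_sub (summable_opMul hA' hB ℓ j k)]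
    simp [sub_mul]
  have e2 : opMul A' (B - B') ℓ j k = opMul A' B ℓ j k - opMul A' B' ℓ j k := by
    simp only [opMul]
    rw [← (summable_opMul hA' hB ℓ j k).tsum_sub (summable_opMul hA' hB' ℓ j k)]
    simp [mul_sub]
  simp only [Pi.sub_apply, Pi.add_apply, e1, e2]
  ring

lemma weighted_opMul (a b e : ℝ) (A B : Op ν) :
    weighted a b (opMul A B) = opMul (weighted a (-e) A) (weighted e b B) := by
  funext ℓ j k
  simp only [weighted, opMul]
  rw [← tsum_mul_left, ← tsum_mul_right]
  refine tsum_congr fun z => ?_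
  have h : ((br z.2 ^ (-e) : ℝ) : ℂ) * ((br z.2 ^ e : ℝ) : ℂ) = 1 := by
    rw [← Complex.ofReal_mul, ← rpow_add (br_pos _)]; simp
  linear_combination (-(((br j ^ a : ℝ) : ℂ) * A (ℓ - z.1) j z.2 * B z.1 z.2 k * ((br k ^ b : ℝ) : ℂ))) * h

lemma weighted_sub (a b : ℝ) (A B : Op ν) : weighted a b (A - B) = weighted a b A - weighted a b B := by
  funext ℓ j k
  simp only [weighted, Pi.sub_apply]; ring

lemma hasSum_weighted {ι : Type*} (a b : ℝ) {A : ι → Op ν} {S : Op ν} (h : HasSum A S) :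
    HasSum (fun i => weighted a b (A i)) (weighted a b S) := by
  rw [Pi.hasSum] at h ⊢
  intro ℓ
  have hℓ := h ℓ
  rw [Pi.hasSum] at hℓ ⊢
  intro j
  have hj := hℓ j
  rw [Pi.hasSum] at hj ⊢
  intro k
  exact ((hj k).mul_left _).mul_right _

lemma hasSum_op_iff {ι : Type*} {A : ι → Op ν} {S : Op ν} :
    HasSum A S ↔ ∀ ℓ j k, HasSum (fun i => A i ℓ j k) (S ℓ j k) := by
  simp only [Pi.hasSum]


/-! ### Blocks and conjugation of matrices -/

/-- The block `A_{[n]}^{[m]}`. -/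
def rblk (A : Mat) (n m : ℕ) : Matrix (blk n) (blk m) ℂ := Matrix.of fun a b => A a b

@[simp] lemma rblk_apply (A : Mat) (n m : ℕ) (a : blk n) (b : blk m) : rblk A n m a b = A a b := rfl

lemma block_eq_rblk (A : Mat) (n : ℕ) : block A n = rblk A n n := rfl

lemma apply_eq_of_rblk_eq {A B : Mat} {j k : ℤ}
    (h : rblk A j.natAbs k.natAbs = rblk B j.natAbs k.natAbs) : A j k = B j k :=
  congrFun (congrFun h ⟨j, self_mem_blk j⟩) ⟨k, self_mem_blk k⟩

lemma mat_ext_rblk {A B : Mat} (h : ∀ n m, rblk A n m = rblk B n m) : A = B := by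
  funext j k
  exact apply_eq_of_rblk_eq (h _ _)

/-- The product `H X` with a block diagonal matrix `H`. -/
def bmulL (H X : Mat) : Mat := fun j k => ∑ i ∈ blk j.natAbs, H j i * X i k

/-- The product `X H` with a block diagonal matrix `H`. -/
def bmulR (X H : Mat) : Mat := fun j k => ∑ i ∈ blk k.natAbs, X j i * H i k

lemma natAbs_coe_blk {n : ℕ} (a : blk n) : (a : ℤ).natAbs = n := mem_blk.1 a.2

lemma rblk_bmulL (H X : Mat) (n m : ℕ) : rblk (bmulL H X) n m = rblk H n n * rblk X n m := by
  ext a b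
  simp only [rblk_apply, bmulL, Matrix.mul_apply]
  rw [natAbs_coe_blk a, ← sum_coe_sort]

lemma rblk_bmulR (X H : Mat) (n m : ℕ) : rblk (bmulR X H) n m = rblk X n m * rblk H m m := by
  ext a b
  simp only [rblk_apply, bmulR, Matrix.mul_apply]
  rw [natAbs_coe_blk b, ← sum_coe_sort]

/-- The coefficients of `conj ψ_k` in the basis `ψ`. -/
def cc (ψ : 𝔹) (j k : ℤ) : ℂ :=
  ∫ x, conj ((ψ j : Circ → ℂ) x) * conj ((ψ k : Circ → ℂ) x) ∂haarAddCircle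

lemma cc_comm (ψ : 𝔹) (j k : ℤ) : cc ψ j k = cc ψ k j := by
  simp only [cc, mul_comm]

/-- The blocks of `ψ` are stable under complex conjugation. -/
def ConjStable (ψ : 𝔹) : Prop :=
  ∀ n, rblk (cc ψ) n n * (rblk (cc ψ) n n).map conj = 1

local notation "CS" => ConjStable ψ

lemma ConjStable.symm (h : CS) (n : ℕ) : (rblk (cc ψ) n n).map conj * rblk (cc ψ) n n = 1 := mul_eq_one_comm.1 (h n)

lemma rblk_conjMat (ψ : 𝔹) (A : Mat) (n m : ℕ) : rblk (conjMat ψ A) n m =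
      rblk (cc ψ) n n * (rblk A n m).map conj * (rblk (cc ψ) m m).map conj := by
  ext a b
  simp only [rblk_apply, conjMat, Matrix.mul_apply, map_apply, sum_mul]
  rw [natAbs_coe_blk a, natAbs_coe_blk b, sum_comm, ← sum_coe_sort]
  refine sum_congr rfl fun k _ => ?_
  rw [← sum_coe_sort]
  rfl

lemma map_conj_mul {ι κ μ : Type*} [Fintype κ] (A : Matrix ι κ ℂ) (B : Matrix κ μ ℂ) :
    (A * B).map conj = A.map conj * B.map conj := Matrix.map_mul

lemma map_conj_map_conj {ι κ : Type*} (A : Matrix ι κ ℂ) : (A.map conj).map conj = A := by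
  ext a b; simp

lemma rblk_cc_transpose (ψ : 𝔹) (n : ℕ) : (rblk (cc ψ) n n).transpose = rblk (cc ψ) n n := by
  ext a b
  simp [cc_comm ψ (a : ℤ) b]

lemma conjMat_conjMat (hψ : CS) (A : Mat) : conjMat ψ (conjMat ψ A) = A := by
  refine mat_ext_rblk fun n m => ?_
  rw [rblk_conjMat, rblk_conjMat, map_conj_mul, map_conj_mul, map_conj_map_conj, map_conj_map_conj,
    ← Matrix.mul_assoc, ← Matrix.mul_assoc, hψ n, Matrix.one_mul, Matrix.mul_assoc, hψ m,
    Matrix.mul_one]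

lemma conjMat_bmulL (hψ : CS) (H X : Mat) : conjMat ψ (bmulL H X) = bmulL (conjMat ψ H) (conjMat ψ X) := by
  refine mat_ext_rblk fun n m => ?_
  rw [rblk_bmulL, rblk_conjMat, rblk_conjMat, rblk_conjMat, rblk_bmulL, map_conj_mul]
  have h := hψ.symm n
  simp only [Matrix.mul_assoc]
  rw [← Matrix.mul_assoc ((rblk (cc ψ) n n).map conj) (rblk (cc ψ) n n), h, Matrix.one_mul]

lemma conjMat_bmulR (hψ : CS) (X H : Mat) : conjMat ψ (bmulR X H) = bmulR (conjMat ψ X) (conjMat ψ H) := by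
  refine mat_ext_rblk fun n m => ?_
  rw [rblk_bmulR, rblk_conjMat, rblk_conjMat, rblk_conjMat, rblk_bmulR, map_conj_mul]
  have h := hψ.symm m
  simp only [Matrix.mul_assoc]
  rw [← Matrix.mul_assoc ((rblk (cc ψ) m m).map conj) (rblk (cc ψ) m m), h, Matrix.one_mul]

lemma conjMat_apply (ψ : 𝔹) (A : Mat) (j k : ℤ) : conjMat ψ A j k = ∑ j₁ ∈ blk j.natAbs, ∑ k₁ ∈ blk k.natAbs,
      cc ψ j j₁ * conj (A j₁ k₁) * conj (cc ψ k₁ k) := rfl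

lemma conjMat_add (ψ : 𝔹) (A B : Mat) : conjMat ψ (A + B) = conjMat ψ A + conjMat ψ B := by
  funext j k
  simp only [conjMat_apply, Pi.add_apply, map_add, mul_add, add_mul, sum_add_distrib]

lemma conjMat_neg (ψ : 𝔹) (A : Mat) : conjMat ψ (-A) = -conjMat ψ A := by
  funext j k
  simp [conjMat_apply]

lemma conjMat_sub (ψ : 𝔹) (A B : Mat) : conjMat ψ (A - B) = conjMat ψ A - conjMat ψ B := by
  rw [sub_eq_add_neg, conjMat_add, conjMat_neg, ← sub_eq_add_neg]

lemma conjMat_smul (ψ : 𝔹) (c : ℂ) (A : Mat) : conjMat ψ (c • A) = conj c • conjMat ψ A := by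
  funext j k
  simp only [conjMat_apply, Pi.smul_apply, smul_eq_mul, map_mul, mul_sum]
  refine sum_congr rfl fun _ _ => sum_congr rfl fun _ _ => by ring

lemma conjMat_conj_transpose (ψ : 𝔹) (A : Mat) (j k : ℤ) :
    conj (conjMat ψ A k j) = conjMat ψ (fun a b => conj (A b a)) j k := by
  simp only [conjMat_apply, map_sum, map_mul, conj_conj]
  rw [sum_comm]
  refine sum_congr rfl fun a _ => sum_congr rfl fun b _ => ?_
  rw [cc_comm ψ a j, cc_comm ψ k b]
  ring

lemma hasSum_conjMat {ι : Type*} (ψ : 𝔹) {A : ι → Mat} {S : Mat} (j k : ℤ)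
    (h : ∀ j₁ ∈ blk j.natAbs, ∀ k₁ ∈ blk k.natAbs, HasSum (fun i => A i j₁ k₁) (S j₁ k₁)) :
    HasSum (fun i => conjMat ψ (A i) j k) (conjMat ψ S j k) := by
  simp only [conjMat_apply]
  refine hasSum_sum fun j₁ hj => hasSum_sum fun k₁ hk => ?_
  have := (h j₁ hj k₁ hk).map (starRingEnd ℂ) continuous_conj
  exact (this.mul_left _).mul_right _

attribute [irreducible] cc

lemma norm_cc_le (hψ : CS) {j k : ℤ} (h : k ∈ blk j.natAbs) : ‖cc ψ j k‖ ≤ 1 := by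
  have h1 := congrFun (congrFun (hψ j.natAbs) ⟨j, self_mem_blk j⟩) ⟨j, self_mem_blk j⟩
  rw [Matrix.mul_apply] at h1
  simp only [rblk_apply, map_apply, one_apply_eq] at h1
  have h2 : ∀ a : blk j.natAbs, cc ψ j a * conj (cc ψ a j) = ((‖cc ψ j a‖ ^ 2 : ℝ) : ℂ) := by
    intro a
    rw [cc_comm ψ a j, mul_conj, normSq_eq_norm_sq]
  simp only [h2] at h1
  have h3 : ∑ a : blk j.natAbs, ‖cc ψ j a‖ ^ 2 = 1 := by exact_mod_cast h1
  have h4 : ‖cc ψ j k‖ ^ 2 ≤ ∑ a : blk j.natAbs, ‖cc ψ j a‖ ^ 2 :=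
    single_le_sum (s := univ) (f := fun a : blk j.natAbs => ‖cc ψ j a‖ ^ 2)
      (fun _ _ => sq_nonneg _) (mem_univ (⟨k, h⟩ : blk j.natAbs))
  rw [h3] at h4
  exact (sq_le_one_iff₀ (norm_nonneg _)).1 h4

lemma hsSq_conjMat_le (hψ : CS) (A : Mat) (n m : ℕ) : hsSq (conjMat ψ A) n m ≤ 8 ^ 2 * hsSq A n m := by
  have key : ∀ j ∈ blk n, ∀ k ∈ blk m, ‖conjMat ψ A j k‖ₑ ≤ 4 * hsSq A n m ^ (1 / 2 : ℝ) := by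
    intro j hj k hk
    rw [mem_blk] at hj hk
    subst hj hk
    rw [conjMat_apply]
    set c := hsSq A j.natAbs k.natAbs ^ (1 / 2 : ℝ)
    have h1 : ∀ j₁ ∈ blk j.natAbs, ∀ k₁ ∈ blk k.natAbs, ‖cc ψ j j₁ * conj (A j₁ k₁) * conj (cc ψ k₁ k)‖ₑ ≤ c := by
      intro j₁ hj k₁ hk
      rw [enorm_mul, enorm_mul]
      have e1 : ‖cc ψ j j₁‖ₑ ≤ 1 := by
        rw [← ofReal_norm, ← ofReal_one]
        exact ofReal_le_ofReal (norm_cc_le hψ hj)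
      have e2 : ‖conj (cc ψ k₁ k)‖ₑ ≤ 1 := by
        rw [← ofReal_norm, ← ofReal_one, norm_conj, cc_comm]
        exact ofReal_le_ofReal (norm_cc_le hψ hk)
      have e3 : ‖conj (A j₁ k₁)‖ₑ ≤ c := by
        rw [← ofReal_norm, norm_conj, ofReal_norm, ← sq_le_sq_iff', rpow_half_sq]
        exact enorm_sq_le_hsSq A hj hk
      calc _ ≤ 1 * c * 1 := by gcongr
        _ = c := by simp
    refine (enorm_sum_le _ _).trans ?_
    have h2 : ∀ j₁ ∈ blk j.natAbs, ‖∑ k₁ ∈ blk k.natAbs, cc ψ j j₁ * conj (A j₁ k₁) * conj (cc ψ k₁ k)‖ₑ ≤ 2 * c := by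
      intro j₁ hj
      refine (enorm_sum_le _ _).trans ((sum_le_card_nsmul _ _ c (h1 j₁ hj)).trans ?_)
      rw [nsmul_eq_mul]; gcongr; exact_mod_cast card_blk_le _
    refine (sum_le_card_nsmul _ _ _ h2).trans ?_
    rw [nsmul_eq_mul]
    calc ((blk j.natAbs).card : ℝ≥0∞) * (2 * c) ≤ 2 * (2 * c) := by
          gcongr; exact_mod_cast card_blk_le _
      _ = 4 * c := by ring
  refine (hsSq_le_of_forall _ key).trans (le_of_eq ?_)
  rw [mul_pow, mul_pow, rpow_half_sq]
  ring

/-- The adjoint. -/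
def adj (A : Op ν) : Op ν := fun ℓ j k => conj (A (-ℓ) k j)

lemma isHam_iff (ψ : 𝔹) (A : OpMat ν) : A.IsHam ψ ↔ adj A.d = A.d ∧ adj A.o = conjOp ψ A.o := by
  constructor
  · intro h
    exact ⟨by funext ℓ j k; exact (h ℓ j k).1, by funext ℓ j k; exact (h ℓ j k).2⟩
  · intro h ℓ j k
    exact ⟨congrFun (congrFun (congrFun h.1 ℓ) j) k, congrFun (congrFun (congrFun h.2 ℓ) j) k⟩

lemma adj_opMul (A B : Op ν) : adj (opMul A B) = opMul (adj B) (adj A) := by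
  funext ℓ j k
  simp only [adj, opMul]
  rw [Complex.conj_tsum, ← ((Equiv.subRight ℓ).prodCongr (Equiv.refl ℤ)).tsum_eq]
  refine tsum_congr fun a => ?_
  simp only [Equiv.prodCongr_apply, Prod.map, Equiv.subRight_apply, Equiv.refl_apply, map_mul]
  rw [show -ℓ - (a.1 - ℓ) = -a.1 by abel, show a.1 - ℓ = -(ℓ - a.1) by abel, mul_comm]

lemma adj_add (A B : Op ν) : adj (A + B) = adj A + adj B := by
  funext ℓ j k; simp [adj]

lemma adj_sub (A B : Op ν) : adj (A - B) = adj A - adj B := by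
  funext ℓ j k; simp [adj]

lemma adj_smul (c : ℂ) (A : Op ν) : adj (c • A) = conj c • adj A := by
  funext ℓ j k; simp [adj]

lemma conjOp_add (ψ : 𝔹) (A B : Op ν) : conjOp ψ (A + B) = conjOp ψ A + conjOp ψ B := by
  funext ℓ; exact conjMat_add ψ _ _

lemma conjOp_sub (ψ : 𝔹) (A B : Op ν) : conjOp ψ (A - B) = conjOp ψ A - conjOp ψ B := by
  funext ℓ; exact conjMat_sub ψ _ _

lemma conjOp_smul (ψ : 𝔹) (c : ℂ) (A : Op ν) : conjOp ψ (c • A) = conj c • conjOp ψ A := by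
  funext ℓ; exact conjMat_smul ψ _ _

lemma conjOp_conjOp (hψ : CS) (A : Op ν) : conjOp ψ (conjOp ψ A) = A := by
  funext ℓ
  simp only [conjOp, neg_neg]
  exact conjMat_conjMat hψ _

lemma adj_conjOp (ψ : 𝔹) (A : Op ν) : adj (conjOp ψ A) = conjOp ψ (adj A) := by
  funext ℓ j k
  simp only [adj, conjOp, neg_neg]
  rw [conjMat_conj_transpose]
  congr 1
  funext a b
  simp only [adj, neg_neg]

lemma hasSum_conjOp {ι : Type*} (ψ : 𝔹) {A : ι → Op ν} {S : Op ν}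
    (h : HasSum A S) : HasSum (fun i => conjOp ψ (A i)) (conjOp ψ S) := by
  rw [hasSum_op_iff] at h ⊢
  intro ℓ j k
  exact hasSum_conjMat ψ j k fun j₁ _ k₁ _ => h (-ℓ) j₁ k₁

lemma hasSum_adj {ι : Type*} {A : ι → Op ν} {S : Op ν} (h : HasSum A S) : HasSum (fun i => adj (A i)) (adj S) := by
  rw [hasSum_op_iff] at h ⊢
  intro ℓ j k
  exact (h (-ℓ) k j).map (starRingEnd ℂ) continuous_conj

lemma decayNorm_conjOp_le (hψ : CS) (s : ℝ) (A : Op ν) : decayNorm s (conjOp ψ A) ≤ 8 * decayNorm s A := by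
  have h1 : decayNorm s (conjOp ψ A) ≤ 8 * decayNorm s (fun ℓ => A (-ℓ)) :=
    decayNorm_le_of_block fun ℓ n m => hsSq_conjMat_le hψ _ n m
  refine h1.trans (mul_le_mul' le_rfl (le_of_eq ?_))
  rw [decayNorm_eq_l2, decayNorm_eq_l2, ← l2_comp_equiv ((Equiv.refl ℕ).prodCongr (Equiv.neg (𝕀 ν)))]
  congr 1
  funext a
  simp [wt, br2, profile]

lemma weighted_conjOp (ψ : 𝔹) (a b : ℝ) (A : Op ν) : weighted a b (conjOp ψ A) = conjOp ψ (weighted a b A) := by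
  have hbr : ∀ {j j₁ : ℤ}, j₁ ∈ blk j.natAbs → br j₁ = br j := by
    intro j j₁ h
    rw [mem_blk] at h
    rcases Int.natAbs_eq_natAbs_iff.1 h with rfl | rfl <;> simp
  funext ℓ j k
  simp only [weighted, conjOp, conjMat_apply, mul_sum, sum_mul]
  refine sum_congr rfl fun j₁ hj => sum_congr rfl fun k₁ hk => ?_
  simp only [map_mul, conj_ofReal, hbr hj, hbr hk]
  ring

/-- Sums over `ℤ^ν × ℤ` that agree on blocks agree. -/
lemma hasSum_unique_of_blocks {f g : 𝕁 ν → ℂ} {S S' : ℂ} (hf : HasSum f S)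
    (hg : HasSum g S') (h : ∀ ℓ n, ∑ i ∈ blk n, f (ℓ, i) = ∑ i ∈ blk n, g (ℓ, i)) : S = S' := by
  set e := (Equiv.refl (𝕀 ν)).prodCongr (Equiv.neg ℤ)
  have hf2 := hf.add (e.hasSum_iff.2 hf)
  have hg2 := hg.add (e.hasSum_iff.2 hg)
  have he : (fun b => f b + (f ∘ e) b) = fun b => g b + (g ∘ e) b := by
    funext z
    obtain ⟨ℓ, i⟩ := z
    have hb := h ℓ i.natAbs
    simp only [Function.comp, e, Equiv.prodCongr_apply, Prod.map, Equiv.refl_apply, Equiv.neg_apply]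
    by_cases hi : i = 0
    · subst hi
      simp only [blk, Int.natAbs_zero, cast_zero, neg_zero, mem_singleton,
        Finset.insert_eq_of_mem, Finset.sum_singleton] at hb
      simp [hb]
    · have hne : (i.natAbs : ℤ) ≠ -(i.natAbs : ℤ) := by omega
      simp only [blk, Finset.sum_pair hne] at hb
      rcases Int.natAbs_eq i with h' | h'
      · rw [← h'] at hb; exact hb
      · have h'' : (i.natAbs : ℤ) = -i := by omega
        rw [h'', neg_neg] at hb
        rw [add_comm, hb, add_comm]
  rw [he] at hf2
  have := hf2.unique hg2
  rw [← two_mul, ← two_mul] at this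
  exact mul_left_cancel₀ two_ne_zero this

lemma conjMat_opMul_block (hψ : CS) (A B : Mat) (n : ℕ) (j k : ℤ) : ∑ i ∈ blk n, conjMat ψ A j i * conjMat ψ B i k =
      conjMat ψ (fun j₁ k₁ => ∑ i ∈ blk n, A j₁ i * B i k₁) j k := by
  have e1 : ∀ C D : Mat, ∀ n p q, rblk (fun j₁ k₁ => ∑ i ∈ blk n, C j₁ i * D i k₁) p q = rblk C p n * rblk D n q := by
    intro C D n p q
    ext a b
    simp only [rblk_apply, Matrix.mul_apply]
    rw [← sum_coe_sort]
  refine apply_eq_of_rblk_eq (A := fun j k => ∑ i ∈ blk n, conjMat ψ A j i * conjMat ψ B i k) ?_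
  rw [e1, rblk_conjMat, rblk_conjMat, rblk_conjMat, e1, map_conj_mul]
  have h := hψ.symm n
  simp only [Matrix.mul_assoc]
  rw [← Matrix.mul_assoc ((rblk (cc ψ) n n).map conj) (rblk (cc ψ) n n), h, Matrix.one_mul]

lemma conjOp_opMul (hψ : CS) {A B : Op ν} (hA : dn₀ A ≠ ⊤) (hB : dn₀ B ≠ ⊤) :
    conjOp ψ (opMul A B) = opMul (conjOp ψ A) (conjOp ψ B) := by
  have hfin : ∀ {C : Op ν}, dn₀ C ≠ ⊤ → dn₀ (conjOp ψ C) ≠ ⊤ :=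
    fun hC => ne_top_of_le_ne_top (mul_ne_top ofNat_ne_top hC) (decayNorm_conjOp_le hψ _ _)
  funext ℓ j k
  have hg := (summable_opMul (hfin hA) (hfin hB) ℓ j k).hasSum
  have hf0 : HasSum (fun a : 𝕁 ν =>
      conjMat ψ (fun j₁ k₁ => A (-ℓ - a.1) j₁ a.2 * B a.1 a.2 k₁) j k)
      (conjMat ψ (opMul A B (-ℓ)) j k) :=
    hasSum_conjMat ψ j k fun j₁ _ k₁ _ => (summable_opMul hA hB (-ℓ) j₁ k₁).hasSum
  have hf := ((Equiv.neg (𝕀 ν)).prodCongr (Equiv.refl ℤ)).hasSum_iff.2 hf0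
  refine hasSum_unique_of_blocks hf hg fun ℓ' n => ?_
  simp only [Function.comp, Equiv.prodCongr_apply, Prod.map, Equiv.neg_apply, Equiv.refl_apply, conjOp]
  rw [conjMat_opMul_block hψ, show -(ℓ - ℓ') = -ℓ - -ℓ' by abel]
  have hl : ∀ (F : ℤ → Mat), conjMat ψ (fun j₁ k₁ => ∑ i ∈ blk n, F i j₁ k₁) =
      fun j k => ∑ i ∈ blk n, conjMat ψ (F i) j k := by
    intro F
    funext j k
    simp only [conjMat_apply, map_sum, mul_sum, sum_mul]
    symm
    rw [sum_comm]
    refine sum_congr rfl fun _ _ => ?_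
    rw [sum_comm]
  have := hl fun i j₁ k₁ => A (-ℓ - -ℓ') j₁ i * B (-ℓ') i k₁
  rw [this]

/-- The bracket `[A, iX] = i (A X - X A)` of operator matrices. -/
def bracket (ψ : 𝔹) (A X : OpMat ν) : OpMat ν where
  d := Complex.I • (opMul A.d X.d - opMul X.d A.d - opMul A.o (conjOp ψ X.o) + opMul X.o (conjOp ψ A.o))
  o := Complex.I • (opMul A.d X.o - opMul X.d A.o - opMul A.o (conjOp ψ X.d) + opMul X.o (conjOp ψ A.d))

/-- Operator matrices whose entries have finite `s₀`-decay norm. -/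
def Fin0 (A : OpMat ν) : Prop := dn₀ A.d ≠ ⊤ ∧ dn₀ A.o ≠ ⊤

lemma decayNorm_conjOp_ne_top (hψ : CS) {s : ℝ} {A : Op ν} (h : decayNorm s A ≠ ⊤) : decayNorm s (conjOp ψ A) ≠ ⊤ :=
  ne_top_of_le_ne_top (mul_ne_top ofNat_ne_top h) (decayNorm_conjOp_le hψ _ _)

lemma isHam_bracket (hψ : CS) {A X : OpMat ν}
    (fA : Fin0 A) (fX : Fin0 X) (hA : A.IsHam ψ) (hX : X.IsHam ψ) : (bracket ψ A X).IsHam ψ := by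
  rw [isHam_iff] at hA hX ⊢
  obtain ⟨hA1, hA2⟩ := hA
  obtain ⟨hX1, hX2⟩ := hX
  have hA3 : adj (conjOp ψ A.o) = A.o := by rw [adj_conjOp, hA2, conjOp_conjOp hψ]
  have hX3 : adj (conjOp ψ X.o) = X.o := by rw [adj_conjOp, hX2, conjOp_conjOp hψ]
  have hA4 : adj (conjOp ψ A.d) = conjOp ψ A.d := by rw [adj_conjOp, hA1]
  have hX4 : adj (conjOp ψ X.d) = conjOp ψ X.d := by rw [adj_conjOp, hX1]
  constructor
  · simp only [bracket, adj_smul, adj_add, adj_sub, adj_opMul, hA1, hX1, hA2, hX2, hA3, hX3, conj_I]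
    rw [neg_smul, ← smul_neg]
    congr 1
    abel
  · have c := fun {P : Op ν} (h : dn₀ P ≠ ⊤) => decayNorm_conjOp_ne_top hψ h
    simp only [bracket, adj_smul, adj_add, adj_sub, adj_opMul, hA1, hX1, hA2, hX2, hA4, hX4,
      conj_I, conjOp_smul, conjOp_add, conjOp_sub]
    rw [conjOp_opMul hψ fA.1 fX.2, conjOp_opMul hψ fX.1 fA.2, conjOp_opMul hψ fA.2 (c fX.1),
      conjOp_opMul hψ fX.2 (c fA.1), conjOp_conjOp hψ, conjOp_conjOp hψ]
    congr 1
    abel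


/-! ### Lipschitz norms -/

section Lip
variable {X : Type*}

/-- The supremum part of the Lipschitz norm. -/
def lipSup (R : Set (Freq ν)) (N : X → ℝ≥0∞) (f : Freq ν → X) : ℝ≥0∞ := ⨆ ω ∈ R, N (f ω)

lemma le_lipSup (N : X → ℝ≥0∞) (f : Freq ν → X) {ω : Freq ν} (h : ω ∈ R) :
    N (f ω) ≤ lipSup R N f := le_iSup₂_of_le ω h le_rfl

variable [Sub X]

/-- The weighted Lipschitz seminorm. -/
def lipSemi (R : Set (Freq ν)) (w : ℝ) (N : X → ℝ≥0∞) (f : Freq ν → X) : ℝ≥0∞ :=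
  ofReal w * ⨆ ω₁ ∈ R, ⨆ ω₂ ∈ R, ⨆ _ : ω₁ ≠ ω₂, N (f ω₁ - f ω₂) / ‖ω₁ - ω₂‖ₑ

lemma lipNorm_eq (N : X → ℝ≥0∞) (f : Freq ν → X) : lipNorm R w N f = lipSup R N f + lipSemi R w N f := rfl

lemma le_lipNorm (N : X → ℝ≥0∞) (f : Freq ν → X) {ω : Freq ν} (h : ω ∈ R) :
    N (f ω) ≤ lipNorm R w N f := (le_lipSup N f h).trans le_self_add

lemma le_lipSemi (N : X → ℝ≥0∞) (f : Freq ν → X) {ω₁ ω₂ : Freq ν} (h₁ : ω₁ ∈ R) (h₂ : ω₂ ∈ R)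
    (h : ω₁ ≠ ω₂) : ofReal w * N (f ω₁ - f ω₂) ≤ lipSemi R w N f * ‖ω₁ - ω₂‖ₑ := by
  have h0 : ‖ω₁ - ω₂‖ₑ ≠ 0 := by simpa [sub_eq_zero] using h
  rw [lipSemi, mul_assoc]
  gcongr
  have := le_iSup₂_of_le (f := fun ω₁ (_ : ω₁ ∈ R) => ⨆ ω₂ ∈ R, ⨆ _ : ω₁ ≠ ω₂,
    N (f ω₁ - f ω₂) / ‖ω₁ - ω₂‖ₑ) ω₁ h₁ (le_iSup₂_of_le ω₂ h₂ (le_iSup_of_le h le_rfl))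
  calc N (f ω₁ - f ω₂) = N (f ω₁ - f ω₂) / ‖ω₁ - ω₂‖ₑ * ‖ω₁ - ω₂‖ₑ :=
        (ENNReal.div_mul_cancel h0 enorm_ne_top).symm
    _ ≤ _ := by gcongr

lemma lipSemi_le {N : X → ℝ≥0∞} {f : Freq ν → X} {b : ℝ≥0∞}
    (h : ∀ ω₁ ∈ R, ∀ ω₂ ∈ R, ω₁ ≠ ω₂ → ofReal w * N (f ω₁ - f ω₂) ≤ b * ‖ω₁ - ω₂‖ₑ) :
    lipSemi R w N f ≤ b := by
  rw [lipSemi]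
  simp_rw [ENNReal.mul_iSup]
  refine iSup₂_le fun ω₁ h₁ => iSup₂_le fun ω₂ h₂ => iSup_le fun hne => ?_
  rw [← mul_div_assoc]
  exact ENNReal.div_le_of_le_mul (h ω₁ h₁ ω₂ h₂ hne)

lemma lipNorm_le {N : X → ℝ≥0∞} {f : Freq ν → X} {a b : ℝ≥0∞} (h₁ : ∀ ω ∈ R, N (f ω) ≤ a)
    (h₂ : ∀ ω₁ ∈ R, ∀ ω₂ ∈ R, ω₁ ≠ ω₂ → ofReal w * N (f ω₁ - f ω₂) ≤ b * ‖ω₁ - ω₂‖ₑ) :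
    lipNorm R w N f ≤ a + b :=
  add_le_add (iSup₂_le h₁) (lipSemi_le h₂)

lemma lipNorm_le_tsum {Y ι : Type*} [Sub Y] {N : X → ℝ≥0∞} {N' : Y → ℝ≥0∞} {f : Freq ν → X}
    {g : ι → Freq ν → Y} (c : ℝ≥0∞) (h₁ : ∀ ω ∈ R, N (f ω) ≤ c * ∑' i, N' (g i ω))
    (h₂ : ∀ ω₁ ∈ R, ∀ ω₂ ∈ R, N (f ω₁ - f ω₂) ≤ c * ∑' i, N' (g i ω₁ - g i ω₂)) :
    lipNorm R w N f ≤ c * ∑' i, lipNorm R w N' (g i) := by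
  simp_rw [lipNorm_eq, tsum_add, mul_add]
  refine lipNorm_le (fun ω hω => (h₁ ω hω).trans ?_) (fun ω₁ hω₁ ω₂ hω₂ hne => ?_)
  · gcongr with i
    exact le_lipSup N' (g i) hω
  · calc ofReal w * N (f ω₁ - f ω₂) ≤ ofReal w * (c * ∑' i, N' (g i ω₁ - g i ω₂)) := by gcongr; exact h₂ ω₁ hω₁ ω₂ hω₂
      _ = c * ∑' i, ofReal w * N' (g i ω₁ - g i ω₂) := by
        rw [ENNReal.tsum_mul_left]; ring
      _ ≤ c * ∑' i, lipSemi R w N' (g i) * ‖ω₁ - ω₂‖ₑ := by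
        exact mul_le_mul' le_rfl (tsum_le_tsum fun i => le_lipSemi N' (g i) hω₁ hω₂ hne)
      _ = c * (∑' i, lipSemi R w N' (g i)) * ‖ω₁ - ω₂‖ₑ := by
        rw [ENNReal.tsum_mul_right]; ring

lemma lipNorm_le_mul {Y : Type*} [Sub Y] {N : X → ℝ≥0∞} {N' : Y → ℝ≥0∞} {f : Freq ν → X}
    {g : Freq ν → Y} (c : ℝ≥0∞) (h₁ : ∀ ω ∈ R, N (f ω) ≤ c * N' (g ω))
    (h₂ : ∀ ω₁ ∈ R, ∀ ω₂ ∈ R, N (f ω₁ - f ω₂) ≤ c * N' (g ω₁ - g ω₂)) :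
    lipNorm R w N f ≤ c * lipNorm R w N' g := by
  have := lipNorm_le_tsum (R := R) (w := w) (N := N) (N' := N') (f := f)
    (g := fun _ : Unit => g) c (by simpa using h₁) (by simpa using h₂)
  simpa using this

lemma CSub.lipNorm_hasSum {ι : Type} {X : Type*} [AddCommGroup X] [TopologicalSpace X]
    [IsTopologicalAddGroup X] {N : X → ℝ≥0∞} (hN : CSub N) {f : Freq ν → X} {g : ι → Freq ν → X}
    (h : ∀ ω ∈ R, HasSum (fun i => g i ω) (f ω)) :
    lipNorm R w N f ≤ ∑' i, lipNorm R w N (g i) := by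
  have := lipNorm_le_tsum (R := R) (w := w) (N := N) (N' := N) (f := f) (g := g) 1
    (fun ω hω => by rw [one_mul]; exact hN ι _ _ (h ω hω))
    (fun ω₁ h₁ ω₂ h₂ => by rw [one_mul]; exact hN ι _ _ ((h ω₁ h₁).sub (h ω₂ h₂)))
  rwa [one_mul] at this

end Lip

/-! ### Families of operators -/

/-- The Lipschitz norm of `⟨D⟩^a A ⟨D⟩^b`. -/
def famNorm (R : Set (Freq ν)) (w s a b : ℝ) (A : Freq ν → Op ν) : ℝ≥0∞ :=
  lipNorm R w (decayNorm s) (fun ω => weighted a b (A ω))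

local notation "fN" => famNorm R w
local notation "fN₀" => famNorm R w (sZero ν)

lemma lipNorm_opMul_le {s : ℝ} (hs : 0 ≤ s) {A B : Freq ν → Op ν}
    (hA : lipNorm R w (dn₀) A ≠ ⊤) (hB : lipNorm R w (dn₀) B ≠ ⊤) :
    lipNorm R w (decayNorm s) (fun ω => opMul (A ω) (B ω)) ≤ mulConst ν s *
      (lipNorm R w (decayNorm s) A * lipNorm R w (dn₀) B + lipNorm R w (dn₀) A * lipNorm R w (decayNorm s) B) := by
  set s₀ : ℝ := (sZero ν : ℝ) with hs₀
  have fA : ∀ ω ∈ R, decayNorm s₀ (A ω) ≠ ⊤ := fun ω h =>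
    ne_top_of_le_ne_top hA (le_lipNorm (decayNorm s₀) A h)
  have fB : ∀ ω ∈ R, decayNorm s₀ (B ω) ≠ ⊤ := fun ω h =>
    ne_top_of_le_ne_top hB (le_lipNorm (decayNorm s₀) B h)
  set A0 := lipSup R (decayNorm s) A
  set A1 := lipSemi R w (decayNorm s) A
  set a0 := lipSup R (decayNorm s₀) A
  set a1 := lipSemi R w (decayNorm s₀) A
  set B0 := lipSup R (decayNorm s) B
  set B1 := lipSemi R w (decayNorm s) B
  set b0 := lipSup R (decayNorm s₀) B
  set b1 := lipSemi R w (decayNorm s₀) B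
  have key : lipNorm R w (decayNorm s) (fun ω => opMul (A ω) (B ω)) ≤ mulConst ν s * (A0 * b0 + a0 * B0) +
      mulConst ν s * (A1 * b0 + a1 * B0 + (A0 * b1 + a0 * B1)) := by
    refine lipNorm_le (fun ω hω => ?_) (fun ω₁ h₁ ω₂ h₂ hne => ?_)
    · refine (decayNorm_opMul_le hs _ _).trans ?_
      gcongr
      exacts [le_lipSup (decayNorm s) A hω, le_lipSup (decayNorm s₀) B hω,
        le_lipSup (decayNorm s₀) A hω, le_lipSup (decayNorm s) B hω]
    · rw [opMul_sub_sub (fA _ h₁) (fA _ h₂) (fB _ h₁) (fB _ h₂)]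
      set D := ‖ω₁ - ω₂‖ₑ
      have e1 := decayNorm_opMul_le hs (A ω₁ - A ω₂) (B ω₁)
      have e2 := decayNorm_opMul_le hs (A ω₂) (B ω₁ - B ω₂)
      have i1 := le_lipSemi (w := w) (decayNorm s) A h₁ h₂ hne
      have i2 := le_lipSemi (w := w) (decayNorm s₀) A h₁ h₂ hne
      have i3 := le_lipSemi (w := w) (decayNorm s) B h₁ h₂ hne
      have i4 := le_lipSemi (w := w) (decayNorm s₀) B h₁ h₂ hne
      have j1 := le_lipSup (decayNorm s) B h₁
      have j2 := le_lipSup (decayNorm s₀) B h₁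
      have j3 := le_lipSup (decayNorm s) A h₂
      have j4 := le_lipSup (decayNorm s₀) A h₂
      set W := ofReal w
      calc W * decayNorm s (opMul (A ω₁ - A ω₂) (B ω₁) + opMul (A ω₂) (B ω₁ - B ω₂))
          ≤ W * (mulConst ν s * (decayNorm s (A ω₁ - A ω₂) * decayNorm s₀ (B ω₁) +
              decayNorm s₀ (A ω₁ - A ω₂) * decayNorm s (B ω₁)) +
            mulConst ν s * (decayNorm s (A ω₂) * decayNorm s₀ (B ω₁ - B ω₂) +
              decayNorm s₀ (A ω₂) * decayNorm s (B ω₁ - B ω₂))) := by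
            gcongr
            exact (decayNorm_add_le s _ _).trans (add_le_add e1 e2)
        _ = mulConst ν s * ((W * decayNorm s (A ω₁ - A ω₂)) * decayNorm s₀ (B ω₁) +
              (W * decayNorm s₀ (A ω₁ - A ω₂)) * decayNorm s (B ω₁) +
            (decayNorm s (A ω₂) * (W * decayNorm s₀ (B ω₁ - B ω₂)) +
              decayNorm s₀ (A ω₂) * (W * decayNorm s (B ω₁ - B ω₂)))) := by ring
        _ ≤ mulConst ν s * ((A1 * D) * b0 + (a1 * D) * B0 + (A0 * (b1 * D) + a0 * (B1 * D))) := by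
            gcongr
        _ = _ := by ring
  refine key.trans ?_
  rw [lipNorm_eq, lipNorm_eq, lipNorm_eq, lipNorm_eq, ← mul_add]
  refine mul_le_mul' le_rfl ?_
  change A0 * b0 + a0 * B0 + (A1 * b0 + a1 * B0 + (A0 * b1 + a0 * B1)) ≤ (A0 + A1) * (b0 + b1) + (a0 + a1) * (B0 + B1)
  calc _ ≤ A0 * b0 + a0 * B0 + (A1 * b0 + a1 * B0 + (A0 * b1 + a0 * B1)) + (A1 * b1 + a1 * B1) := le_self_add
    _ = _ := by ring

lemma famNorm_opMul_le {s : ℝ} (hs : 0 ≤ s) {a b : ℝ} (e : ℝ) {A B : Freq ν → Op ν}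
    (hA : fN₀ a (-e) A ≠ ⊤) (hB : fN₀ e b B ≠ ⊤) :
    fN s a b (fun ω => opMul (A ω) (B ω)) ≤ mulConst ν s * (fN s a (-e) A * fN₀ e b B + fN₀ a (-e) A * fN s e b B) := by
  rw [famNorm]
  simp_rw [weighted_opMul a b e]
  exact lipNorm_opMul_le hs hA hB

lemma famNorm_conjOp_le (hψ : CS) (s a b : ℝ) (A : Freq ν → Op ν) :
    fN s a b (fun ω => conjOp ψ (A ω)) ≤ 8 * fN s a b A := by
  refine lipNorm_le_mul 8 (fun ω _ => ?_) (fun ω₁ _ ω₂ _ => ?_)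
  · rw [weighted_conjOp]; exact decayNorm_conjOp_le hψ _ _
  · rw [weighted_conjOp, weighted_conjOp, ← conjOp_sub]; exact decayNorm_conjOp_le hψ _ _

lemma decayNorm_smul_le {s : ℝ} {c : ℂ} (hc : ‖c‖ ≤ 1) (A : Op ν) : decayNorm s (c • A) ≤ decayNorm s A := by
  have := decayNorm_le_of_entry (s := s) (c := 1) (A := c • A) (B := A) (fun ℓ j k => by
    simp only [Pi.smul_apply, smul_eq_mul, enorm_mul]
    gcongr
    rw [← ofReal_norm c, ← ofReal_one]
    exact ofReal_le_ofReal hc)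
  simpa using this

lemma famNorm_add_le (s a b : ℝ) (A B : Freq ν → Op ν) : fN s a b (fun ω => A ω + B ω) ≤ fN s a b A + fN s a b B := by
  refine ((csub_decayNorm s).lipNorm_hasSum (R := R) (w := w) (ι := Bool)
    (g := fun i ω => weighted a b (cond i (A ω) (B ω))) fun ω _ => ?_).trans
    (by rw [tsum_fintype, Fintype.sum_bool]; rfl)
  convert hasSum_fintype _
  rw [Fintype.sum_bool]
  ext
  simp only [weighted, cond_true, cond_false, Pi.add_apply]; ring

lemma famNorm_smul_le {c : ℂ} (hc : ‖c‖ ≤ 1) (s a b : ℝ) (A : Freq ν → Op ν) :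
    fN s a b (fun ω => c • A ω) ≤ fN s a b A := by
  have e : ∀ B : Op ν, weighted a b (c • B) = c • weighted a b B := fun B => by
    ext; simp only [weighted, Pi.smul_apply, smul_eq_mul]; ring
  have := lipNorm_le_mul (R := R) (w := w) (N := decayNorm s) (N' := decayNorm s)
    (f := fun ω => weighted a b (c • A ω)) (g := fun ω => weighted a b (A ω)) 1
    (fun ω _ => by rw [one_mul, e]; exact decayNorm_smul_le hc _)
    (fun ω₁ _ ω₂ _ => by rw [one_mul, e, e, ← smul_sub]; exact decayNorm_smul_le hc _)
  rwa [one_mul] at this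

lemma famNorm_comb_le (s a b : ℝ) (P₁ P₂ P₃ P₄ : Freq ν → Op ν) :
    fN s a b (fun ω => Complex.I • (P₁ ω - P₂ ω - P₃ ω + P₄ ω)) ≤
      fN s a b P₁ + fN s a b P₂ + fN s a b P₃ + fN s a b P₄ := by
  have e : (fun ω => Complex.I • (P₁ ω - P₂ ω - P₃ ω + P₄ ω)) = fun ω => Complex.I • P₁ ω +
      (-Complex.I) • P₂ ω + (-Complex.I) • P₃ ω + Complex.I • P₄ ω := by funext ω; module
  rw [e]
  refine (famNorm_add_le ..).trans (add_le_add ((famNorm_add_le ..).trans (add_le_add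
    ((famNorm_add_le ..).trans (add_le_add ?_ ?_)) ?_)) ?_) <;>
    exact famNorm_smul_le (by simp) ..

/-- The entry selected by a term of the norm. -/
def OpMat.entry (δ : Bool) (A : OpMat ν) : Op ν := if δ then A.d else A.o

lemma matNorm_eq (s α β : ℝ) (A : Freq ν → OpMat ν) : mN s α β A =
    ∑ c ∈ decayTerms α β, fN s c.2.1 c.2.2 (fun ω => (A ω).entry c.1) := rfl

lemma famNorm_le_matNorm {s α β : ℝ} {A : Freq ν → OpMat ν} {c : Bool × ℝ × ℝ} (h : c ∈ decayTerms α β) :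
    fN s c.2.1 c.2.2 (fun ω => (A ω).entry c.1) ≤ mN s α β A := by
  rw [matNorm_eq]
  exact single_le_sum (f := fun c : Bool × ℝ × ℝ =>
    fN s c.2.1 c.2.2 (fun ω => (A ω).entry c.1)) (fun _ _ => zero_le) h

lemma zero_mem_decayTerms (α β : ℝ) (δ : Bool) : (δ, (0 : ℝ), (0 : ℝ)) ∈ decayTerms α β := by
  simp only [decayTerms, mem_union, mem_image, mem_product]
  exact Or.inr ⟨(0, δ), by simp, by simp⟩

lemma decayNorm_entry_le {s α β : ℝ} {A : Freq ν → OpMat ν} {ω : Freq ν} (h : ω ∈ R) (δ : Bool) :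
    decayNorm s ((A ω).entry δ) ≤ mN s α β A := by
  refine le_trans ?_ (famNorm_le_matNorm (zero_mem_decayTerms α β δ))
  refine (le_of_eq (congrArg _ ?_)).trans (le_lipNorm (R := R) (w := w) (decayNorm s) _ h)
  ext; simp [weighted]

lemma fin0_of_matNorm {α β : ℝ} {A : Freq ν → OpMat ν} (hA : mN₀ α β A ≠ ⊤) {ω : Freq ν} (h : ω ∈ R) : Fin0 (A ω) :=
  ⟨ne_top_of_le_ne_top hA (decayNorm_entry_le h true), ne_top_of_le_ne_top hA (decayNorm_entry_le h false)⟩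

lemma matNorm_mono_exp {s t α β : ℝ} (h : s ≤ t) (A : Freq ν → OpMat ν) : mN s α β A ≤ mN t α β A := by
  rw [matNorm_eq, matNorm_eq]
  refine sum_le_sum fun c _ => ?_
  have := lipNorm_le_mul (R := R) (w := w) (N := decayNorm s) (N' := decayNorm t)
    (f := fun ω => weighted c.2.1 c.2.2 ((A ω).entry c.1))
    (g := fun ω => weighted c.2.1 c.2.2 ((A ω).entry c.1)) 1
    (fun ω _ => by rw [one_mul]; exact decayNorm_mono_exp h _)
    (fun ω₁ _ ω₂ _ => by rw [one_mul]; exact decayNorm_mono_exp h _)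
  rwa [one_mul] at this

lemma matNorm_le_card {s α β : ℝ} {A : Freq ν → OpMat ν} {B : ℝ≥0∞}
    (h : ∀ c ∈ decayTerms α β, fN s c.2.1 c.2.2 (fun ω => (A ω).entry c.1) ≤ B) :
    mN s α β A ≤ (decayTerms α β).card * B := by
  rw [matNorm_eq, ← nsmul_eq_mul]
  exact sum_le_card_nsmul _ _ _ h

lemma matNorm_map_le {s t α β : ℝ} {c : ℝ≥0∞} (L : Bool → Op ν → Op ν) (hsub : ∀ δ A B, L δ (A - B) = L δ A - L δ B)
    (hw : ∀ δ a b A, weighted a b (L δ A) = L δ (weighted a b A))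
    (hL : ∀ δ A, decayNorm s (L δ A) ≤ c * decayNorm t A) {A A' : Freq ν → OpMat ν}
    (hA : ∀ ω δ, (A' ω).entry δ = L δ ((A ω).entry δ)) :
    mN s α β A' ≤ c * mN t α β A := by
  rw [matNorm_eq, matNorm_eq, mul_sum]
  refine sum_le_sum fun e _ => ?_
  refine lipNorm_le_mul c (fun ω _ => ?_) (fun ω₁ _ ω₂ _ => ?_)
  · simp only [hA, hw]; exact hL _ _
  · simp only [hA, hw, ← hsub]; exact hL _ _

lemma matNorm_hasSum_le {ι : Type} {s α β : ℝ} {A : ι → Freq ν → OpMat ν} {S : Freq ν → OpMat ν}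
    (h : ∀ ω ∈ R, ∀ δ, HasSum (fun i => (A i ω).entry δ) ((S ω).entry δ)) :
    mN s α β S ≤ ∑' i, mN s α β (A i) := by
  simp_rw [matNorm_eq]
  rw [Summable.tsum_finsetSum fun _ _ => ENNReal.summable]
  refine sum_le_sum fun c _ => ?_
  exact (csub_decayNorm s).lipNorm_hasSum fun ω hω => hasSum_weighted _ _ (h ω hω c.1)

/-- The constant in the estimate of the bracket. -/
def brConst (ν : ℕ) (α s : ℝ) : ℝ≥0∞ := (decayTerms α 0).card * (32 * mulConst ν s)

lemma brConst_ne_top (ν : ℕ) (α s : ℝ) : brConst ν α s ≠ ⊤ :=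
  mul_ne_top (by simp) (mul_ne_top (by simp) (mulConst_ne_top ν s))

lemma brConst_mono (ν : ℕ) (α : ℝ) {s t : ℝ} (h : s ≤ t) : brConst ν α s ≤ brConst ν α t := by
  unfold brConst mulConst
  gcongr
  norm_num

@[simp] lemma OpMat.entry_true (A : OpMat ν) : A.entry true = A.d := rfl
@[simp] lemma OpMat.entry_false (A : OpMat ν) : A.entry false = A.o := rfl

lemma famNorm_opMul_le' {s : ℝ} (hs : 0 ≤ s) {p q : ℝ} (e : ℝ) {A B : Freq ν → Op ν}
    {u u₀ v v₀ : ℝ≥0∞} (hu : fN s p (-e) A ≤ u)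
    (hu₀ : fN₀ p (-e) A ≤ u₀) (hv : fN s e q B ≤ v)
    (hv₀ : fN₀ e q B ≤ v₀) (fu : u₀ ≠ ⊤) (fv : v₀ ≠ ⊤) :
    fN s p q (fun ω => opMul (A ω) (B ω)) ≤ mulConst ν s * (u * v₀ + u₀ * v) := by
  refine (famNorm_opMul_le hs e (ne_top_of_le_ne_top fu hu₀) (ne_top_of_le_ne_top fv hv₀)).trans ?_
  exact mul_le_mul' le_rfl (add_le_add (mul_le_mul' hu hv₀) (mul_le_mul' hu₀ hv))

lemma famNorm_opMul_conjOp_le (hψ : CS) {s : ℝ} (hs : 0 ≤ s) {p q : ℝ} (e : ℝ) {A B : Freq ν → Op ν}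
    {u u₀ v v₀ : ℝ≥0∞} (hu : fN s p (-e) A ≤ u)
    (hu₀ : fN₀ p (-e) A ≤ u₀) (hv : fN s e q B ≤ v)
    (hv₀ : fN₀ e q B ≤ v₀) (fu : u₀ ≠ ⊤) (fv : v₀ ≠ ⊤) :
    fN s p q (fun ω => opMul (A ω) (conjOp ψ (B ω))) ≤ 8 * (mulConst ν s * (u * v₀ + u₀ * v)) := by
  refine (famNorm_opMul_le' hs e hu hu₀ ((famNorm_conjOp_le hψ s e q B).trans (mul_le_mul' le_rfl hv))
    ((famNorm_conjOp_le hψ _ e q B).trans (mul_le_mul' le_rfl hv₀)) fu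
    (mul_ne_top (by simp) fv)).trans (le_of_eq ?_)
  ring

lemma diag_mem_decayTerms {α β : ℝ} (δ : Bool) {ς : ℝ} (h : ς = α ∨ ς = -α ∨ ς = 0) : (δ, ς, -ς) ∈ decayTerms α β := by
  simp only [decayTerms, mem_union, mem_image, mem_product]
  refine Or.inr ⟨(ς, δ), ?_, rfl⟩
  simp only [mem_insert, mem_singleton, mem_univ, and_true]
  tauto

local notation "tame" s:max α:max A:max X:max => (mN s α 0 A * mN₀ α α X + mN₀ α 0 A * mN s α α X)

lemma famNorm_bracket_le (hψ : CS) {s α : ℝ} (hs : 0 ≤ s)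
    {A X : Freq ν → OpMat ν} (hA : mN₀ α 0 A ≠ ⊤) (hX : mN₀ α α X ≠ ⊤) {p q : ℝ} (δ : Bool)
    (e₁ e₂ e₃ e₄ : ℝ)
    (m₁ : (true, p, -e₁) ∈ decayTerms α 0) (n₁ : (δ, e₁, q) ∈ decayTerms α α)
    (n₂ : (true, p, -e₂) ∈ decayTerms α α) (m₂ : (δ, e₂, q) ∈ decayTerms α 0)
    (m₃ : (false, p, -e₃) ∈ decayTerms α 0) (n₃ : (!δ, e₃, q) ∈ decayTerms α α)
    (n₄ : (false, p, -e₄) ∈ decayTerms α α) (m₄ : (!δ, e₄, q) ∈ decayTerms α 0) :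
    fN s p q (fun ω => (bracket ψ (A ω) (X ω)).entry δ) ≤ 32 * (mulConst ν s * tame s α A X) := by
  have cA : ∀ {t δ p q}, (δ, p, q) ∈ decayTerms α 0 →
      fN t p q (fun ω => (A ω).entry δ) ≤ mN t α 0 A := fun {t δ p q} h =>
    famNorm_le_matNorm (c := (δ, p, q)) h
  have cX : ∀ {t δ p q}, (δ, p, q) ∈ decayTerms α α →
      fN t p q (fun ω => (X ω).entry δ) ≤ mN t α α X := fun {t δ p q} h =>
    famNorm_le_matNorm (c := (δ, p, q)) h
  have hT : ∀ T : ℝ≥0∞, T ≤ 8 * T := fun T => le_mul_of_one_le_left' (by norm_num)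
  have t₁ := famNorm_opMul_le' hs e₁ (cA m₁) (cA m₁) (cX n₁) (cX n₁) hA hX
  have t₂ := famNorm_opMul_le' hs e₂ (cX n₂) (cX n₂) (cA m₂) (cA m₂) hX hA
  have t₃ := famNorm_opMul_conjOp_le hψ hs e₃ (cA m₃) (cA m₃) (cX n₃) (cX n₃) hA hX
  have t₄ := famNorm_opMul_conjOp_le hψ hs e₄ (cX n₄) (cX n₄) (cA m₄) (cA m₄) hX hA
  have e : (fun ω => (bracket ψ (A ω) (X ω)).entry δ) = fun ω => Complex.I •
      (opMul ((A ω).entry true) ((X ω).entry δ) - opMul ((X ω).entry true) ((A ω).entry δ) -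
      opMul ((A ω).entry false) (conjOp ψ ((X ω).entry !δ)) +
      opMul ((X ω).entry false) (conjOp ψ ((A ω).entry !δ))) := by cases δ <;> rfl
  rw [e]
  refine (famNorm_comb_le s p q _ _ _ _).trans ((add_le_add (add_le_add (add_le_add
    (t₁.trans (hT _)) (t₂.trans (hT _))) t₃) t₄).trans (le_of_eq ?_))
  ring

lemma matNorm_bracket_le (hψ : CS) {s α : ℝ} (hs : 0 ≤ s)
    {A X : Freq ν → OpMat ν} (hA : mN₀ α 0 A ≠ ⊤) (hX : mN₀ α α X ≠ ⊤) :
    mN s α 0 (fun ω => bracket ψ (A ω) (X ω)) ≤ brConst ν α s * tame s α A X := by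
  have z0 : -(0 : ℝ) = 0 := neg_zero
  have dA2 : (true, (0 : ℝ), α) ∈ decayTerms α 0 := by simp [decayTerms]
  have dX1 : ∀ δ, (δ, α, (0 : ℝ)) ∈ decayTerms α α := by intro δ; cases δ <;> simp [decayTerms]
  have dX2 : ∀ δ, (δ, (0 : ℝ), α) ∈ decayTerms α α := by intro δ; cases δ <;> simp [decayTerms]
  have z : ∀ β δ, (δ, (0 : ℝ), -(0 : ℝ)) ∈ decayTerms α β := fun β δ =>
    diag_mem_decayTerms δ (by simp)
  have hterm : ∀ δ ς, (ς = α ∨ ς = -α ∨ ς = 0) → fN s ς (-ς) (fun ω => (bracket ψ (A ω) (X ω)).entry δ) ≤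
      32 * (mulConst ν s * tame s α A X) := by
    intro δ ς h
    have m : ∀ β δ, (δ, ς, -ς) ∈ decayTerms α β := fun β δ => diag_mem_decayTerms δ h
    exact famNorm_bracket_le hψ hs hA hX δ ς ς ς ς (m _ _) (m _ _) (m _ _) (m _ _) (m _ _) (m _ _) (m _ _) (m _ _)
  refine (matNorm_le_card (B := 32 * (mulConst ν s * tame s α A X)) ?_).trans (le_of_eq (by rw [brConst]; ring))
  rintro ⟨δ, p, q⟩ hc
  simp only [decayTerms, mem_union, mem_image, mem_product, mem_insert, mem_singleton, Prod.mk.injEq, Prod.exists] at hc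
  rcases hc with (⟨rfl, rfl, rfl⟩ | ⟨rfl, rfl, rfl⟩ | ⟨rfl, rfl, rfl⟩ | ⟨rfl, rfl, rfl⟩) |
    ⟨ς, δ', ⟨hς, -⟩, rfl, rfl, rfl⟩
  · exact famNorm_bracket_le hψ hs hA hX true 0 0 p 0 (by simp [decayTerms])
      (zero_mem_decayTerms _ _ _) (by rw [z0]; exact dX1 _) (zero_mem_decayTerms _ _ _)
      (diag_mem_decayTerms _ (by simp)) (dX1 _) (by rw [z0]; exact dX1 _)
      (zero_mem_decayTerms _ _ _)
  · exact famNorm_bracket_le hψ hs hA hX true 0 0 0 (-q) (z _ _) (dX2 _) (z _ _) dA2 (z _ _)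
      (dX2 _) (by rw [neg_neg]; exact dX2 _)
      (by have := diag_mem_decayTerms (α := q) (β := 0) false (ς := -q) (by simp)
          rwa [neg_neg] at this)
  iterate 2
    · have := hterm false 0 (by simp)
      rwa [z0] at this
  · refine hterm _ _ ?_
    rcases hς with h | h | h | h | h <;> simp [h]

/-- The iterated brackets `ad^k A`. -/
def adIter (ψ : 𝔹) (A X : OpMat ν) : ℕ → OpMat ν
  | 0 => A
  | k + 1 => bracket ψ (adIter ψ A X k) X

lemma matNorm_adIter_zero_ne_top (hψ : CS) {α : ℝ} {A X : Freq ν → OpMat ν} (hA : mN₀ α 0 A ≠ ⊤)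
    (hX : mN₀ α α X ≠ ⊤) (k : ℕ) :
    mN₀ α 0 (fun ω => adIter ψ (A ω) (X ω) k) ≠ ⊤ := by
  induction k with
  | zero => exact hA
  | succ k ih =>
    refine ne_top_of_le_ne_top ?_ (matNorm_bracket_le hψ (by positivity) ih hX)
    exact mul_ne_top (brConst_ne_top _ _ _) (add_ne_top.2 ⟨mul_ne_top ih hX, mul_ne_top ih hX⟩)

lemma matNorm_adIter_succ_le (hψ : CS) {s α : ℝ} (hs : (sZero ν : ℝ) ≤ s) {A X : Freq ν → OpMat ν} (hA : mN₀ α 0 A ≠ ⊤)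
    (hX : mN₀ α α X ≠ ⊤) (k : ℕ) :
    mN s α 0 (fun ω => adIter ψ (A ω) (X ω) (k + 1)) ≤ brConst ν α s * (3 * brConst ν α s * mN₀ α α X) ^ k *
      tame s α A X := by
  have hs0 : (0 : ℝ) ≤ sZero ν := by positivity
  set C := brConst ν α s
  set x := mN s α α X
  set x₀ := mN₀ α α X
  set n : ℕ → ℝ≥0∞ := fun k => mN s α 0 (fun ω => adIter ψ (A ω) (X ω) k) * x₀ +
    mN₀ α 0 (fun ω => adIter ψ (A ω) (X ω) k) * x with hn
  have hstep : ∀ k, mN s α 0 (fun ω => adIter ψ (A ω) (X ω) (k + 1)) ≤ C * n k :=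
    fun k => matNorm_bracket_le hψ (hs0.trans hs) (matNorm_adIter_zero_ne_top hψ hA hX k) hX
  have hstep0 : ∀ k, mN₀ α 0 (fun ω => adIter ψ (A ω) (X ω) (k + 1)) ≤
      2 * C * x₀ * mN₀ α 0 (fun ω => adIter ψ (A ω) (X ω) k) := by
    intro k
    refine (matNorm_bracket_le hψ hs0 (matNorm_adIter_zero_ne_top hψ hA hX k) hX).trans ?_
    rw [← two_mul]
    calc _ ≤ C * (2 * (mN₀ α 0 (fun ω => adIter ψ (A ω) (X ω) k) * x₀)) := by
          gcongr; exact brConst_mono _ _ hs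
      _ = _ := by ring
  have hrec : ∀ k, n (k + 1) ≤ 3 * C * x₀ * n k := by
    intro k
    calc n (k + 1) ≤ C * n k * x₀ + (2 * C * x₀ * mN₀ α 0 (fun ω => adIter ψ (A ω) (X ω) k)) * x := by
          simp only [hn]
          gcongr
          exacts [hstep k, hstep0 k]
      _ = C * n k * x₀ + 2 * C * x₀ * (mN₀ α 0 (fun ω => adIter ψ (A ω) (X ω) k) * x) := by ring
      _ ≤ C * n k * x₀ + 2 * C * x₀ * n k := by gcongr; exact le_add_self
      _ = _ := by ring
  have hpow : ∀ k, n k ≤ (3 * C * x₀) ^ k * n 0 := by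
    intro k
    induction k with
    | zero => simp
    | succ k ih =>
      refine (hrec k).trans ?_
      rw [pow_succ, mul_comm (_ ^ k), mul_assoc (3 * C * x₀)]
      exact mul_le_mul' le_rfl ih
  refine (hstep k).trans ?_
  rw [mul_assoc]
  gcongr
  exact hpow k

/-- The series `∑_{k ≥ 1} r_k ad^k A`. -/
def adSeries (ψ : 𝔹) (r : ℕ → ℝ) (A X : OpMat ν) : OpMat ν where
  d := fun ℓ i j => ∑' k, (r k : ℂ) * (adIter ψ A X (k + 1)).d ℓ i j
  o := fun ℓ i j => ∑' k, (r k : ℂ) * (adIter ψ A X (k + 1)).o ℓ i j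

lemma tsum_matNorm_adIter_le (hψ : CS) {s α : ℝ} (hs : (sZero ν : ℝ) ≤ s) {A X : Freq ν → OpMat ν} (hA : mN₀ α 0 A ≠ ⊤)
    (hX : mN₀ α α X ≠ ⊤)
    (hsmall : 3 * brConst ν α s * mN₀ α α X ≤ 2⁻¹) :
    ∑' k, mN s α 0 (fun ω => adIter ψ (A ω) (X ω) (k + 1)) ≤ 2 * brConst ν α s * tame s α A X := by
  refine (tsum_le_tsum (matNorm_adIter_succ_le hψ hs hA hX)).trans ?_
  rw [ENNReal.tsum_mul_right, ENNReal.tsum_mul_left]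
  refine mul_le_mul' ?_ le_rfl
  rw [mul_comm]
  refine mul_le_mul' ?_ le_rfl
  rw [ENNReal.tsum_geometric]
  rw [ENNReal.inv_le_iff_inv_le, ← ENNReal.one_sub_inv_two]
  exact tsub_le_tsub_left hsmall 1

lemma hasSum_adSeries (hψ : CS) {α : ℝ} {r : ℕ → ℝ} (hr : ∀ k, |r k| ≤ 1) {A X : Freq ν → OpMat ν} (hA : mN₀ α 0 A ≠ ⊤)
    (hX : mN₀ α α X ≠ ⊤)
    (hsmall : 3 * brConst ν α (sZero ν) * mN₀ α α X ≤ 2⁻¹)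
    {ω : Freq ν} (hω : ω ∈ R) (δ : Bool) :
    HasSum (fun k => (r k : ℂ) • (adIter ψ (A ω) (X ω) (k + 1)).entry δ) ((adSeries ψ r (A ω) (X ω)).entry δ) := by
  have hfin : ∑' k, mN₀ α 0 (fun ω => adIter ψ (A ω) (X ω) (k + 1)) ≠ ⊤ := by
    refine ne_top_of_le_ne_top ?_ (tsum_matNorm_adIter_le hψ le_rfl hA hX hsmall)
    exact mul_ne_top (mul_ne_top (by simp) (brConst_ne_top _ _ _)) (add_ne_top.2 ⟨mul_ne_top hA hX, mul_ne_top hA hX⟩)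
  have hsum : ∀ ℓ i j, Summable fun k => (r k : ℂ) * (adIter ψ (A ω) (X ω) (k + 1)).entry δ ℓ i j := by
    intro ℓ i j
    refine Summable.of_enorm (ne_top_of_le_ne_top hfin (tsum_le_tsum fun k => ?_))
    have h1 := decayNorm_smul_le (s := sZero ν) (c := (r k : ℂ)) (by simpa using hr k)
      ((adIter ψ (A ω) (X ω) (k + 1)).entry δ)
    have h2 := enorm_le_decayNorm (s := sZero ν) (by positivity)
      ((r k : ℂ) • (adIter ψ (A ω) (X ω) (k + 1)).entry δ) ℓ i j
    exact h2.trans (h1.trans (decayNorm_entry_le (A := fun ω => adIter ψ (A ω) (X ω) (k + 1)) hω δ))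
  rw [hasSum_op_iff]
  intro ℓ i j
  have := (hsum ℓ i j).hasSum
  cases δ <;> exact this

lemma matNorm_smul_le {s α β : ℝ} {c : ℝ} (hc : |c| ≤ 1) {A A' : Freq ν → OpMat ν}
    (h : ∀ ω δ, (A' ω).entry δ = (c : ℂ) • (A ω).entry δ) :
    mN s α β A' ≤ mN s α β A := by
  have := matNorm_map_le (R := R) (w := w) (s := s) (t := s) (α := α) (β := β) (c := 1)
    (fun _ B => (c : ℂ) • B) (fun _ A B => smul_sub _ A B)
    (fun _ a b B => by
      funext ℓ j k
      simp only [weighted, Pi.smul_apply, smul_eq_mul]; ring)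
    (fun _ B => by rw [one_mul]; exact decayNorm_smul_le (by simpa using hc) B) h
  rwa [one_mul] at this

lemma matNorm_adSeries_le (hψ : CS) {s α : ℝ} (hs : (sZero ν : ℝ) ≤ s) {r : ℕ → ℝ} (hr : ∀ k, |r k| ≤ 1)
    {A X : Freq ν → OpMat ν} (hA : mN₀ α 0 A ≠ ⊤)
    (hX : mN₀ α α X ≠ ⊤)
    (hsmall : 3 * brConst ν α s * mN₀ α α X ≤ 2⁻¹) :
    mN s α 0 (fun ω => adSeries ψ r (A ω) (X ω)) ≤ 2 * brConst ν α s * tame s α A X := by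
  have hsmall0 : 3 * brConst ν α (sZero ν) * mN₀ α α X ≤ 2⁻¹ := by
    refine le_trans ?_ hsmall
    gcongr
    exact brConst_mono _ _ hs
  refine le_trans ?_ (tsum_matNorm_adIter_le hψ hs hA hX hsmall)
  refine (matNorm_hasSum_le (A := fun k ω => ⟨(r k : ℂ) • (adIter ψ (A ω) (X ω) (k + 1)).d,
    (r k : ℂ) • (adIter ψ (A ω) (X ω) (k + 1)).o⟩) fun ω hω δ => ?_).trans ?_
  · convert hasSum_adSeries hψ hr hA hX hsmall0 hω δ using 2
    cases δ <;> rfl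
  · refine tsum_le_tsum fun k => matNorm_smul_le (hr k) fun ω δ => ?_
    cases δ <;> rfl

lemma isHam_adIter (hψ : CS) {A X : OpMat ν}
    (fA : ∀ k, Fin0 (adIter ψ A X k)) (fX : Fin0 X) (hA : A.IsHam ψ) (hX : X.IsHam ψ) (k : ℕ) :
    (adIter ψ A X k).IsHam ψ := by
  induction k with
  | zero => exact hA
  | succ k ih => exact isHam_bracket hψ (fA k) fX ih hX

lemma isHam_hasSum {ι : Type*} {A : ι → OpMat ν} {S : OpMat ν}
    (h : ∀ δ, HasSum (fun i => (A i).entry δ) (S.entry δ)) (hA : ∀ i, (A i).IsHam ψ) :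
    S.IsHam ψ := by
  rw [isHam_iff]
  have hd : HasSum (fun i => (A i).d) S.d := h true
  have ho : HasSum (fun i => (A i).o) S.o := h false
  constructor
  · refine (hasSum_adj hd).unique ?_
    convert hd using 2 with i
    exact ((isHam_iff ψ _).1 (hA i)).1
  · refine (hasSum_adj ho).unique ?_
    convert hasSum_conjOp ψ ho using 2 with i
    exact ((isHam_iff ψ _).1 (hA i)).2

lemma isHam_smul {A : OpMat ν} (h : A.IsHam ψ) (r : ℝ) : (⟨(r : ℂ) • A.d, (r : ℂ) • A.o⟩ : OpMat ν).IsHam ψ := by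
  rw [isHam_iff] at h ⊢
  simp only [adj_smul, conjOp_smul, conj_ofReal, h.1, h.2, and_self]


/-! ### Bounded operators with given matrices -/

section Basis
variable (ψ : 𝔹)

lemma enorm_lp {ι : Type*} {E : Type*} [NormedAddCommGroup E] (f : lp (fun _ : ι => E) 2) :
    ‖f‖ₑ = l2 fun i => ‖f i‖ₑ := by
  have h := lp.hasSum_norm (p := 2) (by norm_num) f
  simp only [toReal_ofNat, rpow_two] at h
  have h2 : ∑' i, ‖f i‖ₑ ^ 2 = ‖f‖ₑ ^ 2 := by
    have := ofReal_tsum_of_nonneg (fun i => sq_nonneg ‖f i‖) h.summable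
    rw [h.tsum_eq] at this
    simp only [ofReal_pow (norm_nonneg _), ofReal_norm] at this
    exact this.symm
  rw [l2, h2, sq_rpow_half]

lemma memLp_two_of_l2 {ι : Type*} {f : ι → ℂ} (h : l2 (fun i => ‖f i‖ₑ) ≠ ⊤) : Memℓp f 2 := by
  refine memℓp_gen ?_
  simp only [toReal_ofNat, rpow_two]
  have h1 : ∑' i, ‖f i‖ₑ ^ 2 ≠ ⊤ := by
    rw [← l2_sq]; exact pow_ne_top h
  have h2 := ENNReal.summable_toReal h1
  simpa using h2

lemma orthonormal_single : Orthonormal ℂ (fun a : 𝕁 ν => (lp.single 2 a.1 (ψ a.2) : L2 ν)) := by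
  rw [orthonormal_iff_ite]
  intro a b
  rw [lp.inner_single_left, lp.single_apply]
  by_cases h : a.1 = b.1
  · have hψ := orthonormal_iff_ite.1 ψ.orthonormal a.2 b.2
    rw [h, Pi.single_eq_same, hψ]
    simp [Prod.ext_iff, h]
  · rw [Pi.single_eq_of_ne h, inner_zero_right, if_neg]
    rintro rfl; exact h rfl

/-- The Hilbert basis `e^{iℓ·φ} ψ_j(x)` of `L²(𝕋^{ν+1})`. -/
def pbasis : HilbertBasis (𝕁 ν) ℂ (L2 ν) :=
  HilbertBasis.mkOfOrthogonalEqBot (orthonormal_single ψ) (by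
    rw [Submodule.eq_bot_iff]
    intro u hu
    rw [Submodule.mem_orthogonal] at hu
    refine lp.ext (funext fun ℓ => ?_)
    refine ψ.repr.injective (lp.ext (funext fun j => ?_))
    have := hu _ (Submodule.subset_span ⟨(ℓ, j), rfl⟩)
    rw [lp.inner_single_left] at this
    rw [ψ.repr_apply_apply, this]
    simp)

lemma pbasis_apply (a : 𝕁 ν) : pbasis ψ a = (lp.single 2 a.1 (ψ a.2) : L2 ν) := by
  rw [pbasis, HilbertBasis.coe_mkOfOrthogonalEqBot]

lemma pbasis_repr (u : L2 ν) (a : 𝕁 ν) : (pbasis ψ).repr u a = coef ψ u a.1 a.2 := by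
  rw [repr_apply_apply, pbasis_apply, lp.inner_single_left, coef, repr_apply_apply]

/-- The Sobolev norm through the basis `e^{iℓ·φ} ψ_j(x)`. -/
def psiNorm (r : ℝ) (u : L2 ν) : ℝ≥0∞ := wnorm r fun a => ‖coef ψ u a.1 a.2‖ₑ

lemma psiNorm_zero (u : L2 ν) : psiNorm ψ 0 u = ‖u‖ₑ := by
  rw [← (pbasis ψ).repr.enorm_map, enorm_lp, psiNorm, wnorm]
  simp only [wt_zero, one_mul, pbasis_repr]

@[simp] lemma coef_add (u v : L2 ν) (ℓ : 𝕀 ν) (j : ℤ) :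
    coef ψ (u + v) ℓ j = coef ψ u ℓ j + coef ψ v ℓ j := by simp [coef]

@[simp] lemma coef_sub (u v : L2 ν) (ℓ : 𝕀 ν) (j : ℤ) :
    coef ψ (u - v) ℓ j = coef ψ u ℓ j - coef ψ v ℓ j := by simp [coef]

@[simp] lemma coef_neg (u : L2 ν) (ℓ : 𝕀 ν) (j : ℤ) : coef ψ (-u) ℓ j = -coef ψ u ℓ j := by simp [coef]

@[simp] lemma coef_smul (c : ℂ) (u : L2 ν) (ℓ : 𝕀 ν) (j : ℤ) : coef ψ (c • u) ℓ j = c * coef ψ u ℓ j := by simp [coef]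

@[simp] lemma coef_zero (ℓ : 𝕀 ν) (j : ℤ) : coef ψ (0 : L2 ν) ℓ j = 0 := by simp [coef]

lemma coef_ext {u v : L2 ν} (h : ∀ ℓ j, coef ψ u ℓ j = coef ψ v ℓ j) : u = v := by
  refine (pbasis ψ).repr.injective (lp.ext (funext fun a => ?_))
  rw [pbasis_repr, pbasis_repr, h]

/-- The coefficients as continuous linear functionals. -/
def coefCLM (ℓ : 𝕀 ν) (j : ℤ) : L2 ν →L[ℂ] ℂ := innerSL ℂ (pbasis ψ (ℓ, j))

lemma coefCLM_apply (ℓ : 𝕀 ν) (j : ℤ) (u : L2 ν) : coefCLM ψ ℓ j u = coef ψ u ℓ j := by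
  rw [coefCLM, innerSL_apply_apply, ← repr_apply_apply, pbasis_repr]

lemma coef_pbasis (b : 𝕁 ν) (ℓ : 𝕀 ν) (j : ℤ) : coef ψ (pbasis ψ b) ℓ j = if (ℓ, j) = b then 1 else 0 := by
  rw [← pbasis_repr ψ _ (ℓ, j), repr_self, lp.single_apply, Pi.single_apply]

lemma clm_ext_of_pbasis {T S : L2 ν →L[ℂ] L2 ν}
    (h : ∀ b ℓ j, coef ψ (T (pbasis ψ b)) ℓ j = coef ψ (S (pbasis ψ b)) ℓ j) : T = S := by
  refine ContinuousLinearMap.ext_on (s := Set.range (pbasis (ν := ν) ψ)) ?_ ?_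
  · have := (pbasis (ν := ν) ψ).dense_span
    rw [Submodule.dense_iff_topologicalClosure_eq_top]
    exact this
  · rintro _ ⟨b, rfl⟩
    exact coef_ext ψ (h b)

end Basis

/-- The reflection `(ℓ, j) ↦ (ℓ, -j)`. -/
def reflJ : 𝕁 ν ≃ 𝕁 ν :=
  (Equiv.refl (𝕀 ν)).prodCongr (Equiv.neg ℤ)

lemma tsum_mat_le (A : Op ν) (F : 𝕁 ν → ℝ≥0∞) (y : 𝕁 ν) : ∑' a : 𝕁 ν, ‖A (y.1 - a.1) y.2 a.2‖ₑ * F a ≤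
      conv (ent A) (fun a => F a + F (reflJ a)) y := by
  have h1 : ∀ a : 𝕁 ν, ‖A (y.1 - a.1) y.2 a.2‖ₑ * F a ≤
      ent A (y.1 - a.1, y.2 - a.2) * F a + ent A (y.1 - a.1, y.2 + a.2) * F a := by
    intro a
    rw [← add_mul]
    refine mul_le_mul' ((le_ent A _ _ _).trans ?_) le_rfl
    have : |(|y.2| - |a.2|)| = |y.2 - a.2| ∨ |(|y.2| - |a.2|)| = |y.2 + a.2| := by
      simp only [Int.abs_eq_natAbs]; omega
    rcases this with h | h
    · rw [ent_congr A _ h]; exact le_self_add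
    · rw [ent_congr A _ h]; exact le_add_self
  refine (tsum_le_tsum h1).trans ?_
  rw [tsum_add]
  have h2 : ∑' a : 𝕁 ν, ent A (y.1 - a.1, y.2 + a.2) * F a = ∑' a, ent A (y - a) * F (reflJ a) := by
    rw [← (reflJ (ν := ν)).tsum_eq]
    refine tsum_congr fun a => ?_
    simp [reflJ, sub_eq_add_neg, Prod.add_def]
  rw [h2, ← tsum_add, conv]
  exact le_of_eq (tsum_congr fun a => (mul_add _ _ _).symm)

/-- The constant in the action of matrices on Sobolev spaces. -/
def actConst (ν : ℕ) : ℝ≥0∞ := 8 * ofReal (2 ^ (sZero ν : ℝ)) * sobConst ν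

lemma actConst_ne_top (ν : ℕ) : actConst ν ≠ ⊤ :=
  mul_ne_top (mul_ne_top (by simp) ofReal_ne_top) (sobConst_ne_top ν)

lemma wnorm_reflJ (r : ℝ) (F : 𝕁 ν → ℝ≥0∞) : wnorm r (fun a => F (reflJ a)) = wnorm r F := by
  rw [wnorm, wnorm]
  conv_rhs => rw [← l2_comp_equiv (reflJ (ν := ν))]
  congr 1
  funext a
  simp [wt, reflJ, br2]

lemma wnorm_mat_le {r : ℝ} (hr : 0 ≤ r) (hr' : r ≤ sZero ν) (A : Op ν) (F : 𝕁 ν → ℝ≥0∞) :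
    wnorm r (fun y => ∑' a : 𝕁 ν, ‖A (y.1 - a.1) y.2 a.2‖ₑ * F a) ≤ actConst ν * dn₀ A * wnorm r F := by
  refine (wnorm_mono_right (tsum_mat_le A F)).trans ?_
  refine (wnorm_conv_le_of_le hr hr' _ _).trans ?_
  have h1 : wnorm r (fun a => F a + F (reflJ a)) ≤ 2 * wnorm r F := by
    calc _ = l2 (fun a => wt r a * F a + wt r a * F (reflJ a)) := by simp only [wnorm, mul_add]
      _ ≤ wnorm r F + wnorm r (fun a => F (reflJ a)) := l2_add_le _ _
      _ = _ := by rw [wnorm_reflJ, two_mul]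
  refine (mul_le_mul' le_rfl (mul_le_mul' (wnorm_ent_le _ A) h1)).trans (le_of_eq ?_)
  rw [actConst]; ring

lemma mat_sum_ne_top {A : Op ν} (hA : dn₀ A ≠ ⊤) (u : L2 ν) (y : 𝕁 ν) :
    ∑' a : 𝕁 ν, ‖A (y.1 - a.1) y.2 a.2‖ₑ * ‖coef ψ u a.1 a.2‖ₑ ≠ ⊤ := by
  have h := wnorm_mat_le le_rfl (cast_nonneg _) A (fun a => ‖coef ψ u a.1 a.2‖ₑ)
  have h2 : wnorm 0 (fun a : 𝕁 ν => ‖coef ψ u a.1 a.2‖ₑ) = ‖u‖ₑ := psiNorm_zero ψ u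
  rw [h2] at h
  refine ne_top_of_le_ne_top (mul_ne_top (mul_ne_top (actConst_ne_top ν) hA) enorm_ne_top) (le_trans ?_ h)
  refine le_trans ?_ (le_l2 _ y)
  rw [wt_zero, one_mul]

lemma summable_mat {A : Op ν} (hA : dn₀ A ≠ ⊤) (u : L2 ν) (y : 𝕁 ν) :
    Summable fun a : 𝕁 ν => A (y.1 - a.1) y.2 a.2 * coef ψ u a.1 a.2 := by
  refine Summable.of_enorm ?_
  simp only [enorm_mul]
  exact mat_sum_ne_top hA u y

lemma l2_matSum_le {A : Op ν} (u : L2 ν) : l2 (fun y : 𝕁 ν => ‖∑' a : 𝕁 ν, A (y.1 - a.1) y.2 a.2 * coef ψ u a.1 a.2‖ₑ) ≤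
      actConst ν * dn₀ A * ‖u‖ₑ := by
  have h := wnorm_mat_le le_rfl (cast_nonneg _) A (fun a => ‖coef ψ u a.1 a.2‖ₑ)
  have h2 : wnorm 0 (fun a : 𝕁 ν => ‖coef ψ u a.1 a.2‖ₑ) = ‖u‖ₑ := psiNorm_zero ψ u
  rw [h2] at h
  refine le_trans (l2_mono fun y => ?_) h
  rw [wt_zero, one_mul]
  refine enorm_tsum_le_tsum_enorm.trans (le_of_eq ?_)
  simp only [enorm_mul]

lemma exists_realizes (ψ : 𝔹) {A : Op ν} (hA : dn₀ A ≠ ⊤) : ∃ T : L2 ν →L[ℂ] L2 ν, Realizes ψ A T := by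
  have hc : actConst ν * dn₀ A ≠ ⊤ := mul_ne_top (actConst_ne_top ν) hA
  have hm : ∀ u : L2 ν, Memℓp (fun y : 𝕁 ν => ∑' a : 𝕁 ν, A (y.1 - a.1) y.2 a.2 * coef ψ u a.1 a.2) 2 := fun u =>
    memLp_two_of_l2 (ne_top_of_le_ne_top (mul_ne_top hc enorm_ne_top) (l2_matSum_le u))
  let L : L2 ν →ₗ[ℂ] lp (fun _ : 𝕁 ν => ℂ) 2 :=
    { toFun := fun u => ⟨_, hm u⟩, map_add' := fun u v => by
        refine lp.ext (funext fun y => ?_)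
        simp only [lp.coeFn_add, Pi.add_apply, coef_add, mul_add]
        exact (summable_mat hA u y).tsum_add (summable_mat hA v y)
      map_smul' := fun c u => by
        refine lp.ext (funext fun y => ?_)
        simp only [lp.coeFn_smul, Pi.smul_apply, coef_smul, RingHom.id_apply, smul_eq_mul]
        rw [← tsum_mul_left]
        exact tsum_congr fun a => by ring }
  have hL : ∀ u, ‖L u‖ ≤ (actConst ν * dn₀ A).toReal * ‖u‖ := by
    intro u
    have h := l2_matSum_le (ψ := ψ) (A := A) u
    have h2 : ‖L u‖ₑ ≤ actConst ν * dn₀ A * ‖u‖ₑ := by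
      rw [enorm_lp]; exact h
    have h3 := toReal_mono (mul_ne_top hc enorm_ne_top) h2
    rwa [toReal_mul, toReal_enorm, toReal_enorm] at h3
  refine ⟨((pbasis (ν := ν) ψ).repr.symm.toContinuousLinearEquiv.toContinuousLinearMap).comp
    (L.mkContinuous _ hL), fun u ℓ j => ?_⟩
  have h := (summable_mat (ψ := ψ) hA u (ℓ, j)).hasSum
  convert h using 1
  rw [← pbasis_repr ψ _ (ℓ, j)]
  simp [L]

lemma realizes_toCLM (ψ : 𝔹) {A : Op ν} (hA : dn₀ A ≠ ⊤) : Realizes ψ A (toCLM ψ A) := by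
  have h := exists_realizes ψ hA
  rw [toCLM, dif_pos h]
  exact h.choose_spec

lemma Realizes.coef_pbasis {A : Op ν} {T : L2 ν →L[ℂ] L2 ν} (h : Realizes ψ A T) (b : 𝕁 ν) (ℓ : 𝕀 ν) (j : ℤ) :
    coef ψ (T (pbasis ψ b)) ℓ j = A (ℓ - b.1) j b.2 := by
  refine (h (pbasis ψ b) ℓ j).unique ?_
  have := hasSum_ite_eq b (A (ℓ - b.1) j b.2)
  convert this using 2 with a
  simp only [KAM.coef_pbasis]
  by_cases hab : a = b
  · subst hab; simp
  · simp [hab]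

lemma toCLM_eq {A : Op ν} (hA : dn₀ A ≠ ⊤) {T : L2 ν →L[ℂ] L2 ν}
    (h : ∀ b ℓ j, coef ψ (T (pbasis ψ b)) ℓ j = A (ℓ - b.1) j b.2) : toCLM ψ A = T :=
  clm_ext_of_pbasis ψ fun b ℓ j => by rw [(realizes_toCLM ψ hA).coef_pbasis, h]

lemma coef_toCLM_pbasis {A : Op ν} (hA : dn₀ A ≠ ⊤) (b : 𝕁 ν) (ℓ : 𝕀 ν) (j : ℤ) :
    coef ψ (toCLM ψ A (pbasis ψ b)) ℓ j = A (ℓ - b.1) j b.2 :=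
  (realizes_toCLM ψ hA).coef_pbasis b ℓ j

lemma decayNorm_add_ne_top {s : ℝ} {A B : Op ν} (hA : decayNorm s A ≠ ⊤) (hB : decayNorm s B ≠ ⊤) :
    decayNorm s (A + B) ≠ ⊤ :=
  ne_top_of_le_ne_top (add_ne_top.2 ⟨hA, hB⟩) (decayNorm_add_le s A B)

lemma decayNorm_smul_ne_top {s : ℝ} {A : Op ν} (c : ℂ) (hA : decayNorm s A ≠ ⊤) : decayNorm s (c • A) ≠ ⊤ :=
  ne_top_of_le_ne_top (mul_ne_top (enorm_ne_top (x := c)) hA) (decayNorm_le_of_entry fun ℓ j k => by simp [enorm_mul])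

lemma decayNorm_sub_ne_top {s : ℝ} {A B : Op ν} (hA : decayNorm s A ≠ ⊤) (hB : decayNorm s B ≠ ⊤) :
    decayNorm s (A - B) ≠ ⊤ := by
  have : A - B = A + (-1 : ℂ) • B := by simp [sub_eq_add_neg]
  rw [this]
  exact decayNorm_add_ne_top hA (decayNorm_smul_ne_top _ hB)

lemma decayNorm_opMul_ne_top {A B : Op ν} (hA : dn₀ A ≠ ⊤) (hB : dn₀ B ≠ ⊤) : dn₀ (opMul A B) ≠ ⊤ :=
  ne_top_of_le_ne_top (mul_ne_top (mulConst_ne_top ν _) (add_ne_top.2 ⟨mul_ne_top hA hB, mul_ne_top hA hB⟩))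
    (decayNorm_opMul_le (cast_nonneg _) A B)

lemma toCLM_add {A B : Op ν} (hA : dn₀ A ≠ ⊤) (hB : dn₀ B ≠ ⊤) : toCLM ψ (A + B) = toCLM ψ A + toCLM ψ B :=
  toCLM_eq (decayNorm_add_ne_top hA hB) fun b ℓ j => by
    simp [coef_toCLM_pbasis hA, coef_toCLM_pbasis hB]

lemma toCLM_sub {A B : Op ν} (hA : dn₀ A ≠ ⊤) (hB : dn₀ B ≠ ⊤) : toCLM ψ (A - B) = toCLM ψ A - toCLM ψ B :=
  toCLM_eq (decayNorm_sub_ne_top hA hB) fun b ℓ j => by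
    simp [coef_toCLM_pbasis hA, coef_toCLM_pbasis hB]

lemma toCLM_smul (c : ℂ) {A : Op ν} (hA : dn₀ A ≠ ⊤) : toCLM ψ (c • A) = c • toCLM ψ A :=
  toCLM_eq (decayNorm_smul_ne_top c hA) fun b ℓ j => by simp [coef_toCLM_pbasis hA]

lemma toCLM_opMul {A B : Op ν} (hA : dn₀ A ≠ ⊤) (hB : dn₀ B ≠ ⊤) : toCLM ψ (opMul A B) = (toCLM ψ A).comp (toCLM ψ B) :=
  toCLM_eq (decayNorm_opMul_ne_top hA hB) fun b ℓ j => by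
    have h := realizes_toCLM ψ hA (toCLM ψ B (pbasis ψ b)) ℓ j
    simp only [coef_toCLM_pbasis hB] at h
    rw [comp_apply, ← h.tsum_eq, opMul, ← ((Equiv.addRight b.1).prodCongr (Equiv.refl ℤ)).tsum_eq]
    refine tsum_congr fun a => ?_
    have : ℓ - (a.1 + b.1) = ℓ - b.1 - a.1 := by abel
    simp [this]

lemma enorm_toCLM_le {A : Op ν} (hA : dn₀ A ≠ ⊤) : ‖toCLM ψ A‖ₑ ≤ actConst ν * dn₀ A := by
  have hc : actConst ν * dn₀ A ≠ ⊤ := mul_ne_top (actConst_ne_top ν) hA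
  rw [← ofReal_norm, ENNReal.ofReal_le_iff_le_toReal hc]
  refine opNorm_le_bound _ toReal_nonneg fun u => ?_
  have h := l2_matSum_le (ψ := ψ) (A := A) u
  have h2 : ‖toCLM ψ A u‖ₑ ≤ actConst ν * dn₀ A * ‖u‖ₑ := by
    rw [← (pbasis ψ).repr.enorm_map, enorm_lp]
    refine le_trans (le_of_eq ?_) h
    congr 1
    funext y
    rw [pbasis_repr, ← (realizes_toCLM ψ hA u y.1 y.2).tsum_eq]
  have h3 := toReal_mono (mul_ne_top hc enorm_ne_top) h2
  rwa [toReal_mul, toReal_enorm, toReal_enorm] at h3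

lemma psiNorm_toCLM_le {r : ℝ} (hr : 0 ≤ r) (hr' : r ≤ sZero ν) {A : Op ν} (hA : dn₀ A ≠ ⊤) (u : L2 ν) :
    psiNorm ψ r (toCLM ψ A u) ≤ actConst ν * dn₀ A * psiNorm ψ r u := by
  refine le_trans (wnorm_mono_right fun y => ?_) (wnorm_mat_le hr hr' A _)
  rw [← (realizes_toCLM ψ hA u y.1 y.2).tsum_eq]
  refine enorm_tsum_le_tsum_enorm.trans (le_of_eq ?_)
  simp only [enorm_mul]

lemma hasSum_toCLM {ι : Type*} {A : ι → Op ν} {S : Op ν} (h : HasSum A S) (hs : ∑' i, dn₀ (A i) ≠ ⊤) (hS : dn₀ S ≠ ⊤) :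
    HasSum (fun i => toCLM ψ (A i)) (toCLM ψ S) := by
  have hA : ∀ i, dn₀ (A i) ≠ ⊤ := ENNReal.ne_top_of_tsum_ne_top hs
  have hsum : Summable fun i => toCLM ψ (A i) := by
    refine Summable.of_enorm (ne_top_of_le_ne_top ?_ (tsum_le_tsum fun i => enorm_toCLM_le (hA i)))
    rw [ENNReal.tsum_mul_left]
    exact mul_ne_top (actConst_ne_top ν) hs
  convert hsum.hasSum using 1
  refine toCLM_eq hS fun b ℓ j => ?_
  have h1 := hsum.hasSum.mapL (ContinuousLinearMap.apply ℂ (L2 ν) (pbasis ψ b))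
  have h2 := h1.mapL (coefCLM ψ ℓ j)
  simp only [apply_apply, coefCLM_apply, coef_toCLM_pbasis (hA _)] at h2
  exact h2.unique (hasSum_op_iff.1 h _ _ _)

lemma fin0_bracket (hψ : CS) {A X : OpMat ν} (hA : Fin0 A) (hX : Fin0 X) : Fin0 (bracket ψ A X) := by
  have cA := decayNorm_conjOp_ne_top hψ hA.1
  have cA' := decayNorm_conjOp_ne_top hψ hA.2
  have cX := decayNorm_conjOp_ne_top hψ hX.1
  have cX' := decayNorm_conjOp_ne_top hψ hX.2
  exact ⟨decayNorm_smul_ne_top _ (decayNorm_add_ne_top (decayNorm_sub_ne_top (decayNorm_sub_ne_top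
      (decayNorm_opMul_ne_top hA.1 hX.1) (decayNorm_opMul_ne_top hX.1 hA.1))
      (decayNorm_opMul_ne_top hA.2 cX')) (decayNorm_opMul_ne_top hX.2 cA')),
    decayNorm_smul_ne_top _ (decayNorm_add_ne_top (decayNorm_sub_ne_top (decayNorm_sub_ne_top
      (decayNorm_opMul_ne_top hA.1 hX.2) (decayNorm_opMul_ne_top hX.1 hA.2))
      (decayNorm_opMul_ne_top hA.2 cX)) (decayNorm_opMul_ne_top hX.2 cA))⟩

lemma OpMat.toCLM_apply (A : OpMat ν) (u : L2 ν × L2 ν) : A.toCLM ψ u = (KAM.toCLM ψ A.d u.1 + KAM.toCLM ψ A.o u.2,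
      -(KAM.toCLM ψ (conjOp ψ A.o) u.1 + KAM.toCLM ψ (conjOp ψ A.d) u.2)) := rfl

lemma toCLM_bracket (hψ : CS) {A X : OpMat ν} (hA : Fin0 A) (hX : Fin0 X) : (bracket ψ A X).toCLM ψ =
      Complex.I • (A.toCLM ψ * X.toCLM ψ - X.toCLM ψ * A.toCLM ψ) := by
  have cA := decayNorm_conjOp_ne_top hψ hA.1
  have cA' := decayNorm_conjOp_ne_top hψ hA.2
  have cX := decayNorm_conjOp_ne_top hψ hX.1
  have cX' := decayNorm_conjOp_ne_top hψ hX.2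
  have key : ∀ {A B C D E F G H : Op ν}, dn₀ A ≠ ⊤ → dn₀ B ≠ ⊤ → dn₀ C ≠ ⊤ → dn₀ D ≠ ⊤ → dn₀ E ≠ ⊤ →
      dn₀ F ≠ ⊤ → dn₀ G ≠ ⊤ → dn₀ H ≠ ⊤ →
      toCLM ψ (Complex.I • (opMul A B - opMul C D - opMul E F + opMul G H)) =
        Complex.I • ((toCLM ψ A).comp (toCLM ψ B) - (toCLM ψ C).comp (toCLM ψ D)
          - (toCLM ψ E).comp (toCLM ψ F) + (toCLM ψ G).comp (toCLM ψ H)) := by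
    intro A B C D E F G H hA hB hC hD hE hF hG hH
    have h1 := decayNorm_opMul_ne_top hA hB
    have h2 := decayNorm_opMul_ne_top hC hD
    have h3 := decayNorm_opMul_ne_top hE hF
    have h4 := decayNorm_opMul_ne_top hG hH
    rw [toCLM_smul _ (decayNorm_add_ne_top (decayNorm_sub_ne_top (decayNorm_sub_ne_top h1 h2) h3)
      h4), toCLM_add (decayNorm_sub_ne_top (decayNorm_sub_ne_top h1 h2) h3) h4,
      toCLM_sub (decayNorm_sub_ne_top h1 h2) h3, toCLM_sub h1 h2, toCLM_opMul hA hB,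
      toCLM_opMul hC hD, toCLM_opMul hE hF, toCLM_opMul hG hH]
  have keyc : ∀ {A B C D E F G H : Op ν}, dn₀ A ≠ ⊤ → dn₀ B ≠ ⊤ → dn₀ C ≠ ⊤ → dn₀ D ≠ ⊤ → dn₀ E ≠ ⊤ →
      dn₀ F ≠ ⊤ → dn₀ G ≠ ⊤ → dn₀ H ≠ ⊤ →
      toCLM ψ (conjOp ψ (Complex.I • (opMul A B - opMul C D - opMul E F + opMul G H))) =
        -(Complex.I • ((toCLM ψ (conjOp ψ A)).comp (toCLM ψ (conjOp ψ B))
          - (toCLM ψ (conjOp ψ C)).comp (toCLM ψ (conjOp ψ D))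
          - (toCLM ψ (conjOp ψ E)).comp (toCLM ψ (conjOp ψ F))
          + (toCLM ψ (conjOp ψ G)).comp (toCLM ψ (conjOp ψ H)))) := by
    intro A B C D E F G H hA hB hC hD hE hF hG hH
    rw [conjOp_smul, conjOp_add, conjOp_sub, conjOp_sub, conjOp_opMul hψ hA hB,
      conjOp_opMul hψ hC hD, conjOp_opMul hψ hE hF, conjOp_opMul hψ hG hH, conj_I]
    have c := fun {A : Op ν} (h : dn₀ A ≠ ⊤) => decayNorm_conjOp_ne_top hψ h
    have h1 := decayNorm_opMul_ne_top (c hA) (c hB)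
    have h2 := decayNorm_opMul_ne_top (c hC) (c hD)
    have h3 := decayNorm_opMul_ne_top (c hE) (c hF)
    have h4 := decayNorm_opMul_ne_top (c hG) (c hH)
    rw [toCLM_smul _ (decayNorm_add_ne_top (decayNorm_sub_ne_top (decayNorm_sub_ne_top h1 h2) h3)
      h4), toCLM_add (decayNorm_sub_ne_top (decayNorm_sub_ne_top h1 h2) h3) h4,
      toCLM_sub (decayNorm_sub_ne_top h1 h2) h3, toCLM_sub h1 h2, toCLM_opMul (c hA) (c hB),
      toCLM_opMul (c hC) (c hD), toCLM_opMul (c hE) (c hF), toCLM_opMul (c hG) (c hH), neg_smul]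
  refine ContinuousLinearMap.ext fun u => ?_
  simp only [smul_apply, sub_apply, mul_apply_eq_comp, OpMat.toCLM_apply]
  simp only [bracket]
  rw [key hA.1 hX.1 hX.1 hA.1 hA.2 cX' hX.2 cA', key hA.1 hX.2 hX.1 hA.2 hA.2 cX hX.2 cA,
    keyc hA.1 hX.1 hX.1 hA.1 hA.2 cX' hX.2 cA', keyc hA.1 hX.2 hX.1 hA.2 hA.2 cX hX.2 cA,
    conjOp_conjOp hψ, conjOp_conjOp hψ, conjOp_conjOp hψ, conjOp_conjOp hψ]
  simp only [smul_apply, sub_apply, add_apply, neg_apply, comp_apply, map_add, map_neg, Prod.mk_sub_mk, Prod.smul_mk,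
    ← smul_add, ← smul_neg]
  refine Prod.ext ?_ ?_
  · dsimp only; congr 1; abel
  · dsimp only; congr 1; abel

lemma hasSum_opMat_toCLM (hψ : CS) {ι : Type*} {A : ι → OpMat ν} {S : OpMat ν}
    (hd : HasSum (fun i => (A i).d) S.d) (ho : HasSum (fun i => (A i).o) S.o)
    (sd : ∑' i, dn₀ (A i).d ≠ ⊤) (so : ∑' i, dn₀ (A i).o ≠ ⊤)
    (hS : Fin0 S) : HasSum (fun i => (A i).toCLM ψ) (S.toCLM ψ) := by
  have conj_ne : ∀ B : ι → Op ν, ∑' i, dn₀ (B i) ≠ ⊤ → ∑' i, dn₀ (conjOp ψ (B i)) ≠ ⊤ := fun B hB =>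
    ne_top_of_le_ne_top (mul_ne_top (by simp : (8 : ℝ≥0∞) ≠ ⊤) hB) (by
      rw [← ENNReal.tsum_mul_left]
      exact tsum_le_tsum fun i => decayNorm_conjOp_le hψ _ _)
  have h1 := hasSum_toCLM (ψ := ψ) hd sd hS.1
  have h2 := hasSum_toCLM (ψ := ψ) ho so hS.2
  have h3 := hasSum_toCLM (ψ := ψ) (hasSum_conjOp ψ ho) (conj_ne _ so) (decayNorm_conjOp_ne_top hψ hS.2)
  have h4 := hasSum_toCLM (ψ := ψ) (hasSum_conjOp ψ hd) (conj_ne _ sd) (decayNorm_conjOp_ne_top hψ hS.1)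
  let F := (ContinuousLinearMap.fst ℂ (L2 ν) (L2 ν))
  let G := (ContinuousLinearMap.snd ℂ (L2 ν) (L2 ν))
  let cF := (ContinuousLinearMap.compL ℂ (L2 ν × L2 ν) (L2 ν) (L2 ν)).flip F
  let cG := (ContinuousLinearMap.compL ℂ (L2 ν × L2 ν) (L2 ν) (L2 ν)).flip G
  have e1 := (h1.mapL cF).add (h2.mapL cG)
  have e2 := ((h3.mapL cF).add (h4.mapL cG)).neg
  let P : ((L2 ν × L2 ν →L[ℂ] L2 ν) × (L2 ν × L2 ν →L[ℂ] L2 ν)) →L[ℂ] (L2 ν × L2 ν →L[ℂ] L2 ν × L2 ν) :=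
    (prodₗᵢ ℂ : _ ≃ₗᵢ[ℂ] _).toContinuousLinearEquiv.toContinuousLinearMap
  exact (e1.prodMk e2).mapL P

/-- The norm of `H^r × H^r` through the basis `e^{iℓ·φ} ψ_j(x)`. -/
def psiNorm2 (ψ : 𝔹) (r : ℝ) (u : L2 ν × L2 ν) : ℝ≥0∞ :=
  psiNorm ψ r u.1 + psiNorm ψ r u.2

lemma psiNorm_add_le (r : ℝ) (u v : L2 ν) : psiNorm ψ r (u + v) ≤ psiNorm ψ r u + psiNorm ψ r v := by
  refine le_trans (l2_mono fun a => ?_) (l2_add_le _ _)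
  simp only [← mul_add, coef_add]
  exact mul_le_mul' le_rfl (enorm_add_le _ _)

lemma psiNorm_neg (r : ℝ) (u : L2 ν) : psiNorm ψ r (-u) = psiNorm ψ r u := by
  simp [psiNorm]

lemma psiNorm2_toCLM_le (hψ : CS) {r : ℝ} (hr : 0 ≤ r) (hr' : r ≤ sZero ν)
    {A : OpMat ν} (hA : Fin0 A) (u : L2 ν × L2 ν) :
    psiNorm2 ψ r (A.toCLM ψ u) ≤ 9 * actConst ν * (dn₀ A.d + dn₀ A.o) * psiNorm2 ψ r u := by
  have p := fun {B : Op ν} (hB : dn₀ B ≠ ⊤) (v : L2 ν) =>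
    psiNorm_toCLM_le (ψ := ψ) hr hr' hB v
  have q := fun {B : Op ν} (hB : dn₀ B ≠ ⊤) (v : L2 ν) =>
    (p (decayNorm_conjOp_ne_top hψ hB) v).trans (mul_le_mul' (mul_le_mul' le_rfl
      (decayNorm_conjOp_le hψ (sZero ν) B)) le_rfl)
  rw [OpMat.toCLM_apply, psiNorm2, psiNorm_neg]
  refine (add_le_add (psiNorm_add_le _ _ _) (psiNorm_add_le _ _ _)).trans
    ((add_le_add (add_le_add (p hA.1 _) (p hA.2 _)) (add_le_add (q hA.2 _) (q hA.1 _))).trans ?_)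
  rw [psiNorm2]
  generalize psiNorm ψ r u.1 = x, psiNorm ψ r u.2 = y, dn₀ A.d = a, dn₀ A.o = b, actConst ν = c
  calc _ ≤ (c * a * x + c * b * y + (c * (8 * b) * x + c * (8 * a) * y)) +
        (8 * (c * a * x) + 8 * (c * b * y) + c * b * x + c * a * y) := le_self_add
    _ = _ := by ring

lemma enorm_prod (u : L2 ν × L2 ν) : ‖u‖ₑ = max ‖u.1‖ₑ ‖u.2‖ₑ := by
  simp only [← ofReal_norm, Prod.norm_def]
  exact ENNReal.ofReal_max _ _

lemma enorm_le_psiNorm2 (u : L2 ν × L2 ν) : ‖u‖ₑ ≤ psiNorm2 ψ 0 u := by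
  rw [psiNorm2, psiNorm_zero, psiNorm_zero, enorm_prod]
  exact max_le le_self_add le_add_self

lemma psiNorm2_le_enorm (u : L2 ν × L2 ν) : psiNorm2 ψ 0 u ≤ 2 * ‖u‖ₑ := by
  rw [psiNorm2, psiNorm_zero, psiNorm_zero, enorm_prod]
  refine le_of_le_of_eq ?_ (two_mul _).symm
  exact add_le_add (le_max_left _ _) (le_max_right _ _)

lemma enorm_clm_le_of_psiNorm2 {T : 𝔏 ν} {c : ℝ≥0∞}
    (h : ∀ u, psiNorm2 ψ 0 (T u) ≤ c * psiNorm2 ψ 0 u) : ‖T‖ₑ ≤ 2 * c := by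
  by_cases hc : c = ⊤
  · simp [hc]
  have hc' : 2 * c ≠ ⊤ := mul_ne_top (by simp) hc
  rw [← ofReal_norm, ENNReal.ofReal_le_iff_le_toReal hc']
  refine opNorm_le_bound _ toReal_nonneg fun u => ?_
  have h1 : ‖T u‖ₑ ≤ 2 * c * ‖u‖ₑ := (enorm_le_psiNorm2 _).trans ((h u).trans
    ((mul_le_mul' le_rfl (psiNorm2_le_enorm u)).trans (le_of_eq (by ring))))
  have h3 := toReal_mono (mul_ne_top hc' enorm_ne_top) h1
  rwa [toReal_mul, toReal_enorm, toReal_enorm] at h3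


/-! ### Regularised inverses -/

section RegInv

/-- The cut-off `θ(t)`, `0` for `t ≤ 1/2` and `1` for `t ≥ 1`. -/
def ramp (t : ℝ) : ℝ := max 0 (min 1 (2 * t - 1))

lemma ramp_nonneg (t : ℝ) : 0 ≤ ramp t := le_max_left _ _

lemma ramp_le_one (t : ℝ) : ramp t ≤ 1 := max_le zero_le_one (min_le_left _ _)

lemma ramp_eq_one {t : ℝ} (h : 1 ≤ t) : ramp t = 1 := by
  rw [ramp, min_eq_left (by linarith)]; norm_num

lemma ramp_eq_zero {t : ℝ} (h : t ≤ 1 / 2) : ramp t = 0 := by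
  rw [ramp, max_eq_left]
  exact (min_le_right _ _).trans (by linarith)

lemma abs_ramp_sub_le (s t : ℝ) : |ramp s - ramp t| ≤ 2 * |s - t| := by
  refine (abs_max_sub_max_le_max _ _ _ _).trans (max_le (by simp) ?_)
  refine (abs_min_sub_min_le_max _ _ _ _).trans (max_le (by simp) ?_)
  rw [show 2 * s - 1 - (2 * t - 1) = 2 * (s - t) by ring, abs_mul]
  norm_num

variable {E : Type*} [NormedAddCommGroup E] [NormedSpace ℂ E]

/-- The lower bound `inf_{|x| = 1} |G x|` of a linear map. -/
def lowBd (G : E →ₗ[ℂ] E) : ℝ := ⨅ x : {x : E // ‖x‖ = 1}, ‖G x‖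

lemma lowBd_nonneg (G : E →ₗ[ℂ] E) : 0 ≤ lowBd G := Real.iInf_nonneg fun _ => norm_nonneg _

lemma lowBd_mul_le (G : E →ₗ[ℂ] E) (x : E) : lowBd G * ‖x‖ ≤ ‖G x‖ := by
  by_cases hx : x = 0
  · simp [hx]
  have hx' : ‖x‖ ≠ 0 := norm_ne_zero_iff.2 hx
  have h1 : ‖((‖x‖⁻¹ : ℝ) : ℂ) • x‖ = 1 := by
    rw [norm_smul, norm_real, norm_inv, norm_norm, inv_mul_cancel₀ hx']
  have h2 : lowBd G ≤ ‖G (((‖x‖⁻¹ : ℝ) : ℂ) • x)‖ :=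
    ciInf_le ⟨0, by rintro _ ⟨y, rfl⟩; exact norm_nonneg _⟩ (⟨_, h1⟩ : {x : E // ‖x‖ = 1})
  rw [map_smul, norm_smul, norm_real, norm_inv, norm_norm] at h2
  calc _ ≤ ‖x‖⁻¹ * ‖G x‖ * ‖x‖ := by gcongr
    _ = _ := by field_simp

variable (E) in
lemma exists_norm_eq_one [Nontrivial E] : ∃ x : E, ‖x‖ = 1 := by
  obtain ⟨x, hx⟩ := exists_ne (0 : E)
  refine ⟨((‖x‖⁻¹ : ℝ) : ℂ) • x, ?_⟩
  rw [norm_smul, norm_real, norm_inv, norm_norm, inv_mul_cancel₀ (norm_ne_zero_iff.2 hx)]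

lemma le_lowBd [Nontrivial E] {G : E →ₗ[ℂ] E} {c : ℝ} (h : ∀ x, c * ‖x‖ ≤ ‖G x‖) : c ≤ lowBd G := by
  obtain ⟨x, hx⟩ := exists_norm_eq_one E
  have : Nonempty {x : E // ‖x‖ = 1} := ⟨⟨x, hx⟩⟩
  refine le_ciInf fun x => ?_
  simpa [x.2] using h x

lemma lowBd_le_add [Nontrivial E] {G G' : E →ₗ[ℂ] E} {b : ℝ} (h : ∀ x, ‖G x - G' x‖ ≤ b * ‖x‖) :
    lowBd G ≤ lowBd G' + b := by
  suffices lowBd G - b ≤ lowBd G' by linarith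
  refine le_lowBd fun x => ?_
  have h1 := lowBd_mul_le G x
  have h2 := norm_sub_norm_le (G x) (G' x)
  linarith [h x]

variable [FiniteDimensional ℂ E]

lemma bijective_of_lowBd_pos {G : E →ₗ[ℂ] E} (h : 0 < lowBd G) : Bijective G := by
  have hi : Injective G := by
    rw [← LinearMap.ker_eq_bot, LinearMap.ker_eq_bot']
    intro x hx
    have := lowBd_mul_le G x
    rw [hx, norm_zero] at this
    exact norm_le_zero_iff.1 (nonpos_of_mul_nonpos_right this h)
  exact ⟨hi, LinearMap.surjective_of_injective hi⟩

/-- The regularised inverse `θ(c d(G)) G⁻¹`. -/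
def regInv (c : ℝ) (G : E →ₗ[ℂ] E) (y : E) : E :=
  ((ramp (c * lowBd G) : ℝ) : ℂ) • invFun G y

lemma apply_invFun {G : E →ₗ[ℂ] E} (h : 0 < lowBd G) (y : E) : G (invFun G y) = y :=
  Function.rightInverse_invFun (bijective_of_lowBd_pos h).2 y

lemma norm_invFun_le {G : E →ₗ[ℂ] E} {c : ℝ} (hc : 0 < c) (h : 1 / 2 < c * lowBd G) (y : E) :
    ‖invFun G y‖ ≤ 2 * c * ‖y‖ := by
  have hp : 0 < lowBd G := pos_of_mul_pos_right (by linarith) hc.le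
  have h1 := lowBd_mul_le G (invFun G y)
  rw [apply_invFun hp] at h1
  have h2 : 1 ≤ 2 * c * lowBd G := by linarith
  calc ‖invFun G y‖ ≤ 2 * c * lowBd G * ‖invFun G y‖ :=
        le_mul_of_one_le_left (norm_nonneg _) h2
    _ = 2 * c * (lowBd G * ‖invFun G y‖) := by ring
    _ ≤ _ := by gcongr

lemma norm_regInv_le {G : E →ₗ[ℂ] E} {c : ℝ} (hc : 0 < c) (y : E) : ‖regInv c G y‖ ≤ 2 * c * ‖y‖ := by
  by_cases h : 1 / 2 < c * lowBd G
  · rw [regInv, norm_smul, norm_real, norm_of_nonneg (ramp_nonneg _)]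
    exact (mul_le_of_le_one_left (norm_nonneg _) (ramp_le_one _)).trans (norm_invFun_le hc h y)
  · rw [regInv, ramp_eq_zero (not_lt.1 h)]
    simp; positivity

lemma apply_regInv [Nontrivial E] {G : E →ₗ[ℂ] E} {c : ℝ} (hc : 0 < c)
    (h : ∀ x, ‖x‖ ≤ c * ‖G x‖) (y : E) : G (regInv c G y) = y := by
  have h1 : c⁻¹ ≤ lowBd G := le_lowBd fun x => by
    rw [inv_mul_le_iff₀ hc]; exact h x
  have h2 : 1 ≤ c * lowBd G := by rwa [inv_le_iff_one_le_mul₀' hc] at h1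
  rw [regInv, ramp_eq_one h2, Complex.ofReal_one, one_smul]
  exact apply_invFun (lt_of_lt_of_le (inv_pos.2 hc) h1) y

lemma regInv_sub (c : ℝ) (G : E →ₗ[ℂ] E) (y z : E) : regInv c G (y - z) = regInv c G y - regInv c G z := by
  rcases (lowBd_nonneg G).eq_or_lt with h | h
  · simp [regInv, ← h, ramp_eq_zero]
  · rw [regInv, regInv, regInv, ← smul_sub]
    congr 1
    refine (bijective_of_lowBd_pos h).1 ?_
    rw [map_sub, apply_invFun h, apply_invFun h, apply_invFun h]

lemma norm_regInv_sub_le [Nontrivial E] {G G' : E →ₗ[ℂ] E} {c b : ℝ} (hc : 0 < c)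
    (hb : ∀ x, ‖G x - G' x‖ ≤ b * ‖x‖) (y : E) :
    ‖regInv c G y - regInv c G' y‖ ≤ 8 * c ^ 2 * b * ‖y‖ := by
  have hb0 : 0 ≤ b := by
    obtain ⟨x, hx⟩ := exists_norm_eq_one E
    have := (norm_nonneg _).trans (hb x)
    rwa [hx, mul_one] at this
  have hb' : ∀ x, ‖G' x - G x‖ ≤ b * ‖x‖ := fun x => by rw [norm_sub_rev]; exact hb x
  have hθ : |ramp (c * lowBd G) - ramp (c * lowBd G')| ≤ 2 * c * b := by
    refine (abs_ramp_sub_le _ _).trans ?_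
    rw [← mul_sub, abs_mul, abs_of_pos hc, mul_assoc]
    have : |lowBd G - lowBd G'| ≤ b := by
      rw [abs_le]; constructor
      · linarith [lowBd_le_add hb']
      · linarith [lowBd_le_add hb]
    gcongr
  have hy : 0 ≤ 4 * c ^ 2 * b * ‖y‖ := by positivity
  by_cases h : 1 / 2 < c * lowBd G
  · by_cases h' : 1 / 2 < c * lowBd G'
    · have hp : 0 < lowBd G := pos_of_mul_pos_right (by linarith) hc.le
      have hp' : 0 < lowBd G' := pos_of_mul_pos_right (by linarith) hc.le
      set x := invFun G y
      set x' := invFun G' y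
      have e : regInv c G y - regInv c G' y = ((ramp (c * lowBd G) - ramp (c * lowBd G') : ℝ) : ℂ) • x +
            ((ramp (c * lowBd G') : ℝ) : ℂ) • (x - x') := by
        simp only [regInv, ofReal_sub, sub_smul, smul_sub, x, x']; abel
      have h1 : x - x' = invFun G (G' x' - G x') := by
        refine (bijective_of_lowBd_pos hp).1 ?_
        rw [apply_invFun hp, map_sub, apply_invFun hp, apply_invFun hp']
      have h2 : ‖x - x'‖ ≤ 4 * c ^ 2 * b * ‖y‖ := by
        rw [h1]
        refine (norm_invFun_le hc h _).trans ?_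
        calc _ ≤ 2 * c * (b * (2 * c * ‖y‖)) := by
              gcongr
              refine (hb' x').trans ?_
              gcongr
              exact norm_invFun_le hc h' y
          _ = _ := by ring
      rw [e]
      refine (norm_add_le _ _).trans ?_
      rw [norm_smul, norm_smul, norm_real, norm_real, norm_eq_abs, norm_of_nonneg (ramp_nonneg _)]
      calc _ ≤ 2 * c * b * (2 * c * ‖y‖) + 1 * (4 * c ^ 2 * b * ‖y‖) := by
            gcongr
            · exact norm_invFun_le hc h y
            · exact ramp_le_one _
        _ = _ := by ring
    · rw [regInv, regInv, ramp_eq_zero (not_lt.1 h'), ofReal_zero, zero_smul, sub_zero,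
        norm_smul, norm_real, norm_eq_abs]
      rw [ramp_eq_zero (not_lt.1 h'), sub_zero] at hθ
      calc _ ≤ 2 * c * b * (2 * c * ‖y‖) := by
            gcongr; exact norm_invFun_le hc h y
        _ ≤ _ := by linarith
  · by_cases h' : 1 / 2 < c * lowBd G'
    · rw [regInv, regInv, ramp_eq_zero (not_lt.1 h), ofReal_zero, zero_smul, zero_sub,
        norm_neg, norm_smul, norm_real, norm_eq_abs]
      rw [ramp_eq_zero (not_lt.1 h), zero_sub, abs_neg] at hθ
      calc _ ≤ 2 * c * b * (2 * c * ‖y‖) := by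
            gcongr; exact norm_invFun_le hc h' y
        _ ≤ _ := by linarith
    · rw [regInv, regInv, ramp_eq_zero (not_lt.1 h), ramp_eq_zero (not_lt.1 h')]
      simp; linarith

/-- The regularised inverse is equivariant under isometries. -/
lemma regInv_equivariant [Nontrivial E] {F : Type*} [NormedAddCommGroup F] [NormedSpace ℂ F]
    [FiniteDimensional ℂ F] [Nontrivial F] {G : E →ₗ[ℂ] E} {G' : F →ₗ[ℂ] F} (T : E → F)
    (hT : ∀ x, ‖T x‖ = ‖x‖) (hs : Function.Surjective T) (hr : ∀ (t : ℝ) x, T ((t : ℂ) • x) = (t : ℂ) • T x)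
    (hG : ∀ x, G' (T x) = T (G x)) (c : ℝ) (y : E) : regInv c G' (T y) = T (regInv c G y) := by
  have hd : lowBd G' = lowBd G := by
    apply le_antisymm
    · refine le_lowBd fun x => ?_
      rw [← hT x, ← hT (G x), ← hG]; exact lowBd_mul_le _ _
    · refine le_lowBd fun z => ?_
      obtain ⟨x, rfl⟩ := hs z
      rw [hT, hG, hT]; exact lowBd_mul_le _ _
  rw [regInv, regInv, hd, hr]
  rcases (lowBd_nonneg G).eq_or_lt with h | h
  · simp [← h, ramp_eq_zero]
  · congr 1
    refine (bijective_of_lowBd_pos (hd ▸ h)).1 ?_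
    rw [apply_invFun (hd ▸ h), hG, apply_invFun h]

lemma regInv_neg (c : ℝ) (G : E →ₗ[ℂ] E) (y : E) : regInv c (-G) y = -regInv c G y := by
  have hd : lowBd (-G) = lowBd G := by simp [lowBd]
  rw [regInv, regInv, hd]
  rcases (lowBd_nonneg G).eq_or_lt with h | h
  · simp [← h, ramp_eq_zero]
  · rw [← smul_neg]
    congr 1
    refine (bijective_of_lowBd_pos h).1 ?_
    have := apply_invFun (G := -G) (hd ▸ h) y
    rw [LinearMap.neg_apply] at this
    rw [map_neg, apply_invFun h, ← neg_eq_iff_eq_neg, this]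

end RegInv

/-! ### Sylvester operators -/

attribute [local instance] frobeniusNormedAddCommGroup frobeniusNormedSpace

section Sylvester

variable {ι κ : Type*} [Fintype ι] [Fintype κ]

lemma hs_eq_norm (X : Matrix ι κ ℂ) : hs X = ‖X‖ := by
  rw [hs, Matrix.frobenius_norm_def, Real.sqrt_eq_rpow]
  simp only [rpow_two]

/-- The operator `X ↦ a X + P X + X Q`. -/
def syl (a : ℝ) (P : Matrix ι ι ℂ) (Q : Matrix κ κ ℂ) : Matrix ι κ ℂ →ₗ[ℂ] Matrix ι κ ℂ where
  toFun X := (a : ℂ) • X + P * X + X * Q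
  map_add' X Y := by simp only [smul_add, Matrix.mul_add, Matrix.add_mul]; abel
  map_smul' c X := by
    simp only [RingHom.id_apply, smul_add, Matrix.mul_smul, smul_mul]
    rw [smul_comm]

lemma syl_apply (a : ℝ) (P : Matrix ι ι ℂ) (Q : Matrix κ κ ℂ) (X : Matrix ι κ ℂ) :
    syl a P Q X = (a : ℂ) • X + P * X + X * Q := rfl

lemma norm_syl_sub_le (a a' : ℝ) (P P' : Matrix ι ι ℂ) (Q Q' : Matrix κ κ ℂ) (X : Matrix ι κ ℂ) :
    ‖syl a P Q X - syl a' P' Q' X‖ ≤ (|a - a'| + ‖P - P'‖ + ‖Q - Q'‖) * ‖X‖ := by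
  have e : syl a P Q X - syl a' P' Q' X = ((a - a' : ℝ) : ℂ) • X + (P - P') * X + X * (Q - Q') := by
    simp only [syl_apply, Matrix.sub_mul, Matrix.mul_sub, ofReal_sub, sub_smul]; abel
  rw [e]
  refine (norm_add₃_le).trans ?_
  rw [norm_smul, norm_real, norm_eq_abs, add_mul, add_mul]
  gcongr
  · exact Matrix.frobenius_norm_mul _ _
  · rw [mul_comm]; exact Matrix.frobenius_norm_mul _ _

lemma frobenius_norm_sq (X : Matrix ι κ ℂ) : ‖X‖ ^ 2 = RCLike.re (trace (X * X.conjTranspose)) := by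
  rw [← hs_eq_norm, hs, sq_sqrt (by positivity)]
  simp [trace, Matrix.mul_apply, ← normSq_eq_norm_sq, mul_conj]

lemma norm_conjTranspose (X : Matrix ι κ ℂ) : ‖X.conjTranspose‖ = ‖X‖ :=
  Matrix.frobenius_norm_conjTranspose X

lemma norm_mul_of_unitary [DecidableEq κ] {U : Matrix κ κ ℂ} (hU : U * U.conjTranspose = 1) (X : Matrix ι κ ℂ) :
    ‖X * U‖ = ‖X‖ := by
  refine (sq_eq_sq₀ (norm_nonneg _) (norm_nonneg _)).1 ?_
  rw [frobenius_norm_sq, frobenius_norm_sq, conjTranspose_mul, Matrix.mul_assoc,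
    ← Matrix.mul_assoc U, hU, Matrix.one_mul]

lemma norm_unitary_mul [DecidableEq ι] {U : Matrix ι ι ℂ} (hU : U.conjTranspose * U = 1) (X : Matrix ι κ ℂ) :
    ‖U * X‖ = ‖X‖ := by
  rw [← norm_conjTranspose, conjTranspose_mul, norm_mul_of_unitary (by simpa using hU), norm_conjTranspose]

/-- A Hermitian matrix is unitarily equivalent to its transpose. -/
lemma exists_unitary_transpose [DecidableEq κ] {H : Matrix κ κ ℂ} (hH : H.IsHermitian) :
    ∃ U : Matrix κ κ ℂ, U * U.conjTranspose = 1 ∧ H.transpose = U * H * U.conjTranspose := by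
  set E : Matrix κ κ ℂ := (hH.eigenvectorUnitary : Matrix κ κ ℂ) with hE
  have h1 : E.conjTranspose * E = 1 := by
    have := hH.eigenvectorUnitary.2
    rw [Matrix.mem_unitaryGroup_iff'] at this; exact this
  have h1' : E * E.conjTranspose = 1 := by
    have := hH.eigenvectorUnitary.2
    rw [Matrix.mem_unitaryGroup_iff] at this; exact this
  obtain ⟨D, hD, hDt⟩ : ∃ D : Matrix κ κ ℂ, H = E * D * E.conjTranspose ∧ D.transpose = D := by
    refine ⟨Matrix.diagonal (RCLike.ofReal ∘ hH.eigenvalues), ?_, Matrix.diagonal_transpose _⟩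
    exact hH.spectral_theorem
  have e1 : E.conjTranspose.transpose * E.transpose = 1 := by
    rw [← transpose_mul, h1', Matrix.transpose_one]
  have e2 : E.transpose * E.conjTranspose.transpose = 1 := by
    rw [← transpose_mul, h1, Matrix.transpose_one]
  refine ⟨E.conjTranspose.transpose * E.conjTranspose, ?_, ?_⟩
  · rw [conjTranspose_mul, conjTranspose_conjTranspose, Matrix.mul_assoc,
      ← Matrix.mul_assoc E.conjTranspose, h1, Matrix.one_mul,
      show E.conjTranspose.transpose.conjTranspose = E.transpose from by
        ext i j; simp [conjTranspose, Matrix.transpose], e1]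
  · have e3 : E.conjTranspose.transpose.conjTranspose = E.transpose := by
      ext i j; simp [conjTranspose, Matrix.transpose]
    rw [conjTranspose_mul, conjTranspose_conjTranspose, e3, hD]
    have : E.conjTranspose.transpose * E.conjTranspose * (E * D * E.conjTranspose) *
        (E * E.transpose) = E.conjTranspose.transpose * (E.conjTranspose * E) * D *
          (E.conjTranspose * E) * E.transpose := by simp only [Matrix.mul_assoc]
    rw [this, h1, Matrix.mul_one, Matrix.mul_one, transpose_mul, transpose_mul, hDt, Matrix.mul_assoc]

lemma syl_bound_of_conj [DecidableEq κ] {a c : ℝ} {P : Matrix ι ι ℂ} {Q U : Matrix κ κ ℂ}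
    (hU : U * U.conjTranspose = 1) (h : ∀ X : Matrix ι κ ℂ, ‖X‖ ≤ c * ‖syl a P Q X‖)
    (X : Matrix ι κ ℂ) : ‖X‖ ≤ c * ‖syl a P (U * Q * U.conjTranspose) X‖ := by
  have hU' : U.conjTranspose * U = 1 := mul_eq_one_comm.1 hU
  have e : syl a P Q (X * U) = syl a P (U * Q * U.conjTranspose) X * U := by
    simp only [syl_apply, Matrix.add_mul, smul_mul, Matrix.mul_assoc, hU', Matrix.mul_one]
  have := h (X * U)
  rwa [e, norm_mul_of_unitary hU, norm_mul_of_unitary hU] at this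

end Sylvester

/-! ### The homological equation -/

section BlockOps

lemma hsSq_eq_enorm (A : Mat) (n m : ℕ) : hsSq A n m = ‖rblk A n m‖ₑ ^ 2 := by
  rw [← ofReal_norm, ← hs_eq_norm, hs, ← ofReal_pow (Real.sqrt_nonneg _),
    sq_sqrt (by positivity), hsSq, ENNReal.ofReal_sum_of_nonneg (fun _ _ => by positivity)]
  rw [← sum_coe_sort]
  refine sum_congr rfl fun a _ => ?_
  rw [ENNReal.ofReal_sum_of_nonneg (fun _ _ => by positivity), ← sum_coe_sort]
  refine sum_congr rfl fun b _ => ?_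
  rw [ofReal_pow (norm_nonneg _), ofReal_norm, rblk_apply]

lemma hsBlock_eq_enorm (A : Mat) (n : ℕ) : hsBlock n A = ‖rblk A n n‖ₑ := by
  rw [hsBlock, hsSq_eq_enorm, sq_rpow_half]

/-- The matrix with given blocks. -/
def ofBlocks (F : ∀ n m : ℕ, Matrix (blk n) (blk m) ℂ) : Mat := fun j k =>
  F j.natAbs k.natAbs ⟨j, self_mem_blk j⟩ ⟨k, self_mem_blk k⟩

lemma rblk_ofBlocks (F : ∀ n m : ℕ, Matrix (blk n) (blk m) ℂ) (n m : ℕ) : rblk (ofBlocks F) n m = F n m := by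
  ext ⟨a, ha⟩ ⟨b, hb⟩
  obtain rfl := mem_blk.1 ha
  obtain rfl := mem_blk.1 hb
  rfl

lemma rblk_sub (A B : Mat) (n m : ℕ) : rblk (A - B) n m = rblk A n m - rblk B n m := rfl
lemma rblk_add (A B : Mat) (n m : ℕ) : rblk (A + B) n m = rblk A n m + rblk B n m := rfl
lemma rblk_neg (A : Mat) (n m : ℕ) : rblk (-A) n m = -rblk A n m := rfl
lemma rblk_smul (c : ℂ) (A : Mat) (n m : ℕ) : rblk (c • A) n m = c • rblk A n m := rfl

lemma rblk_weighted (p q : ℝ) (A : Op ν) (ℓ : 𝕀 ν) (n m : ℕ) :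
    rblk (weighted p q A ℓ) n m = ((br n ^ p * br m ^ q : ℝ) : ℂ) • rblk (A ℓ) n m := by
  have e : ∀ a : ℤ, br a = br ((a.natAbs : ℕ) : ℝ) := fun a => by
    rw [← br_abs, ← Int.cast_abs, Int.abs_eq_natAbs, Int.cast_natCast]
  ext ⟨a, ha⟩ ⟨b, hb⟩
  obtain rfl := mem_blk.1 ha
  obtain rfl := mem_blk.1 hb
  simp only [rblk_apply, weighted, Matrix.smul_apply, smul_eq_mul, Complex.ofReal_mul, e a, e b]
  ring

instance nontrivial_blk (n m : ℕ) : Nontrivial (Matrix (blk n) (blk m) ℂ) := by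
  have h1 : Nonempty (blk n) := ⟨⟨(n : ℤ), mem_blk.2 (by simp)⟩⟩
  have h2 : Nonempty (blk m) := ⟨⟨(m : ℤ), mem_blk.2 (by simp)⟩⟩
  exact inferInstanceAs (Nontrivial (blk n → blk m → ℂ))

/-- Blockwise application of regularised inverses. -/
def resOp (good : (𝕀 ν) → ℕ → ℕ → Prop) (c : ℕ → ℕ → ℝ)
    (G : (𝕀 ν) → ∀ n m : ℕ, Matrix (blk n) (blk m) ℂ →ₗ[ℂ] Matrix (blk n) (blk m) ℂ)
    (V : Op ν) : Op ν := fun ℓ => ofBlocks fun n m =>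
  open Classical in
  if good ℓ n m then Complex.I • regInv (c n m) (G ℓ n m) (rblk (V ℓ) n m) else 0

variable {good : (𝕀 ν) → ℕ → ℕ → Prop} {c : ℕ → ℕ → ℝ}

open Classical in
lemma rblk_resOp (G : (𝕀 ν) → ∀ n m : ℕ, Matrix (blk n) (blk m) ℂ →ₗ[ℂ] Matrix (blk n) (blk m) ℂ)
    (V : Op ν) (ℓ : 𝕀 ν) (n m : ℕ) : rblk (resOp good c G V ℓ) n m =
    if good ℓ n m then Complex.I • regInv (c n m) (G ℓ n m) (rblk (V ℓ) n m) else 0 := by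
  rw [resOp, rblk_ofBlocks]

lemma resOp_sub (G : (𝕀 ν) → ∀ n m : ℕ, Matrix (blk n) (blk m) ℂ →ₗ[ℂ] Matrix (blk n) (blk m) ℂ)
    (V V' : Op ν) : resOp good c G (V - V') = resOp good c G V - resOp good c G V' := by
  funext ℓ
  refine mat_ext_rblk fun n m => ?_
  rw [Pi.sub_apply, rblk_sub, rblk_resOp, rblk_resOp, rblk_resOp, Pi.sub_apply, rblk_sub]
  split_ifs
  · rw [regInv_sub, smul_sub]
  · simp

lemma decayNorm_le_of_norm_rblk {s t : ℝ} (ht : 0 ≤ t) {A B : Op ν}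
    (h : ∀ ℓ n m, ‖rblk (A ℓ) n m‖ ≤ t * ‖rblk (B ℓ) n m‖) :
    decayNorm s A ≤ ofReal t * decayNorm s B := by
  refine decayNorm_le_of_block fun ℓ n m => ?_
  rw [hsSq_eq_enorm, hsSq_eq_enorm, ← mul_pow]
  refine pow_le_pow_left' ?_ 2
  rw [← ofReal_norm, ← ofReal_norm, ← ofReal_mul ht]
  exact ofReal_le_ofReal (h ℓ n m)

variable {s p q p' q' c₀ : ℝ}

lemma decayNorm_weighted_resOp_le (hc : ∀ n m, 0 < c n m) (hc₀ : 0 ≤ c₀)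
    (hw : ∀ n m : ℕ, br n ^ p * br m ^ q * c n m ≤ c₀ * (br n ^ p' * br m ^ q'))
    (G : (𝕀 ν) → ∀ n m : ℕ, Matrix (blk n) (blk m) ℂ →ₗ[ℂ] Matrix (blk n) (blk m) ℂ)
    (V : Op ν) : decayNorm s (weighted p q (resOp good c G V)) ≤ ofReal (2 * c₀) * decayNorm s (weighted p' q' V) := by
  refine decayNorm_le_of_norm_rblk (by positivity) fun ℓ n m => ?_
  have b1 := br_pos n
  have b2 := br_pos m
  rw [rblk_weighted, rblk_weighted, norm_smul, norm_smul, norm_real, norm_real,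
    norm_of_nonneg (by positivity), norm_of_nonneg (by positivity), rblk_resOp]
  split_ifs with h
  · rw [norm_smul, norm_I, one_mul]
    calc _ ≤ br n ^ p * br m ^ q * (2 * c n m * ‖rblk (V ℓ) n m‖) := by
          gcongr; exact norm_regInv_le (hc n m) _
      _ = 2 * (br n ^ p * br m ^ q * c n m) * ‖rblk (V ℓ) n m‖ := by ring
      _ ≤ 2 * (c₀ * (br n ^ p' * br m ^ q')) * ‖rblk (V ℓ) n m‖ :=
          mul_le_mul_of_nonneg_right (mul_le_mul_of_nonneg_left (hw n m) two_pos.le) (norm_nonneg _)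
      _ = _ := by ring
  · simp; positivity

lemma decayNorm_weighted_resOp_sub_le (hc : ∀ n m, 0 < c n m) (hc₀ : ∀ n m, c n m ≤ c₀)
    (hw : ∀ n m : ℕ, br n ^ p * br m ^ q * c n m ≤ c₀ * (br n ^ p' * br m ^ q'))
    {G G' : (𝕀 ν) → ∀ n m : ℕ, Matrix (blk n) (blk m) ℂ →ₗ[ℂ] Matrix (blk n) (blk m) ℂ}
    {b : ℝ} (hb : 0 ≤ b)
    (hG : ∀ ℓ n m, good ℓ n m → ∀ x, ‖G ℓ n m x - G' ℓ n m x‖ ≤ b * ‖x‖)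
    (V : Op ν) : decayNorm s (weighted p q (resOp good c G V - resOp good c G' V)) ≤
      ofReal (8 * c₀ ^ 2 * b) * decayNorm s (weighted p' q' V) := by
  have hc₀' : 0 ≤ c₀ := (hc 0 0).le.trans (hc₀ 0 0)
  refine decayNorm_le_of_norm_rblk (by positivity) fun ℓ n m => ?_
  have b1 := br_pos n
  have b2 := br_pos m
  rw [rblk_weighted, rblk_weighted, norm_smul, norm_smul, norm_real, norm_real,
    norm_of_nonneg (by positivity), norm_of_nonneg (by positivity), Pi.sub_apply,
    rblk_sub, rblk_resOp, rblk_resOp]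
  split_ifs with h
  · rw [← smul_sub, norm_smul, norm_I, one_mul]
    have hcp := (hc n m).le
    calc _ ≤ br n ^ p * br m ^ q * (8 * c n m ^ 2 * b * ‖rblk (V ℓ) n m‖) := by
          gcongr; exact norm_regInv_sub_le (hc n m) (hG ℓ n m h) _
      _ = br n ^ p * br m ^ q * c n m * c n m * (8 * b * ‖rblk (V ℓ) n m‖) := by ring
      _ ≤ c₀ * (br n ^ p' * br m ^ q') * c₀ * (8 * b * ‖rblk (V ℓ) n m‖) :=
          mul_le_mul_of_nonneg_right (mul_le_mul (hw n m) (hc₀ n m) hcp (by positivity)) (by positivity)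
      _ = _ := by ring
  · simp; positivity

lemma famNorm_resOp_le (hw0 : 0 ≤ w) (hc : ∀ n m, 0 < c n m) (hc₀ : ∀ n m, c n m ≤ c₀)
    (hw : ∀ n m : ℕ, br n ^ p * br m ^ q * c n m ≤ c₀ * (br n ^ p' * br m ^ q'))
    {G : Freq ν → (𝕀 ν) → ∀ n m : ℕ, Matrix (blk n) (blk m) ℂ →ₗ[ℂ] Matrix (blk n) (blk m) ℂ}
    {b : ℝ} (hb : 0 ≤ b)
    (hG : ∀ ω₁ ∈ R, ∀ ω₂ ∈ R, ∀ ℓ n m, good ℓ n m → ∀ x, ‖G ω₁ ℓ n m x - G ω₂ ℓ n m x‖ ≤ b * ‖ω₁ - ω₂‖ * ‖x‖)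
    (V : Freq ν → Op ν) : fN s p q (fun ω => resOp good c (G ω) (V ω)) ≤
      ofReal (2 * c₀ + 8 * c₀ ^ 2 * b * w) * fN s p' q' V := by
  have hc₀' : 0 ≤ c₀ := (hc 0 0).le.trans (hc₀ 0 0)
  set S := lipSup R (decayNorm s) (fun ω => weighted p' q' (V ω)) with hS
  set L := lipSemi R w (decayNorm s) (fun ω => weighted p' q' (V ω)) with hL
  have key : fN s p q (fun ω => resOp good c (G ω) (V ω)) ≤ ofReal (2 * c₀) * S +
        (ofReal (8 * c₀ ^ 2 * b * w) * S + ofReal (2 * c₀) * L) := by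
    refine lipNorm_le (fun ω hω => ?_) fun ω₁ h₁ ω₂ h₂ hne => ?_
    · refine (decayNorm_weighted_resOp_le hc hc₀' hw _ _).trans (mul_le_mul' le_rfl ?_)
      exact le_lipSup (decayNorm s) (fun ω => weighted p' q' (V ω)) hω
    · have e : weighted p q (resOp good c (G ω₁) (V ω₁)) - weighted p q (resOp good c (G ω₂) (V ω₂))
          = weighted p q (resOp good c (G ω₁) (V ω₁) - resOp good c (G ω₂) (V ω₁)) +
            weighted p q (resOp good c (G ω₂) (V ω₁ - V ω₂)) := by
        rw [resOp_sub, weighted_sub, weighted_sub]; abel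
      rw [e]
      have h1 := decayNorm_weighted_resOp_sub_le (s := s) hc hc₀ hw (by positivity) (hG ω₁ h₁ ω₂ h₂) (V ω₁)
      have h2 := decayNorm_weighted_resOp_le (s := s) (good := good) hc hc₀' hw (G ω₂) (V ω₁ - V ω₂)
      rw [weighted_sub] at h2
      have h3 := le_lipSemi (w := w) (decayNorm s) (fun ω => weighted p' q' (V ω)) h₁ h₂ hne
      have h4 := le_lipSup (decayNorm s) (fun ω => weighted p' q' (V ω)) h₁
      calc _ ≤ ofReal w * (ofReal (8 * c₀ ^ 2 * (b * ‖ω₁ - ω₂‖)) * S + ofReal (2 * c₀) *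
              decayNorm s (weighted p' q' (V ω₁) - weighted p' q' (V ω₂))) :=
            mul_le_mul' le_rfl ((decayNorm_add_le _ _ _).trans (add_le_add (h1.trans (mul_le_mul' le_rfl h4)) h2))
        _ = ofReal (8 * c₀ ^ 2 * b * w) * S * ‖ω₁ - ω₂‖ₑ + ofReal (2 * c₀) * (ofReal w *
              decayNorm s (weighted p' q' (V ω₁) - weighted p' q' (V ω₂))) := by
            rw [show 8 * c₀ ^ 2 * (b * ‖ω₁ - ω₂‖) = 8 * c₀ ^ 2 * b * ‖ω₁ - ω₂‖ by ring,
              ofReal_mul (p := 8 * c₀ ^ 2 * b) (by positivity),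
              ofReal_mul (p := 8 * c₀ ^ 2 * b) (by positivity), ofReal_norm]
            ring
        _ ≤ _ := by
            rw [add_mul, mul_assoc (ofReal (2 * c₀))]
            exact add_le_add le_rfl (mul_le_mul' le_rfl h3)
  refine key.trans ?_
  rw [ofReal_add (by positivity) (by positivity),
    show fN s p' q' V = S + L from lipNorm_eq _ _, add_mul, mul_add, mul_add]
  calc _ ≤ (ofReal (2 * c₀) * S + (ofReal (8 * c₀ ^ 2 * b * w) * S +
        ofReal (2 * c₀) * L)) + ofReal (8 * c₀ ^ 2 * b * w) * L := le_self_add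
    _ = _ := by ring

end BlockOps

section Homological

/-- The bound for the inverse of `G^±` in the non-resonance conditions. -/
def gapC (N τ γ α M : ℝ) (ε : ℤ) (n m : ℕ) : ℝ :=
  2 * N ^ τ / γ * (M ^ α / br ((n : ℝ) + ε * m) ^ α)

/-- The regularised solution of the homological equation. -/
def homSol (ψ : 𝔹) (N τ γ α M : ℝ) (ω : Freq ν) (H : Mat) (V : OpMat ν) :
    OpMat ν where
  d := resOp (fun ℓ n m => absZ ℓ ≤ N ∧ ¬ (ℓ = 0 ∧ n = m)) (gapC N τ γ α M (-1))
    (fun ℓ n m => syl (dot ω ℓ) (block H n) (-block H m)) V.d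
  o := resOp (fun ℓ _ _ => absZ ℓ ≤ N) (gapC N τ γ α M 1)
    (fun ℓ n m => syl (dot ω ℓ) (block H n) (block (conjMat ψ H) m)) V.o

variable {N : ℝ} {ω : Freq ν} {H : Mat} {V : OpMat ν}

lemma gapC_pos (hN : 0 < N) (hγ : 0 < γ) (hM : 0 < M) (ε : ℤ) (n m : ℕ) : 0 < gapC N τ γ α M ε n m := by
  have := br_pos ((n : ℝ) + ε * m)
  rw [gapC]; positivity

lemma homSol_supp (ℓ : 𝕀 ν) (h : N < absZ ℓ) :
    (homSol ψ N τ γ α M ω H V).d ℓ = 0 ∧ (homSol ψ N τ γ α M ω H V).o ℓ = 0 := by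
  constructor
  · refine mat_ext_rblk fun n m => ?_
    rw [homSol, rblk_resOp, if_neg (fun h' => absurd h'.1 (not_le.2 h))]; rfl
  · refine mat_ext_rblk fun n m => ?_
    rw [homSol, rblk_resOp, if_neg (not_le.2 h)]; rfl

lemma homSol_diag (j k : ℤ) (h : j.natAbs = k.natAbs) : (homSol ψ N τ γ α M ω H V).d 0 j k = 0 := by
  refine apply_eq_of_rblk_eq (B := 0) ?_
  rw [homSol, rblk_resOp, if_neg (fun h' => h'.2 ⟨rfl, h⟩)]; rfl

lemma rblk_bmul_comb (a : ℝ) (H X H' : Mat) (n m : ℕ) : rblk (Complex.I • ((a : ℂ) • X + bmulL H X + bmulR X H')) n m =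
      Complex.I • syl a (block H n) (block H' m) (rblk X n m) := by
  rw [rblk_smul, rblk_add, rblk_add, rblk_smul, rblk_bmulL, rblk_bmulR, syl_apply, block_eq_rblk, block_eq_rblk]

lemma bmulR_neg (X H : Mat) : bmulR X (-H) = -bmulR X H := by
  funext j k
  simp [bmulR]

lemma gOp_eq_syl (ω : Freq ν) (H : Mat) (ε : ℤ) (ℓ : 𝕀 ν) (n m : ℕ) (X : Matrix (blk n) (blk m) ℂ) :
    gOp ω H ε ℓ n m X = syl (dot ω ℓ) (block H n) ((ε : ℂ) • block H m) X := by
  rw [gOp, syl_apply, Matrix.mul_smul]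

lemma homSol_d (hN : 0 < N) (hγ : 0 < γ) (hM : 0 < M) (h : ∀ (ℓ : 𝕀 ν) (n m : ℕ), IsIndex (-1) ℓ n m → absZ ℓ ≤ N →
      GInvBound ω H (-1) ℓ n m (gapC N τ γ α M (-1) n m))
    {ℓ : 𝕀 ν} (hℓ : absZ ℓ ≤ N) (j k : ℤ) :
    Complex.I * ((dot ω ℓ : ℂ) * (homSol ψ N τ γ α M ω H V).d ℓ j k
        + ∑ i ∈ blk j.natAbs, H j i * (homSol ψ N τ γ α M ω H V).d ℓ i k
        - ∑ i ∈ blk k.natAbs, (homSol ψ N τ γ α M ω H V).d ℓ j i * H i k)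
      = (if ℓ = 0 ∧ j.natAbs = k.natAbs then V.d 0 j k else 0) - V.d ℓ j k := by
  set X := (homSol ψ N τ γ α M ω H V).d ℓ with hX
  have key : rblk (Complex.I • ((dot ω ℓ : ℂ) • X + bmulL H X + bmulR X (-H))) j.natAbs k.natAbs =
      rblk (if ℓ = 0 ∧ j.natAbs = k.natAbs then 0 else -V.d ℓ) j.natAbs k.natAbs := by
    rw [rblk_bmul_comb, hX, homSol, rblk_resOp]
    by_cases h0 : ℓ = 0 ∧ j.natAbs = k.natAbs
    · rw [if_neg (fun h' => h'.2 h0), if_pos h0, map_zero, smul_zero]; rfl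
    · rw [if_pos ⟨hℓ, h0⟩, if_neg h0, map_smul, smul_smul, I_mul_I, rblk_neg, neg_smul, one_smul]
      congr 1
      refine apply_regInv (gapC_pos hN hγ hM _ _ _) (fun x => ?_) _
      have := (h ℓ j.natAbs k.natAbs (Or.inr ⟨rfl, h0⟩) hℓ).2 x
      rw [hs_eq_norm, hs_eq_norm, gOp_eq_syl] at this
      simpa [block_eq_rblk, rblk_neg] using this
  have key' := apply_eq_of_rblk_eq key
  rw [bmulR_neg] at key'
  have e : (Complex.I • ((dot ω ℓ : ℂ) • X + bmulL H X + -bmulR X H)) j k =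
      Complex.I * ((dot ω ℓ : ℂ) * X j k + ∑ i ∈ blk j.natAbs, H j i * X i k - ∑ i ∈ blk k.natAbs, X j i * H i k) := by
    simp [bmulL, bmulR, sub_eq_add_neg]
  rw [← e, key']
  split_ifs with h0
  · rw [h0.1]; simp
  · simp

lemma unitary_rblk_cc (hψ : CS) (n : ℕ) : rblk (cc ψ) n n * (rblk (cc ψ) n n).conjTranspose = 1 := by
  have : (rblk (cc ψ) n n).conjTranspose = (rblk (cc ψ) n n).map conj := by
    rw [conjTranspose, rblk_cc_transpose]; rfl
  rw [this]; exact hψ n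

lemma conjTranspose_rblk_cc (ψ : 𝔹) (n : ℕ) : (rblk (cc ψ) n n).conjTranspose = (rblk (cc ψ) n n).map conj := by
  rw [conjTranspose, rblk_cc_transpose]; rfl

lemma map_conj_eq_transpose {n : ℕ} {P : Matrix (blk n) (blk n) ℂ} (hP : P.IsHermitian) : P.map conj = P.transpose := by
  conv_rhs => rw [← hP.eq]
  rfl

lemma homSol_o (hψ : CS) (hN : 0 < N) (hγ : 0 < γ) (hM : 0 < M) (hH : ∀ n, (block H n).IsHermitian)
    (h : ∀ (ℓ : 𝕀 ν) (n m : ℕ), IsIndex 1 ℓ n m → absZ ℓ ≤ N → GInvBound ω H 1 ℓ n m (gapC N τ γ α M 1 n m))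
    {ℓ : 𝕀 ν} (hℓ : absZ ℓ ≤ N) (j k : ℤ) :
    Complex.I * ((dot ω ℓ : ℂ) * (homSol ψ N τ γ α M ω H V).o ℓ j k
        + ∑ i ∈ blk j.natAbs, H j i * (homSol ψ N τ γ α M ω H V).o ℓ i k
        + ∑ i ∈ blk k.natAbs, (homSol ψ N τ γ α M ω H V).o ℓ j i * conjMat ψ H i k)
      = - V.o ℓ j k := by
  set X := (homSol ψ N τ γ α M ω H V).o ℓ with hX
  have key : rblk (Complex.I • ((dot ω ℓ : ℂ) • X + bmulL H X + bmulR X (conjMat ψ H)))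
      j.natAbs k.natAbs = rblk (-V.o ℓ) j.natAbs k.natAbs := by
    rw [rblk_bmul_comb, hX, homSol, rblk_resOp]
    rw [if_pos hℓ, map_smul, smul_smul, I_mul_I, rblk_neg, neg_smul, one_smul]
    congr 1
    refine apply_regInv (gapC_pos hN hγ hM _ _ _) (fun x => ?_) _
    have hb : ∀ x : Matrix (blk j.natAbs) (blk k.natAbs) ℂ, ‖x‖ ≤ gapC N τ γ α M 1 j.natAbs k.natAbs *
        ‖syl (dot ω ℓ) (block H j.natAbs) (block H k.natAbs) x‖ := fun x => by
      have := (h ℓ j.natAbs k.natAbs (Or.inl rfl) hℓ).2 x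
      rw [hs_eq_norm, hs_eq_norm, gOp_eq_syl] at this
      simpa using this
    obtain ⟨U, hU, hUt⟩ := exists_unitary_transpose (hH k.natAbs)
    have e : block (conjMat ψ H) k.natAbs = rblk (cc ψ) k.natAbs k.natAbs * (U * block H k.natAbs * U.conjTranspose) *
        (rblk (cc ψ) k.natAbs k.natAbs).conjTranspose := by
      rw [block_eq_rblk, rblk_conjMat, conjTranspose_rblk_cc, ← hUt, ← map_conj_eq_transpose (hH _), block_eq_rblk]
    rw [e]
    exact syl_bound_of_conj (unitary_rblk_cc hψ _) (syl_bound_of_conj hU hb) x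
  have key' := apply_eq_of_rblk_eq key
  have e : (Complex.I • ((dot ω ℓ : ℂ) • X + bmulL H X + bmulR X (conjMat ψ H))) j k =
      Complex.I * ((dot ω ℓ : ℂ) * X j k + ∑ i ∈ blk j.natAbs, H j i * X i k
        + ∑ i ∈ blk k.natAbs, X j i * conjMat ψ H i k) := by
    simp [bmulL, bmulR]
  rw [← e, key']
  rfl

end Homological

section HomologicalHam

variable {N : ℝ} {ω : Freq ν} {H : Mat} {V : OpMat ν}

/-- The transposition `conj (A^*)` on blocks. -/
def trBlk (ψ : 𝔹) (n m : ℕ) (x : Matrix (blk n) (blk m) ℂ) :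
    Matrix (blk m) (blk n) ℂ :=
  rblk (cc ψ) m m * x.transpose * (rblk (cc ψ) n n).map conj

lemma rblk_conj_swap (B : Mat) (n m : ℕ) : rblk (fun j k => conj (B k j)) n m = (rblk B m n).conjTranspose := rfl

lemma ham_o_iff (ψ : 𝔹) (B : Mat) : (∀ j k, conj (B k j) = conjMat ψ B j k) ↔
    ∀ n m, rblk B m n = trBlk ψ n m (rblk B n m) := by
  have e : ∀ n m, (rblk B m n).conjTranspose = rblk (conjMat ψ B) n m ↔ rblk B m n = trBlk ψ n m (rblk B n m) := by
    intro n m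
    have e1 : (rblk (conjMat ψ B) n m).conjTranspose = trBlk ψ n m (rblk B n m) := by
      rw [rblk_conjMat, conjTranspose_mul, conjTranspose_mul, trBlk,
        conjTranspose_rblk_cc, ← conjTranspose_rblk_cc, conjTranspose_conjTranspose,
        Matrix.mul_assoc]
      congr 2
      ext i j
      simp [conjTranspose]
    constructor
    · intro h
      rw [← e1, ← h, conjTranspose_conjTranspose]
    · intro h
      rw [h, ← e1, conjTranspose_conjTranspose]
  constructor
  · intro h n m
    rw [← e, ← rblk_conj_swap]
    congr 1
    funext j k
    exact h j k
  · intro h j k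
    refine apply_eq_of_rblk_eq (A := fun j k => conj (B k j)) ?_
    rw [rblk_conj_swap, e]
    exact h _ _

lemma norm_trBlk (hψ : CS) (n m : ℕ) (x : Matrix (blk n) (blk m) ℂ) : ‖trBlk ψ n m x‖ = ‖x‖ := by
  have h1 := unitary_rblk_cc hψ n
  have h2 := unitary_rblk_cc hψ m
  have h2' := mul_eq_one_comm.1 h2
  have h1' := mul_eq_one_comm.1 h1
  rw [trBlk, norm_mul_of_unitary, norm_unitary_mul h2', Matrix.frobenius_norm_transpose]
  rw [← conjTranspose_rblk_cc, conjTranspose_conjTranspose, h1']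

lemma trBlk_trBlk (hψ : CS) (n m : ℕ) (x : Matrix (blk m) (blk n) ℂ) : trBlk ψ n m (trBlk ψ m n x) = x := by
  have h1 := hψ m
  have h3 : ((rblk (cc ψ) m m).map conj).transpose = (rblk (cc ψ) m m).map conj := by
    rw [← Matrix.transpose_map, rblk_cc_transpose]
  have e : trBlk ψ n m (trBlk ψ m n x) = rblk (cc ψ) m m * (rblk (cc ψ) m m).map conj * x *
      (rblk (cc ψ) n n * (rblk (cc ψ) n n).map conj) := by
    simp only [trBlk, transpose_mul, Matrix.transpose_transpose, rblk_cc_transpose, h3, Matrix.mul_assoc]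
  rw [e, hψ m, hψ n, Matrix.one_mul, Matrix.mul_one]

lemma syl_trBlk (hψ : CS) (hH : ∀ n, (block H n).IsHermitian) (a : ℝ) (n m : ℕ) (x : Matrix (blk n) (blk m) ℂ) :
    syl a (block H m) (block (conjMat ψ H) n) (trBlk ψ n m x) =
      trBlk ψ n m (syl a (block H n) (block (conjMat ψ H) m) x) := by
  have h3 : ∀ m, ((rblk (cc ψ) m m).map conj).transpose = (rblk (cc ψ) m m).map conj := fun m => by
    rw [← Matrix.transpose_map, rblk_cc_transpose]
  have h4 : ((block H m).map conj).transpose = block H m := by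
    rw [map_conj_eq_transpose (hH m), Matrix.transpose_transpose]
  have h5 := map_conj_eq_transpose (hH n)
  simp only [syl_apply, trBlk, block_eq_rblk, rblk_conjMat, Matrix.transpose_add,
    Matrix.transpose_smul, transpose_mul, Matrix.mul_add, Matrix.add_mul, Matrix.mul_smul,
    smul_mul, rblk_cc_transpose, h3] at *
  rw [h4, ← h5, add_right_comm]
  congr 1
  · congr 1
    simp only [Matrix.mul_assoc]
    rw [← Matrix.mul_assoc ((rblk (cc ψ) n n).map conj) (rblk (cc ψ) n n), hψ.symm n, Matrix.one_mul]
  · simp only [← Matrix.mul_assoc]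
    rw [hψ m, Matrix.one_mul]

lemma isHam_homSol (hψ : CS) (hH : ∀ n, (block H n).IsHermitian) (hV : V.IsHam ψ) :
    (homSol ψ N τ γ α M ω H V).IsHam ψ := by
  have hd : ∀ ℓ j k, conj ((homSol ψ N τ γ α M ω H V).d (-ℓ) k j) = (homSol ψ N τ γ α M ω H V).d ℓ j k := by
    intro ℓ j k
    refine apply_eq_of_rblk_eq (A := fun j k => conj ((homSol ψ N τ γ α M ω H V).d (-ℓ) k j)) ?_
    generalize j.natAbs = n
    generalize k.natAbs = m
    rw [rblk_conj_swap, homSol, rblk_resOp, rblk_resOp]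
    have hc : (absZ (-ℓ) ≤ N ∧ ¬ (-ℓ = 0 ∧ m = n)) ↔ (absZ ℓ ≤ N ∧ ¬ (ℓ = 0 ∧ n = m)) := by
      rw [absZ_neg, neg_eq_zero, eq_comm (a := m)]
    by_cases h : absZ ℓ ≤ N ∧ ¬ (ℓ = 0 ∧ n = m)
    · rw [if_pos (hc.2 h), if_pos h, conjTranspose_smul]
      have hv : rblk (V.d (-ℓ)) m n = (rblk (V.d ℓ) n m).conjTranspose := by
        rw [← rblk_conj_swap]
        congr 1
        funext a b
        rw [← (hV ℓ b a).1, conj_conj]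
      have hg : gapC N τ γ α M (-1) m n = gapC N τ γ α M (-1) n m := by
        rw [gapC, gapC, ← br_neg]
        congr 4
        push_cast; ring
      have he := regInv_equivariant (G := syl (dot ω ℓ) (block H n) (-block H m))
        (G' := -syl (dot ω (-ℓ)) (block H m) (-block H n)) conjTranspose
        norm_conjTranspose (fun y => ⟨y.conjTranspose, conjTranspose_conjTranspose y⟩)
        (fun t x => by rw [conjTranspose_smul]; simp) (fun x => by
          rw [LinearMap.neg_apply, syl_apply, syl_apply, Matrix.conjTranspose_add,
            Matrix.conjTranspose_add, conjTranspose_smul, conjTranspose_mul,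
            conjTranspose_mul, Matrix.conjTranspose_neg, (hH n).eq, (hH m).eq, dot_neg]
          simp only [star_def, conj_ofReal, ofReal_neg, neg_smul, Matrix.mul_neg, Matrix.neg_mul]
          abel) (gapC N τ γ α M (-1) n m) (rblk (V.d ℓ) n m)
      rw [hv, hg, star_def, conj_I, neg_smul, ← smul_neg]
      congr 1
      rw [regInv_neg] at he
      rw [← Matrix.conjTranspose_neg, he, conjTranspose_conjTranspose]
    · rw [if_neg (fun h' => h (hc.1 h')), if_neg h]; simp
  have ho : ∀ ℓ j k, conj ((homSol ψ N τ γ α M ω H V).o ℓ k j) = conjMat ψ ((homSol ψ N τ γ α M ω H V).o ℓ) j k := by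
    intro ℓ
    rw [ham_o_iff ψ]
    intro n m
    have hv := (ham_o_iff ψ (V.o ℓ)).1 (fun j k => by
      have := (hV (-ℓ) j k).2
      rwa [conjOp, neg_neg] at this) n m
    rw [homSol, rblk_resOp, rblk_resOp]
    by_cases h : absZ ℓ ≤ N
    · rw [if_pos h, if_pos h]
      have hg : gapC N τ γ α M 1 m n = gapC N τ γ α M 1 n m := by
        rw [gapC, gapC]
        congr 4
        push_cast; ring
      have hsm : ∀ (t : ℂ) (x : Matrix (blk n) (blk m) ℂ),
          trBlk ψ n m (t • x) = t • trBlk ψ n m x := fun t x => by simp [trBlk]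
      have he := regInv_equivariant (G := syl (dot ω ℓ) (block H n) (block (conjMat ψ H) m))
        (G' := syl (dot ω ℓ) (block H m) (block (conjMat ψ H) n)) (trBlk ψ n m)
        (norm_trBlk hψ n m) (fun y => ⟨trBlk ψ m n y, trBlk_trBlk hψ n m y⟩)
        (fun t x => hsm t x) (syl_trBlk hψ hH _ n m) (gapC N τ γ α M 1 n m) (rblk (V.o ℓ) n m)
      rw [hv, hg, he, hsm]
    · rw [if_neg h, if_neg h]; simp [trBlk]
  intro ℓ j k
  exact ⟨hd ℓ j k, ho (-ℓ) j k⟩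

end HomologicalHam

section HomologicalEstimate

variable {N : ℝ}

lemma norm_rblk_conjMat (hψ : CS) (A : Mat) (n m : ℕ) : ‖rblk (conjMat ψ A) n m‖ = ‖rblk A n m‖ := by
  have h1' := mul_eq_one_comm.1 (unitary_rblk_cc hψ n)
  have h2 := mul_eq_one_comm.1 (unitary_rblk_cc hψ m)
  rw [rblk_conjMat, norm_mul_of_unitary, norm_unitary_mul h1']
  · exact Matrix.frobenius_norm_map_eq _ _ (fun z => by simp)
  · rw [← conjTranspose_rblk_cc, conjTranspose_conjTranspose, h2]

/-- The constant in the estimate of the solution of the homological equation. -/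
def homConst (N τ γ α M : ℝ) : ℝ := 100 * (M ^ α / γ) * N ^ (2 * τ + 1)

lemma gapC_le (hN : 0 < N) (hγ : 0 < γ) (hM : 0 < M) (hα : 0 ≤ α) (ε : ℤ) (n m : ℕ) :
    gapC N τ γ α M ε n m ≤ 2 * N ^ τ / γ * M ^ α := by
  rw [gapC]
  have h1 : 1 ≤ br ((n : ℝ) + ε * m) ^ α := one_le_rpow (one_le_br _) hα
  gcongr
  exact div_le_self (by positivity) h1

lemma matNorm_homSol_le (hψ : CS) (hN : 1 ≤ N) (hτ : 0 ≤ τ) (hγ : 0 < γ) (hM : 0 < M) (hα : 0 < α) {H : Freq ν → Mat}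
    (hH : ∀ ω₁ ∈ R, ∀ ω₂ ∈ R, ∀ n, ‖rblk (H ω₁ - H ω₂) n n‖ ≤ ‖ω₁ - ω₂‖)
    (V : Freq ν → OpMat ν) (s : ℝ) :
    matNorm R (γ / M ^ α) s α α (fun ω => homSol ψ N τ γ α M ω (H ω) (V ω)) ≤
      (decayTerms α α).card * (ofReal (homConst N τ γ α M) * matNorm R (γ / M ^ α) s α 0 V) := by
  have hN0 : 0 < N := by linarith
  set c₀ := 2 * N ^ τ / γ * M ^ α with hc₀
  have hMα : 0 < M ^ α := rpow_pos_of_pos hM α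
  have hNτ : 0 < N ^ τ := rpow_pos_of_pos hN0 τ
  have hw0 : 0 ≤ γ / M ^ α := by positivity
  have hconst : 2 * c₀ + 8 * c₀ ^ 2 * (3 * N) * (γ / M ^ α) ≤ homConst N τ γ α M := by
    have h1 : N ^ (2 * τ + 1) = N ^ τ * N ^ τ * N := by
      rw [rpow_add hN0, rpow_one, two_mul, rpow_add hN0]
    have h2 : 1 ≤ N ^ τ := one_le_rpow hN hτ
    have h3 : N ^ τ ≤ N ^ τ * N ^ τ * N := by nlinarith
    have e : 8 * c₀ ^ 2 * (3 * N) * (γ / M ^ α) = 96 * (M ^ α / γ) * (N ^ τ * N ^ τ * N) := by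
      rw [hc₀]; field_simp; ring
    have e2 : 2 * c₀ = 4 * (M ^ α / γ) * N ^ τ := by rw [hc₀]; ring
    rw [e, e2, homConst, h1]
    have : 4 * (M ^ α / γ) * N ^ τ ≤ 4 * (M ^ α / γ) * (N ^ τ * N ^ τ * N) := by gcongr
    linarith
  have hb : (0 : ℝ) ≤ 3 * N := by positivity
  have hHb : ∀ ω₁ ∈ R, ∀ ω₂ ∈ R, ∀ n, ‖block (H ω₁) n - block (H ω₂) n‖ ≤ ‖ω₁ - ω₂‖ := by
    simpa only [block_eq_rblk, rblk_sub] using hH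
  have hG : ∀ (ω₁ ω₂ : Freq ν) (ℓ : 𝕀 ν) (n m : ℕ) (A A' : Matrix (blk n) (blk n) ℂ)
      (B B' : Matrix (blk m) (blk m) ℂ) (x : Matrix (blk n) (blk m) ℂ), absZ ℓ ≤ N →
      ‖A - A'‖ ≤ ‖ω₁ - ω₂‖ → ‖B - B'‖ ≤ ‖ω₁ - ω₂‖ →
      ‖syl (dot ω₁ ℓ) A B x - syl (dot ω₂ ℓ) A' B' x‖ ≤ 3 * N * ‖ω₁ - ω₂‖ * ‖x‖ := by
    intro ω₁ ω₂ ℓ n m A A' B B' x h hA hB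
    refine (norm_syl_sub_le _ _ _ _ _ _ x).trans (mul_le_mul_of_nonneg_right ?_ (norm_nonneg _))
    have a1 : |dot ω₁ ℓ - dot ω₂ ℓ| ≤ N * ‖ω₁ - ω₂‖ := by
      rw [← dot_sub_left, mul_comm]
      exact (abs_dot_le _ _).trans (by gcongr)
    linarith [le_mul_of_one_le_left (norm_nonneg (ω₁ - ω₂)) hN]
  have hsame : ∀ (ε : ℤ) (p q : ℝ) (n m : ℕ), br n ^ p * br m ^ q * gapC N τ γ α M ε n m ≤
      c₀ * (br n ^ p * br m ^ q) := fun ε p q n m => by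
    have b1 := br_pos n
    have b2 := br_pos m
    rw [mul_comm c₀]
    exact mul_le_mul_of_nonneg_left (gapC_le hN0 hγ hM hα.le ε n m) (by positivity)
  have hpos : ∀ ε n m, 0 < gapC N τ γ α M ε n m := gapC_pos hN0 hγ hM
  have hle : ∀ ε n m, gapC N τ γ α M ε n m ≤ c₀ := gapC_le hN0 hγ hM hα.le
  have fd : ∀ p q : ℝ, (true, p, q) ∈ decayTerms α 0 → famNorm R (γ / M ^ α) s p q
      (fun ω => (homSol ψ N τ γ α M ω (H ω) (V ω)).d) ≤
      ofReal (homConst N τ γ α M) * matNorm R (γ / M ^ α) s α 0 V := fun p q hm =>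
    (famNorm_resOp_le (G := fun ω ℓ n m => syl (dot ω ℓ) (block (H ω) n) (-block (H ω) m))
      hw0 (hpos _) (hle _) (hsame (-1) p q) hb (fun ω₁ h₁ ω₂ h₂ ℓ n m h x =>
        hG _ _ _ _ _ _ _ _ _ x h.1 (hHb ω₁ h₁ ω₂ h₂ n) (by
          rw [neg_sub_neg, norm_sub_rev]; exact hHb ω₁ h₁ ω₂ h₂ m)) fun ω => (V ω).d).trans
      (mul_le_mul' (ofReal_le_ofReal hconst) (famNorm_le_matNorm (A := V) (c := (true, p, q)) hm))
  have fo : ∀ p q p' q' : ℝ, (∀ n m : ℕ, br n ^ p * br m ^ q * gapC N τ γ α M 1 n m ≤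
      c₀ * (br n ^ p' * br m ^ q')) → (false, p', q') ∈ decayTerms α 0 →
      famNorm R (γ / M ^ α) s p q (fun ω => (homSol ψ N τ γ α M ω (H ω) (V ω)).o) ≤
      ofReal (homConst N τ γ α M) * matNorm R (γ / M ^ α) s α 0 V := fun p q p' q' h hm =>
    (famNorm_resOp_le (G := fun ω ℓ n m => syl (dot ω ℓ) (block (H ω) n) (block (conjMat ψ (H ω)) m))
      hw0 (hpos _) (hle _) h hb (fun ω₁ h₁ ω₂ h₂ ℓ n m h x =>
        hG _ _ _ _ _ _ _ _ _ x h (hHb ω₁ h₁ ω₂ h₂ n) (by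
          have := hH ω₁ h₁ ω₂ h₂ m
          rwa [← norm_rblk_conjMat hψ, conjMat_sub, rblk_sub] at this)) fun ω => (V ω).o).trans
      (mul_le_mul' (ofReal_le_ofReal hconst) (famNorm_le_matNorm (A := V) (c := (false, p', q')) hm))
  have hdec : ∀ n m k : ℕ, k ≤ n + m → br k ^ α * gapC N τ γ α M 1 n m ≤ c₀ := by
    intro n m k hk
    have hB : br k ≤ br ((n : ℝ) + (1 : ℤ) * m) := by
      refine max_le_max le_rfl ?_
      rw [Int.cast_one, one_mul, abs_of_nonneg (by positivity), abs_of_nonneg (by positivity)]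
      exact_mod_cast hk
    have hk0 := br_pos k
    have hB' : 0 < br ((n : ℝ) + (1 : ℤ) * m) ^ α := rpow_pos_of_pos (br_pos _) α
    have := hpos 1 n m
    calc _ ≤ br ((n : ℝ) + (1 : ℤ) * m) ^ α * gapC N τ γ α M 1 n m := by gcongr
      _ = c₀ := by rw [gapC, hc₀]; field_simp
  refine matNorm_le_card fun c hcm => ?_
  simp only [decayTerms, mem_union, mem_insert, mem_singleton,
    mem_image, mem_product, mem_univ, and_true, Prod.exists] at hcm
  rcases hcm with (rfl | rfl | rfl | rfl) | ⟨ς, δ, hς, rfl⟩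
  · exact fd α 0 (by simp [decayTerms])
  · exact fd 0 α (by simp [decayTerms])
  · exact fo α 0 0 0 (fun n m => by simpa using hdec n m n (by omega)) (zero_mem_decayTerms _ _ _)
  · exact fo 0 α 0 0 (fun n m => by simpa using hdec n m m (by omega)) (zero_mem_decayTerms _ _ _)
  · have hm := fun δ => diag_mem_decayTerms (α := α) (β := 0) δ (ς := ς) (by tauto)
    cases δ with
    | true => exact fd ς (-ς) (hm _)
    | false => exact fo ς (-ς) ς (-ς) (hsame 1 ς (-ς)) (hm _)

end HomologicalEstimate

/-! ### Lie series in Banach algebras -/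

section LieSeries
variable {𝔸 : Type*} [NormedRing 𝔸]

/-- The iterated commutators `[…[[a, x], x], …, x]`. -/
def adPow (a x : 𝔸) : ℕ → 𝔸
  | 0 => a
  | k + 1 => adPow a x k * x - x * adPow a x k

lemma norm_adPow_le (a x : 𝔸) (k : ℕ) : ‖adPow a x k‖ ≤ (2 * ‖x‖) ^ k * ‖a‖ := by
  induction k with
  | zero => simp [adPow]
  | succ k ih =>
    rw [adPow]
    calc _ ≤ ‖adPow a x k‖ * ‖x‖ + ‖x‖ * ‖adPow a x k‖ :=
          (norm_sub_le _ _).trans (add_le_add (norm_mul_le _ _) (norm_mul_le _ _))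
      _ = 2 * ‖x‖ * ‖adPow a x k‖ := by ring
      _ ≤ 2 * ‖x‖ * ((2 * ‖x‖) ^ k * ‖a‖) := by gcongr
      _ = _ := by ring

variable [NormedAlgebra ℂ 𝔸]

/-- `x^n / n!`. -/
def divPow (x : 𝔸) (n : ℕ) : 𝔸 := ((n.factorial : ℂ)⁻¹) • x ^ n

lemma succ_smul_divPow (x : 𝔸) (n : ℕ) : ((n : ℂ) + 1) • divPow x (n + 1) = divPow x n * x := by
  rw [divPow, divPow, smul_smul, smul_mul_assoc, ← pow_succ, Nat.factorial_succ]
  congr 1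
  push_cast
  have h1 : (n : ℂ) + 1 ≠ 0 := Nat.cast_add_one_ne_zero n
  have h2 : (n.factorial : ℂ) ≠ 0 := Nat.cast_ne_zero.2 (Nat.factorial_ne_zero n)
  field_simp

lemma succ_smul_divPow' (x : 𝔸) (n : ℕ) : ((n : ℂ) + 1) • divPow x (n + 1) = x * divPow x n := by
  rw [succ_smul_divPow, divPow, smul_mul_assoc, mul_smul_comm, ← pow_succ, ← pow_succ']

/-- `[…[a, x], …, x] / k!`. -/
def divAd (a x : 𝔸) (k : ℕ) : 𝔸 := ((k.factorial : ℂ)⁻¹) • adPow a x k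

lemma succ_smul_divAd (a x : 𝔸) (k : ℕ) : ((k : ℂ) + 1) • divAd a x (k + 1) = divAd a x k * x - x * divAd a x k := by
  rw [divAd, divAd, smul_smul, smul_mul_assoc, mul_smul_comm, ← smul_sub, ← adPow, Nat.factorial_succ]
  congr 1
  push_cast
  have h1 : (k : ℂ) + 1 ≠ 0 := Nat.cast_add_one_ne_zero k
  have h2 : (k.factorial : ℂ) ≠ 0 := Nat.cast_ne_zero.2 (Nat.factorial_ne_zero k)
  field_simp

/-- The Leibniz rule for a recursion `(n+1) p_{n+1} = x p_n + r_n`. -/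
lemma leibniz_aux (x : 𝔸) (q r : ℕ → 𝔸) (h : ∀ b : ℕ, ((b : ℂ) + 1) • q (b + 1) = r b) (n : ℕ) :
    ((n : ℂ) + 1) • ∑ p ∈ HasAntidiagonal.antidiagonal (n + 1), divPow x p.1 * q p.2 =
      x * (∑ p ∈ HasAntidiagonal.antidiagonal n, divPow x p.1 * q p.2) +
        ∑ p ∈ HasAntidiagonal.antidiagonal n, divPow x p.1 * r p.2 := by
  have e1 : ((n : ℂ) + 1) • ∑ p ∈ HasAntidiagonal.antidiagonal (n + 1), divPow x p.1 * q p.2 =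
      ∑ p ∈ HasAntidiagonal.antidiagonal (n + 1), ((p.1 : ℂ) • (divPow x p.1 * q p.2)) +
      ∑ p ∈ HasAntidiagonal.antidiagonal (n + 1), ((p.2 : ℂ) • (divPow x p.1 * q p.2)) := by
    rw [← sum_add_distrib, Finset.smul_sum]
    refine sum_congr rfl fun p hp => ?_
    rw [← add_smul]
    congr 1
    have := HasAntidiagonal.mem_antidiagonal.1 hp
    exact_mod_cast this.symm
  rw [e1]
  congr 1
  · rw [Finset.Nat.sum_antidiagonal_succ, mul_sum]
    simp only [cast_zero, zero_smul, zero_add]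
    refine sum_congr rfl fun p _ => ?_
    push_cast
    rw [← smul_mul_assoc, succ_smul_divPow', mul_assoc]
  · rw [Finset.Nat.sum_antidiagonal_succ']
    simp only [cast_zero, zero_smul, zero_add]
    refine sum_congr rfl fun p _ => ?_
    push_cast
    rw [← mul_smul_comm, h]

lemma mul_divPow_eq (a x : 𝔸) (n : ℕ) :
    a * divPow x n = ∑ p ∈ HasAntidiagonal.antidiagonal n, divPow x p.1 * divAd a x p.2 := by
  induction n with
  | zero => simp [divPow, divAd, adPow]
  | succ n ih =>
    have h := leibniz_aux x (divAd a x) _ (fun b => succ_smul_divAd a x b) n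
    have hne : (n : ℂ) + 1 ≠ 0 := Nat.cast_add_one_ne_zero n
    refine smul_right_injective 𝔸 hne ?_
    change ((n : ℂ) + 1) • (a * divPow x (n + 1)) = _
    refine Eq.trans ?_ h.symm
    rw [← mul_smul_comm, succ_smul_divPow, ← mul_assoc, ih, sum_mul, mul_sum, ← sum_add_distrib]
    refine sum_congr rfl fun p _ => ?_
    have hc : x * divPow x p.1 = divPow x p.1 * x := by
      rw [← succ_smul_divPow, succ_smul_divPow']
    rw [mul_sub, ← mul_assoc, ← mul_assoc, ← mul_assoc, hc]
    abel

lemma hasSum_divPow [CompleteSpace 𝔸] (x : 𝔸) : HasSum (divPow x) (exp x) :=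
  NormedSpace.exp_series_hasSum_exp' (𝕂 := ℂ) x

lemma summable_norm_divPow (x : 𝔸) : Summable fun n => ‖divPow x n‖ :=
  NormedSpace.norm_expSeries_summable' (𝕂 := ℂ) x

lemma summable_norm_divAd (a x : 𝔸) : Summable fun n => ‖divAd a x n‖ := by
  refine Summable.of_nonneg_of_le (fun _ => norm_nonneg _) (fun n => ?_)
    ((Real.summable_pow_div_factorial (2 * ‖x‖)).mul_right ‖a‖)
  rw [divAd, norm_smul, norm_inv, Complex.norm_natCast, div_eq_inv_mul, mul_assoc]
  gcongr
  exact norm_adPow_le a x n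

/-- `a e^x = e^x (a + [a,x] + [[a,x],x]/2! + …)`. -/
lemma mul_exp_eq [CompleteSpace 𝔸] {a x e : 𝔸} (he : HasSum (divAd a x) e) : a * exp x = exp x * e := by
  have h1 := (hasSum_divPow x).mul_left a
  have h2 := tsum_mul_tsum_eq_tsum_sum_antidiagonal_of_summable_norm (summable_norm_divPow x) (summable_norm_divAd a x)
  rw [(hasSum_divPow x).tsum_eq, he.tsum_eq] at h2
  rw [h2, ← h1.tsum_eq]
  exact tsum_congr fun n => mul_divPow_eq a x n

end LieSeries

section InvariantRelation
variable {F : Type*} [NormedAddCommGroup F] [NormedSpace ℂ F]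

/-- The operator `(u, g) ↦ (x u, x g + d u)`. -/
def lowTri (x d : F →L[ℂ] F) : (F × F) →L[ℂ] (F × F) :=
  (x.comp (ContinuousLinearMap.fst ℂ F F)).prod
    (x.comp (ContinuousLinearMap.snd ℂ F F) + d.comp (ContinuousLinearMap.fst ℂ F F))

lemma lowTri_apply (x d : F →L[ℂ] F) (z : F × F) : lowTri x d z = (x z.1, x z.2 + d z.1) := rfl

/-- `[…[d, x], …, x] / k!` with `k - 1` commutators, `0` for `k = 0`. -/
def intAd (d x : F →L[ℂ] F) : ℕ → (F →L[ℂ] F)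
  | 0 => 0
  | k + 1 => ((k : ℂ) + 1)⁻¹ • divAd d x k

lemma divPow_lowTri (x d : F →L[ℂ] F) (n : ℕ) (z : F × F) : divPow (lowTri x d) n z = (divPow x n z.1, divPow x n z.2 +
      (∑ p ∈ HasAntidiagonal.antidiagonal n, divPow x p.1 * intAd d x p.2) z.1) := by
  induction n with
  | zero => simp [divPow, intAd]
  | succ n ih =>
    have hne : (n : ℂ) + 1 ≠ 0 := Nat.cast_add_one_ne_zero n
    refine smul_right_injective (F × F) hne ?_
    change ((n : ℂ) + 1) • (divPow (lowTri x d) (n + 1) z) = _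
    have h1 := congrArg (fun T : (F × F) →L[ℂ] (F × F) => T z) (succ_smul_divPow' (lowTri x d) n)
    simp only [smul_apply, mul_apply_eq_comp] at h1
    rw [h1, ih, lowTri_apply]
    have h2 := congrArg (fun T : F →L[ℂ] F => T z.1) (succ_smul_divPow' x n)
    have h3 := congrArg (fun T : F →L[ℂ] F => T z.2) (succ_smul_divPow' x n)
    have h4 := leibniz_aux x (intAd d x) (divAd d x) (fun b => by
      rw [intAd, smul_smul, mul_inv_cancel₀ (Nat.cast_add_one_ne_zero b), one_smul]) n
    rw [← mul_divPow_eq] at h4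
    have h5 := congrArg (fun T : F →L[ℂ] F => T z.1) h4
    simp only [smul_apply, mul_apply_eq_comp, add_apply] at h2 h3 h5
    refine Prod.ext ?_ ?_
    · simp only [Prod.smul_mk, h2]
    · simp only [Prod.smul_mk, smul_add, h3, h5, map_add]
      abel

lemma divPow_neg_mem {𝔸 : Type*} [NormedRing 𝔸] [NormedAlgebra ℂ 𝔸] (x : 𝔸) (n : ℕ) :
    divPow (-x) n = ((-1 : ℂ) ^ n) • divPow x n := by
  rw [divPow, divPow, neg_pow, smul_comm]
  congr 1
  rcases Nat.even_or_odd n with h | h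
  · simp [h.neg_one_pow]
  · simp [h.neg_one_pow]

variable [CompleteSpace F]

lemma exp_lowTri_apply {x d Q : F →L[ℂ] F} (hQ : HasSum (intAd d x) Q) (z : F × F) : exp (lowTri x d) z =
      (exp x z.1, exp x (z.2 + Q z.1)) := by
  have hs : Summable fun n => ‖intAd d x n‖ := by
    rw [← summable_nat_add_iff 1]
    refine Summable.of_nonneg_of_le (fun _ => norm_nonneg _) (fun n => ?_) (summable_norm_divAd d x)
    rw [intAd, norm_smul, norm_inv]
    refine mul_le_of_le_one_left (norm_nonneg _) (inv_le_one_of_one_le₀ ?_)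
    have : ((n : ℂ) + 1) = ((n + 1 : ℕ) : ℂ) := by push_cast; ring
    rw [this, Complex.norm_natCast]
    exact_mod_cast Nat.succ_le_succ (Nat.zero_le n)
  have h1 := (hasSum_divPow (lowTri x d)).mapL (ContinuousLinearMap.apply ℂ (F × F) z)
  have hm := (summable_norm_sum_mul_antidiagonal_of_summable_norm (summable_norm_divPow x) hs).of_norm.hasSum
  rw [← tsum_mul_tsum_eq_tsum_sum_antidiagonal_of_summable_norm (summable_norm_divPow x) hs,
    (hasSum_divPow x).tsum_eq, hQ.tsum_eq] at hm
  have a1 := (hasSum_divPow x).mapL (ContinuousLinearMap.apply ℂ F z.1)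
  have a2 := (hasSum_divPow x).mapL (ContinuousLinearMap.apply ℂ F z.2)
  have a3 := hm.mapL (ContinuousLinearMap.apply ℂ F z.1)
  have h2 := a1.prodMk (a2.add a3)
  simp only [apply_apply, divPow_lowTri] at h1 h2
  rw [h1.unique h2]
  simp [mul_apply_eq_comp, map_add]

lemma exp_neg_mul_exp {G : Type*} [NormedAddCommGroup G] [NormedSpace ℂ G] [CompleteSpace G]
    (x : G →L[ℂ] G) : exp (-x) * exp x = 1 := by
  have h := NormedSpace.expSeries_radius_eq_top ℂ (G →L[ℂ] G)
  rw [← NormedSpace.exp_add_of_commute_of_mem_ball (𝕂 := ℂ) (Commute.neg_left (Commute.refl x))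
    (h.symm ▸ edist_lt_top _ _) (h.symm ▸ edist_lt_top _ _), neg_add_cancel, exp_zero]

/-- A closed subspace invariant under `(u, g) ↦ (x u, x g + d u)` is invariant under the
corresponding flow. -/
lemma mem_iff_exp_lowTri {L : Submodule ℂ (F × F)} (hL : IsClosed (L : Set (F × F)))
    {x d Q : F →L[ℂ] F} (hQ : HasSum (intAd d x) Q)
    (hx : ∀ z ∈ L, lowTri x d z ∈ L) (u g : F) :
    (exp x u, exp x (g + Q u)) ∈ L ↔ (u, g) ∈ L := by
  have hpow : ∀ n, ∀ z ∈ L, divPow (lowTri x d) n z ∈ L := by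
    intro n z hz
    rw [divPow, smul_apply]
    refine L.smul_mem _ ?_
    induction n with
    | zero => simpa using hz
    | succ n ih => rw [pow_succ', mul_apply_eq_comp]; exact hx _ ih
  have hinv : ∀ y : (F × F) →L[ℂ] (F × F), (∀ n, ∀ z ∈ L, divPow y n z ∈ L) → ∀ z ∈ L, exp y z ∈ L := by
    intro y hy z hz
    have h1 := (hasSum_divPow y).mapL (ContinuousLinearMap.apply ℂ (F × F) z)
    simp only [apply_apply] at h1
    exact hL.mem_of_tendsto h1 (Eventually.of_forall fun s => L.sum_mem fun n _ => hy n z hz)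
  have e := exp_lowTri_apply hQ (u, g)
  dsimp only at e
  rw [← e]
  constructor
  · intro h
    have := hinv (-(lowTri x d)) (fun n z hz => by
      rw [divPow_neg_mem, smul_apply]; exact L.smul_mem _ (hpow n z hz)) _ h
    rw [← mul_apply_eq_comp, exp_neg_mul_exp] at this
    simpa using this
  · exact hinv _ hpow _

end InvariantRelation

/-! ### The conjugation of the Hamiltonian -/

section Relation
variable {ω : Freq ν}

instance : Add (OpMat ν) := ⟨fun A B => ⟨A.d + B.d, A.o + B.o⟩⟩

lemma OpMat.add_d (A B : OpMat ν) : (A + B).d = A.d + B.d := rfl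
lemma OpMat.add_o (A B : OpMat ν) : (A + B).o = A.o + B.o := rfl

lemma fin0_add {A B : OpMat ν} (hA : Fin0 A) (hB : Fin0 B) : Fin0 (A + B) :=
  ⟨decayNorm_add_ne_top hA.1 hB.1, decayNorm_add_ne_top hA.2 hB.2⟩

lemma opMat_toCLM_add (hψ : CS) {A B : OpMat ν} (hA : Fin0 A) (hB : Fin0 B) :
    (A + B).toCLM ψ = A.toCLM ψ + B.toCLM ψ := by
  have c := fun {A : Op ν} (h : dn₀ A ≠ ⊤) => decayNorm_conjOp_ne_top hψ h
  refine ContinuousLinearMap.ext fun u => ?_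
  rw [add_apply, OpMat.toCLM_apply, OpMat.toCLM_apply, OpMat.toCLM_apply, OpMat.add_d, OpMat.add_o,
    conjOp_add, conjOp_add, toCLM_add hA.1 hB.1, toCLM_add hA.2 hB.2,
    toCLM_add (c hA.1) (c hB.1), toCLM_add (c hA.2) (c hB.2)]
  refine Prod.ext ?_ ?_
  · simp only [add_apply, Prod.mk_add_mk]; abel
  · simp only [add_apply, Prod.mk_add_mk]; abel

/-- The graph of `-i ω·∂_φ + diag(H, -conj H)`. -/
def relSub (ψ : 𝔹) (ω : Freq ν) (H : Mat) :
    Submodule ℂ ((L2 ν × L2 ν) × (L2 ν × L2 ν)) where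
  carrier := {z | IsImage ψ ω H 0 z.1 z.2}
  add_mem' := by
    intro z z' hz hz' ℓ j
    have h1 := hz ℓ j
    have h2 := hz' ℓ j
    simp only [zero_apply, fst_zero, snd_zero, coef_zero, add_zero, fst_add,
      snd_add, coef_add, mul_add, sum_add_distrib] at *
    rw [h1.1, h1.2, h2.1, h2.2]
    constructor <;> ring
  zero_mem' := by
    intro ℓ j
    simp
  smul_mem' := by
    intro c z hz ℓ j
    have h1 := hz ℓ j
    simp only [zero_apply, fst_zero, snd_zero, coef_zero, add_zero, smul_fst, smul_snd, coef_smul] at *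
    rw [h1.1, h1.2, mul_add, mul_sub, mul_sum, mul_sum]
    refine ⟨?_, ?_⟩
    · rw [mul_left_comm]; congr 1
      exact sum_congr rfl fun k _ => by ring
    · rw [mul_left_comm]; congr 1
      exact sum_congr rfl fun k _ => by ring

lemma mem_relSub {H : Mat} {u g : L2 ν × L2 ν} : (u, g) ∈ relSub ψ ω H ↔ ∀ ℓ j,
    coef ψ g.1 ℓ j = (dot ω ℓ : ℂ) * coef ψ u.1 ℓ j + ∑ k ∈ blk j.natAbs, H j k * coef ψ u.1 ℓ k ∧
    coef ψ g.2 ℓ j = (dot ω ℓ : ℂ) * coef ψ u.2 ℓ j + ∑ k ∈ blk j.natAbs, (-conjMat ψ H) j k * coef ψ u.2 ℓ k := by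
  refine forall_congr' fun ℓ => forall_congr' fun j => ?_
  simp [sub_eq_add_neg]

lemma continuous_coef (ℓ : 𝕀 ν) (j : ℤ) : Continuous fun u : L2 ν => coef ψ u ℓ j := by
  simp only [← coefCLM_apply]
  exact (coefCLM ψ ℓ j).continuous

lemma isClosed_relSub (H : Mat) : IsClosed (relSub ψ ω H : Set ((L2 ν × L2 ν) × (L2 ν × L2 ν))) := by
  have : (relSub ψ ω H : Set ((L2 ν × L2 ν) × (L2 ν × L2 ν))) = ⋂ ℓ, ⋂ j,
      {z | coef ψ z.2.1 ℓ j = (dot ω ℓ : ℂ) * coef ψ z.1.1 ℓ j + ∑ k ∈ blk j.natAbs, H j k * coef ψ z.1.1 ℓ k} ∩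
      {z | coef ψ z.2.2 ℓ j = (dot ω ℓ : ℂ) * coef ψ z.1.2 ℓ j +
      ∑ k ∈ blk j.natAbs, (-conjMat ψ H) j k * coef ψ z.1.2 ℓ k} := by
    ext z
    simp only [SetLike.mem_coe, Set.mem_iInter, Set.mem_inter_iff, Set.mem_ofPred_eq]
    exact mem_relSub
  rw [this]
  have c1 : ∀ ℓ j, Continuous fun z : (L2 ν × L2 ν) × (L2 ν × L2 ν) => coef ψ z.1.1 ℓ j :=
    fun ℓ j => (continuous_coef ℓ j).comp (continuous_fst.comp continuous_fst)
  have c2 : ∀ ℓ j, Continuous fun z : (L2 ν × L2 ν) × (L2 ν × L2 ν) => coef ψ z.1.2 ℓ j :=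
    fun ℓ j => (continuous_coef ℓ j).comp (continuous_snd.comp continuous_fst)
  have c3 : ∀ ℓ j, Continuous fun z : (L2 ν × L2 ν) × (L2 ν × L2 ν) => coef ψ z.2.1 ℓ j :=
    fun ℓ j => (continuous_coef ℓ j).comp (continuous_fst.comp continuous_snd)
  have c4 : ∀ ℓ j, Continuous fun z : (L2 ν × L2 ν) × (L2 ν × L2 ν) => coef ψ z.2.2 ℓ j :=
    fun ℓ j => (continuous_coef ℓ j).comp (continuous_snd.comp continuous_snd)
  refine isClosed_iInter fun ℓ => isClosed_iInter fun j => IsClosed.inter ?_ ?_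
  · exact isClosed_eq (c3 ℓ j) ((continuous_const.mul (c1 ℓ j)).add
      (continuous_finsetSum _ fun k _ => continuous_const.mul (c1 ℓ k)))
  · exact isClosed_eq (c4 ℓ j) ((continuous_const.mul (c2 ℓ j)).add
      (continuous_finsetSum _ fun k _ => continuous_const.mul (c2 ℓ k)))

lemma isImage_iff_mem {H : Mat} {V : 𝔏 ν} {u f : L2 ν × L2 ν} : IsImage ψ ω H V u f ↔ (u, f - V u) ∈ relSub ψ ω H := by
  rw [mem_relSub]
  refine forall_congr' fun ℓ => forall_congr' fun j => ?_
  simp only [fst_sub, snd_sub, coef_sub, Pi.neg_apply, neg_mul, Finset.sum_neg_distrib, sub_eq_iff_eq_add]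
  simp only [sub_eq_add_neg]

/-- Commutation of a matrix with the unperturbed operators. -/
lemma coef_intertwine {A D : Op ν} (hA : dn₀ A ≠ ⊤) (hD : dn₀ D ≠ ⊤) {H₁ H₂ : Mat}
    (h : ∀ ℓ, Complex.I • ((dot ω ℓ : ℂ) • A ℓ + bmulL H₁ (A ℓ) - bmulR (A ℓ) H₂) = D ℓ)
    {u g : L2 ν} (hg : ∀ ℓ j, coef ψ g ℓ j = (dot ω ℓ : ℂ) * coef ψ u ℓ j +
      ∑ k ∈ blk j.natAbs, H₂ j k * coef ψ u ℓ k) (ℓ : 𝕀 ν) (j : ℤ) :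
    Complex.I * coef ψ (toCLM ψ A g) ℓ j + coef ψ (toCLM ψ D u) ℓ j =
      Complex.I * ((dot ω ℓ : ℂ) * coef ψ (toCLM ψ A u) ℓ j +
        ∑ i ∈ blk j.natAbs, H₁ j i * coef ψ (toCLM ψ A u) ℓ i) := by
  have a1 := ((realizes_toCLM ψ hA g ℓ j).mul_left Complex.I).add (realizes_toCLM ψ hD u ℓ j)
  have a2 := (((realizes_toCLM ψ hA u ℓ j).mul_left (dot ω ℓ : ℂ)).add (hasSum_sum (s := blk j.natAbs)
      (fun i _ => (realizes_toCLM ψ hA u ℓ i).mul_left (H₁ j i)))).mul_left Complex.I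
  refine hasSum_unique_of_blocks a1 a2 fun ℓ' n => ?_
  have e : ∑ i ∈ blk n, A (ℓ - ℓ') j i * ∑ k ∈ blk n, H₂ i k * coef ψ u ℓ' k =
      ∑ k ∈ blk n, (∑ i ∈ blk n, A (ℓ - ℓ') j i * H₂ i k) * coef ψ u ℓ' k := by
    simp only [mul_sum, sum_mul]
    rw [sum_comm]
    exact sum_congr rfl fun _ _ => sum_congr rfl fun _ _ => by ring
  have e2 : ∀ i ∈ blk n, Complex.I * (A (ℓ - ℓ') j i * coef ψ g ℓ' i) + D (ℓ - ℓ') j i * coef ψ u ℓ' i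
      = (Complex.I * ((dot ω ℓ : ℂ) * (A (ℓ - ℓ') j i * coef ψ u ℓ' i) +
        ∑ i_1 ∈ blk j.natAbs, H₁ j i_1 * (A (ℓ - ℓ') i_1 i * coef ψ u ℓ' i))) +
        (Complex.I * (A (ℓ - ℓ') j i * ∑ k ∈ blk n, H₂ i k * coef ψ u ℓ' k) -
        Complex.I * ((∑ i_1 ∈ blk n, A (ℓ - ℓ') j i_1 * H₂ i_1 i) * coef ψ u ℓ' i)) := by
    intro i hi
    have hn := mem_blk.1 hi
    rw [hg, ← h (ℓ - ℓ'), hn, dot_sub_right]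
    simp only [Pi.smul_apply, Pi.add_apply, Pi.sub_apply, smul_eq_mul, bmulL, bmulR, hn, ofReal_sub]
    have e3 : ∑ i_1 ∈ blk j.natAbs, H₁ j i_1 * (A (ℓ - ℓ') i_1 i * coef ψ u ℓ' i) =
        (∑ i_1 ∈ blk j.natAbs, H₁ j i_1 * A (ℓ - ℓ') i_1 i) * coef ψ u ℓ' i := by
      rw [sum_mul]; exact sum_congr rfl fun _ _ => by ring
    rw [e3]
    ring
  rw [sum_congr rfl e2, sum_add_distrib, sum_sub_distrib, ← mul_sum, ← mul_sum, ← mul_sum, e, sub_self, add_zero]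

/-- `X` solves the homological equation with right-hand side `D`. -/
def HomEq (ψ : 𝔹) (ω : Freq ν) (H : Mat) (X D : OpMat ν) : Prop :=
  ∀ ℓ, Complex.I • ((dot ω ℓ : ℂ) • X.d ℓ + bmulL H (X.d ℓ) - bmulR (X.d ℓ) H) = D.d ℓ ∧
    Complex.I • ((dot ω ℓ : ℂ) • X.o ℓ + bmulL H (X.o ℓ) + bmulR (X.o ℓ) (conjMat ψ H)) = D.o ℓ

lemma bmulL_neg (H X : Mat) : bmulL (-H) X = -bmulL H X := by
  funext j k
  simp [bmulL]

lemma lowTri_mem_relSub (hψ : CS) {H : Mat} {X D : OpMat ν} (hX : Fin0 X) (hD : Fin0 D) (h : HomEq ψ ω H X D) :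
    ∀ z ∈ relSub ψ ω H, lowTri (Complex.I • X.toCLM ψ) (D.toCLM ψ) z ∈ relSub ψ ω H := by
  have c := fun {A : Op ν} (h : dn₀ A ≠ ⊤) => decayNorm_conjOp_ne_top hψ h
  rintro ⟨u, g⟩ hz
  rw [mem_relSub] at hz
  have hd : ∀ ℓ, Complex.I • ((dot ω ℓ : ℂ) • X.d ℓ + bmulL H (X.d ℓ) - bmulR (X.d ℓ) H) = D.d ℓ :=
    fun ℓ => (h ℓ).1
  have ho : ∀ ℓ, Complex.I • ((dot ω ℓ : ℂ) • X.o ℓ + bmulL H (X.o ℓ) -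
      bmulR (X.o ℓ) (-conjMat ψ H)) = D.o ℓ := fun ℓ => by
    rw [bmulR_neg, sub_neg_eq_add]; exact (h ℓ).2
  have hdc : ∀ ℓ, Complex.I • ((dot ω ℓ : ℂ) • conjOp ψ X.d ℓ +
      bmulL (-conjMat ψ H) (conjOp ψ X.d ℓ) - bmulR (conjOp ψ X.d ℓ) (-conjMat ψ H)) =
      conjOp ψ D.d ℓ := fun ℓ => by
    rw [conjOp, conjOp, ← hd (-ℓ), conjMat_smul, conjMat_sub, conjMat_add, conjMat_smul,
      conjMat_bmulL hψ, conjMat_bmulR hψ, bmulR_neg, bmulL_neg, conj_I, dot_neg,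
      conj_ofReal, ofReal_neg, neg_smul, neg_smul, ← smul_neg]
    congr 1; abel
  have hoc : ∀ ℓ, Complex.I • ((dot ω ℓ : ℂ) • conjOp ψ X.o ℓ +
      bmulL (-conjMat ψ H) (conjOp ψ X.o ℓ) - bmulR (conjOp ψ X.o ℓ) H) =
      conjOp ψ D.o ℓ := fun ℓ => by
    rw [conjOp, conjOp, ← (h (-ℓ)).2, conjMat_smul, conjMat_add, conjMat_add, conjMat_smul,
      conjMat_bmulL hψ, conjMat_bmulR hψ, conjMat_conjMat hψ, bmulL_neg, conj_I, dot_neg,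
      conj_ofReal, ofReal_neg, neg_smul, neg_smul, ← smul_neg]
    congr 1; abel
  have g1 : ∀ ℓ j, coef ψ g.1 ℓ j = _ := fun ℓ j => (hz ℓ j).1
  have g2 : ∀ ℓ j, coef ψ g.2 ℓ j = _ := fun ℓ j => (hz ℓ j).2
  rw [lowTri_apply, mem_relSub]
  intro ℓ j
  have r1 := coef_intertwine hX.1 hD.1 hd g1 ℓ j
  have r2 := coef_intertwine hX.2 hD.2 ho g2 ℓ j
  have r3 := coef_intertwine (c hX.2) (c hD.2) hoc g1 ℓ j
  have r4 := coef_intertwine (c hX.1) (c hD.1) hdc g2 ℓ j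
  simp only [smul_apply, OpMat.toCLM_apply, fst_add, snd_add, smul_fst, smul_snd, coef_add, coef_smul, coef_neg]
  have dist : ∀ (a b : ℤ → ℂ) (K : Mat), ∑ k ∈ blk j.natAbs, K j k * (Complex.I * (a k + b k)) =
      Complex.I * (∑ k ∈ blk j.natAbs, K j k * a k) + Complex.I * (∑ k ∈ blk j.natAbs, K j k * b k) := fun a b K => by
    rw [mul_sum, mul_sum, ← sum_add_distrib]
    exact sum_congr rfl fun _ _ => by ring
  have distn : ∀ (a b : ℤ → ℂ) (K : Mat), ∑ k ∈ blk j.natAbs, K j k * (Complex.I * -(a k + b k)) =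
      -(Complex.I * (∑ k ∈ blk j.natAbs, K j k * a k) +
        Complex.I * (∑ k ∈ blk j.natAbs, K j k * b k)) := fun a b K => by
    rw [← dist, ← Finset.sum_neg_distrib]
    exact sum_congr rfl fun _ _ => by ring
  rw [dist, distn]
  constructor
  · linear_combination r1 + r2
  · linear_combination -r3 - r4

lemma coef_toCLM_diag {B : Op ν} (hB : dn₀ B ≠ ⊤) (h0 : ∀ ℓ, ℓ ≠ 0 → B ℓ = 0)
    (h1 : ∀ j k : ℤ, j.natAbs ≠ k.natAbs → B 0 j k = 0) (u : L2 ν) (ℓ : 𝕀 ν) (j : ℤ) :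
    coef ψ (toCLM ψ B u) ℓ j = ∑ k ∈ blk j.natAbs, B 0 j k * coef ψ u ℓ k := by
  refine (realizes_toCLM ψ hB u ℓ j).unique ?_
  have := hasSum_sum_of_ne_finset_zero (L := SummationFilter.unconditional _) (f := fun a : 𝕁 ν =>
    B (ℓ - a.1) j a.2 * coef ψ u a.1 a.2) (s := (blk j.natAbs).image fun k => (ℓ, k)) (by
      rintro ⟨ℓ', k⟩ hk
      by_cases hℓ : ℓ - ℓ' = 0
      · have hℓ' : ℓ = ℓ' := sub_eq_zero.1 hℓ
        subst hℓ'
        rw [sub_self, h1, zero_mul]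
        intro hjk
        exact hk (mem_image.2 ⟨k, mem_blk.2 hjk.symm, rfl⟩)
      · simp [h0 _ hℓ])
  rw [Finset.sum_image (by intro a _ b _ h; exact (Prod.ext_iff.1 h).2)] at this
  simpa using this

end Relation

/-! ### The KAM step -/

open Classical in
/-- The right-hand side `Z - Π_N V` of the homological equation. -/
def homRhs (N : ℝ) (V : OpMat ν) : OpMat ν where
  d := fun ℓ j k => if absZ ℓ ≤ N ∧ ¬ (ℓ = 0 ∧ j.natAbs = k.natAbs) then -V.d ℓ j k else 0
  o := fun ℓ j k => if absZ ℓ ≤ N then -V.o ℓ j k else 0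

open Classical in
/-- The high frequencies of `V`. -/
def highPart (N : ℝ) (V : OpMat ν) : OpMat ν where
  d := fun ℓ j k => if absZ ℓ ≤ N then 0 else V.d ℓ j k
  o := fun ℓ j k => if absZ ℓ ≤ N then 0 else V.o ℓ j k

open Classical in
/-- The resonant part `Z` of `V`. -/
def diagPart (V : OpMat ν) : OpMat ν where
  d := fun ℓ j k => if ℓ = 0 ∧ j.natAbs = k.natAbs then V.d ℓ j k else 0
  o := 0

lemma highPart_add_diagPart {N : ℝ} (hN : 0 ≤ N) (V : OpMat ν) : highPart N V + diagPart V = V + homRhs N V := by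
  have hd : (highPart N V).d + (diagPart V).d = V.d + (homRhs N V).d := by
    funext ℓ j k
    simp only [highPart, diagPart, homRhs, Pi.add_apply]
    by_cases h : absZ ℓ ≤ N
    · by_cases h' : ℓ = 0 ∧ j.natAbs = k.natAbs <;> simp [h, h', not_lt.2 hN]
    · have h' : ¬ (ℓ = 0 ∧ j.natAbs = k.natAbs) := fun h' => h (by rw [h'.1, absZ_zero]; exact hN)
      simp [h, h']
  have ho : (highPart N V).o + (diagPart V).o = V.o + (homRhs N V).o := by
    funext ℓ j k
    simp only [highPart, diagPart, homRhs, Pi.add_apply]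
    by_cases h : absZ ℓ ≤ N <;> simp [h]
  change OpMat.mk ((highPart N V).d + (diagPart V).d) ((highPart N V).o + (diagPart V).o) =
    OpMat.mk (V.d + (homRhs N V).d) (V.o + (homRhs N V).o)
  rw [hd, ho]

lemma fin0_of_entry_le {A B : OpMat ν} (hA : Fin0 A) (hd : ∀ ℓ j k, ‖B.d ℓ j k‖ₑ ≤ ‖A.d ℓ j k‖ₑ)
    (ho : ∀ ℓ j k, ‖B.o ℓ j k‖ₑ ≤ ‖A.o ℓ j k‖ₑ) : Fin0 B :=
  ⟨ne_top_of_le_ne_top hA.1 ((decayNorm_le_of_entry (c := 1) (by simpa using hd)).trans_eq (one_mul _)),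
    ne_top_of_le_ne_top hA.2 ((decayNorm_le_of_entry (c := 1) (by simpa using ho)).trans_eq (one_mul _))⟩

lemma fin0_homRhs (N : ℝ) {V : OpMat ν} (hV : Fin0 V) : Fin0 (homRhs N V) :=
  fin0_of_entry_le hV (fun ℓ j k => by simp only [homRhs]; split_ifs <;> simp)
    (fun ℓ j k => by simp only [homRhs]; split_ifs <;> simp)

lemma fin0_highPart (N : ℝ) {V : OpMat ν} (hV : Fin0 V) : Fin0 (highPart N V) :=
  fin0_of_entry_le hV (fun ℓ j k => by simp only [highPart]; split_ifs <;> simp)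
    (fun ℓ j k => by simp only [highPart]; split_ifs <;> simp)

lemma fin0_diagPart {V : OpMat ν} (hV : Fin0 V) : Fin0 (diagPart V) :=
  fin0_of_entry_le hV (fun ℓ j k => by simp only [diagPart]; split_ifs <;> simp) (fun ℓ j k => by simp [diagPart])

/-- The coefficients `1 / (k + 1)!`. -/
def coefA (k : ℕ) : ℝ := ((k + 1).factorial : ℝ)⁻¹

/-- The coefficients `1 / (k + 2)!`. -/
def coefB (k : ℕ) : ℝ := ((k + 2).factorial : ℝ)⁻¹

lemma abs_inv_factorial_le (n : ℕ) : |((n.factorial : ℝ)⁻¹)| ≤ 1 := by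
  rw [abs_of_nonneg (by positivity)]
  exact inv_le_one_of_one_le₀ (by exact_mod_cast n.factorial_pos)

/-- The new perturbation. -/
def kamNext (ψ : 𝔹) (N : ℝ) (V X : OpMat ν) : OpMat ν :=
  highPart N V + (adSeries ψ coefB (homRhs N V) X + adSeries ψ coefA V X)

lemma fin0_adIter (hψ : CS) {A X : OpMat ν} (hA : Fin0 A) (hX : Fin0 X) (k : ℕ) : Fin0 (adIter ψ A X k) := by
  induction k with
  | zero => exact hA
  | succ k ih => exact fin0_bracket hψ ih hX

lemma toCLM_adIter (hψ : CS) {A X : OpMat ν} (hA : Fin0 A) (hX : Fin0 X) (k : ℕ) :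
    (adIter ψ A X k).toCLM ψ = adPow (A.toCLM ψ) (Complex.I • X.toCLM ψ) k := by
  induction k with
  | zero => rfl
  | succ k ih =>
    rw [adIter, toCLM_bracket hψ (fin0_adIter hψ hA hX k) hX, ih, adPow, mul_smul_comm, smul_mul_assoc, smul_sub]

lemma opMat_toCLM_smul (hψ : CS) (r : ℝ) {A : OpMat ν} (hA : Fin0 A) :
    (⟨(r : ℂ) • A.d, (r : ℂ) • A.o⟩ : OpMat ν).toCLM ψ = (r : ℂ) • A.toCLM ψ := by
  have c := fun {A : Op ν} (h : dn₀ A ≠ ⊤) => decayNorm_conjOp_ne_top hψ h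
  refine ContinuousLinearMap.ext fun u => ?_
  rw [smul_apply, OpMat.toCLM_apply, OpMat.toCLM_apply]
  simp only [conjOp_smul, conj_ofReal]
  rw [toCLM_smul _ hA.1, toCLM_smul _ hA.2, toCLM_smul _ (c hA.1), toCLM_smul _ (c hA.2)]
  simp only [smul_apply, Prod.smul_mk, smul_add, smul_neg]

lemma hasSum_toCLM_adSeries (hψ : CS) {r : ℕ → ℝ} (hr : ∀ k, |r k| ≤ 1) {A X : Freq ν → OpMat ν} (hA : mN₀ α 0 A ≠ ⊤)
    (hX : mN₀ α α X ≠ ⊤)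
    (hsmall : 3 * brConst ν α (sZero ν) * mN₀ α α X ≤ 2⁻¹)
    {ω : Freq ν} (hω : ω ∈ R) :
    Fin0 (adSeries ψ r (A ω) (X ω)) ∧ HasSum (fun k => (r k : ℂ) •
        adPow ((A ω).toCLM ψ) (Complex.I • (X ω).toCLM ψ) (k + 1))
        ((adSeries ψ r (A ω) (X ω)).toCLM ψ) := by
  have fA := fin0_of_matNorm hA hω
  have fX := fin0_of_matNorm hX hω
  have hfin : Fin0 (adSeries ψ r (A ω) (X ω)) := by
    refine fin0_of_matNorm (R := R) (w := w) (α := α) (β := 0) (A := fun ω => adSeries ψ r (A ω) (X ω)) ?_ hω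
    refine ne_top_of_le_ne_top ?_ (matNorm_adSeries_le hψ le_rfl hr hA hX hsmall)
    exact mul_ne_top (mul_ne_top (by simp) (brConst_ne_top _ _ _)) (add_ne_top.2 ⟨mul_ne_top hA hX, mul_ne_top hA hX⟩)
  refine ⟨hfin, ?_⟩
  have hs : ∀ δ, HasSum (fun k => (r k : ℂ) • (adIter ψ (A ω) (X ω) (k + 1)).entry δ)
      ((adSeries ψ r (A ω) (X ω)).entry δ) := fun δ => hasSum_adSeries hψ hr hA hX hsmall hω δ
  have hsum : ∀ δ, ∑' k, dn₀ ((r k : ℂ) • (adIter ψ (A ω) (X ω) (k + 1)).entry δ) ≠ ⊤ := by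
    intro δ
    refine ne_top_of_le_ne_top ?_ ((tsum_le_tsum fun k =>
      (decayNorm_smul_le (by simpa using hr k) _).trans (decayNorm_entry_le (R := R) (w := w)
        (α := α) (β := 0) (A := fun ω => adIter ψ (A ω) (X ω) (k + 1)) hω δ)).trans
      (tsum_matNorm_adIter_le hψ le_rfl hA hX hsmall))
    exact mul_ne_top (mul_ne_top (by simp) (brConst_ne_top _ _ _)) (add_ne_top.2 ⟨mul_ne_top hA hX, mul_ne_top hA hX⟩)
  have := hasSum_opMat_toCLM hψ (A := fun k => (⟨(r k : ℂ) • (adIter ψ (A ω) (X ω) (k + 1)).d,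
    (r k : ℂ) • (adIter ψ (A ω) (X ω) (k + 1)).o⟩ : OpMat ν)) (hs true) (hs false) (hsum true)
    (hsum false) hfin
  convert this using 2 with k
  rw [opMat_toCLM_smul hψ _ (fin0_adIter hψ fA fX _), toCLM_adIter hψ fA fX]

lemma conjOp_diagPart_zero (V : OpMat ν) {ℓ : 𝕀 ν} (h : ℓ ≠ 0) : conjOp ψ (diagPart V).d ℓ = 0 := by
  have : (diagPart V).d (-ℓ) = 0 := by
    funext j k
    simp only [diagPart, neg_eq_zero]
    rw [if_neg (fun h' => h h'.1)]; rfl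
  rw [conjOp, this]
  have := conjMat_smul ψ 0 0
  simpa using this

lemma conjMat_eq_of_block {A B : Mat} {j k : ℤ}
    (h : ∀ a b : ℤ, a.natAbs = j.natAbs → b.natAbs = k.natAbs → A a b = B a b) :
    conjMat ψ A j k = conjMat ψ B j k := by
  simp only [conjMat_apply]
  refine sum_congr rfl fun a ha => sum_congr rfl fun b hb => ?_
  rw [h a b (mem_blk.1 ha) (mem_blk.1 hb)]

lemma mem_relSub_succ (hψ : CS) {ω : Freq ν} {H H' : Mat} {V : OpMat ν} (hV : Fin0 V)
    (hH : ∀ j k : ℤ, j.natAbs = k.natAbs → H' j k = H j k + V.d 0 j k) (u g : L2 ν × L2 ν) :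
    (u, g) ∈ relSub ψ ω H' ↔ (u, g - (diagPart V).toCLM ψ u) ∈ relSub ψ ω H := by
  rw [mem_relSub, mem_relSub]
  have hZ := fin0_diagPart hV
  have z1 : ∀ ℓ j, coef ψ ((diagPart V).toCLM ψ u).1 ℓ j = ∑ k ∈ blk j.natAbs, V.d 0 j k * coef ψ u.1 ℓ k := by
    intro ℓ j
    have ho : toCLM ψ (diagPart V).o = 0 := by
      refine toCLM_eq hZ.2 fun b ℓ j => ?_
      simp [diagPart]
    rw [OpMat.toCLM_apply, coef_add, ho, coef_toCLM_diag hZ.1]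
    · simp only [zero_apply, coef_zero, add_zero]
      refine sum_congr rfl fun k hk => ?_
      simp only [diagPart]
      rw [if_pos ⟨trivial, (mem_blk.1 hk).symm⟩]
    · intro ℓ hℓ
      funext j k
      simp [diagPart, hℓ]
    · intro j k hjk
      simp [diagPart, hjk]
  have z2 : ∀ ℓ j, coef ψ ((diagPart V).toCLM ψ u).2 ℓ j =
      -∑ k ∈ blk j.natAbs, conjMat ψ (V.d 0) j k * coef ψ u.2 ℓ k := by
    intro ℓ j
    have ho : toCLM ψ (conjOp ψ (diagPart V).o) = 0 := by
      have e : conjOp ψ (diagPart V).o = 0 := by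
        have := conjOp_smul ψ 0 (0 : Op ν)
        simpa [diagPart] using this
      rw [e]
      refine toCLM_eq (by rw [decayNorm_zero]; simp) fun b ℓ j => ?_
      simp
    rw [OpMat.toCLM_apply]
    dsimp only
    rw [coef_neg, coef_add, ho, coef_toCLM_diag (decayNorm_conjOp_ne_top hψ hZ.1)]
    · simp only [zero_apply, coef_zero, zero_add]
      congr 1
      refine sum_congr rfl fun k hk => ?_
      congr 1
      rw [conjOp, neg_zero]
      refine conjMat_eq_of_block fun a b ha hb => ?_
      simp only [diagPart]
      rw [if_pos ⟨trivial, by rw [ha, hb, mem_blk.1 hk]⟩]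
    · exact fun ℓ hℓ => conjOp_diagPart_zero V hℓ
    · intro j k hjk
      rw [conjOp, neg_zero]
      have : conjMat ψ ((diagPart V).d 0) j k = conjMat ψ 0 j k := by
        refine conjMat_eq_of_block fun a b ha hb => ?_
        simp [diagPart, ha, hb, hjk]
      rw [this]
      simp [conjMat_apply]
  refine forall_congr' fun ℓ => forall_congr' fun j => ?_
  rw [fst_sub, snd_sub, coef_sub, coef_sub, z1, z2]
  have e1 : ∑ k ∈ blk j.natAbs, H' j k * coef ψ u.1 ℓ k = ∑ k ∈ blk j.natAbs, H j k * coef ψ u.1 ℓ k +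
        ∑ k ∈ blk j.natAbs, V.d 0 j k * coef ψ u.1 ℓ k := by
    rw [← sum_add_distrib]
    refine sum_congr rfl fun k hk => ?_
    rw [hH j k (mem_blk.1 hk).symm, add_mul]
  have e2 : ∑ k ∈ blk j.natAbs, (-conjMat ψ H') j k * coef ψ u.2 ℓ k =
      ∑ k ∈ blk j.natAbs, (-conjMat ψ H) j k * coef ψ u.2 ℓ k -
        ∑ k ∈ blk j.natAbs, conjMat ψ (V.d 0) j k * coef ψ u.2 ℓ k := by
    rw [← sum_sub_distrib]
    refine sum_congr rfl fun k hk => ?_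
    have : conjMat ψ H' j k = conjMat ψ (H + V.d 0) j k :=
      conjMat_eq_of_block fun a b ha hb => hH a b (by rw [ha, hb, mem_blk.1 hk])
    rw [Pi.neg_apply, Pi.neg_apply, Pi.neg_apply, Pi.neg_apply, this, conjMat_add, Pi.add_apply, Pi.add_apply]
    ring
  rw [e1, e2]
  constructor
  · rintro ⟨h1, h2⟩
    exact ⟨by rw [h1]; ring, by rw [h2]; ring⟩
  · rintro ⟨h1, h2⟩
    exact ⟨by linear_combination h1, by linear_combination h2⟩

/-- One step of the iteration conjugates `H + V` to `H' + V'`. -/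
lemma conjugates_kamNext (hψ : CS) {N : ℝ} (hN : 0 ≤ N) {V X : Freq ν → OpMat ν} (hV : mN₀ α 0 V ≠ ⊤)
    (hD : mN₀ α 0 (fun ω => homRhs N (V ω)) ≠ ⊤)
    (hX : mN₀ α α X ≠ ⊤)
    (hsmall : 3 * brConst ν α (sZero ν) * mN₀ α α X ≤ 2⁻¹)
    {ω : Freq ν} (hω : ω ∈ R) {H H' : Mat}
    (hH : ∀ j k : ℤ, j.natAbs = k.natAbs → H' j k = H j k + (V ω).d 0 j k)
    (hom : HomEq ψ ω H (X ω) (homRhs N (V ω))) :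
    Conjugates ψ ω (exp (Complex.I • (X ω).toCLM ψ)) H ((V ω).toCLM ψ) H' ((kamNext ψ N (V ω) (X ω)).toCLM ψ) := by
  intro u f
  have fV := fin0_of_matNorm hV hω
  have fX := fin0_of_matNorm hX hω
  have fD := fin0_homRhs N fV
  obtain ⟨fB, sB⟩ := hasSum_toCLM_adSeries hψ (r := coefB) (fun k => abs_inv_factorial_le _) hD hX hsmall hω
  obtain ⟨fA, sA⟩ := hasSum_toCLM_adSeries hψ (r := coefA) (fun k => abs_inv_factorial_le _) hV hX hsmall hω
  set x := Complex.I • (X ω).toCLM ψ with hx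
  set d := (homRhs N (V ω)).toCLM ψ with hd
  set E := (V ω).toCLM ψ with hE
  set TB := (adSeries ψ coefB (homRhs N (V ω)) (X ω)).toCLM ψ with hTB
  set TA := (adSeries ψ coefA (V ω) (X ω)).toCLM ψ with hTA
  have hQ : HasSum (intAd d x) (d + TB) := by
    rw [hasSum_nat_add_iff' 2 |>.symm]
    have e : d + TB - ∑ i ∈ range 2, intAd d x i = TB := by
      rw [sum_range_succ, sum_range_succ, Finset.sum_range_zero, intAd, intAd, divAd, adPow]
      simp
    have e' : (fun k => intAd d x (k + 2)) = fun k => (coefB k : ℂ) • adPow d x (k + 1) := funext fun k => by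
      change (((k + 1 : ℕ) : ℂ) + 1)⁻¹ • (((k + 1).factorial : ℂ)⁻¹ • adPow d x (k + 1)) = _
      rw [smul_smul, coefB, Nat.factorial_succ (k + 1)]
      push_cast
      rw [mul_inv]
    rw [e, e']
    exact sB
  have hE' : HasSum (divAd E x) (E + TA) := by
    rw [hasSum_nat_add_iff' 1 |>.symm]
    have e : E + TA - ∑ i ∈ range 1, divAd E x i = TA := by
      rw [Finset.sum_range_one, divAd, adPow]; simp
    have e' : (fun k => divAd E x (k + 1)) = fun k => (coefA k : ℂ) • adPow E x (k + 1) := funext fun k => by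
      change ((k + 1).factorial : ℂ)⁻¹ • adPow E x (k + 1) = _
      rw [coefA]
      push_cast
      rfl
    rw [e, e']
    exact sA
  have hsumC : (kamNext ψ N (V ω) (X ω)).toCLM ψ + (diagPart (V ω)).toCLM ψ = (d + TB) + (E + TA) := by
    rw [kamNext, opMat_toCLM_add hψ (fin0_highPart N fV) (fin0_add fB fA), opMat_toCLM_add hψ fB fA]
    have h1 := congrArg (OpMat.toCLM ψ) (highPart_add_diagPart hN (V ω))
    rw [opMat_toCLM_add hψ (fin0_highPart N fV) (fin0_diagPart fV), opMat_toCLM_add hψ fV fD] at h1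
    rw [← hTB, ← hTA]
    calc _ = ((highPart N (V ω)).toCLM ψ + (diagPart (V ω)).toCLM ψ) + (TB + TA) := by abel
      _ = _ := by rw [h1]; abel
  rw [isImage_iff_mem, isImage_iff_mem, mem_relSub_succ hψ fV hH]
  have e1 : f - (kamNext ψ N (V ω) (X ω)).toCLM ψ u - (diagPart (V ω)).toCLM ψ u = f - ((d + TB) u + (E + TA) u) := by
    rw [← add_apply, ← hsumC, add_apply]; abel
  rw [e1, ← mem_iff_exp_lowTri (isClosed_relSub H) hQ (lowTri_mem_relSub hψ fX fD hom) u
    (f - ((d + TB) u + (E + TA) u))]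
  have e2 : f - ((d + TB) u + (E + TA) u) + (d + TB) u = f - (E + TA) u := by abel
  have e3 : E (exp x u) = exp x ((E + TA) u) := by
    have := congrArg (fun T : 𝔏 ν => T u) (mul_exp_eq hE')
    simpa only [mul_apply_eq_comp] using this
  rw [e2, e3, map_sub]


section StepEstimates
variable {β : ℝ}

lemma entry_add (A B : OpMat ν) (δ : Bool) : (A + B).entry δ = A.entry δ + B.entry δ := by
  cases δ <;> rfl

lemma matNorm_add_le (s : ℝ) (A B : Freq ν → OpMat ν) : mN s α β (fun ω => A ω + B ω) ≤ mN s α β A + mN s α β B := by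
  have h := matNorm_hasSum_le (R := R) (w := w) (s := s) (α := α) (β := β)
    (A := fun b : Bool => if b then A else B) (S := fun ω => A ω + B ω) (fun ω _ δ => by
      have := hasSum_fintype (fun b : Bool => ((if b then A else B) ω).entry δ)
      simpa [entry_add] using this)
  simpa using h

open Classical in
/-- The linear map selecting entries of the matrix. -/
def mask (P : Bool → (𝕀 ν) → ℤ → ℤ → Prop) (c : ℂ) (δ : Bool) (A : Op ν) : Op ν :=
  fun ℓ j k => if P δ ℓ j k then c * A ℓ j k else 0

lemma mask_sub (P : Bool → (𝕀 ν) → ℤ → ℤ → Prop) (c : ℂ) (δ : Bool) (A B : Op ν) :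
    mask P c δ (A - B) = mask P c δ A - mask P c δ B := by
  funext ℓ j k
  simp only [mask, Pi.sub_apply]
  split_ifs <;> ring

lemma mask_weighted (P : Bool → (𝕀 ν) → ℤ → ℤ → Prop) (c : ℂ) (δ : Bool) (a b : ℝ)
    (A : Op ν) : weighted a b (mask P c δ A) = mask P c δ (weighted a b A) := by
  funext ℓ j k
  simp only [mask, weighted]
  split_ifs <;> ring

lemma decayNorm_mask_le {P : Bool → (𝕀 ν) → ℤ → ℤ → Prop} {c : ℂ} (hc : ‖c‖ ≤ 1) (δ : Bool)
    (s : ℝ) (A : Op ν) : decayNorm s (mask P c δ A) ≤ 1 * decayNorm s A := by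
  refine decayNorm_le_of_entry fun ℓ j k => ?_
  rw [one_mul, mask]
  split_ifs
  · rw [enorm_mul]
    refine mul_le_of_le_one_left' ?_
    rw [← ofReal_norm]
    exact ofReal_le_one.2 hc
  · simp

lemma homRhs_entry (N : ℝ) (V : OpMat ν) (δ : Bool) : (homRhs N V).entry δ =
    mask (fun δ ℓ j k => absZ ℓ ≤ N ∧ (δ = true → ¬ (ℓ = 0 ∧ j.natAbs = k.natAbs))) (-1) δ (V.entry δ) := by
  cases δ
  · funext ℓ j k; simp [homRhs, mask]
  · funext ℓ j k; simp [homRhs, mask]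

lemma highPart_entry (N : ℝ) (V : OpMat ν) (δ : Bool) : (highPart N V).entry δ =
    mask (fun _ ℓ _ _ => ¬ absZ ℓ ≤ N) 1 δ (V.entry δ) := by
  cases δ
  · funext ℓ j k; by_cases h : absZ ℓ ≤ N <;> simp [highPart, mask, h]
  · funext ℓ j k; by_cases h : absZ ℓ ≤ N <;> simp [highPart, mask, h]

lemma matNorm_homRhs_le (N s : ℝ) (V : Freq ν → OpMat ν) : mN s α β (fun ω => homRhs N (V ω)) ≤ mN s α β V :=
  (matNorm_map_le _ (mask_sub _ _) (mask_weighted _ _)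
    (fun δ A => decayNorm_mask_le (by simp) δ s A) fun ω δ => homRhs_entry N (V ω) δ).trans_eq
    (one_mul _)

lemma matNorm_highPart_le (N s : ℝ) (V : Freq ν → OpMat ν) : mN s α β (fun ω => highPart N (V ω)) ≤ mN s α β V :=
  (matNorm_map_le _ (mask_sub _ _) (mask_weighted _ _)
    (fun δ A => decayNorm_mask_le (by simp) δ s A) fun ω δ => highPart_entry N (V ω) δ).trans_eq
    (one_mul _)

lemma matNorm_highPart_le_pow {N b : ℝ} (hN : 0 < N) (hb : 0 ≤ b) (s : ℝ) (V : Freq ν → OpMat ν) :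
    mN s α β (fun ω => highPart N (V ω)) ≤ ofReal (N ^ (-b)) * mN (s + b) α β V := by
  refine matNorm_map_le _ (mask_sub _ _) (mask_weighted _ _) (fun δ A => ?_) fun ω δ => highPart_entry N (V ω) δ
  refine (decayNorm_le_of_support hN hb (fun ℓ hℓ => ?_)).trans (mul_le_mul' le_rfl
    ((decayNorm_mask_le (by simp) δ (s + b) A).trans_eq (one_mul _)))
  funext j k
  simp [mask, hℓ]

lemma isHam_of_d_o {A : OpMat ν} (hd : ∀ ℓ j k, conj (A.d (-ℓ) k j) = A.d ℓ j k)
    (ho : ∀ ℓ j k, conj (A.o (-ℓ) k j) = conjOp ψ A.o ℓ j k) : A.IsHam ψ :=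
  fun ℓ j k => ⟨hd ℓ j k, ho ℓ j k⟩

lemma conjMat_zero' (j k : ℤ) : conjMat ψ 0 j k = 0 := by simp [conjMat_apply]

lemma isHam_add {A B : OpMat ν} (hA : A.IsHam ψ) (hB : B.IsHam ψ) : (A + B).IsHam ψ := by
  rw [isHam_iff] at *
  rw [OpMat.add_d, OpMat.add_o, adj_add, adj_add, conjOp_add, hA.1, hA.2, hB.1, hB.2]
  exact ⟨rfl, rfl⟩

lemma isHam_homRhs {N : ℝ} {V : OpMat ν} (hV : V.IsHam ψ) : (homRhs N V).IsHam ψ := by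
  refine isHam_of_d_o (fun ℓ j k => ?_) fun ℓ j k => ?_
  · have hc : (absZ (-ℓ) ≤ N ∧ ¬ (-ℓ = 0 ∧ k.natAbs = j.natAbs)) ↔ (absZ ℓ ≤ N ∧ ¬ (ℓ = 0 ∧ j.natAbs = k.natAbs)) := by
      rw [absZ_neg, neg_eq_zero, eq_comm (a := k.natAbs)]
    simp only [homRhs]
    rw [if_congr hc rfl rfl]
    split_ifs
    · rw [map_neg, (hV ℓ j k).1]
    · simp
  · by_cases h : absZ ℓ ≤ N
    · have e : (homRhs N V).o (-ℓ) = -V.o (-ℓ) := by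
        funext a b; simp [homRhs, absZ_neg, h]
      have := (hV ℓ j k).2
      rw [conjOp] at this ⊢
      rw [e, conjMat_neg, Pi.neg_apply, Pi.neg_apply, Pi.neg_apply, Pi.neg_apply, map_neg, this]
    · have e : (homRhs N V).o (-ℓ) = 0 := by
        funext a b; simp [homRhs, absZ_neg, h]
      rw [conjOp, e, conjMat_zero']; simp

lemma isHam_highPart {N : ℝ} {V : OpMat ν} (hV : V.IsHam ψ) : (highPart N V).IsHam ψ := by
  refine isHam_of_d_o (fun ℓ j k => ?_) fun ℓ j k => ?_
  · simp only [highPart, absZ_neg]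
    split_ifs
    · simp
    · exact (hV ℓ j k).1
  · by_cases h : absZ ℓ ≤ N
    · have e : (highPart N V).o (-ℓ) = 0 := by
        funext a b; simp [highPart, absZ_neg, h]
      rw [conjOp, e, conjMat_zero']; simp
    · have e : (highPart N V).o (-ℓ) = V.o (-ℓ) := by
        funext a b; simp [highPart, absZ_neg, h]
      rw [conjOp, e]
      exact (hV ℓ j k).2

lemma isHam_adSeries (hψ : CS) {r : ℕ → ℝ} (hr : ∀ k, |r k| ≤ 1) {A X : Freq ν → OpMat ν} (hA : mN₀ α 0 A ≠ ⊤)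
    (hX : mN₀ α α X ≠ ⊤)
    (hsmall : 3 * brConst ν α (sZero ν) * mN₀ α α X ≤ 2⁻¹)
    {ω : Freq ν} (hω : ω ∈ R) (hamA : (A ω).IsHam ψ) (hamX : (X ω).IsHam ψ) :
    (adSeries ψ r (A ω) (X ω)).IsHam ψ := by
  have fA := fin0_of_matNorm hA hω
  have fX := fin0_of_matNorm hX hω
  refine isHam_hasSum (A := fun k => (⟨(r k : ℂ) • (adIter ψ (A ω) (X ω) (k + 1)).d,
    (r k : ℂ) • (adIter ψ (A ω) (X ω) (k + 1)).o⟩ : OpMat ν)) (fun δ => ?_) fun k =>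
    isHam_smul (isHam_adIter hψ (fin0_adIter hψ fA fX) fX hamA hamX (k + 1)) (r k)
  have := hasSum_adSeries hψ hr hA hX hsmall hω δ
  cases δ
  · exact this
  · exact this

/-- Quantitative estimates for one step. -/
lemma matNorm_kamNext_le (hψ : CS) {N b h a₀ a b₁ κ : ℝ} (hN : 0 < N) (hb : 0 ≤ b)
    (ha₀ : 0 ≤ a₀) (ha : 0 ≤ a) (hh : 0 ≤ h) (hκ : 0 ≤ κ) (hb₁ : 0 ≤ b₁)
    (hbr : brConst ν α (sZero ν + b) ≤ ofReal b₁)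
    {V X : Freq ν → OpMat ν}
    (hV₀ : mN₀ α 0 V ≤ ofReal a₀)
    (hV : mN (sZero ν + b) α 0 V ≤ ofReal a)
    (hX₀ : mN₀ α α X ≤ ofReal (κ * h * a₀))
    (hX : mN (sZero ν + b) α α X ≤ ofReal (κ * h * a))
    (hsm : 3 * b₁ * (κ * h * a₀) ≤ 2⁻¹) :
    mN₀ α 0 (fun ω => kamNext ψ N (V ω) (X ω)) ≤ ofReal (N ^ (-b) * a + 8 * b₁ * κ * h * a₀ * a₀) ∧
    mN (sZero ν + b) α 0 (fun ω => kamNext ψ N (V ω) (X ω)) ≤ ofReal (a + 8 * b₁ * κ * h * a₀ * a) := by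
  have hbr₀ : brConst ν α (sZero ν) ≤ ofReal b₁ :=
    (brConst_mono ν α (by linarith)).trans hbr
  have fV := ne_top_of_le_ne_top ofReal_ne_top hV₀
  have fX := ne_top_of_le_ne_top ofReal_ne_top hX₀
  have hsmall : ∀ s, brConst ν α s ≤ ofReal b₁ → 3 * brConst ν α s * mN₀ α α X ≤ 2⁻¹ := fun s hs => by
    calc _ ≤ 3 * ofReal b₁ * ofReal (κ * h * a₀) :=
          mul_le_mul' (mul_le_mul' le_rfl hs) hX₀
      _ = ofReal (3 * b₁ * (κ * h * a₀)) := by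
          rw [ofReal_mul (p := 3 * b₁) (by positivity), ofReal_mul (p := 3) (by positivity)]
          norm_num
      _ ≤ ofReal 2⁻¹ := ofReal_le_ofReal hsm
      _ = 2⁻¹ := by rw [ENNReal.ofReal_inv_of_pos two_pos]; norm_num
  have series : ∀ (s c : ℝ), (sZero ν : ℝ) ≤ s → 0 ≤ c → brConst ν α s ≤ ofReal b₁ →
      mN s α 0 V ≤ ofReal c → mN s α α X ≤ ofReal (κ * h * c) →
      ∀ (r : ℕ → ℝ), (∀ k, |r k| ≤ 1) → ∀ A : Freq ν → OpMat ν, (∀ s, mN s α 0 A ≤ mN s α 0 V) →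
        mN s α 0 (fun ω => adSeries ψ r (A ω) (X ω)) ≤ ofReal (4 * b₁ * κ * h * a₀ * c) := by
    intro s c hs hc hbs hVs hXs r hr A hA
    refine (matNorm_adSeries_le hψ hs hr (ne_top_of_le_ne_top fV (hA _)) fX (hsmall s hbs)).trans ?_
    calc _ ≤ 2 * ofReal b₁ * (ofReal c * ofReal (κ * h * a₀) + ofReal a₀ * ofReal (κ * h * c)) :=
          mul_le_mul' (mul_le_mul' le_rfl hbs) (add_le_add (mul_le_mul' ((hA s).trans hVs) hX₀)
            (mul_le_mul' ((hA _).trans hV₀) hXs))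
      _ = ofReal (2 * b₁ * (c * (κ * h * a₀) + a₀ * (κ * h * c))) := by
          rw [ofReal_mul (p := 2 * b₁) (by positivity), ofReal_mul (p := 2) (by positivity),
            ofReal_add (by positivity) (by positivity), ofReal_mul (p := c) hc,
            ofReal_mul (p := a₀) ha₀]
          norm_num
      _ = _ := by congr 1; ring
  have hrB : ∀ k, |coefB k| ≤ 1 := fun k => abs_inv_factorial_le _
  have hrA : ∀ k, |coefA k| ≤ 1 := fun k => abs_inv_factorial_le _
  have tot : ∀ (s c q : ℝ), (sZero ν : ℝ) ≤ s → 0 ≤ c → 0 ≤ q → brConst ν α s ≤ ofReal b₁ →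
      mN s α 0 V ≤ ofReal c → mN s α α X ≤ ofReal (κ * h * c) →
      mN s α 0 (fun ω => highPart N (V ω)) ≤ ofReal q →
      mN s α 0 (fun ω => kamNext ψ N (V ω) (X ω)) ≤ ofReal (q + 8 * b₁ * κ * h * a₀ * c) := by
    intro s c q hs hc hq hbs hVs hXs hhi
    have s1 := series s c hs hc hbs hVs hXs coefB hrB (fun ω => homRhs N (V ω)) (fun s => matNorm_homRhs_le N s V)
    have s2 := series s c hs hc hbs hVs hXs coefA hrA V (fun s => le_rfl)
    refine (matNorm_add_le s _ _).trans ((add_le_add hhi ((matNorm_add_le s _ _).trans (add_le_add s1 s2))).trans_eq ?_)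
    rw [← ofReal_add (by positivity) (by positivity), ← ofReal_add hq (by positivity)]
    congr 1; ring
  constructor
  · refine tot _ _ _ le_rfl ha₀ (by positivity) hbr₀ hV₀ hX₀ ?_
    refine (matNorm_highPart_le_pow hN hb _ V).trans ?_
    rw [ofReal_mul (by positivity)]
    exact mul_le_mul' le_rfl hV
  · exact tot _ _ _ (by linarith) ha ha hbr hV hX ((matNorm_highPart_le N _ V).trans hV)

lemma isHam_kamNext (hψ : CS) {N : ℝ} {V X : Freq ν → OpMat ν} (hV : mN₀ α 0 V ≠ ⊤) (hX : mN₀ α α X ≠ ⊤)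
    (hsmall : 3 * brConst ν α (sZero ν) * mN₀ α α X ≤ 2⁻¹)
    {ω : Freq ν} (hω : ω ∈ R) (hamV : (V ω).IsHam ψ) (hamX : (X ω).IsHam ψ) :
    (kamNext ψ N (V ω) (X ω)).IsHam ψ :=
  isHam_add (isHam_highPart hamV) (isHam_add
    (isHam_adSeries hψ (A := fun ω => homRhs N (V ω)) (fun _ => abs_inv_factorial_le _)
      (ne_top_of_le_ne_top hV (matNorm_homRhs_le N _ V)) hX hsmall hω (isHam_homRhs hamV) hamX)
    (isHam_adSeries hψ (fun _ => abs_inv_factorial_le _) hV hX hsmall hω hamV hamX))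

end StepEstimates

lemma scale_natCast (N₀ p : ℕ) : scale N₀ (p : ℤ) = (N₀ : ℝ) ^ ((3 / 2 : ℝ) ^ p) := by
  rw [scale, if_neg (by omega), zpow_natCast]

lemma scale_zero (N₀ : ℕ) : scale N₀ ((0 : ℕ) : ℤ) = N₀ := by
  rw [scale_natCast]; simp

lemma scale_pred_zero (N₀ : ℕ) : scale N₀ (((0 : ℕ) : ℤ) - 1) = 1 := by
  rw [scale, if_pos (by norm_num)]

lemma scale_pred_succ (N₀ p : ℕ) : scale N₀ (((p + 1 : ℕ) : ℤ) - 1) = scale N₀ (p : ℤ) := by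
  congr 1; push_cast; ring

lemma scale_succ (N₀ p : ℕ) : scale N₀ ((p + 1 : ℕ) : ℤ) = scale N₀ (p : ℤ) ^ (3 / 2 : ℝ) := by
  rw [scale_natCast, scale_natCast, ← rpow_mul (cast_nonneg _), pow_succ]

lemma sixteen_le_scale (p : ℕ) : 16 ≤ 𝐍 p := by
  rw [scale_natCast]
  calc (16 : ℝ) = ((16 : ℕ) : ℝ) ^ (1 : ℝ) := by simp
    _ ≤ _ := rpow_le_rpow_of_exponent_le (by norm_num) (one_le_pow₀ (by norm_num))

lemma one_le_scale_pred (p : ℕ) : 1 ≤ 𝐍₋ p := by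
  cases p with
  | zero => rw [scale_pred_zero]
  | succ p => rw [scale_pred_succ]; linarith [sixteen_le_scale p]

lemma scale_pred_mul_le (p : ℕ) : 4 * 𝐍₋ p ≤ 𝐍 p := by
  cases p with
  | zero => rw [scale_pred_zero, scale_zero]; norm_num
  | succ p =>
    rw [scale_pred_succ, scale_succ]
    have h := sixteen_le_scale p
    have h0 : 0 < 𝐍 p := by linarith
    rw [show (3 / 2 : ℝ) = 1 / 2 + 1 by norm_num, rpow_add h0, rpow_one]
    gcongr
    calc (4 : ℝ) = (16 : ℝ) ^ (1 / 2 : ℝ) := by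
          rw [show (16 : ℝ) = 4 ^ (2 : ℝ) by norm_num, ← rpow_mul (by norm_num)]; norm_num
      _ ≤ _ := rpow_le_rpow (by norm_num) h (by norm_num)

/-- The ratios `N_p^{2τ+1} N_{p-1}^{-ϱ}`. -/
def ratio (τ : ℝ) (p : ℕ) : ℝ :=
  𝐍 p ^ (2 * τ + 1) * 𝐍₋ p ^ (-rho τ)

lemma ratio_pos (τ : ℝ) (p : ℕ) : 0 < ratio τ p := by
  have h1 : 0 < 𝐍 p := by linarith [sixteen_le_scale p]
  have h2 : 0 < 𝐍₋ p := by linarith [one_le_scale_pred p]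
  rw [ratio]; positivity

lemma ratio_succ_eq (τ : ℝ) (p : ℕ) : ratio τ (p + 1) = 𝐍 p ^ (-(3 * τ + 5 / 2)) := by
  have h0 : 0 < 𝐍 p := by linarith [sixteen_le_scale p]
  rw [ratio, scale_pred_succ, scale_succ, ← rpow_mul h0.le, ← rpow_add h0, rho]
  congr 1; ring

lemma ratio_succ_le_one {τ : ℝ} (hτ : 0 < τ) (p : ℕ) : ratio τ (p + 1) ≤ 1 := by
  rw [ratio_succ_eq]
  exact rpow_le_one_of_one_le_of_nonpos (by linarith [sixteen_le_scale p]) (by linarith)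

lemma ratio_zero (τ : ℝ) : ratio τ 0 = 16 ^ (2 * τ + 1) := by
  rw [ratio, scale_pred_zero, scale_zero]; simp

lemma ratio_succ_le_half {τ : ℝ} (hτ : 0 < τ) (p : ℕ) : ratio τ (p + 1) ≤ 1 / 2 * ratio τ p := by
  cases p with
  | zero =>
    rw [ratio_succ_eq, ratio_zero, scale_zero]
    have h1 : ((16 : ℕ) : ℝ) ^ (-(3 * τ + 5 / 2)) ≤ 1 :=
      rpow_le_one_of_one_le_of_nonpos (by norm_num) (by linarith)
    have h2 : (16 : ℝ) ^ (1 : ℝ) ≤ 16 ^ (2 * τ + 1) :=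
      rpow_le_rpow_of_exponent_le (by norm_num) (by linarith)
    rw [rpow_one] at h2
    linarith
  | succ p =>
    rw [ratio_succ_eq, ratio_succ_eq]
    have h0 : 0 < 𝐍 p := by linarith [sixteen_le_scale p]
    have h4 := scale_pred_mul_le (p + 1)
    rw [scale_pred_succ] at h4
    calc _ ≤ (4 * 𝐍 p) ^ (-(3 * τ + 5 / 2)) :=
          rpow_le_rpow_of_nonpos (by positivity) h4 (by linarith)
      _ = 4 ^ (-(3 * τ + 5 / 2)) * 𝐍 p ^ (-(3 * τ + 5 / 2)) :=
          mul_rpow (by norm_num) h0.le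
      _ ≤ 1 / 2 * 𝐍 p ^ (-(3 * τ + 5 / 2)) := by
          gcongr
          calc (4 : ℝ) ^ (-(3 * τ + 5 / 2)) ≤ 4 ^ (-1 : ℝ) :=
                rpow_le_rpow_of_exponent_le (by norm_num) (by linarith)
            _ ≤ 1 / 2 := by rw [rpow_neg_one]; norm_num

lemma scale_rpow_neg_rho_le {τ : ℝ} (hτ : 0 < τ) (p : ℕ) : 𝐍 p ^ (-rho τ) ≤ 1 / 2 * 𝐍₋ p ^ (-rho τ) := by
  have h0 : 0 < 𝐍₋ p := by linarith [one_le_scale_pred p]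
  have hρ : 1 ≤ rho τ := by rw [rho]; linarith
  calc _ ≤ (4 * 𝐍₋ p) ^ (-rho τ) :=
        rpow_le_rpow_of_nonpos (by positivity) (scale_pred_mul_le p) (by linarith)
    _ = 4 ^ (-rho τ) * 𝐍₋ p ^ (-rho τ) := mul_rpow (by norm_num) h0.le
    _ ≤ _ := by
        gcongr
        calc (4 : ℝ) ^ (-rho τ) ≤ 4 ^ (-1 : ℝ) :=
              rpow_le_rpow_of_exponent_le (by norm_num) (by linarith)
          _ ≤ 1 / 2 := by rw [rpow_neg_one]; norm_num


/-- The number of terms in the norm of the generators, as a real number. -/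
def termCount (α : ℝ) : ℝ := (decayTerms α α).card

lemma termCount_nonneg (α : ℝ) : 0 ≤ termCount α := cast_nonneg _

lemma one_le_termCount (α : ℝ) : 1 ≤ termCount α := by
  rw [termCount]
  exact_mod_cast Finset.card_pos.2 ⟨_, zero_mem_decayTerms α α true⟩

lemma ratio_le {τ : ℝ} (hτ : 0 < τ) (p : ℕ) : ratio τ p ≤ 16 ^ (2 * τ + 1) := by
  have h2 : (1 : ℝ) ≤ 16 ^ (2 * τ + 1) := one_le_rpow (by norm_num) (by linarith)
  cases p with
  | zero => rw [ratio_zero]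
  | succ p => exact (ratio_succ_le_one hτ p).trans h2

lemma ratio_mul_le {τ : ℝ} (hτ : 0 < τ) (p : ℕ) : 𝐍 p ^ rho τ * (ratio τ p * 𝐍₋ p ^ (-rho τ)) ≤
      16 ^ (2 * τ + 1 + rho τ) := by
  cases p with
  | zero =>
    rw [ratio_zero, scale_zero, scale_pred_zero, one_rpow, mul_one, Nat.cast_ofNat, ← rpow_add (by norm_num), add_comm]
  | succ p =>
    have h0 : 0 < 𝐍 p := by linarith [sixteen_le_scale p]
    rw [ratio_succ_eq, scale_pred_succ, scale_succ, ← rpow_mul h0.le, ← rpow_add h0, ← rpow_add h0]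
    refine (rpow_le_one_of_one_le_of_nonpos (by linarith [sixteen_le_scale p]) ?_).trans
      (one_le_rpow (by norm_num) (by rw [rho]; linarith))
    rw [rho]; linarith

/-- The hypotheses of the iteration: `𝐕⁰` is Hamiltonian with norm at most `e`, and `e` is small. -/
structure SmallData {ν : ℕ} (ψ : 𝔹) (γ τ α M e b₁ C : ℝ)
    (V₀ : Freq ν → OpMat ν) : Prop where
  conjStable : ConjStable ψ
  τ_pos : 0 < τ
  α_pos : 0 < α
  γ_pos : 0 < γ
  M_pos : 0 < M
  ham : ∀ ω ∈ annulus ν M, (V₀ ω).IsHam ψ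
  e_nonneg : 0 ≤ e
  norm : matNorm (annulus ν M) (γ / M ^ α) (sZero ν + beta τ) α 0 V₀ ≤ ofReal e
  b_nonneg : 0 ≤ b₁
  br : brConst ν α (sZero ν + beta τ) ≤ ofReal b₁
  const : 2 * (800 * b₁ * termCount α) + 4 ≤ C
  small : C * 16 ^ (2 * τ + 2 + rho τ) * (M ^ α / γ * e) ≤ 1

local notation "SD" => SmallData ψ γ τ α M e b₁ C V₀

namespace SmallData

variable (h : SmallData ψ γ τ α M e b₁ C V₀)
include h

lemma C_pos : 0 < C := by
  have := mul_nonneg (mul_nonneg (by norm_num : (0 : ℝ) ≤ 800) h.b_nonneg) (termCount_nonneg α)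
  linarith [h.const]

lemma size_nonneg : 0 ≤ M ^ α / γ * e :=
  mul_nonneg (div_nonneg (rpow_nonneg h.M_pos.le _) h.γ_pos.le) h.e_nonneg

lemma const_mul_le {x : ℝ} (hx : x ≤ 16 ^ (2 * τ + 2 + rho τ)) : C * (x * (M ^ α / γ * e)) ≤ 1 := by
  refine le_trans ?_ h.small
  rw [mul_assoc]
  exact mul_le_mul_of_nonneg_left (mul_le_mul_of_nonneg_right hx h.size_nonneg) h.C_pos.le

lemma coeff_mul_le {x : ℝ} (hx0 : 0 ≤ x) (hx : x ≤ 16 ^ (2 * τ + 2 + rho τ)) :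
    800 * b₁ * termCount α * (x * (M ^ α / γ * e)) ≤ 1 / 2 := by
  have h1 := h.const_mul_le hx
  have h2 := mul_le_mul_of_nonneg_right h.const (mul_nonneg hx0 h.size_nonneg)
  have h3 := mul_nonneg hx0 h.size_nonneg
  nlinarith

lemma ratio_le_pow (p : ℕ) : ratio τ p ≤ 16 ^ (2 * τ + 2 + rho τ) :=
  (ratio_le h.τ_pos p).trans (rpow_le_rpow_of_exponent_le (by norm_num) (by rw [rho]; linarith [h.τ_pos]))

lemma const_ratio_le (p : ℕ) : C * (ratio τ p * (M ^ α / γ * e)) ≤ 1 :=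
  h.const_mul_le (h.ratio_le_pow p)

lemma coeff_ratio_le (p : ℕ) : 800 * b₁ * termCount α * (ratio τ p * (M ^ α / γ * e)) ≤ 1 / 2 :=
  h.coeff_mul_le (ratio_pos τ p).le (h.ratio_le_pow p)

lemma four_size_le : 4 * (M ^ α / γ * e) ≤ 1 := by
  have h1 := h.const_mul_le (x := 1) (one_le_rpow (by norm_num) (by rw [rho]; linarith [h.τ_pos]))
  have h2 := mul_nonneg (mul_nonneg (by norm_num : (0 : ℝ) ≤ 800) h.b_nonneg) (termCount_nonneg α)
  have := mul_le_mul_of_nonneg_right h.const h.size_nonneg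
  have h3 := mul_nonneg h2 h.size_nonneg
  nlinarith

lemma low_step (p : ℕ) : 𝐍 p ^ (-beta τ) * (𝐍₋ p * e) + 8 * b₁ * termCount α * homConst (𝐍 p) τ γ α M *
        (𝐍₋ p ^ (-rho τ) * e) * (𝐍₋ p ^ (-rho τ) * e) ≤
      𝐍 p ^ (-rho τ) * e := by
  have hN : 0 < 𝐍 p := by linarith [sixteen_le_scale p]
  have he := h.e_nonneg
  have h1 : 𝐍 p ^ (-beta τ) * (𝐍₋ p * e) ≤ 1 / 2 * (𝐍 p ^ (-rho τ) * e) := by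
    rw [beta, neg_add, rpow_add hN, rpow_neg_one]
    have h4 : (𝐍 p)⁻¹ * 𝐍₋ p ≤ 1 / 2 := by
      rw [inv_mul_le_iff₀ hN]
      linarith [scale_pred_mul_le p]
    calc _ = ((𝐍 p)⁻¹ * 𝐍₋ p) * (𝐍 p ^ (-rho τ) * e) := by ring
      _ ≤ _ := mul_le_mul_of_nonneg_right h4 (by positivity)
  have h2 : 8 * b₁ * termCount α * homConst (𝐍 p) τ γ α M * (𝐍₋ p ^ (-rho τ) * e) * (𝐍₋ p ^ (-rho τ) * e) ≤
      1 / 2 * (𝐍 p ^ (-rho τ) * e) := by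
    have h3 := h.coeff_mul_le (x := 𝐍 p ^ rho τ * (ratio τ p * 𝐍₋ p ^ (-rho τ)))
      (mul_nonneg (rpow_nonneg hN.le _) (mul_nonneg (ratio_pos τ p).le
        (rpow_nonneg (by linarith [one_le_scale_pred p]) _)))
      ((ratio_mul_le h.τ_pos p).trans (rpow_le_rpow_of_exponent_le (by norm_num) (by linarith)))
    have h5 : 𝐍 p ^ (-rho τ) * 𝐍 p ^ rho τ = 1 := by
      rw [← rpow_add hN, neg_add_cancel, Real.rpow_zero]
    calc _ = (𝐍 p ^ (-rho τ) * 𝐍 p ^ rho τ) * (8 * b₁ * termCount α * homConst (𝐍 p) τ γ α M *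
        (𝐍₋ p ^ (-rho τ) * e) * (𝐍₋ p ^ (-rho τ) * e)) := by
          rw [h5, one_mul]
      _ = (800 * b₁ * termCount α * (𝐍 p ^ rho τ * (ratio τ p * 𝐍₋ p ^ (-rho τ)) * (M ^ α / γ * e))) *
            (𝐍 p ^ (-rho τ) * e) := by
          rw [homConst, ratio]; ring
      _ ≤ _ := mul_le_mul_of_nonneg_right h3 (by positivity)
  linarith

lemma high_step (p : ℕ) : 𝐍₋ p * e + 8 * b₁ * termCount α * homConst (𝐍 p) τ γ α M *
        (𝐍₋ p ^ (-rho τ) * e) * (𝐍₋ p * e) ≤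
      𝐍 p * e := by
  have h1 := one_le_scale_pred p
  have h2 := mul_le_mul_of_nonneg_right (h.coeff_ratio_le p) (mul_nonneg (zero_le_one.trans h1) h.e_nonneg)
  have h3 := mul_le_mul_of_nonneg_right (scale_pred_mul_le p) h.e_nonneg
  have h4 := mul_nonneg (zero_le_one.trans h1) h.e_nonneg
  have : 8 * b₁ * termCount α * homConst (𝐍 p) τ γ α M * (𝐍₋ p ^ (-rho τ) * e) * (𝐍₋ p * e) =
      800 * b₁ * termCount α * (ratio τ p * (M ^ α / γ * e)) * (𝐍₋ p * e) := by
    rw [homConst, ratio]; ring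
  rw [this]
  linarith

lemma small_step (p : ℕ) : 3 * b₁ * (termCount α * homConst (𝐍 p) τ γ α M * (𝐍₋ p ^ (-rho τ) * e)) ≤ 2⁻¹ := by
  have h1 := h.coeff_ratio_le p
  have h2 := mul_nonneg (mul_nonneg h.b_nonneg (termCount_nonneg α)) (mul_nonneg (ratio_pos τ p).le h.size_nonneg)
  have : 3 * b₁ * (termCount α * homConst (𝐍 p) τ γ α M * (𝐍₋ p ^ (-rho τ) * e)) =
      300 * (b₁ * termCount α * (ratio τ p * (M ^ α / γ * e))) := by rw [homConst, ratio]; ring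
  rw [this]
  linarith

end SmallData

/-- The block diagonal part of the average of `V^d`. -/
def avgBlk (V : OpMat ν) : Mat := fun j k => if j.natAbs = k.natAbs then V.d 0 j k else 0

section Defs
variable (ψ lam γ τ α M V₀)

/-- The iteration: normal forms and remainders. -/
def kamState : ℕ → (Freq ν → Mat) × (Freq ν → OpMat ν)
  | 0 => (fun _ => diagMat lam, V₀)
  | p + 1 =>
    let S := kamState p
    (fun ω => S.1 ω + avgBlk (S.2 ω), fun ω => kamNext ψ (𝐍 p) (S.2 ω) (homSol ψ (𝐍 p) τ γ α M ω (S.1 ω) (S.2 ω)))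

/-- The normal forms. -/
def kamH (p : ℕ) : Freq ν → Mat := (kamState ψ lam γ τ α M V₀ p).1

/-- The remainders. -/
def kamV (p : ℕ) : Freq ν → OpMat ν := (kamState ψ lam γ τ α M V₀ p).2

/-- The generators. -/
def kamX (p : ℕ) (ω : Freq ν) : OpMat ν :=
  homSol ψ (𝐍 p) τ γ α M ω (kamH ψ lam γ τ α M V₀ p ω) (kamV ψ lam γ τ α M V₀ p ω)

end Defs

local notation "𝓗" => kamH ψ lam γ τ α M V₀
local notation "𝓥" => kamV ψ lam γ τ α M V₀
local notation "𝓧" => kamX ψ lam γ τ α M V₀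

lemma kamH_zero (ω : Freq ν) : 𝓗 0 ω = diagMat lam := rfl

lemma kamV_zero : 𝓥 0 = V₀ := rfl

lemma kamH_succ (p : ℕ) (ω : Freq ν) : 𝓗 (p + 1) ω = 𝓗 p ω + avgBlk (𝓥 p ω) := rfl

lemma kamV_succ (p : ℕ) : 𝓥 (p + 1) = fun ω => kamNext ψ (𝐍 p) (𝓥 p ω) (𝓧 p ω) := rfl

lemma kamH_blockDiag (p : ℕ) (ω : Freq ν) {j k : ℤ} (hjk : j.natAbs ≠ k.natAbs) : 𝓗 p ω j k = 0 := by
  induction p with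
  | zero => rw [kamH_zero, diagMat, if_neg (fun h => hjk (by rw [h]))]
  | succ p ih =>
    rw [kamH_succ]
    simp [ih, avgBlk, hjk]

lemma avgBlk_hermitian {V : OpMat ν} (hV : V.IsHam ψ) (n : ℕ) : (block (avgBlk V) n).IsHermitian := by
  refine Matrix.IsHermitian.ext fun a b => ?_
  have ha := mem_blk.1 a.2
  have hb := mem_blk.1 b.2
  simp only [block, of_apply, avgBlk, ha, hb, if_true]
  simpa using (hV 0 a b).1

lemma block_add (A B : Mat) (n : ℕ) : block (A + B) n = block A n + block B n := rfl

lemma diagMat_hermitian (lam : ℤ → ℝ) (n : ℕ) : (block (diagMat lam) n).IsHermitian := by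
  refine Matrix.IsHermitian.ext fun a b => ?_
  simp only [block, of_apply, diagMat]
  by_cases hab : (a : ℤ) = b
  · simp [hab]
  · simp [hab, Ne.symm hab]

lemma rblk_avgBlk (V : OpMat ν) (n : ℕ) : rblk (avgBlk V) n n = rblk (V.d 0) n n := by
  ext a b
  have ha := mem_blk.1 a.2
  have hb := mem_blk.1 b.2
  simp only [rblk_apply, avgBlk, ha, hb, if_true]

lemma avgBlk_sub (V W : OpMat ν) : avgBlk V - avgBlk W = avgBlk (V - W) := by
  funext j k
  simp only [avgBlk, Pi.sub_apply]
  split_ifs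
  · rfl
  · simp

lemma hsBlock_avgBlk_le {a s : ℝ} (hs : 0 ≤ s) (V : OpMat ν) (n : ℕ) :
    ofReal (br n ^ a) * hsBlock n (avgBlk V) ≤ decayNorm s (weighted a 0 V.d) := by
  refine le_trans (le_of_eq ?_) (hsSq_rpow_half_le_decayNorm hs _ 0 n n)
  rw [hsBlock_eq_enorm, rblk_avgBlk, hsSq_eq_enorm, sq_rpow_half, rblk_weighted, enorm_smul,
    Real.rpow_zero, mul_one, ← ofReal_norm (E := ℂ), norm_real,
    norm_of_nonneg (rpow_nonneg (br_pos _).le _)]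

lemma lipNorm_avgBlk_le {s β : ℝ} (hs : 0 ≤ s) (V : Freq ν → OpMat ν) (n : ℕ) :
    ofReal (br n ^ α) * lipNorm R w (hsBlock n) (fun ω => avgBlk (V ω)) ≤ mN s α β V := by
  have hb : 0 < br n ^ α := rpow_pos_of_pos (br_pos _) _
  have h0 : ofReal (br n ^ α) ≠ 0 := by simpa using hb
  have hmem : (true, α, (0 : ℝ)) ∈ decayTerms α β := by simp [decayTerms]
  refine le_trans ?_ (famNorm_le_matNorm (c := (true, α, 0)) hmem)
  rw [famNorm]
  have key : ∀ x y : ℝ≥0∞, ofReal (br n ^ α) * x ≤ y → x ≤ (ofReal (br n ^ α))⁻¹ * y := fun x y hxy => by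
    rw [mul_comm, ← div_eq_mul_inv]
    exact ENNReal.le_div_iff_mul_le (Or.inl h0) (Or.inl ofReal_ne_top) |>.2 (by rwa [mul_comm])
  have := lipNorm_le_mul (R := R) (w := w) (N := hsBlock n) (N' := decayNorm s)
    (f := fun ω => avgBlk (V ω)) (g := fun ω => weighted α 0 ((V ω).entry true))
    (ofReal (br n ^ α))⁻¹
    (fun ω _ => key _ _ (hsBlock_avgBlk_le hs (V ω) n))
    (fun ω₁ _ ω₂ _ => key _ _ (by
      rw [avgBlk_sub, ← weighted_sub]
      exact hsBlock_avgBlk_le hs (V ω₁ - V ω₂) n))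
  calc _ ≤ ofReal (br n ^ α) * ((ofReal (br n ^ α))⁻¹ * _) :=
        mul_le_mul' le_rfl this
    _ = _ := by rw [← mul_assoc, ENNReal.mul_inv_cancel h0 ofReal_ne_top, one_mul]

lemma lipNorm_hsBlock_add_le (n : ℕ) (f g : Freq ν → Mat) : lipNorm R w (hsBlock n) (fun ω => f ω + g ω) ≤
      lipNorm R w (hsBlock n) f + lipNorm R w (hsBlock n) g := by
  have := (csub_hsBlock n).lipNorm_hasSum (R := R) (w := w) (ι := Bool)
    (f := fun ω => f ω + g ω) (g := fun i ω => if i then f ω else g ω) (fun ω _ => by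
      simpa using hasSum_fintype (fun i : Bool => if i then f ω else g ω))
  simpa [tsum_fintype] using this

/-- The size of the `p`-th remainder. -/
def lowSize (τ : ℝ) (p : ℕ) : ℝ := 𝐍₋ p ^ (-rho τ)

lemma lowSize_pos (τ : ℝ) (p : ℕ) : 0 < lowSize τ p :=
  rpow_pos_of_pos (by linarith [one_le_scale_pred p]) _

lemma lowSize_zero (τ : ℝ) : lowSize τ 0 = 1 := by rw [lowSize, scale_pred_zero, one_rpow]

lemma lowSize_succ_le (hτ : 0 < τ) (p : ℕ) : lowSize τ (p + 1) ≤ 1 / 2 * lowSize τ p := by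
  rw [lowSize, scale_pred_succ]; exact scale_rpow_neg_rho_le hτ p

variable (ψ lam γ τ α M e V₀) in
/-- The properties carried along the iteration. -/
structure StepInv (p : ℕ) : Prop where
  ham : ∀ ω ∈ annulus ν M, (𝓥 p ω).IsHam ψ
  herm : ∀ ω ∈ annulus ν M, ∀ n, (block (𝓗 p ω) n).IsHermitian
  low : mA (sZero ν) α 0 (𝓥 p) ≤ ofReal (lowSize τ p * e)
  high : mA (sZero ν + beta τ) α 0 (𝓥 p) ≤ ofReal (𝐍₋ p * e)
  lip : ∀ n : ℕ, ofReal (br n ^ α) * lA (hsBlock n) (fun ω => 𝓗 p ω - 𝓗 0 ω) ≤ ofReal ((2 - 2 * lowSize τ p) * e)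

lemma matNorm_homSol_le_ofReal (h : SD) {N : ℝ} (hN : 1 ≤ N) {H : Freq ν → Mat}
    (hH : ∀ ω₁ ∈ R, ∀ ω₂ ∈ R, ∀ n, ‖rblk (H ω₁ - H ω₂) n n‖ ≤ ‖ω₁ - ω₂‖)
    {V : Freq ν → OpMat ν} {s a : ℝ}
    (hV : matNorm R (γ / M ^ α) s α 0 V ≤ ofReal a) :
    matNorm R (γ / M ^ α) s α α (fun ω => homSol ψ N τ γ α M ω (H ω) (V ω)) ≤
      ofReal (termCount α * homConst N τ γ α M * a) := by
  refine (matNorm_homSol_le h.conjStable hN h.τ_pos.le h.γ_pos h.M_pos h.α_pos hH V s).trans ?_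
  have hh : 0 ≤ homConst N τ γ α M := by
    have := h.M_pos; have := h.γ_pos
    rw [homConst]; positivity
  rw [mul_assoc, ofReal_mul (termCount_nonneg α), ofReal_mul hh, termCount, ENNReal.ofReal_natCast]
  exact mul_le_mul' le_rfl (mul_le_mul' le_rfl hV)

namespace StepInv

variable {p : ℕ} (I : StepInv ψ lam γ τ α M e V₀ p)
include I

lemma rblk_sub_le (h : SD) : ∀ ω₁ ∈ annulus ν M, ∀ ω₂ ∈ annulus ν M, ∀ n, ‖rblk (𝓗 p ω₁ - 𝓗 p ω₂) n n‖ ≤ ‖ω₁ - ω₂‖ := by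
  intro ω₁ h₁ ω₂ h₂ n
  rcases eq_or_ne ω₁ ω₂ with rfl | hne
  · rw [sub_self, sub_self, norm_zero]
    exact (norm_zero (E := Matrix (blk n) (blk n) ℂ)).le
  have hw : 0 < γ / M ^ α := div_pos h.γ_pos (rpow_pos_of_pos h.M_pos _)
  have hb : 1 ≤ br n ^ α := one_le_rpow (one_le_br _) h.α_pos.le
  have e1 := le_lipSemi (w := γ / M ^ α) (hsBlock n) (fun ω => 𝓗 p ω - 𝓗 0 ω) h₁ h₂ hne
  have e2 : lipSemi (annulus ν M) (γ / M ^ α) (hsBlock n) (fun ω => 𝓗 p ω - 𝓗 0 ω) ≤ ofReal (2 * e) := by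
    calc _ ≤ lA (hsBlock n) (fun ω => 𝓗 p ω - 𝓗 0 ω) := by
          rw [lipNorm_eq]; exact le_add_self
      _ ≤ ofReal (br n ^ α) * lA (hsBlock n) (fun ω => 𝓗 p ω - 𝓗 0 ω) :=
          le_mul_of_one_le_left' (by simpa using hb)
      _ ≤ _ := (I.lip n).trans (ofReal_le_ofReal
          (mul_le_mul_of_nonneg_right (by linarith [lowSize_pos τ p]) h.e_nonneg))
  have e3 := e1.trans (mul_le_mul' e2 le_rfl)
  have : 𝓗 p ω₁ - 𝓗 0 ω₁ - (𝓗 p ω₂ - 𝓗 0 ω₂) = 𝓗 p ω₁ - 𝓗 p ω₂ := by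
    rw [kamH_zero, kamH_zero]; abel
  rw [this, hsBlock_eq_enorm, ← ofReal_norm, ← ofReal_norm, ← ofReal_mul hw.le,
    ← ofReal_mul (by linarith [h.e_nonneg]), ofReal_le_ofReal_iff
      (mul_nonneg (by linarith [h.e_nonneg]) (norm_nonneg _))] at e3
  have e4 : 2 * e ≤ γ / M ^ α := by
    have := h.four_size_le
    have h5 := h.size_nonneg
    have h6 : γ / M ^ α * (M ^ α / γ) = 1 := by
      have := (rpow_pos_of_pos h.M_pos α).ne'
      have := h.γ_pos.ne'
      field_simp
    calc 2 * e = γ / M ^ α * (2 * (M ^ α / γ * e)) := by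
          linear_combination (-2 * e) * h6
      _ ≤ γ / M ^ α * 1 := mul_le_mul_of_nonneg_left (by linarith) hw.le
      _ = _ := mul_one _
  have e5 := e3.trans (mul_le_mul_of_nonneg_right e4 (norm_nonneg _))
  exact le_of_mul_le_mul_left e5 hw

lemma matNorm_kamX_low (h : SD) : mA (sZero ν) α α (𝓧 p) ≤
      ofReal (termCount α * homConst (𝐍 p) τ γ α M * (lowSize τ p * e)) :=
  matNorm_homSol_le_ofReal h (by linarith [sixteen_le_scale p]) (I.rblk_sub_le h) I.low

lemma matNorm_kamX_high (h : SD) : mA (sZero ν + beta τ) α α (𝓧 p) ≤ ofReal (termCount α * homConst (𝐍 p) τ γ α M *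
        (𝐍₋ p * e)) :=
  matNorm_homSol_le_ofReal h (by linarith [sixteen_le_scale p]) (I.rblk_sub_le h) I.high

lemma kamX_ham (h : SD) : ∀ ω ∈ annulus ν M, (𝓧 p ω).IsHam ψ :=
  fun ω hω => isHam_homSol h.conjStable (I.herm ω hω) (I.ham ω hω)

lemma brConst_mul_le (h : SD) : 3 * brConst ν α (sZero ν) * mA (sZero ν) α α (𝓧 p) ≤ 2⁻¹ := by
  have hβ : 0 ≤ beta τ := by rw [beta, rho]; linarith [h.τ_pos]
  have hb := (brConst_mono ν α (show (sZero ν : ℝ) ≤ sZero ν + beta τ by linarith)).trans h.br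
  have hb₁ := h.b_nonneg
  calc _ ≤ 3 * ofReal b₁ * ofReal (termCount α * homConst (𝐍 p) τ γ α M * (lowSize τ p * e)) :=
        mul_le_mul' (mul_le_mul' le_rfl hb) (I.matNorm_kamX_low h)
    _ = ofReal (3 * b₁ * (termCount α * homConst (𝐍 p) τ γ α M * (lowSize τ p * e))) := by
        rw [ofReal_mul (p := 3 * b₁) (by positivity), ofReal_mul (p := 3) (by positivity)]
        norm_num
    _ ≤ ofReal 2⁻¹ := ofReal_le_ofReal (h.small_step p)
    _ = 2⁻¹ := by rw [ENNReal.ofReal_inv_of_pos two_pos]; norm_num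

lemma succ (h : SD) : StepInv ψ lam γ τ α M e V₀ (p + 1) := by
  have hβ : 0 ≤ beta τ := by rw [beta, rho]; linarith [h.τ_pos]
  have hx := lowSize_pos τ p
  have he := h.e_nonneg
  have h1 := one_le_scale_pred p
  have hh : 0 ≤ homConst (𝐍 p) τ γ α M := by
    have := h.M_pos; have := h.γ_pos
    have := sixteen_le_scale p
    rw [homConst]; positivity
  have est := matNorm_kamNext_le (R := annulus ν M) (w := γ / M ^ α) (α := α) h.conjStable
    (N := 𝐍 p) (b := beta τ) (by linarith [sixteen_le_scale p]) hβ
    (a₀ := lowSize τ p * e) (a := 𝐍₋ p * e)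
    (h := homConst (𝐍 p) τ γ α M) (κ := termCount α) (b₁ := b₁)
    (by positivity) (by positivity) hh (termCount_nonneg α) h.b_nonneg h.br I.low I.high
    (I.matNorm_kamX_low h) (I.matNorm_kamX_high h) (h.small_step p)
  refine ⟨fun ω hω => ?_, fun ω hω n => ?_, ?_, ?_, fun n => ?_⟩
  · rw [kamV_succ]
    exact isHam_kamNext h.conjStable (ne_top_of_le_ne_top ofReal_ne_top I.low)
      (ne_top_of_le_ne_top ofReal_ne_top (I.matNorm_kamX_low h)) (I.brConst_mul_le h) hω
      (I.ham ω hω) (I.kamX_ham h ω hω)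
  · rw [kamH_succ, block_add]
    exact (I.herm ω hω n).add (avgBlk_hermitian (I.ham ω hω) n)
  · rw [kamV_succ, lowSize, scale_pred_succ]
    exact est.1.trans (ofReal_le_ofReal (h.low_step p))
  · rw [kamV_succ, scale_pred_succ]
    exact est.2.trans (ofReal_le_ofReal (h.high_step p))
  · have e1 : (fun ω => 𝓗 (p + 1) ω - 𝓗 0 ω) = fun ω => (𝓗 p ω - 𝓗 0 ω) + avgBlk (𝓥 p ω) := by
      funext ω; rw [kamH_succ]; abel
    have h2 := lowSize_succ_le h.τ_pos p
    have h3 : lowSize τ p ≤ 1 := by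
      rw [lowSize]
      exact rpow_le_one_of_one_le_of_nonpos h1 (by rw [rho]; linarith [h.τ_pos])
    rw [e1]
    calc _ ≤ ofReal (br n ^ α) * (lA (hsBlock n) (fun ω => 𝓗 p ω - 𝓗 0 ω) + lA (hsBlock n)
              (fun ω => avgBlk (𝓥 p ω))) := mul_le_mul' le_rfl (lipNorm_hsBlock_add_le n _ _)
      _ ≤ ofReal ((2 - 2 * lowSize τ p) * e) + ofReal (lowSize τ p * e) := by
          rw [mul_add]
          exact add_le_add (I.lip n) ((lipNorm_avgBlk_le (cast_nonneg _) (𝓥 p) n).trans I.low)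
      _ = ofReal ((2 - 2 * lowSize τ p) * e + lowSize τ p * e) :=
          (ofReal_add (mul_nonneg (by linarith) he) (by positivity)).symm
      _ ≤ _ := ofReal_le_ofReal (by nlinarith)

end StepInv

variable (lam) in
lemma SmallData.stepInv (h : SD) (p : ℕ) : StepInv ψ lam γ τ α M e V₀ p := by
  induction p with
  | zero =>
    have hβ : 0 ≤ beta τ := by rw [beta, rho]; linarith [h.τ_pos]
    refine ⟨h.ham, fun ω _ n => diagMat_hermitian lam n, ?_, ?_, fun n => ?_⟩
    · rw [lowSize_zero, one_mul]
      exact (matNorm_mono_exp (by linarith) _).trans h.norm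
    · rw [scale_pred_zero, one_mul]
      exact h.norm
    · have : (fun ω : Freq ν => 𝓗 0 ω - 𝓗 0 ω) = fun _ => 0 := by funext ω; simp
      rw [this]
      have h0 : hsBlock n 0 = 0 := by rw [hsBlock_eq_enorm]; simp [rblk]; rfl
      simp [lipNorm, h0]
  | succ p ih => exact ih.succ h

variable (lam) in
lemma SmallData.matNorm_kamX_le (h : SD) (p : ℕ) : mA (sZero ν) α α (𝓧 p) ≤
      ofReal (100 * termCount α * ratio τ p * (M ^ α / γ * e)) := by
  refine ((h.stepInv lam p).matNorm_kamX_low h).trans_eq (congrArg _ ?_)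
  rw [homConst, ratio, lowSize]; ring

lemma omegaSeq_subset_annulus {γ₀ τ₀ : ℝ} {N₀ : ℕ} {H : ℕ → Freq ν → Mat} (p : ℕ) :
    omegaSeq γ₀ τ₀ γ τ α M N₀ H p ⊆ annulus ν M := by
  induction p with
  | zero => exact fun ω hω => hω.1
  | succ p ih => exact fun ω hω => ih hω.1

lemma homEq_of {N : ℝ} {ω : Freq ν} {H : Mat} {V X : OpMat ν} (supp : ∀ ℓ, N < absZ ℓ → X.d ℓ = 0 ∧ X.o ℓ = 0)
    (hd : ∀ ℓ, absZ ℓ ≤ N → ∀ j k : ℤ, Complex.I * ((dot ω ℓ : ℂ) * X.d ℓ j k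
        + ∑ i ∈ blk j.natAbs, H j i * X.d ℓ i k - ∑ i ∈ blk k.natAbs, X.d ℓ j i * H i k)
      = (if ℓ = 0 ∧ j.natAbs = k.natAbs then V.d 0 j k else 0) - V.d ℓ j k)
    (ho : ∀ ℓ, absZ ℓ ≤ N → ∀ j k : ℤ, Complex.I * ((dot ω ℓ : ℂ) * X.o ℓ j k + ∑ i ∈ blk j.natAbs, H j i * X.o ℓ i k
        + ∑ i ∈ blk k.natAbs, X.o ℓ j i * conjMat ψ H i k) = - V.o ℓ j k) :
    HomEq ψ ω H X (homRhs N V) := by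
  intro ℓ
  by_cases hℓ : absZ ℓ ≤ N
  · constructor
    · funext j k
      refine (hd ℓ hℓ j k).trans ?_
      simp only [homRhs, hℓ, true_and]
      by_cases h0 : ℓ = 0 ∧ j.natAbs = k.natAbs
      · obtain ⟨rfl, h1⟩ := h0
        simp [h1]
      · simp [h0]
    · funext j k
      refine (ho ℓ hℓ j k).trans ?_
      simp [homRhs, hℓ]
  · obtain ⟨h1, h2⟩ := supp ℓ (not_le.1 hℓ)
    constructor
    · funext j k
      simp [h1, homRhs, hℓ, bmulL, bmulR]
    · funext j k
      simp [h2, homRhs, hℓ, bmulL, bmulR]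

variable (lam) in
lemma SmallData.isKAMIteration (h : SD) {γ₀ τ₀ K : ℝ} (he : mA (sZero ν + beta τ) α 0 V₀ = ofReal e)
    (hK : 2 * e ≤ K * (γ₀ * M)⁻¹) (hK' : 100 * termCount α ≤ K) :
    IsKAMIteration ψ lam γ₀ τ₀ γ τ α M 16 K V₀ 𝓗 𝓥 𝓧 := by
  have I := h.stepInv lam
  have hK0 : 0 ≤ K := le_trans (mul_nonneg (by norm_num) (termCount_nonneg α)) hK'
  have he0 := h.e_nonneg
  have hd : ∀ p : ℕ, ∀ ω ∈ omegaSeq γ₀ τ₀ γ τ α M 16 𝓗 (p + 1), ∀ ℓ, absZ ℓ ≤ scale 16 p →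
      ∀ j k : ℤ, Complex.I * ((dot ω ℓ : ℂ) * (𝓧 p ω).d ℓ j k + ∑ i ∈ blk j.natAbs, 𝓗 p ω j i * (𝓧 p ω).d ℓ i k
        - ∑ i ∈ blk k.natAbs, (𝓧 p ω).d ℓ j i * 𝓗 p ω i k)
      = (if ℓ = 0 ∧ j.natAbs = k.natAbs then (𝓥 p ω).d 0 j k else 0) - (𝓥 p ω).d ℓ j k :=
    fun p ω hω ℓ hℓ j k => homSol_d (by linarith [sixteen_le_scale p]) h.γ_pos h.M_pos
      (fun ℓ n m hi hℓ => hω.2 (-1) ℓ n m hi hℓ) hℓ j k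
  have ho : ∀ p : ℕ, ∀ ω ∈ omegaSeq γ₀ τ₀ γ τ α M 16 𝓗 (p + 1), ∀ ℓ, absZ ℓ ≤ scale 16 p →
      ∀ j k : ℤ, Complex.I * ((dot ω ℓ : ℂ) * (𝓧 p ω).o ℓ j k + ∑ i ∈ blk j.natAbs, 𝓗 p ω j i * (𝓧 p ω).o ℓ i k
        + ∑ i ∈ blk k.natAbs, (𝓧 p ω).o ℓ j i * conjMat ψ (𝓗 p ω) i k) = -(𝓥 p ω).o ℓ j k :=
    fun p ω hω ℓ hℓ j k => homSol_o h.conjStable (by linarith [sixteen_le_scale p]) h.γ_pos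
      h.M_pos ((I p).herm ω (omegaSeq_subset_annulus _ hω))
      (fun ℓ n m hi hℓ => hω.2 1 ℓ n m hi hℓ) hℓ j k
  refine ⟨fun ω => rfl, rfl, fun p ω _ j k hjk => kamH_blockDiag p ω hjk, fun p => (I p).herm,
    fun p ω _ j k hjk => ?_, fun p n => ?_, fun p n => ?_, fun p => (I p).ham, fun p => ?_,
    fun p => ?_, fun p => (I p).kamX_ham h, fun p => ?_, fun p ω _ ℓ hℓ => homSol_supp ℓ hℓ,
    fun p ω _ j k hjk => homSol_diag j k hjk, hd, ho, fun p ω hω => ?_⟩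
  · rw [kamH_succ]; simp [avgBlk, hjk]
  · refine ((I p).lip n).trans (ofReal_le_ofReal ?_)
    have := mul_nonneg (lowSize_pos τ p).le he0
    nlinarith
  · have : (fun ω => 𝓗 (p + 1) ω - 𝓗 p ω) = fun ω => avgBlk (𝓥 p ω) := by
      funext ω; rw [kamH_succ]; abel
    rw [this]
    refine ((lipNorm_avgBlk_le (cast_nonneg _) (𝓥 p) n).trans (I p).low).trans (ofReal_le_ofReal ?_)
    rw [mul_comm]
    exact mul_le_mul_of_nonneg_right (by linarith) (lowSize_pos τ p).le
  · rw [he, ← ofReal_mul (rpow_nonneg (by linarith [one_le_scale_pred p]) _)]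
    exact (I p).low
  · rw [he, ← ofReal_mul (by linarith [one_le_scale_pred p])]
    exact (I p).high
  · have hw : 0 ≤ M ^ α / γ := div_nonneg (rpow_nonneg h.M_pos.le _) h.γ_pos.le
    have hr := (ratio_pos τ p).le
    rw [he, show K * (M ^ α / γ) * 𝐍 p ^ (2 * τ + 1) *
      𝐍₋ p ^ (-rho τ) = K * (M ^ α / γ) * ratio τ p by rw [ratio]; ring,
      ← ofReal_mul (by positivity)]
    refine (h.matNorm_kamX_le lam p).trans (ofReal_le_ofReal ?_)
    calc _ = 100 * termCount α * (ratio τ p * (M ^ α / γ * e)) := by ring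
      _ ≤ K * (ratio τ p * (M ^ α / γ * e)) :=
          mul_le_mul_of_nonneg_right hK' (mul_nonneg hr h.size_nonneg)
      _ = _ := by ring
  · have fV := ne_top_of_le_ne_top ofReal_ne_top (I p).low
    refine conjugates_kamNext h.conjStable (by linarith [sixteen_le_scale p]) fV
      (ne_top_of_le_ne_top fV (matNorm_homRhs_le _ _ _))
      (ne_top_of_le_ne_top ofReal_ne_top ((I p).matNorm_kamX_low h))
      ((I p).brConst_mul_le h) (omegaSeq_subset_annulus _ hω) (fun j k hjk => ?_)
      (homEq_of (fun ℓ hℓ => homSol_supp ℓ hℓ) (hd p ω hω) (ho p ω hω))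
    rw [kamH_succ]; simp [avgBlk, hjk]


/-- The weight `⟨h⟩^T`. -/
def bw (T : ℝ) (h : ℤ) : ℝ≥0∞ := ofReal (br h ^ T)

lemma bw_mul (s t : ℝ) (h : ℤ) : bw s h * bw t h = bw (s + t) h := by
  rw [bw, bw, bw, ← ofReal_mul (rpow_nonneg (br_pos _).le _), rpow_add (br_pos _)]

lemma bw_mono {s t : ℝ} (hst : s ≤ t) (h : ℤ) : bw s h ≤ bw t h :=
  ofReal_le_ofReal (rpow_le_rpow_of_exponent_le (one_le_br _) hst)

lemma bw_zero (h : ℤ) : bw 0 h = 1 := by simp [bw]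

lemma br_le_br {x y : ℝ} (h : |x| ≤ |y|) : br x ≤ br y := max_le_max le_rfl h

lemma bw_neg_le {T : ℝ} (hT : 0 ≤ T) {x y z : ℤ} (h : |z - x| ≤ |y|) :
    bw (-T) x ≤ ofReal (2 ^ T) * (bw T y * bw (-T) z) := by
  have h1 : br z ≤ 2 * (br y * br x) := by
    have h2 := br_add_le_mul ((z - x : ℤ) : ℝ) (x : ℝ)
    rw [Int.cast_sub, sub_add_cancel, ← Int.cast_sub] at h2
    refine h2.trans (mul_le_mul_of_nonneg_left (mul_le_mul_of_nonneg_right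
      (br_le_br (by exact_mod_cast h)) (br_pos _).le) zero_le_two)
  have h3 := rpow_le_rpow (br_pos _).le h1 hT
  have := br_pos x; have := br_pos y; have := br_pos z
  rw [bw, bw, bw, ← ofReal_mul (by positivity), ← ofReal_mul (by positivity)]
  refine ofReal_le_ofReal ?_
  rw [mul_rpow (by norm_num) (by positivity), mul_rpow (by positivity) (by positivity)] at h3
  rw [rpow_neg (by positivity), rpow_neg (by positivity), inv_le_iff_one_le_mul₀ (by positivity)]
  calc (1 : ℝ) = br z ^ T * (br z ^ T)⁻¹ := (mul_inv_cancel₀ (by positivity)).symm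
    _ ≤ (2 ^ T * (br y ^ T * br x ^ T)) * (br z ^ T)⁻¹ := by gcongr
    _ = _ := by ring

/-- The sum of `⟨h⟩^{-T}`. -/
def bwSum (T : ℝ) : ℝ≥0∞ := 2 * ∑' h : ℤ, bw (-T) h

lemma bwSum_ne_top {T : ℝ} (hT : 1 < T) : bwSum T ≠ ⊤ :=
  mul_ne_top (by norm_num) (tsum_br_ne_top hT)

lemma tsum_bw_abs_le (T : ℝ) (j : ℤ) : ∑' a : ℤ, bw (-T) (|a| - |j|) ≤ bwSum T := by
  have h1 := tsum_natAbs_le (fun n => bw (-T) ((n : ℤ) - |j|))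
  simp only [Int.natCast_natAbs] at h1
  refine h1.trans (mul_le_mul' le_rfl ?_)
  exact ENNReal.tsum_comp_le_tsum_of_injective (f := fun n : ℕ => (n : ℤ) - |j|) (fun a b hab => by simpa using hab) _

/-- `G` is the continuous derivative of the function `F` on the circle. -/
def HasCDeriv (F G : Circ → ℂ) : Prop :=
  (∀ x : ℝ, HasDerivAt (fun y : ℝ => F (y : Circ)) (G (x : Circ)) x) ∧ Continuous G

lemma continuous_circ_iff {E : Type*} [TopologicalSpace E] {F : Circ → E} :
    Continuous F ↔ Continuous fun x : ℝ => F (x : Circ) :=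
  (QuotientAddGroup.isQuotientMap_mk (N := AddSubgroup.zmultiples (2 * pi))).continuous_iff

lemma HasCDeriv.continuous {F G : Circ → ℂ} (h : HasCDeriv F G) : Continuous F :=
  continuous_circ_iff.2 (continuous_iff_continuousAt.2 fun x => (h.1 x).continuousAt)

lemma fourierCoeff_of_hasCDeriv {F G : Circ → ℂ} (h : HasCDeriv F G) (a : ℤ) :
    fourierCoeff G a = Complex.I * a * fourierCoeff F a := by
  rw [fourierCoeff_eq_intervalIntegral _ _ 0, fourierCoeff_eq_intervalIntegral _ _ 0]
  simp only [smul_eq_mul]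
  have hc : Continuous fun x : ℝ => G (x : Circ) := continuous_circ_iff.1 h.2
  have hu : ∀ x : ℝ, HasDerivAt (fun y : ℝ => fourier (-a) (y : Circ))
      (-Complex.I * a * fourier (-a) (x : Circ)) x := fun x => by
    convert hasDerivAt_fourier_neg (2 * pi) a x using 2
    have := Real.pi_ne_zero
    push_cast
    field_simp
  have hcu : Continuous fun x : ℝ => (fourier (-a) (x : Circ) : ℂ) :=
    continuous_iff_continuousAt.2 fun x => (hu x).continuousAt
  rw [intervalIntegral.integral_mul_deriv_eq_deriv_mul (fun x _ => hu x) (fun x _ => h.1 x)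
    ((continuous_const.mul hcu).intervalIntegrable _ _) (hc.intervalIntegrable _ _), zero_add,
    coe_period]
  simp_rw [mul_assoc]
  rw [intervalIntegral.integral_const_mul, intervalIntegral.integral_const_mul]
  simp only [QuotientAddGroup.mk_zero, sub_self, zero_sub, smul_neg]
  simp only [Complex.real_smul]
  ring

lemma exists_hasCDeriv {F : Circ → ℂ} {n : WithTop ℕ∞} (h : ContDiff ℝ (n + 1) fun x : ℝ => F (x : Circ)) :
    ∃ G : Circ → ℂ, HasCDeriv F G ∧ (∀ x : ℝ, G x = deriv (fun y : ℝ => F (y : Circ)) x) ∧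
      ContDiff ℝ n fun x : ℝ => G (x : Circ) := by
  set f := fun x : ℝ => F (x : Circ) with hf
  have per : Periodic f (2 * pi) := fun x => by
    simp only [hf]
    rw [coe_add, coe_period, add_zero]
  have per' : Periodic (deriv f) (2 * pi) := fun x => by
    rw [← deriv_comp_add_const]
    congr 1
    funext y; exact per y
  have h1 := contDiff_succ_iff_deriv.1 h
  refine ⟨per'.lift, ⟨fun x => (h1.1 x).hasDerivAt, continuous_circ_iff.2 h1.2.2.continuous⟩, fun x => rfl, h1.2.2⟩

lemma norm_fourierCoeff_le {F : Circ → ℂ} {C : ℝ} (h : ∀ x, ‖F x‖ ≤ C) (a : ℤ) : ‖fourierCoeff F a‖ ≤ C := by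
  have := MeasureTheory.norm_integral_le_of_norm_le_const (μ := (haarAddCircle : MeasureTheory.Measure Circ)) (C := C)
    (f := fun x => fourier (-a) x • F x) (Eventually.of_forall fun x => by
      rw [norm_smul, fourier_apply, Circle.norm_coe, one_mul]; exact h x)
  simpa [fourierCoeff] using this

/-- Fourier coefficients of smooth functions decay rapidly. -/
lemma exists_fourierCoeff_decay (T : ℕ) : ∀ {F : Circ → ℂ},
    ContDiff ℝ ((⊤ : ℕ∞) : WithTop ℕ∞) (fun x : ℝ => F (x : Circ)) →
    ∃ C : ℝ, 0 ≤ C ∧ ∀ a : ℤ, ‖fourierCoeff F a‖ ≤ C * br a ^ (-(T : ℝ)) := by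
  have bdd : ∀ {F : Circ → ℂ}, Continuous F → ∃ C : ℝ, 0 ≤ C ∧ ∀ x, ‖F x‖ ≤ C := fun {F} hF =>
    ⟨‖(⟨F, hF⟩ : C(Circ, ℂ))‖, norm_nonneg _, fun x => ContinuousMap.norm_coe_le_norm ⟨F, hF⟩ x⟩
  induction T with
  | zero =>
    intro F hF
    obtain ⟨C, h0, hC⟩ := bdd (continuous_circ_iff.2 hF.continuous)
    exact ⟨C, h0, fun a => by simpa using norm_fourierCoeff_le hC a⟩
  | succ T ih =>
    intro F hF
    obtain ⟨C, h0, hC⟩ := bdd (continuous_circ_iff.2 hF.continuous)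
    obtain ⟨G, hG, -, hG'⟩ := exists_hasCDeriv (n := ((⊤ : ℕ∞) : WithTop ℕ∞)) (by simpa using hF)
    obtain ⟨C', h0', hC'⟩ := ih hG'
    refine ⟨C + C', by positivity, fun a => ?_⟩
    have hb := br_pos a
    have hp : 0 < br a ^ (-((T + 1 : ℕ) : ℝ)) := by positivity
    rcases eq_or_ne a 0 with rfl | ha
    · have h1 : br (0 : ℤ) = 1 := by simp [br]
      rw [h1, one_rpow]
      linarith [norm_fourierCoeff_le hC 0]
    · have hba : ‖(a : ℂ)‖ = br a := by
        rw [norm_intCast, br, max_eq_right]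
        exact_mod_cast Int.one_le_abs ha
      have h1 := hC' a
      rw [fourierCoeff_of_hasCDeriv hG, norm_mul, norm_mul, norm_I, one_mul, hba] at h1
      have h2 : br a ^ (-((T + 1 : ℕ) : ℝ)) = br a ^ (-(T : ℝ)) * (br a)⁻¹ := by
        push_cast
        rw [neg_add, rpow_add hb, rpow_neg_one]
      calc ‖fourierCoeff F a‖ = br a * ‖fourierCoeff F a‖ * (br a)⁻¹ := by field_simp
        _ ≤ C' * br a ^ (-(T : ℝ)) * (br a)⁻¹ := by gcongr
        _ = C' * br a ^ (-((T + 1 : ℕ) : ℝ)) := by rw [h2]; ring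
        _ ≤ _ := by gcongr; linarith

/-- The weighted `ℓ¹` norm of the Fourier coefficients. -/
def fl1 (T : ℝ) (p : Circ → ℂ) : ℝ≥0∞ := ∑' a : ℤ, ‖fourierCoeff p a‖ₑ * bw T a

lemma fl1_ne_top {F : Circ → ℂ} (T : ℝ)
    (hF : ContDiff ℝ ((⊤ : ℕ∞) : WithTop ℕ∞) (fun x : ℝ => F (x : Circ))) : fl1 T F ≠ ⊤ := by
  obtain ⟨n, hn⟩ := exists_nat_ge (T + 2)
  obtain ⟨C, h0, hC⟩ := exists_fourierCoeff_decay n hF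
  have h2 : ∑' a : ℤ, ofReal C * bw (-2) a ≠ ⊤ := by
    rw [ENNReal.tsum_mul_left]
    exact mul_ne_top ofReal_ne_top (tsum_br_ne_top (by norm_num))
  refine ne_top_of_le_ne_top h2 (tsum_le_tsum fun a => ?_)
  calc _ ≤ ofReal C * bw (-(n : ℝ)) a * bw T a := by
        refine mul_le_mul' ?_ le_rfl
        rw [bw, ← ofReal_mul h0, ← ofReal_norm]
        exact ofReal_le_ofReal (hC a)
    _ ≤ _ := by
        rw [mul_assoc, bw_mul]
        exact mul_le_mul' le_rfl (bw_mono (by linarith) a)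

/-- Parseval's identity, as an inequality. -/
lemma enorm_inner_le_tsum (f g : L2x) : ‖inner ℂ f g‖ₑ ≤
    ∑' a : ℤ, ‖fourierCoeff (f : Circ → ℂ) a‖ₑ * ‖fourierCoeff (g : Circ → ℂ) a‖ₑ := by
  have h := (fourierBasis (T := 2 * pi)).hasSum_inner_mul_inner f g
  rw [← h.tsum_eq]
  refine enorm_tsum_le_tsum_enorm.trans (tsum_le_tsum fun a => ?_)
  rw [enorm_mul, ← inner_conj_symm, ← repr_apply_apply, ← repr_apply_apply, fourierBasis_repr, fourierBasis_repr]
  simp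

lemma enorm_fourierCoeff_mul_le (p : C(Circ, ℂ)) (f : L2x) (b : ℤ) :
    ‖fourierCoeff (fun x => p x * (f : Circ → ℂ) x) b‖ₑ ≤
      ∑' c : ℤ, ‖fourierCoeff p (b - c)‖ₑ * ‖fourierCoeff (f : Circ → ℂ) c‖ₑ := by
  set P : C(Circ, ℂ) := ⟨fun x => conj (p x) * fourier b x, by fun_prop⟩ with hP
  set F : L2x := ContinuousMap.toLp 2 haarAddCircle ℂ P with hF
  have hFP : (F : Circ → ℂ) =ᵐ[haarAddCircle] P := ContinuousMap.coeFn_toLp _ P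
  have h1 : fourierCoeff (fun x => p x * (f : Circ → ℂ) x) b = inner ℂ F f := by
    rw [MeasureTheory.L2.inner_def, fourierCoeff]
    refine integral_congr_ae (hFP.mono fun x hx => ?_)
    simp only [hx, hP, ContinuousMap.coe_mk, inner_apply, map_mul, conj_conj, fourier_neg, smul_eq_mul]
    ring
  rw [h1]
  refine (enorm_inner_le_tsum F f).trans (le_of_eq (tsum_congr fun c => ?_))
  congr 1
  rw [fourierCoeff_congr_ae hFP, ← RCLike.enorm_conj, fourierCoeff, ← integral_conj, fourierCoeff]
  congr 2
  funext x
  simp only [hP, ContinuousMap.coe_mk, smul_eq_mul, map_mul, conj_conj, ← fourier_neg, neg_neg]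
  rw [neg_sub, sub_eq_add_neg, fourier_add]
  ring

lemma enorm_fourierCoeff_mul_decay (p : C(Circ, ℂ)) {f : L2x} {T : ℝ} (hT : 0 ≤ T) {A : ℝ≥0∞}
    {j : ℤ} (hf : ∀ c : ℤ, ‖fourierCoeff (f : Circ → ℂ) c‖ₑ ≤ A * bw (-T) (|c| - |j|)) (b : ℤ) :
    ‖fourierCoeff (fun x => p x * (f : Circ → ℂ) x) b‖ₑ ≤ A * (ofReal (2 ^ T) * fl1 T p) * bw (-T) (|b| - |j|) := by
  refine (enorm_fourierCoeff_mul_le p f b).trans ?_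
  have e : ∑' c : ℤ, ‖fourierCoeff p (b - c)‖ₑ * bw T (b - c) = fl1 T p :=
    (Equiv.subLeft b).tsum_eq fun a => ‖fourierCoeff p a‖ₑ * bw T a
  rw [← e, ← ENNReal.tsum_mul_left, ← ENNReal.tsum_mul_left, ← ENNReal.tsum_mul_right]
  refine tsum_le_tsum fun c => ?_
  have h1 : bw (-T) (|c| - |j|) ≤ ofReal (2 ^ T) * (bw T (b - c) * bw (-T) (|b| - |j|)) := by
    refine bw_neg_le hT ?_
    rw [sub_sub_sub_cancel_right]
    exact abs_abs_sub_abs_le_abs_sub b c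
  calc _ ≤ ‖fourierCoeff p (b - c)‖ₑ * (A * (ofReal (2 ^ T) * (bw T (b - c) *
          bw (-T) (|b| - |j|)))) := mul_le_mul' le_rfl ((hf c).trans (mul_le_mul' le_rfl h1))
    _ = _ := by ring

/-- Matrix elements of multiplication operators between localised functions. -/
lemma enorm_inner_mul_le (p : C(Circ, ℂ)) {f g : L2x} {T : ℝ} (hT : 0 ≤ T) {A : ℝ≥0∞}
    {j k : ℤ} (hf : ∀ c : ℤ, ‖fourierCoeff (f : Circ → ℂ) c‖ₑ ≤ A * bw (-(T + 2)) (|c| - |k|))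
    (hg : ∀ c : ℤ, ‖fourierCoeff (g : Circ → ℂ) c‖ₑ ≤ A * bw (-(T + 2)) (|c| - |j|)) :
    ‖∫ x, p x * (f : Circ → ℂ) x * conj ((g : Circ → ℂ) x) ∂haarAddCircle‖ₑ ≤
      A ^ 2 * (ofReal (2 ^ (T + 2)) * ofReal (2 ^ T) * bwSum 2) * fl1 (T + 2) p * bw (-T) (|j| - |k|) := by
  have hpf : MemLp (fun x => p x * (f : Circ → ℂ) x) 2 haarAddCircle :=
    (Lp.memLp f).of_le_mul (c := ‖p‖) (p.continuous.aestronglyMeasurable.mul (Lp.aestronglyMeasurable f))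
      (Eventually.of_forall fun x => by
        rw [norm_mul]
        exact mul_le_mul_of_nonneg_right (p.norm_coe_le_norm x) (norm_nonneg _))
  have h1 : ∫ x, p x * (f : Circ → ℂ) x * conj ((g : Circ → ℂ) x) ∂haarAddCircle = inner ℂ g hpf.toLp := by
    rw [MeasureTheory.L2.inner_def]
    refine integral_congr_ae (hpf.coeFn_toLp.mono fun x hx => ?_)
    simp only [hx, inner_apply]
  rw [h1]
  refine (enorm_inner_le_tsum _ _).trans ?_
  have h2 : ∀ b : ℤ, bw (-(T + 2)) (|b| - |j|) * bw (-(T + 2)) (|b| - |k|) ≤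
      ofReal (2 ^ T) * bw (-T) (|j| - |k|) * bw (-2) (|b| - |j|) := fun b => by
    have h3 : bw (-T) (|b| - |k|) ≤ ofReal (2 ^ T) * (bw T (|b| - |j|) * bw (-T) (|j| - |k|)) := by
      refine bw_neg_le hT ?_
      rw [sub_sub_sub_cancel_right, abs_sub_comm]
    calc _ ≤ bw (-(T + 2)) (|b| - |j|) * (ofReal (2 ^ T) * (bw T (|b| - |j|) * bw (-T) (|j| - |k|))) :=
          mul_le_mul' le_rfl ((bw_mono (by linarith) _).trans h3)
      _ = ofReal (2 ^ T) * bw (-T) (|j| - |k|) * (bw (-(T + 2)) (|b| - |j|) * bw T (|b| - |j|)) := by ring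
      _ = _ := by rw [bw_mul]; congr 2; ring
  calc _ ≤ ∑' b : ℤ, (A * bw (-(T + 2)) (|b| - |j|)) * (A * (ofReal (2 ^ (T + 2)) *
        fl1 (T + 2) p) * bw (-(T + 2)) (|b| - |k|)) := by
        refine tsum_le_tsum fun b => mul_le_mul' (hg b) ?_
        rw [fourierCoeff_congr_ae hpf.coeFn_toLp]
        exact enorm_fourierCoeff_mul_decay p (by linarith) hf b
    _ ≤ ∑' b : ℤ, A ^ 2 * (ofReal (2 ^ (T + 2)) * fl1 (T + 2) p) *
          (ofReal (2 ^ T) * bw (-T) (|j| - |k|)) * bw (-2) (|b| - |j|) := by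
        refine tsum_le_tsum fun b => ?_
        calc _ = A ^ 2 * (ofReal (2 ^ (T + 2)) * fl1 (T + 2) p) *
              (bw (-(T + 2)) (|b| - |j|) * bw (-(T + 2)) (|b| - |k|)) := by ring
          _ ≤ _ := mul_le_mul' le_rfl (h2 b)
          _ = _ := by ring
    _ ≤ A ^ 2 * (ofReal (2 ^ (T + 2)) * fl1 (T + 2) p) * (ofReal (2 ^ T) * bw (-T) (|j| - |k|)) * bwSum 2 := by
        rw [ENNReal.tsum_mul_left]
        exact mul_le_mul' le_rfl (tsum_bw_abs_le 2 j)
    _ = _ := by ring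


lemma integrable_of_continuous {F : Circ → ℂ} (hF : Continuous F) : Integrable F haarAddCircle :=
  hF.integrable_of_hasCompactSupport (HasCompactSupport.of_compactSpace F)

lemma IsEigenbasis.exists_rep (h : EB) (j : ℤ) : ∃ f f₁ f₂ : Circ → ℂ,
    (ψ j : Circ → ℂ) =ᵐ[haarAddCircle] f ∧ HasCDeriv f f₁ ∧ HasCDeriv f₁ f₂ ∧
      ∀ x, f₂ x = ((q x : ℂ) - ((lam j ^ 2 : ℝ) : ℂ)) * f x := by
  obtain ⟨f, hf, hf2, hode⟩ := h.eigen j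
  obtain ⟨f₁, h1, e1, c1⟩ := exists_hasCDeriv (n := 1) (by simpa [one_add_one_eq_two] using hf2)
  obtain ⟨f₂, h2, e2, -⟩ := exists_hasCDeriv (F := f₁) (n := 0) (by simpa using c1)
  refine ⟨f, f₁, f₂, hf, h1, h2, fun x => ?_⟩
  induction x using QuotientAddGroup.induction_on with
  | H x =>
    have h3 := hode x
    rw [iteratedDeriv_succ, iteratedDeriv_one] at h3
    have h4 : f₂ (x : Circ) = deriv (deriv fun y : ℝ => f (y : Circ)) x := by
      rw [e2 x]
      congr 1
      funext y; exact e1 y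
    refine h4.trans ?_
    linear_combination -h3

lemma IsEigenbasis.fourier_eq (h : EB) (j a : ℤ) :
    (((a : ℝ) ^ 2 - lam j ^ 2 : ℝ) : ℂ) * fourierCoeff (ψ j : Circ → ℂ) a =
      -fourierCoeff (fun x => (q x : ℂ) * (ψ j : Circ → ℂ) x) a := by
  obtain ⟨f, f₁, f₂, hf, h1, h2, ode⟩ := h.exists_rep j
  have e1 : fourierCoeff (fun x => (q x : ℂ) * (ψ j : Circ → ℂ) x) a = fourierCoeff (fun x => (q x : ℂ) * f x) a :=
    congrFun (fourierCoeff_congr_ae (hf.mono fun x hx => by simp only [hx])) a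
  have e2 : (fun x => (q x : ℂ) * f x) = f₂ + fun x => ((lam j ^ 2 : ℝ) : ℂ) * f x := by
    funext x
    simp only [Pi.add_apply, ode]
    ring
  rw [e1, fourierCoeff_congr_ae hf, e2, fourierCoeff.add (f := f₂)
    (g := fun x => ((lam j ^ 2 : ℝ) : ℂ) * f x) (integrable_of_continuous h2.2)
    (integrable_of_continuous (continuous_const.mul h1.continuous)), Pi.add_apply,
    fourierCoeff.const_mul, fourierCoeff_of_hasCDeriv h2, fourierCoeff_of_hasCDeriv h1]
  push_cast
  linear_combination ((a : ℂ) ^ 2 * fourierCoeff f a) * I_mul_I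

lemma IsEigenbasis.exists_bound (h : EB) : ∃ R : ℝ, 0 ≤ R ∧ ∀ j : ℤ, |lam j ^ 2 - (j : ℝ) ^ 2| ≤ R := by
  set m := ∫ x, q x ∂(haarAddCircle : MeasureTheory.Measure Circ) with hm
  have hs := h.asymp
  set S := ∑' j : ℤ, (lam j ^ 2 - (j : ℝ) ^ 2 - m) ^ 2 with hS
  have hS0 : 0 ≤ S := tsum_nonneg fun j => sq_nonneg _
  refine ⟨S + 1 + |m|, by positivity, fun j => ?_⟩
  have h1 : (lam j ^ 2 - (j : ℝ) ^ 2 - m) ^ 2 ≤ S := hs.le_tsum j fun _ _ => sq_nonneg _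
  have h2 : |lam j ^ 2 - (j : ℝ) ^ 2 - m| ≤ S + 1 := abs_le_of_sq_le_sq (by nlinarith) (by linarith)
  calc _ = |(lam j ^ 2 - (j : ℝ) ^ 2 - m) + m| := by ring_nf
    _ ≤ _ := (abs_add_le _ _).trans (by linarith)

lemma IsEigenbasis.exists_localised_nat (h : EB) (hq : SmoothPot) (T : ℕ) : ∃ A : ℝ≥0∞, A ≠ ⊤ ∧ ∀ j c : ℤ,
      ‖fourierCoeff (ψ j : Circ → ℂ) c‖ₑ ≤ A * bw (-(T : ℝ)) (|c| - |j|) := by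
  have hqc : Continuous q := continuous_circ_iff.2 hq.continuous
  have le_one : ∀ j c : ℤ, ‖fourierCoeff (ψ j : Circ → ℂ) c‖ ≤ 1 := fun j c => by
    rw [← fourierBasis_repr]
    refine (lp.norm_apply_le_norm (by norm_num) _ c).trans ?_
    rw [LinearIsometryEquiv.norm_map, ψ.orthonormal.1]
  induction T with
  | zero =>
    refine ⟨1, by simp, fun j c => ?_⟩
    rw [cast_zero, neg_zero, bw_zero, mul_one, ← ofReal_norm]
    exact ofReal_le_one.2 (le_one j c)
  | succ T ih =>
    obtain ⟨A, hA, hloc⟩ := ih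
    obtain ⟨R, hR, hlam⟩ := h.exists_bound
    set p : C(Circ, ℂ) := ⟨fun x => (q x : ℂ), Complex.continuous_ofReal.comp hqc⟩ with hp
    have hfin : fl1 T p ≠ ⊤ := fl1_ne_top _ (Complex.ofRealCLM.contDiff.comp hq)
    set D := 2 * R + 1 with hD
    set A' := A * (ofReal (2 ^ (T : ℝ)) * fl1 T p) with hA'
    refine ⟨2 * A' + ofReal (D ^ ((T + 1 : ℕ) : ℝ)), add_ne_top.2 ⟨mul_ne_top (by norm_num) (mul_ne_top hA
        (mul_ne_top ofReal_ne_top hfin)), ofReal_ne_top⟩, fun j c => ?_⟩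
    set k : ℤ := |c| - |j| with hk
    have hb := br_pos k
    rcases le_or_gt D |(k : ℝ)| with hkD | hkD
    · have hk1 : 1 ≤ |(k : ℝ)| := by linarith
      have hbk : br k = |(k : ℝ)| := max_eq_right hk1
      have hcj : |(c : ℝ) ^ 2 - (j : ℝ) ^ 2| ≥ |(k : ℝ)| ^ 2 := by
        have e : (c : ℝ) ^ 2 - (j : ℝ) ^ 2 = (k : ℝ) * (|(c : ℝ)| + |(j : ℝ)|) := by
          rw [hk]; push_cast
          rw [← sq_abs (c : ℝ), ← sq_abs (j : ℝ)]; ring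
        rw [e, abs_mul, sq, abs_of_nonneg (by positivity : 0 ≤ |(c : ℝ)| + |(j : ℝ)|)]
        refine mul_le_mul_of_nonneg_left ?_ (abs_nonneg _)
        rw [hk]; push_cast
        refine (abs_sub _ _).trans ?_
        simp
      have hgap : br k / 2 ≤ |(c : ℝ) ^ 2 - lam j ^ 2| := by
        have h1 := abs_sub_abs_le_abs_sub ((c : ℝ) ^ 2 - (j : ℝ) ^ 2) (lam j ^ 2 - (j : ℝ) ^ 2)
        rw [sub_sub_sub_cancel_right] at h1
        have := hlam j
        rw [hbk]
        nlinarith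
      have h1 := enorm_fourierCoeff_mul_decay p (cast_nonneg T) (hloc j) c
      have h2 := h.fourier_eq j c
      have h3 : ofReal (br k / 2) * ‖fourierCoeff (ψ j : Circ → ℂ) c‖ₑ ≤ A' * bw (-(T : ℝ)) k := by
        refine le_trans ?_ h1
        change _ ≤ ‖fourierCoeff (fun x => (q x : ℂ) * (ψ j : Circ → ℂ) x) c‖ₑ
        rw [← enorm_neg (fourierCoeff (fun x => (q x : ℂ) * (ψ j : Circ → ℂ) x) c), ← h2,
          enorm_mul, ← ofReal_norm (E := ℂ) (((c : ℝ) ^ 2 - lam j ^ 2 : ℝ) : ℂ),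
          norm_real]
        exact mul_le_mul' (ofReal_le_ofReal hgap) le_rfl
      calc _ = bw (-1) k * 2 * (ofReal (br k / 2) * ‖fourierCoeff (ψ j : Circ → ℂ) c‖ₑ) := by
            generalize ‖fourierCoeff (ψ j : Circ → ℂ) c‖ₑ = X
            rw [← mul_assoc, show (2 : ℝ≥0∞) = ofReal 2 by norm_num, bw,
              ← ofReal_mul (by positivity), ← ofReal_mul (by positivity),
              rpow_neg_one, show (br k)⁻¹ * 2 * (br k / 2) = 1 by field_simp]
            simp
        _ ≤ bw (-1) k * 2 * (A' * bw (-(T : ℝ)) k) := mul_le_mul' le_rfl h3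
        _ = 2 * A' * (bw (-(T : ℝ)) k * bw (-1) k) := by ring
        _ ≤ _ := by
            rw [bw_mul, Nat.cast_succ, neg_add]
            exact mul_le_mul' le_self_add le_rfl
    · have hbk : br k ≤ D := max_le (by linarith) hkD.le
      calc _ ≤ (1 : ℝ≥0∞) := by
            rw [← ofReal_norm]; exact ofReal_le_one.2 (le_one j c)
        _ ≤ ofReal (D ^ ((T + 1 : ℕ) : ℝ)) * bw (-((T + 1 : ℕ) : ℝ)) k := by
            rw [bw, ← ofReal_mul (by positivity), one_le_ofReal,
              rpow_neg hb.le, ← div_eq_mul_inv, one_le_div (by positivity)]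
            exact rpow_le_rpow hb.le hbk (by positivity)
        _ ≤ _ := mul_le_mul' le_add_self le_rfl

/-- The eigenfunction `ψ_j` is localised near the frequencies `±j`. -/
lemma IsEigenbasis.exists_localised (h : EB) (hq : SmoothPot) (T : ℝ) : ∃ A : ℝ≥0∞, A ≠ ⊤ ∧ ∀ j c : ℤ,
      ‖fourierCoeff (ψ j : Circ → ℂ) c‖ₑ ≤ A * bw (-T) (|c| - |j|) := by
  obtain ⟨n, hn⟩ := exists_nat_ge T
  obtain ⟨A, hA, hloc⟩ := h.exists_localised_nat hq n
  exact ⟨A, hA, fun j c => (hloc j c).trans (mul_le_mul' le_rfl (bw_mono (by linarith) _))⟩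

lemma IsEigenbasis.cc_eq_zero (h : EB) {j k : ℤ} (hjk : lam j ≠ lam k) : cc ψ j k = 0 := by
  obtain ⟨f, f₁, f₂, hf, h1, h2, ode⟩ := h.exists_rep j
  obtain ⟨g, g₁, g₂, hg, k1, k2, ode'⟩ := h.exists_rep k
  have hW : HasCDeriv (fun x => f₁ x * g x - f x * g₁ x)
      (fun x => ((lam k ^ 2 - lam j ^ 2 : ℝ) : ℂ) * (f x * g x)) := by
    refine ⟨fun x => ?_, continuous_const.mul (h1.continuous.mul k1.continuous)⟩
    refine (((h2.1 x).mul (k1.1 x)).sub ((h1.1 x).mul (k2.1 x))).congr_deriv ?_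
    rw [ode, ode']; push_cast; ring
  have h3 := fourierCoeff_of_hasCDeriv hW 0
  rw [fourierCoeff.const_mul] at h3
  simp only [Int.cast_zero, mul_zero, zero_mul, mul_eq_zero, Complex.ofReal_eq_zero] at h3
  have h4 : lam k ^ 2 - lam j ^ 2 ≠ 0 := fun h0 => hjk <| by
    have := h.pos j; have := h.pos k
    nlinarith [mul_self_inj_of_nonneg (h.pos k).le (h.pos j).le |>.1 (by nlinarith)]
  have h5 := h3.resolve_left h4
  have h6 : cc ψ j k = conj (fourierCoeff (fun x => f x * g x) 0) := by
    rw [cc, fourierCoeff, ← integral_conj]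
    refine integral_congr_ae ?_
    filter_upwards [hf, hg] with x hx hx'
    simp [hx, hx']
  rw [h6, h5, map_zero]

lemma IsEigenbasis.cc_eq_zero_of_natAbs (h : EB) {j k : ℤ}
    (hjk : j.natAbs ≠ k.natAbs) : cc ψ j k = 0 := h.cc_eq_zero (h.sep j k hjk)

lemma inner_star (ψ : 𝔹) (j k : ℤ) : inner ℂ (ψ j) (star (ψ k)) = cc ψ j k := by
  rw [MeasureTheory.L2.inner_def, cc]
  refine integral_congr_ae ((Lp.coeFn_star (ψ k)).mono fun x hx => ?_)
  simp only [inner_apply, hx, Pi.star_apply]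
  exact mul_comm _ _

lemma inner_star_star (f g : L2x) : inner ℂ (star f) (star g) = conj (inner ℂ f g) := by
  rw [MeasureTheory.L2.inner_def, MeasureTheory.L2.inner_def, ← integral_conj]
  refine integral_congr_ae ?_
  filter_upwards [Lp.coeFn_star f, Lp.coeFn_star g] with x hx hx'
  simp [inner_apply, hx, hx']

lemma IsEigenbasis.conjStable (h : EB) : ConjStable ψ := by
  intro n
  ext a b
  have ha := mem_blk.1 a.2
  have h1 := ψ.hasSum_inner_mul_inner (star (ψ b)) (star (ψ a))
  have h2 : HasSum (fun i => inner ℂ (star (ψ b)) (ψ i) * inner ℂ (ψ i) (star (ψ a)))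
      (∑ i ∈ blk n, inner ℂ (star (ψ b)) (ψ i) * inner ℂ (ψ i) (star (ψ a))) :=
    hasSum_sum_of_ne_finset_zero fun i hi => by
      rw [inner_star, h.cc_eq_zero_of_natAbs (fun e => hi (mem_blk.2 (e.trans ha))), mul_zero]
  have h3 := h2.unique h1
  rw [inner_star_star, orthonormal_iff_ite.1 ψ.orthonormal] at h3
  rw [Matrix.mul_apply, Matrix.one_apply]
  have h4 : ∑ i : blk n, rblk (cc ψ) n n a i * (rblk (cc ψ) n n).map conj i b =
      ∑ i ∈ blk n, inner ℂ (star (ψ b)) (ψ i) * inner ℂ (ψ i) (star (ψ a)) := by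
    rw [← sum_coe_sort (blk n)]
    refine sum_congr rfl fun i _ => ?_
    rw [← inner_conj_symm, inner_star, inner_star, rblk_apply, map_apply, rblk_apply, cc_comm ψ a i, mul_comm]
  rw [h4, h3]
  by_cases hab : a = b
  · simp [hab]
  · have : (b : ℤ) ≠ a := fun e => hab (Subtype.ext e.symm)
    simp [hab, this]

lemma IsEigenbasis.star_eq_sum (h : EB) (j : ℤ) : star (ψ j) = ∑ i ∈ blk j.natAbs, cc ψ i j • ψ i := by
  refine (ψ.hasSum_repr (star (ψ j))).unique ?_
  have : ∀ i, ψ.repr (star (ψ j)) i = cc ψ i j := fun i => by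
    rw [repr_apply_apply, inner_star]
  simp only [this]
  exact hasSum_sum_of_ne_finset_zero fun i hi => by
    rw [h.cc_eq_zero_of_natAbs (fun e => hi (mem_blk.2 e)), zero_smul]

lemma IsEigenbasis.exists_lam_bounds (h : EB) : ∃ c : ℝ, 0 < c ∧ c ≤ 1 ∧
    (∀ j : ℤ, c * br j ≤ lam j) ∧ (∀ j : ℤ, lam j ≤ c⁻¹ * br j) ∧
      ∀ j k : ℤ, |lam j - lam k| ≤ c⁻¹ * br (|j| - |k| : ℤ) := by
  obtain ⟨R, hR, hlam⟩ := h.exists_bound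
  obtain ⟨n, hn⟩ := exists_nat_ge (2 * R + 1)
  obtain ⟨c₁, hc₁, hle⟩ : ∃ c₁ : ℝ, 0 < c₁ ∧ ∀ j ∈ Icc (-(n : ℤ)) n, c₁ ≤ lam j := by
    obtain ⟨j₀, -, hj₀⟩ := Finset.exists_min_image (Icc (-(n : ℤ)) n) lam ⟨0, by simp⟩
    exact ⟨lam j₀, h.pos j₀, hj₀⟩
  have lower : ∃ c : ℝ, 0 < c ∧ ∀ j : ℤ, c * br j ≤ lam j := by
    refine ⟨min (c₁ / (n + 1)) (1 / 2), by positivity, fun j => ?_⟩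
    have hb := br_pos j
    by_cases hj : j ∈ Icc (-(n : ℤ)) n
    · have : br j ≤ n + 1 := by
        rw [mem_Icc] at hj
        refine max_le (by linarith [n.cast_nonneg (α := ℝ)]) ?_
        have : |j| ≤ n := abs_le.2 hj
        have : |(j : ℝ)| ≤ n := by exact_mod_cast this
        linarith
      calc _ ≤ c₁ / (n + 1) * (n + 1) := by gcongr; exact min_le_left _ _
        _ = c₁ := by field_simp
        _ ≤ _ := hle j hj
    · have h1 : (n : ℝ) ≤ |(j : ℝ)| := by
        have : (n : ℤ) ≤ |j| := by
          by_contra hlt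
          exact hj (mem_Icc.2 (abs_le.1 (le_of_lt (not_le.1 hlt))))
        exact_mod_cast this
      have h2 : br j = |(j : ℝ)| := max_eq_right (by linarith)
      have h3 := abs_le.1 (hlam j)
      have h4 : (|(j : ℝ)| / 2) ^ 2 ≤ lam j ^ 2 := by
        have := sq_abs (j : ℝ)
        nlinarith
      have h5 := abs_le_of_sq_le_sq' h4 (h.pos j).le
      rw [h2]
      nlinarith [min_le_right (c₁ / (n + 1)) (1 / 2), abs_nonneg (j : ℝ)]
  obtain ⟨c, hc, hlow⟩ := lower
  have upper : ∀ j : ℤ, lam j ≤ (R + 1) * br j := fun j => by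
    have h3 := abs_le.1 (hlam j)
    have hb := one_le_br j
    have hj := abs_le_br (j : ℝ)
    have := sq_abs (j : ℝ)
    refine (abs_le_of_sq_le_sq' ?_ (by positivity)).2
    have h6 : (j : ℝ) ^ 2 ≤ br j ^ 2 := by rw [← sq_abs]; gcongr
    have h7 := mul_nonneg (sq_nonneg R) (sq_nonneg (br j))
    nlinarith [mul_le_mul_of_nonneg_left (one_le_pow₀ hb (n := 2)) hR]
  have diff : ∀ j k : ℤ, |lam j - lam k| ≤ (2 * R + 2) / c * br (|j| - |k| : ℤ) := by
    intro j k
    have hj := hlow j; have hk := hlow k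
    have bj := one_le_br j; have bk := one_le_br k
    have b1 := one_le_br ((|j| - |k| : ℤ) : ℝ)
    have b2 := abs_le_br ((|j| - |k| : ℤ) : ℝ)
    have hs : 0 < lam j + lam k := add_pos (h.pos j) (h.pos k)
    have e1 : |lam j - lam k| * (lam j + lam k) ≤
        |((|j| - |k| : ℤ) : ℝ)| * (|(j : ℝ)| + |(k : ℝ)|) + 2 * R := by
      have e : ((j : ℝ) ^ 2 - (k : ℝ) ^ 2) = ((|j| - |k| : ℤ) : ℝ) * (|(j : ℝ)| + |(k : ℝ)|) := by
        push_cast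
        rw [← sq_abs (j : ℝ), ← sq_abs (k : ℝ)]; ring
      rw [← abs_of_pos hs, ← abs_mul, show (lam j - lam k) * (lam j + lam k) = ((j : ℝ) ^ 2 - (k : ℝ) ^ 2) +
          ((lam j ^ 2 - (j : ℝ) ^ 2) - (lam k ^ 2 - (k : ℝ) ^ 2)) by ring]
      refine (abs_add_le _ _).trans (add_le_add ?_ ((abs_sub _ _).trans (by linarith [hlam j, hlam k])))
      rw [e, abs_mul, abs_of_nonneg (by positivity : 0 ≤ |(j : ℝ)| + |(k : ℝ)|)]
    have e2 : |(j : ℝ)| + |(k : ℝ)| ≤ br j + br k := add_le_add (abs_le_br _) (abs_le_br _)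
    have e3 : |lam j - lam k| * (c * (br j + br k)) ≤ (2 * R + 2) * br (|j| - |k| : ℤ) * (br j + br k) := by
      calc _ ≤ |lam j - lam k| * (lam j + lam k) := by gcongr; linarith
        _ ≤ br (|j| - |k| : ℤ) * (br j + br k) + 2 * R := by
            refine e1.trans ?_; gcongr
        _ ≤ _ := by
            have : 1 ≤ br (|j| - |k| : ℤ) * (br j + br k) := by nlinarith
            nlinarith
    rw [div_mul_eq_mul_div, le_div_iff₀ hc]
    have e4 : 0 < br j + br k := by linarith
    refine le_of_mul_le_mul_right ?_ e4
    linarith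
  have hR1 : 0 < R + 1 := by linarith
  set d := min (min c 1) (min (R + 1)⁻¹ (c / (2 * R + 2))) with hd
  have hd0 : 0 < d := by positivity
  have hd1 : d ≤ c := (min_le_left _ _).trans (min_le_left _ _)
  have hd2 : R + 1 ≤ d⁻¹ := by
    rw [le_inv_comm₀ hR1 hd0]; exact (min_le_right _ _).trans (min_le_left _ _)
  have hd3 : (2 * R + 2) / c ≤ d⁻¹ := by
    rw [le_inv_comm₀ (by positivity) hd0, inv_div]
    exact (min_le_right _ _).trans (min_le_right _ _)
  refine ⟨d, hd0, (min_le_left _ _).trans (min_le_right _ _), fun j => ?_, fun j => ?_, fun j k => ?_⟩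
  · exact (mul_le_mul_of_nonneg_right hd1 (br_pos _).le).trans (hlow j)
  · exact (upper j).trans (mul_le_mul_of_nonneg_right hd2 (br_pos _).le)
  · exact (diff j k).trans (mul_le_mul_of_nonneg_right hd3 (br_pos _).le)

lemma conjMat_scale (h : EB) (F : ℝ → ℝ → ℝ) (A : Mat) (j k : ℤ) :
    conjMat ψ (fun a b => (F (lam a) (lam b) : ℂ) * A a b) j k = (F (lam j) (lam k) : ℂ) * conjMat ψ A j k := by
  rw [conjMat_apply, conjMat_apply, mul_sum]
  refine sum_congr rfl fun a _ => ?_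
  rw [mul_sum]
  refine sum_congr rfl fun b _ => ?_
  by_cases h1 : lam j = lam a
  · by_cases h2 : lam b = lam k
    · rw [h1, h2, map_mul, conj_ofReal]; ring
    · rw [h.cc_eq_zero h2]; simp
  · rw [h.cc_eq_zero h1]; simp


lemma IsCutoff.exists_lipschitz {χ : ℝ → ℝ} (h : IsCutoff χ) : ∃ G : ℝ, 0 ≤ G ∧
    (∀ y, |χ y / y| ≤ G) ∧ ∀ y z, |χ y / y - χ z / z| ≤ G * |y - z| := by
  have hsupp : HasCompactSupport fun y => 1 - χ y :=
    HasCompactSupport.of_support_subset_isCompact (isCompact_Icc (a := (-1 : ℝ)) (b := 1)) fun y hy => by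
        by_contra hy'
        refine hy ?_
        have : (2 / 3 : ℝ) ≤ |y| := by
          by_contra hlt
          have := abs_lt.1 (not_le.1 hlt)
          exact hy' ⟨by linarith, by linarith⟩
        simp [h.one y this]
  obtain ⟨L, hL⟩ := ContDiff.lipschitzWith_of_hasCompactSupport hsupp (contDiff_const.sub h.smooth) (by simp)
  have lip : ∀ y z, |χ y - χ z| ≤ L * |y - z| := fun y z => by
    have := hL.dist_le_mul y z
    rw [dist_eq, dist_eq, sub_sub_sub_cancel_left] at this
    rwa [abs_sub_comm]
  have hL0 : (0 : ℝ) ≤ L := L.2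
  have bdd : ∀ y, |χ y| ≤ 1 + 2 * L := fun y => by
    rcases le_total (2 / 3 : ℝ) |y| with hy | hy
    · rw [h.one y hy]; simp
    · have h1 := lip y (2 / 3)
      rw [h.one (2 / 3) (by norm_num [abs_of_pos])] at h1
      have h2 : |y - 2 / 3| ≤ 2 := by
        have := abs_le.1 hy
        rw [abs_le]; constructor <;> linarith
      have h3 := abs_sub_abs_le_abs_sub (χ y) 1
      rw [abs_one] at h3
      nlinarith [abs_nonneg (y - 2 / 3)]
  have small : ∀ y, |y| ≤ 1 / 3 → χ y / y = 0 := fun y hy => by rw [h.zero y hy, zero_div]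
  have one : ∀ y z, |y| ≤ 1 / 3 → 1 / 3 < |z| → |χ y / y - χ z / z| ≤ 3 * L * |y - z| := by
    intro y z hy hz
    have h1 := lip y z
    rw [h.zero y hy] at h1
    rw [small y hy, zero_sub, abs_neg, abs_div, div_le_iff₀ (by linarith)]
    rw [zero_sub, abs_neg] at h1
    nlinarith [abs_nonneg (y - z), mul_nonneg hL0 (abs_nonneg (y - z))]
  refine ⟨9 * (1 + 2 * L) + 3 * L, by positivity, fun y => ?_, fun y z => ?_⟩
  · rcases le_or_gt |y| (1 / 3) with hy | hy
    · rw [small y hy, abs_zero]; positivity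
    · rw [abs_div, div_le_iff₀ (by linarith)]
      nlinarith [bdd y]
  · have hyz := abs_nonneg (y - z)
    rcases le_or_gt |y| (1 / 3) with hy | hy <;> rcases le_or_gt |z| (1 / 3) with hz | hz
    · rw [small y hy, small z hz, sub_self, abs_zero]; positivity
    · refine (one y z hy hz).trans (mul_le_mul_of_nonneg_right (by linarith) hyz)
    · rw [abs_sub_comm, abs_sub_comm y z] at *
      refine (one z y hz hy).trans (mul_le_mul_of_nonneg_right (by linarith) hyz)
    · have hy0 : y ≠ 0 := by rintro rfl; norm_num at hy
      have hz0 : z ≠ 0 := by rintro rfl; norm_num at hz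
      have e : χ y / y - χ z / z = (χ y - χ z) / y + χ z * (z - y) / (y * z) := by
        field_simp; ring
      rw [e]
      have h1 : |(χ y - χ z) / y| ≤ 3 * L * |y - z| := by
        rw [abs_div, div_le_iff₀ (by linarith)]
        nlinarith [lip y z, mul_nonneg hL0 hyz]
      have h2 : |χ z * (z - y) / (y * z)| ≤ 9 * (1 + 2 * L) * |y - z| := by
        rw [abs_div, abs_mul, abs_mul, div_le_iff₀ (by positivity), abs_sub_comm z y]
        have h3 : 1 / 9 ≤ |y| * |z| := by nlinarith
        calc |χ z| * |y - z| ≤ (1 + 2 * L) * |y - z| * 1 := by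
              rw [mul_one]; exact mul_le_mul_of_nonneg_right (bdd z) hyz
          _ ≤ (1 + 2 * L) * |y - z| * (9 * (|y| * |z|)) :=
              mul_le_mul_of_nonneg_left (by linarith) (by positivity)
          _ = _ := by ring
      refine (abs_add_le _ _).trans ?_
      linarith

/-- The multiplier of the generator of the Magnus transformation. -/
def magnusG (χ : ℝ → ℝ) (γ₀ τ₀ M : ℝ) (ω : Freq ν) (ℓ : 𝕀 ν) : ℂ :=
  (χ (dot ω ℓ / (γ₀ * M * br (absZ ℓ) ^ (-τ₀))) : ℂ) / (Complex.I * (dot ω ℓ : ℂ))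

lemma IsCutoff.exists_magnusG_bound {χ : ℝ → ℝ} (h : IsCutoff χ) : ∃ G : ℝ, 0 ≤ G ∧
    ∀ (γ₀ τ₀ M : ℝ), 0 < γ₀ * M → 0 ≤ τ₀ → ∀ ℓ : 𝕀 ν, (∀ ω, ‖magnusG χ γ₀ τ₀ M ω ℓ‖ ≤
        G * ((γ₀ * M)⁻¹ + (γ₀ * M)⁻¹ ^ 2) * br (absZ ℓ) ^ (2 * τ₀ + 1)) ∧
      ∀ ω₁ ω₂, ‖magnusG χ γ₀ τ₀ M ω₁ ℓ - magnusG χ γ₀ τ₀ M ω₂ ℓ‖ ≤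
        G * ((γ₀ * M)⁻¹ + (γ₀ * M)⁻¹ ^ 2) * br (absZ ℓ) ^ (2 * τ₀ + 1) * ‖ω₁ - ω₂‖ := by
  obtain ⟨G, hG0, hG, hL⟩ := h.exists_lipschitz
  refine ⟨G, hG0, fun γ₀ τ₀ M hκ hτ₀ ℓ => ?_⟩
  have hb1 := one_le_br (absZ ℓ)
  have hb := br_pos (absZ ℓ)
  set κ := (γ₀ * M)⁻¹ with hκd
  have hκ0 : 0 < κ := inv_pos.2 hκ
  set ρ := γ₀ * M * br (absZ ℓ) ^ (-τ₀) with hρ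
  have hρ0 : 0 < ρ := by positivity
  have hρi : ρ⁻¹ = κ * br (absZ ℓ) ^ τ₀ := by
    rw [hρ, mul_inv, rpow_neg hb.le, inv_inv]
  have form : ∀ ω, magnusG χ γ₀ τ₀ M ω ℓ =
      -Complex.I * ((ρ⁻¹ * (χ (dot ω ℓ / ρ) / (dot ω ℓ / ρ)) : ℝ) : ℂ) := fun ω => by
    rw [magnusG, ← hρ]
    have e : ρ⁻¹ * (χ (dot ω ℓ / ρ) / (dot ω ℓ / ρ)) = χ (dot ω ℓ / ρ) / dot ω ℓ := by
      rcases eq_or_ne (dot ω ℓ) 0 with h0 | h0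
      · simp [h0]
      · field_simp
    rw [e, div_mul_eq_div_div, div_I]
    push_cast
    ring
  have hp : br (absZ ℓ) ^ τ₀ ≤ br (absZ ℓ) ^ (2 * τ₀ + 1) :=
    rpow_le_rpow_of_exponent_le hb1 (by linarith)
  constructor
  · intro ω
    rw [form, norm_mul, norm_neg, norm_I, one_mul, norm_real, norm_eq_abs, abs_mul, abs_of_pos (inv_pos.2 hρ0), hρi]
    calc _ ≤ κ * br (absZ ℓ) ^ τ₀ * G := by gcongr; exact hG _
      _ ≤ (κ + κ ^ 2) * br (absZ ℓ) ^ (2 * τ₀ + 1) * G := by gcongr; nlinarith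
      _ = _ := by ring
  · intro ω₁ ω₂
    rw [form, form, ← mul_sub, ← ofReal_sub, norm_mul, norm_neg, norm_I, one_mul,
      norm_real, norm_eq_abs, ← mul_sub, abs_mul, abs_of_pos (inv_pos.2 hρ0)]
    have h1 : |dot ω₁ ℓ / ρ - dot ω₂ ℓ / ρ| ≤ ρ⁻¹ * (‖ω₁ - ω₂‖ * br (absZ ℓ)) := by
      rw [← sub_div, ← dot_sub_left, abs_div, abs_of_pos hρ0, div_eq_inv_mul]
      gcongr
      refine (abs_dot_le _ _).trans ?_
      gcongr
      exact (le_abs_self _).trans (abs_le_br _)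
    calc _ ≤ ρ⁻¹ * (G * (ρ⁻¹ * (‖ω₁ - ω₂‖ * br (absZ ℓ)))) := by
          gcongr
          refine (hL _ _).trans ?_
          gcongr
      _ = G * κ ^ 2 * (br (absZ ℓ) ^ τ₀ * br (absZ ℓ) ^ τ₀ * br (absZ ℓ)) * ‖ω₁ - ω₂‖ := by
          rw [hρi]; ring
      _ = G * κ ^ 2 * br (absZ ℓ) ^ (2 * τ₀ + 1) * ‖ω₁ - ω₂‖ := by
          congr 2
          rw [← rpow_add hb, ← rpow_add_one hb.ne']
          congr 1; ring
      _ ≤ _ := by gcongr; linarith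

section Driving

variable {S : ℝ} {v : (Fin ν → Circ) → Circ → ℝ}

lemma IsDriving.continuous_fourierPhi (h : IsDriving S v) (ℓ : 𝕀 ν) : Continuous (fourierPhi v ℓ) := by
  have := continuous_parametric_integral_of_continuous (μ := MeasureTheory.Measure.pi fun _ : Fin ν => (haarAddCircle :
      MeasureTheory.Measure Circ)) (s := Set.univ)
    (f := fun (x : Circ) (φ : Fin ν → Circ) => (∏ i, fourier (-(ℓ i)) (φ i)) * (v φ x : ℂ))
    (by
      have h1 : Continuous fun a : Circ × (Fin ν → Circ) => v a.2 a.1 :=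
        h.cont.comp (continuous_snd.prodMk continuous_fst)
      refine Continuous.mul (continuous_finsetProd _ fun i _ => ?_) (Complex.continuous_ofReal.comp h1)
      exact (fourier (-(ℓ i))).continuous.comp ((continuous_apply i).comp continuous_snd))
    isCompact_univ
  simp only [MeasureTheory.Measure.restrict_univ] at this
  exact this

lemma fourierPhi_neg (v : (Fin ν → Circ) → Circ → ℝ) (ℓ : 𝕀 ν) (x : Circ) :
    fourierPhi v (-ℓ) x = conj (fourierPhi v ℓ x) := by
  rw [fourierPhi, fourierPhi, ← integral_conj]
  congr 1
  funext φ
  simp [map_mul, map_prod]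

lemma IsDriving.exists_fl1_bound (h : IsDriving S v) {T : ℝ} (hT : 0 ≤ T) (hS : 2 * T + 4 ≤ S) :
    ∃ L : ℝ≥0∞, L ≠ ⊤ ∧ ∀ ℓ : 𝕀 ν, fl1 (T + 2) (fourierPhi v ℓ) ≤ L * ofReal (br (absZ ℓ) ^ (-T)) := by
  set Q := ∑' a : 𝕁 ν, br2 a.1 a.2 ^ (2 * S) * ‖fourierCoeff (fourierPhi v a.1) a.2‖ ^ 2 with hQ
  have hnn : ∀ a : 𝕁 ν, 0 ≤ br2 a.1 a.2 ^ (2 * S) * ‖fourierCoeff (fourierPhi v a.1) a.2‖ ^ 2 := fun a => by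
    have := br2_pos a.1 a.2
    positivity
  have hQ0 : 0 ≤ Q := tsum_nonneg hnn
  have pt : ∀ (ℓ : 𝕀 ν) (a : ℤ), ‖fourierCoeff (fourierPhi v ℓ) a‖ ≤
      (Q + 1) * (br (absZ ℓ) ^ (-T) * br a ^ (-(T + 4))) := fun ℓ a => by
    have h1 := h.sob.le_tsum (ℓ, a) fun b _ => hnn b
    have hb := br2_pos ℓ a
    have h2 : br2 ℓ a ^ S * ‖fourierCoeff (fourierPhi v ℓ) a‖ ≤ Q + 1 := by
      refine (abs_le_of_sq_le_sq' ?_ (by linarith)).2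
      rw [mul_pow, ← Real.rpow_natCast, ← rpow_mul hb.le, mul_comm S]
      have : Q ≤ (Q + 1) ^ 2 := by nlinarith
      exact le_trans h1 this
    have h3 : br (absZ ℓ) ^ T * br a ^ (T + 4) ≤ br2 ℓ a ^ S := by
      calc _ ≤ br2 ℓ a ^ T * br2 ℓ a ^ (T + 4) :=
            mul_le_mul (rpow_le_rpow (br_pos _).le (br_absZ_le_br2 _ _) hT)
              (rpow_le_rpow (br_pos _).le (br_le_br2 _ _) (by linarith))
              (rpow_nonneg (br_pos _).le _) (rpow_nonneg hb.le _)
        _ = br2 ℓ a ^ (2 * T + 4) := by rw [← rpow_add hb]; congr 1; ring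
        _ ≤ _ := rpow_le_rpow_of_exponent_le (one_le_br2 _ _) hS
    have p1 := rpow_pos_of_pos (br_pos (absZ ℓ)) T
    have p2 := rpow_pos_of_pos (br_pos (a : ℝ)) (T + 4)
    rw [rpow_neg (br_pos _).le, rpow_neg (br_pos _).le, ← mul_inv, ← div_eq_mul_inv,
      le_div_iff₀ (by positivity), mul_comm]
    exact (mul_le_mul_of_nonneg_right h3 (norm_nonneg _)).trans h2
  refine ⟨ofReal (Q + 1) * ∑' a : ℤ, bw (-2) a, mul_ne_top ofReal_ne_top (tsum_br_ne_top (by norm_num)), fun ℓ => ?_⟩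
  rw [mul_right_comm, ← ENNReal.tsum_mul_left, fl1]
  refine tsum_le_tsum fun a => ?_
  calc _ ≤ ofReal (Q + 1) * (ofReal (br (absZ ℓ) ^ (-T)) * bw (-(T + 4)) a) * bw (T + 2) a := by
        refine mul_le_mul' ?_ le_rfl
        rw [bw, ← ofReal_mul (rpow_nonneg (br_pos _).le _), ← ofReal_mul (by linarith), ← ofReal_norm]
        exact ofReal_le_ofReal (pt ℓ a)
    _ = ofReal (Q + 1) * ofReal (br (absZ ℓ) ^ (-T)) * (bw (-(T + 4)) a * bw (T + 2) a) := by ring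
    _ = _ := by rw [bw_mul]; congr 2; ring

lemma ofReal_br_mul_bw_le (ℓ : 𝕀 ν) (h : ℤ) {T : ℝ} (hT : 0 ≤ T) :
    ofReal (br (absZ ℓ) ^ (-T)) * bw (-T) h ≤ wt (-T) (ℓ, h) := by
  have h1 := br_pos (absZ ℓ)
  have h2 := br_pos h
  rw [bw, wt, ← ofReal_mul (by positivity), ← mul_rpow h1.le h2.le]
  refine ofReal_le_ofReal (rpow_le_rpow_of_nonpos (br2_pos _ _) ?_ (by linarith))
  have e1 := one_le_br (absZ ℓ)
  have e2 := one_le_br (h : ℝ)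
  have e3 := (le_abs_self _).trans (abs_le_br (absZ ℓ))
  have e4 := abs_le_br (h : ℝ)
  simp only [br2]
  exact max_le (by nlinarith) (max_le (by nlinarith) (by nlinarith))

lemma IsEigenbasis.exists_driving_bound (h : EB) (hq : SmoothPot)
    (hv : IsDriving S v) {T : ℝ} (hT : 0 ≤ T) (hS : 2 * T + 4 ≤ S) :
    ∃ L : ℝ≥0∞, L ≠ ⊤ ∧ ∀ (ℓ : 𝕀 ν) (j k : ℤ), ‖drivingOp ψ lam v ℓ j k‖ₑ ≤ L * wt (-T) (ℓ, |j| - |k|) *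
        ofReal (br j ^ (-(1 / 2) : ℝ) * br k ^ (-(1 / 2) : ℝ)) := by
  obtain ⟨A, hA, hloc⟩ := h.exists_localised hq (T + 2)
  obtain ⟨L, hL, hfl⟩ := hv.exists_fl1_bound hT hS
  obtain ⟨c, hc, hc1, hlow, -, -⟩ := h.exists_lam_bounds
  set B := A ^ 2 * (ofReal (2 ^ (T + 2)) * ofReal (2 ^ T) * bwSum 2) with hB
  refine ⟨ofReal c⁻¹ * (B * L), mul_ne_top ofReal_ne_top (mul_ne_top (mul_ne_top (pow_ne_top hA) (mul_ne_top
      (mul_ne_top ofReal_ne_top ofReal_ne_top)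
      (bwSum_ne_top (by norm_num)))) hL), fun ℓ j k => ?_⟩
  have h1 := enorm_inner_mul_le (⟨fourierPhi v ℓ, hv.continuous_fourierPhi ℓ⟩ : C(Circ, ℂ)) hT (hloc k) (hloc j)
  have h2 : ‖((1 / 2 * lam j ^ (-(1 / 2) : ℝ) * lam k ^ (-(1 / 2) : ℝ) : ℝ) : ℂ)‖ₑ ≤ ofReal c⁻¹ *
        ofReal (br j ^ (-(1 / 2) : ℝ) * br k ^ (-(1 / 2) : ℝ)) := by
    have lo : ∀ i, lam i ^ (-(1 / 2) : ℝ) ≤ c ^ (-(1 / 2) : ℝ) * br i ^ (-(1 / 2) : ℝ) :=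
      fun i => by
        rw [← mul_rpow hc.le (br_pos _).le]
        exact rpow_le_rpow_of_nonpos (mul_pos hc (br_pos _)) (hlow i) (by norm_num)
    have pj := rpow_pos_of_pos (h.pos j) (-(1 / 2) : ℝ)
    have pk := rpow_pos_of_pos (h.pos k) (-(1 / 2) : ℝ)
    have bj := rpow_pos_of_pos (br_pos (j : ℝ)) (-(1 / 2) : ℝ)
    have bk := rpow_pos_of_pos (br_pos (k : ℝ)) (-(1 / 2) : ℝ)
    have cc : c ^ (-(1 / 2) : ℝ) * c ^ (-(1 / 2) : ℝ) = c⁻¹ := by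
      rw [← rpow_add hc, ← rpow_neg_one]; norm_num
    rw [← ofReal_norm, norm_real, norm_of_nonneg (by positivity), ← ofReal_mul (by positivity)]
    refine ofReal_le_ofReal ?_
    calc _ ≤ 1 * lam j ^ (-(1 / 2) : ℝ) * lam k ^ (-(1 / 2) : ℝ) := by gcongr; norm_num
      _ ≤ 1 * (c ^ (-(1 / 2) : ℝ) * br j ^ (-(1 / 2) : ℝ)) * (c ^ (-(1 / 2) : ℝ) * br k ^ (-(1 / 2) : ℝ)) := by
          gcongr
          · exact lo j
          · exact lo k
      _ = _ := by rw [← cc]; ring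
  rw [drivingOp, enorm_mul]
  refine (mul_le_mul' h2 h1).trans ?_
  calc _ ≤ ofReal c⁻¹ * ofReal (br j ^ (-(1 / 2) : ℝ) * br k ^ (-(1 / 2) : ℝ)) *
        (B * (L * ofReal (br (absZ ℓ) ^ (-T))) * bw (-T) (|j| - |k|)) :=
        mul_le_mul' le_rfl (mul_le_mul' (mul_le_mul' le_rfl (hfl ℓ)) le_rfl)
    _ = ofReal c⁻¹ * (B * L) * (ofReal (br (absZ ℓ) ^ (-T)) * bw (-T) (|j| - |k|)) *
        ofReal (br j ^ (-(1 / 2) : ℝ) * br k ^ (-(1 / 2) : ℝ)) := by ring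
    _ ≤ _ := mul_le_mul' (mul_le_mul' le_rfl (ofReal_br_mul_bw_le ℓ _ hT)) le_rfl

end Driving

section MagnusNorm

/-- The constant in the comparison of pointwise decay with the decay norm. -/
def decConst (ν : ℕ) (s T : ℝ) : ℝ≥0∞ := 2 * l2 fun z : 𝕁 ν => wt (s - T) z

lemma decConst_ne_top {s T : ℝ} (h : (ν : ℝ) + 1 < 2 * (T - s)) : decConst ν s T ≠ ⊤ := by
  refine mul_ne_top (by norm_num) (ENNReal.rpow_ne_top_of_nonneg (by norm_num) ?_)
  refine ne_top_of_le_ne_top (tsum_wt_ne_top h) (le_of_eq (tsum_congr fun z => ?_))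
  rw [wt_sq]; congr 1; ring

lemma decayNorm_le_of_decay {s T : ℝ} {c : ℝ≥0∞} {A : Op ν}
    (h : ∀ ℓ j k, ‖A ℓ j k‖ₑ ≤ c * wt (-T) (ℓ, |j| - |k|)) : decayNorm s A ≤ c * decConst ν s T := by
  refine (decayNorm_le_wnorm_ent s A).trans ?_
  have h1 : wnorm s (ent A) ≤ c * l2 fun z : 𝕁 ν => wt (s - T) z := by
    rw [wnorm, ← l2_const_mul]
    refine l2_mono fun z => ?_
    have : ent A z ≤ c * wt (-T) z := by
      refine iSup_le fun j => iSup_le fun k => iSup_le fun hjk => (h z.1 j k).trans (le_of_eq ?_)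
      simp only [wt, br2]
      rw [← Int.cast_abs, hjk, Int.cast_abs]
    calc _ ≤ wt s z * (c * wt (-T) z) := mul_le_mul' le_rfl this
      _ = c * (wt s z * wt (-T) z) := by ring
      _ = _ := by rw [wt_mul, sub_eq_add_neg]
  calc _ ≤ 2 * (c * l2 fun z : 𝕁 ν => wt (s - T) z) := mul_le_mul' le_rfl h1
    _ = _ := by rw [decConst]; ring

/-- Multiplier families `g_ℓ(ω) P(ℓ)`. -/
lemma lipNorm_multiplier_le {s T m : ℝ} (hm : 0 ≤ m) (hw : w ≤ 1) {A : ℝ} (hA : 0 ≤ A) {c : ℝ≥0∞}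
    {g : Freq ν → (𝕀 ν) → ℂ} {P : Op ν}
    (hg : ∀ ω ℓ, ‖g ω ℓ‖ ≤ A * br (absZ ℓ) ^ m)
    (hg' : ∀ ω₁ ω₂ ℓ, ‖g ω₁ ℓ - g ω₂ ℓ‖ ≤ A * br (absZ ℓ) ^ m * ‖ω₁ - ω₂‖)
    (hP : ∀ ℓ j k, ‖P ℓ j k‖ₑ ≤ c * wt (-T) (ℓ, |j| - |k|)) :
    lipNorm R w (decayNorm s) (fun ω ℓ j k => g ω ℓ * P ℓ j k) ≤ 2 * (ofReal A * c * decConst ν s (T - m)) := by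
  have key : ∀ (B : ℝ) (f : (𝕀 ν) → ℂ), 0 ≤ B → (∀ ℓ, ‖f ℓ‖ ≤ B * br (absZ ℓ) ^ m) →
      decayNorm s (fun ℓ j k => f ℓ * P ℓ j k) ≤ ofReal B * c * decConst ν s (T - m) := by
    intro B f hB hf
    refine decayNorm_le_of_decay fun ℓ j k => ?_
    have h1 : ‖f ℓ‖ₑ ≤ ofReal B * wt m (ℓ, |j| - |k|) := by
      rw [wt, ← ofReal_mul hB, ← ofReal_norm]
      refine ofReal_le_ofReal ((hf ℓ).trans ?_)
      exact mul_le_mul_of_nonneg_left (rpow_le_rpow (br_pos _).le (br_absZ_le_br2 _ _) hm) hB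
    rw [enorm_mul]
    calc _ ≤ ofReal B * wt m (ℓ, |j| - |k|) * (c * wt (-T) (ℓ, |j| - |k|)) :=
          mul_le_mul' h1 (hP ℓ j k)
      _ = ofReal B * c * (wt m (ℓ, |j| - |k|) * wt (-T) (ℓ, |j| - |k|)) := by ring
      _ = _ := by rw [wt_mul]; congr 2; ring
  refine le_of_le_of_eq (lipNorm_le (a := ofReal A * c * decConst ν s (T - m))
    (b := ofReal A * c * decConst ν s (T - m)) (fun ω _ => key A (g ω) hA (hg ω))
    fun ω₁ _ ω₂ _ _ => ?_) (two_mul _).symm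
  have e : ((fun ℓ j k => g ω₁ ℓ * P ℓ j k) - fun ℓ j k => g ω₂ ℓ * P ℓ j k : Op ν) =
      fun ℓ j k => (g ω₁ ℓ - g ω₂ ℓ) * P ℓ j k := by
    funext ℓ j k
    simp only [Pi.sub_apply]; ring
  rw [e]
  calc _ ≤ 1 * (ofReal (A * ‖ω₁ - ω₂‖) * c * decConst ν s (T - m)) :=
        mul_le_mul' (ofReal_le_one.2 hw) (key (A * ‖ω₁ - ω₂‖) _ (by positivity)
          fun ℓ => (hg' ω₁ ω₂ ℓ).trans_eq (by ring))
    _ = _ := by rw [ofReal_mul hA, ofReal_norm]; ring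

lemma br_rpow_mul_le {a b : ℝ} (hab : a + b ≤ 0) (ha : a ≤ 2) (hb : b ≤ 2) (j k : ℤ) :
    br j ^ a * br k ^ b ≤ 4 * br (|j| - |k| : ℤ) ^ 2 := by
  have key : ∀ (a b : ℝ) (x y z : ℝ), 1 ≤ x → 1 ≤ y → 1 ≤ z → x ≤ 2 * (z * y) → a + b ≤ 0 → a ≤ 2 →
      0 ≤ a → x ^ a * y ^ b ≤ 4 * z ^ 2 := by
    intro a b x y z hx hy hz hxy hab ha ha0
    have hy0 : 0 < y := by linarith
    have hz0 : 0 < z := by linarith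
    calc x ^ a * y ^ b ≤ (2 * (z * y)) ^ a * y ^ b := by
          gcongr
      _ = (2 * z) ^ a * y ^ (a + b) := by
          rw [← mul_assoc, mul_rpow (by positivity) hy0.le, rpow_add hy0]; ring
      _ ≤ (2 * z) ^ (2 : ℝ) * 1 := by
          gcongr
          · linarith
          · exact rpow_le_one_of_one_le_of_nonpos hy hab
      _ = _ := by rw [rpow_two]; ring
  have br_abs' : ∀ i : ℤ, br i = br (|i| : ℤ) := fun i => by simp [br]
  have h1 : br j ≤ 2 * (br (|j| - |k| : ℤ) * br k) := by
    have := br_add_le_mul ((|j| - |k| : ℤ) : ℝ) ((|k| : ℤ) : ℝ)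
    rwa [← Int.cast_add, sub_add_cancel, ← br_abs' k, ← br_abs' j] at this
  have h2 : br k ≤ 2 * (br (|j| - |k| : ℤ) * br j) := by
    have := br_add_le_mul (-((|j| - |k| : ℤ) : ℝ)) ((|j| : ℤ) : ℝ)
    rw [← Int.cast_neg, ← Int.cast_add, neg_sub, sub_add_cancel, ← br_abs' j, ← br_abs' k] at this
    have e : br (|j| - |k| : ℤ) = br (|k| - |j| : ℤ) := by
      rw [← br_neg, ← Int.cast_neg, neg_sub]
    rwa [e]
  have hj := one_le_br (j : ℝ)
  have hk := one_le_br (k : ℝ)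
  have hz := one_le_br ((|j| - |k| : ℤ) : ℝ)
  rcases le_total 0 a with h0 | h0
  · exact key a b _ _ _ hj hk hz h1 hab ha h0
  · rcases le_total 0 b with h0' | h0'
    · rw [mul_comm]
      exact key b a _ _ _ hk hj hz h2 (by linarith) hb h0'
    · have e1 := rpow_le_one_of_one_le_of_nonpos hj h0
      have e2 := rpow_le_one_of_one_le_of_nonpos hk h0'
      have e3 : (0 : ℝ) ≤ br k ^ b := rpow_nonneg (br_pos _).le _
      nlinarith

variable {S : ℝ}
  {v : (Fin ν → Circ) → Circ → ℝ} {χ : ℝ → ℝ}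

lemma magnusY_eq (γ₀ τ₀ M : ℝ) (ω : Freq ν) (ℓ : 𝕀 ν) (j k : ℤ) :
    magnusY ψ lam v χ γ₀ τ₀ M ω ℓ j k = magnusG χ γ₀ τ₀ M ω ℓ * drivingOp ψ lam v ℓ j k := rfl

/-- The operators `m(j,k) Y_j^k` are bounded by the size of the multiplier. -/
lemma exists_famNorm_magnusY_le (h : EB) (hq : SmoothPot) (hv : IsDriving S v) {τ₀ s : ℝ} (hτ₀ : 0 ≤ τ₀) (hs : 0 ≤ s)
    (hS : 2 * (s + 2 * τ₀ + ν + 6) + 4 ≤ S) :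
    ∃ L : ℝ≥0∞, L ≠ ⊤ ∧ ∀ (R : Set (Freq ν)) (w : ℝ), w ≤ 1 → ∀ (γ₀ M κ : ℝ), 0 ≤ κ →
      (∀ ℓ : 𝕀 ν, (∀ ω, ‖magnusG χ γ₀ τ₀ M ω ℓ‖ ≤ κ * br (absZ ℓ) ^ (2 * τ₀ + 1)) ∧
        ∀ ω₁ ω₂, ‖magnusG χ γ₀ τ₀ M ω₁ ℓ - magnusG χ γ₀ τ₀ M ω₂ ℓ‖ ≤ κ * br (absZ ℓ) ^ (2 * τ₀ + 1) * ‖ω₁ - ω₂‖) →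
      ∀ (a b : ℝ) (m : ℤ → ℤ → ℂ) (D : ℝ), 0 ≤ D →
      (∀ j k : ℤ, ‖m j k‖ * (br j ^ (a - 1 / 2) * br k ^ (b - 1 / 2)) ≤ D * br (|j| - |k| : ℤ) ^ 3) →
      famNorm R w s a b (fun ω ℓ j k => m j k * magnusY ψ lam v χ γ₀ τ₀ M ω ℓ j k) ≤ L * ofReal D * ofReal κ := by
  set T := s + 2 * τ₀ + ν + 6 with hT
  have hν : (0 : ℝ) ≤ ν := cast_nonneg ν
  obtain ⟨L, hL, hdr⟩ := h.exists_driving_bound hq hv (T := T) (by positivity) hS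
  refine ⟨2 * (L * decConst ν s (T - 3 - (2 * τ₀ + 1))), mul_ne_top (by norm_num)
    (mul_ne_top hL (decConst_ne_top (by rw [hT]; linarith))), ?_⟩
  intro R w hw γ₀ M κ hκ hg a b m D hD hm
  have hP : ∀ (ℓ : 𝕀 ν) (j k : ℤ), ‖(br j ^ a : ℝ) * (m j k * drivingOp ψ lam v ℓ j k) * (br k ^ b : ℝ)‖ₑ
        ≤ L * ofReal D * wt (-(T - 3)) (ℓ, |j| - |k|) := by
    intro ℓ j k
    have pj := br_pos (j : ℝ)
    have pk := br_pos (k : ℝ)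
    set W : ℂ := (br j ^ a : ℝ) * m j k * (br k ^ b : ℝ) with hW
    set y := ofReal (br j ^ (-(1 / 2) : ℝ) * br k ^ (-(1 / 2) : ℝ)) with hy
    set z := (ℓ, |j| - |k|)
    have e1 : ‖W‖ₑ * y ≤ ofReal D * wt 3 z := by
      rw [← ofReal_norm, ← ofReal_mul (norm_nonneg _), wt, ← ofReal_mul hD]
      refine ofReal_le_ofReal ?_
      rw [hW, norm_mul, norm_mul, norm_real, norm_real, norm_of_nonneg (by positivity), norm_of_nonneg (by positivity)]
      calc _ = ‖m j k‖ * (br j ^ (a - 1 / 2) * br k ^ (b - 1 / 2)) := by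
            rw [sub_eq_add_neg, sub_eq_add_neg, rpow_add pj, rpow_add pk]; ring
        _ ≤ _ := hm j k
        _ ≤ D * br2 ℓ (|j| - |k|) ^ 3 :=
            mul_le_mul_of_nonneg_left (pow_le_pow_left₀ (br_pos _).le (br_le_br2 _ _) 3) hD
        _ = _ := by norm_num [z]
    calc _ = ‖W‖ₑ * ‖drivingOp ψ lam v ℓ j k‖ₑ := by rw [← enorm_mul]; congr 1; ring
      _ ≤ ‖W‖ₑ * (L * wt (-T) z * y) := mul_le_mul' le_rfl (hdr ℓ j k)
      _ = L * wt (-T) z * (‖W‖ₑ * y) := by ring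
      _ ≤ L * wt (-T) z * (ofReal D * wt 3 z) := mul_le_mul' le_rfl e1
      _ = L * ofReal D * (wt 3 z * wt (-T) z) := by ring
      _ = _ := by rw [wt_mul]; congr 2; ring
  have := lipNorm_multiplier_le (R := R) (w := w) (s := s) (m := 2 * τ₀ + 1) (by linarith) hw
    hκ (fun ω ℓ => (hg ℓ).1 ω) (fun ω₁ ω₂ ℓ => (hg ℓ).2 ω₁ ω₂) hP
  refine (le_of_eq ?_).trans (this.trans (le_of_eq (by ring)))
  rw [famNorm]; congr 1; funext ω ℓ j k
  simp only [weighted, magnusY_eq]; ring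

lemma sandwich_eq (Y : Op ν) : sandwich lam Y = opMul Y (fun ℓ j k => (lam j : ℂ) * Y ℓ j k) := by
  funext ℓ j k
  simp only [sandwich, opMul, mul_assoc]

/-- The size of the perturbation after the Magnus normal form. -/
lemma exists_matNorm_magnusV_le (h : EB) (hq : SmoothPot)
    (hv : IsDriving S v) (hχ : IsCutoff χ) {τ₀ s α : ℝ} (hτ₀ : 0 ≤ τ₀) (hs : (sZero ν : ℝ) ≤ s)
    (hS : 2 * (s + 2 * τ₀ + ν + 6) + 4 ≤ S) (hα0 : 0 ≤ α) (hα1 : α ≤ 1) :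
    ∃ L : ℝ≥0∞, L ≠ ⊤ ∧ ∀ (R : Set (Freq ν)) (w : ℝ), w ≤ 1 → ∀ (γ₀ M : ℝ), 0 < γ₀ * M →
      matNorm R w s α 0 (magnusV ψ lam v χ γ₀ τ₀ M) ≤ L * (ofReal ((γ₀ * M)⁻¹ + (γ₀ * M)⁻¹ ^ 2) +
          ofReal ((γ₀ * M)⁻¹ + (γ₀ * M)⁻¹ ^ 2) ^ 2) ∧
      ∀ ω ∈ R, dn₀ (magnusY ψ lam v χ γ₀ τ₀ M ω) ≠ ⊤ ∧
        dn₀ (fun ℓ j k => (lam j : ℂ) * magnusY ψ lam v χ γ₀ τ₀ M ω ℓ j k) ≠ ⊤ := by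
  have hs0 : (0 : ℝ) ≤ s := (cast_nonneg _).trans hs
  obtain ⟨G, hG0, hG⟩ := hχ.exists_magnusG_bound (ν := ν)
  obtain ⟨c, hc, hc1, hlow, hup, hdiff⟩ := h.exists_lam_bounds
  obtain ⟨L, hL, hest⟩ := exists_famNorm_magnusY_le (χ := χ) h hq hv hτ₀ hs0 hS
  have hc' : 1 ≤ c⁻¹ := (one_le_inv₀ hc).2 hc1
  set E := L * ofReal (8 * c⁻¹) * ofReal G with hE
  have hEt : E ≠ ⊤ := by finiteness
  have hmt := mulConst_ne_top ν s
  set F := 2 * (mulConst ν s * (E * E + E * E)) with hF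
  refine ⟨(decayTerms α 0).card * (E + F), by finiteness, ?_⟩
  intro R w hw γ₀ M hκ
  set κ := (γ₀ * M)⁻¹ + (γ₀ * M)⁻¹ ^ 2 with hκd
  have hκ0 : 0 ≤ κ := by positivity
  set x := ofReal κ with hx
  have hfx : E * x ≠ ⊤ := by finiteness
  set Y := magnusY ψ lam v χ γ₀ τ₀ M with hY
  have hfam : ∀ (a b : ℝ) (m : ℤ → ℤ → ℂ), (∀ j k : ℤ, ‖m j k‖ * (br j ^ (a - 1 / 2) *
      br k ^ (b - 1 / 2)) ≤ 8 * c⁻¹ * br (|j| - |k| : ℤ) ^ 3) →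
      famNorm R w s a b (fun ω ℓ j k => m j k * Y ω ℓ j k) ≤ E * x := fun a b m hm =>
    (hest R w hw γ₀ M (G * κ) (by positivity) (hG γ₀ τ₀ M hκ hτ₀) a b m _
      (by positivity) hm).trans_eq (by rw [ofReal_mul hG0]; ring)
  have bnd_sub : ∀ (a b : ℝ) (m : ℤ → ℤ → ℂ), (∀ j k, ‖m j k‖ ≤ c⁻¹ * br (|j| - |k| : ℤ)) → a + b ≤ 1 → a ≤ 2 → b ≤ 2 →
      famNorm R w s a b (fun ω ℓ j k => m j k * Y ω ℓ j k) ≤ E * x := by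
    refine fun a b m hm hab ha hb => hfam a b m fun j k => ?_
    have pj := br_pos (j : ℝ)
    have pk := br_pos (k : ℝ)
    have pz := br_pos ((|j| - |k| : ℤ) : ℝ)
    have h1 := br_rpow_mul_le (a := a - 1 / 2) (b := b - 1 / 2) (by linarith) (by linarith) (by linarith) j k
    calc _ ≤ c⁻¹ * br (|j| - |k| : ℤ) * (4 * br (|j| - |k| : ℤ) ^ 2) := by
          gcongr
          exact hm j k
      _ = 4 * c⁻¹ * br (|j| - |k| : ℤ) ^ 3 := by ring
      _ ≤ _ := by gcongr; norm_num
  have bnd_add : ∀ (a b : ℝ) (m : ℤ → ℤ → ℂ), (∀ j k : ℤ, ‖m j k‖ ≤ c⁻¹ * br k + c⁻¹ * br j) →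
      a + b ≤ 0 → a ≤ 1 → b ≤ 1 →
      famNorm R w s a b (fun ω ℓ j k => m j k * Y ω ℓ j k) ≤ E * x := by
    refine fun a b m hm hab ha hb => hfam a b m fun j k => ?_
    have h1 := br_rpow_mul_le (a := a - 1 / 2 + 1) (b := b - 1 / 2) (by linarith) (by linarith) (by linarith) j k
    have h2 := br_rpow_mul_le (a := a - 1 / 2) (b := b - 1 / 2 + 1) (by linarith) (by linarith) (by linarith) j k
    have pj := br_pos (j : ℝ)
    have pk := br_pos (k : ℝ)
    rw [rpow_add_one pj.ne'] at h1
    rw [rpow_add_one pk.ne'] at h2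
    calc _ ≤ (c⁻¹ * br k + c⁻¹ * br j) * (br j ^ (a - 1 / 2) * br k ^ (b - 1 / 2)) := by
          gcongr
          exact hm j k
      _ ≤ c⁻¹ * (8 * br (|j| - |k| : ℤ) ^ 2) := by nlinarith
      _ ≤ c⁻¹ * (8 * br (|j| - |k| : ℤ) ^ 3) := by
          gcongr
          exacts [one_le_br _, by norm_num]
      _ = _ := by ring
  have hYn : ∀ a b : ℝ, a + b ≤ 1 → a ≤ 2 → b ≤ 2 → famNorm R w s a b Y ≤ E * x := by
    intro a b hab ha hb
    simpa only [one_mul] using bnd_sub a b (fun _ _ => 1)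
      (fun j k => by rw [norm_one]; nlinarith [one_le_br ((|j| - |k| : ℤ) : ℝ)]) hab ha hb
  have hBY : ∀ a b : ℝ, a + b ≤ 0 → a ≤ 1 → b ≤ 1 →
      famNorm R w s a b (fun ω ℓ j k => (lam j : ℂ) * Y ω ℓ j k) ≤ E * x := fun a b =>
    bnd_add a b (fun j _ => lam j) fun j k => by
      rw [norm_real, norm_of_nonneg (h.pos j).le]; nlinarith [hup j, br_pos (k : ℝ)]
  have mono : ∀ a b A, famNorm R w (sZero ν) a b A ≤ famNorm R w s a b A := fun a b A => by
    have := lipNorm_le_mul (R := R) (w := w) (N := dn₀) (N' := decayNorm s)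
      (f := fun ω => weighted a b (A ω)) (g := fun ω => weighted a b (A ω)) 1
      (fun ω _ => by rw [one_mul]; exact decayNorm_mono_exp hs _)
      (fun ω₁ _ ω₂ _ => by rw [one_mul]; exact decayNorm_mono_exp hs _)
    rwa [one_mul] at this
  have hsand : ∀ a b : ℝ, a + b ≤ 1 → a ≤ 1 → -1 ≤ b → b ≤ 1 → famNorm R w s a b (fun ω => sandwich lam (Y ω)) ≤
        mulConst ν s * (E * x * (E * x) + E * x * (E * x)) := by
    intro a b hab ha hb hb'
    simp only [sandwich_eq]
    have h1 := hYn a (-(-b)) (by linarith) (by linarith) (by linarith)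
    have h2 := hBY (-b) b (by linarith) (by linarith) hb'
    exact famNorm_opMul_le' hs0 (-b) h1 ((mono _ _ _).trans h1) h2 ((mono _ _ _).trans h2) hfx hfx
  have add2 : ∀ (a b : ℝ) (A B : Freq ν → Op ν) (u t : ℝ≥0∞), famNorm R w s a b A ≤ u → famNorm R w s a b B ≤ t →
      famNorm R w s a b (fun ω ℓ j k => A ω ℓ j k + 2 * B ω ℓ j k) ≤ u + 2 * t := by
    intro a b A B u t hA hB
    simp only [two_mul]
    exact (famNorm_add_le s a b A _).trans (add_le_add hA ((famNorm_add_le s a b B B).trans (add_le_add hB hB)))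
  constructor
  · have main : matNorm R w s α 0 (magnusV ψ lam v χ γ₀ τ₀ M) ≤ (decayTerms α 0).card *
        (E * x + 2 * (mulConst ν s * (E * x * (E * x) + E * x * (E * x)))) := by
      refine matNorm_le_card fun ⟨δ, a, b⟩ ht => ?_
      simp only [decayTerms, mem_union, mem_insert, mem_singleton,
        mem_image, mem_product, mem_univ, and_true, Prod.mk.injEq,
        Prod.exists] at ht
      obtain ⟨hab, hab1, ha, hb, hb'⟩ : (δ = false → a + b ≤ 0) ∧ a + b ≤ 1 ∧ a ≤ 1 ∧ -1 ≤ b ∧ b ≤ 1 := by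
        rcases ht with (⟨rfl, rfl, rfl⟩ | ⟨rfl, rfl, rfl⟩ | ⟨rfl, rfl, rfl⟩ | ⟨rfl, rfl, rfl⟩) |
          ⟨ς, δ', hς, rfl, rfl, rfl⟩
        on_goal 5 => rcases hς with rfl | rfl | rfl | rfl | rfl
        all_goals refine ⟨fun h => ?_, ?_, ?_, ?_, ?_⟩ <;> first | linarith | cases h
      cases δ with
      | true =>
        refine add2 a b _ _ _ _ (bnd_sub a b (fun j k => Complex.I * (lam k - lam j : ℝ))
          (fun j k => ?_) hab1 (by linarith) (by linarith)) (hsand a b hab1 ha hb hb')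
        rw [norm_mul, norm_I, one_mul, norm_real, norm_eq_abs, abs_sub_comm]
        exact hdiff j k
      | false =>
        refine add2 a b _ _ _ _ (bnd_add a b (fun j k => -Complex.I * (lam k + lam j : ℝ))
          (fun j k => ?_) (hab rfl) ha hb') (hsand a b hab1 ha hb hb')
        rw [norm_mul, norm_neg, norm_I, one_mul, norm_real, norm_of_nonneg (add_pos (h.pos k) (h.pos j)).le]
        exact add_le_add (hup k) (hup j)
    refine main.trans ?_
    rw [mul_assoc ((decayTerms α 0).card : ℝ≥0∞)]
    refine mul_le_mul' le_rfl ?_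
    calc _ = E * x + F * x ^ 2 := by ring
      _ ≤ (E + F) * x + (E + F) * x ^ 2 :=
          add_le_add (mul_le_mul' le_self_add le_rfl) (mul_le_mul' le_add_self le_rfl)
      _ = _ := (mul_add _ _ _).symm
  · intro ω hω
    have fin : ∀ A : Freq ν → Op ν, famNorm R w s 0 0 A ≤ E * x → dn₀ (A ω) ≠ ⊤ := fun A hA =>
      ne_top_of_le_ne_top hfx ((le_of_eq (congrArg _ (by ext; simp [weighted]))).trans
        ((le_lipNorm (w := w) dn₀ (fun ω => weighted 0 0 (A ω)) hω).trans ((mono 0 0 A).trans hA)))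
    exact ⟨fin Y (hYn 0 0 (by norm_num) (by norm_num) (by norm_num)),
      fin (fun ω ℓ j k => lam j * Y ω ℓ j k) (hBY 0 0 (by norm_num) (by norm_num) (by norm_num))⟩

end MagnusNorm

section MagnusHam

variable {S : ℝ}
  {v : (Fin ν → Circ) → Circ → ℝ} {χ : ℝ → ℝ}

lemma coeFn_sum_smul {ι : Type*} (s : Finset ι) (c : ι → ℂ) (f : ι → L2x) :
    ((∑ i ∈ s, c i • f i : L2x) : Circ → ℂ) =ᵐ[haarAddCircle] fun x => ∑ i ∈ s, c i * (f i : Circ → ℂ) x := by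
  classical
  induction s using Finset.induction_on with
  | empty =>
    simp only [Finset.sum_empty]
    exact Lp.coeFn_zero _ _ _
  | insert a s ha ih =>
    rw [sum_insert ha]
    filter_upwards [ih, Lp.coeFn_add (c a • f a) (∑ i ∈ s, c i • f i), Lp.coeFn_smul (c a) (f a)] with x h1 h2 h3
    rw [h2, Pi.add_apply, h1, h3, sum_insert ha, Pi.smul_apply, smul_eq_mul]

lemma IsEigenbasis.conj_ae_eq (h : EB) (j : ℤ) : ∀ᵐ x ∂haarAddCircle, conj ((ψ j : Circ → ℂ) x) =
      ∑ i ∈ blk j.natAbs, cc ψ i j * (ψ i : Circ → ℂ) x := by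
  have h1 := coeFn_sum_smul (blk j.natAbs) (fun i => cc ψ i j) (fun i => ψ i)
  rw [← h.star_eq_sum] at h1
  filter_upwards [h1, Lp.coeFn_star (ψ j)] with x h2 h3
  rw [← h2, h3]; rfl

lemma conjMat_mul_eq (h : EB) (p : C(Circ, ℂ)) (j k : ℤ) :
    conjMat ψ (fun a b => ∫ x, conj (p x) * (ψ b : Circ → ℂ) x * conj ((ψ a : Circ → ℂ) x) ∂haarAddCircle) j k =
    ∫ x, p x * (ψ k : Circ → ℂ) x * conj ((ψ j : Circ → ℂ) x) ∂haarAddCircle := by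
  have int : ∀ a b : ℤ, Integrable (fun x => p x * ((ψ a : Circ → ℂ) x * conj ((ψ b : Circ → ℂ) x))) haarAddCircle :=
    fun a b => by
      have h1 := MeasureTheory.L2.integrable_inner (𝕜 := ℂ) (ψ b) (ψ a)
      simp only [inner_apply] at h1
      exact h1.bdd_mul (c := ‖p‖) p.continuous.aestronglyMeasurable (Eventually.of_forall fun x => p.norm_coe_le_norm x)
  rw [conjMat_apply]
  have e1 : ∀ a b : ℤ, cc ψ j a * conj (∫ x, conj (p x) * (ψ b : Circ → ℂ) x *
      conj ((ψ a : Circ → ℂ) x) ∂haarAddCircle) * conj (cc ψ b k) =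
      ∫ x, cc ψ j a * conj (cc ψ b k) * (p x * ((ψ a : Circ → ℂ) x * conj ((ψ b : Circ → ℂ) x))) ∂haarAddCircle := by
    intro a b
    rw [MeasureTheory.integral_const_mul, ← integral_conj, mul_right_comm]
    congr 2
    funext x
    simp only [map_mul, conj_conj]; ring
  simp only [e1]
  have e2 : ∀ a : ℤ, ∑ b ∈ blk k.natAbs, ∫ x, cc ψ j a * conj (cc ψ b k) *
        (p x * ((ψ a : Circ → ℂ) x * conj ((ψ b : Circ → ℂ) x))) ∂haarAddCircle =
      ∫ x, ∑ b ∈ blk k.natAbs, cc ψ j a * conj (cc ψ b k) *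
        (p x * ((ψ a : Circ → ℂ) x * conj ((ψ b : Circ → ℂ) x))) ∂haarAddCircle :=
    fun a => (integral_finsetSum _ fun b _ => (int a b).const_mul _).symm
  simp only [e2]
  rw [← integral_finsetSum _ fun a _ =>
    MeasureTheory.integrable_finsetSum _ fun b _ => (int a b).const_mul _]
  refine integral_congr_ae ?_
  filter_upwards [h.conj_ae_eq j, h.conj_ae_eq k] with x hj hk
  have hk' : (ψ k : Circ → ℂ) x = ∑ b ∈ blk k.natAbs, conj (cc ψ b k) * conj ((ψ b : Circ → ℂ) x) := by
    rw [← conj_conj ((ψ k : Circ → ℂ) x), hk, map_sum]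
    simp only [map_mul]
  rw [hj, hk', mul_sum]
  refine sum_congr rfl fun a _ => ?_
  rw [mul_sum, sum_mul]
  refine sum_congr rfl fun b _ => ?_
  rw [cc_comm ψ a j]; ring

lemma adj_drivingOp : adj (drivingOp ψ lam v) = drivingOp ψ lam v := by
  funext ℓ j k
  simp only [adj, drivingOp]
  rw [map_mul, conj_ofReal, ← integral_conj]
  congr 2
  · ring
  · funext x
    rw [map_mul, map_mul, conj_conj, fourierPhi_neg, conj_conj]; ring

lemma conjOp_drivingOp (h : EB) (hv : IsDriving S v) : conjOp ψ (drivingOp ψ lam v) = drivingOp ψ lam v := by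
  funext ℓ j k
  have h1 := conjMat_mul_eq h ⟨fourierPhi v ℓ, hv.continuous_fourierPhi ℓ⟩ j k
  have h2 := conjMat_scale h (fun x y => 1 / 2 * x ^ (-(1 / 2) : ℝ) * y ^ (-(1 / 2) : ℝ))
    (fun a b => ∫ x, conj (fourierPhi v ℓ x) * (ψ b : Circ → ℂ) x * conj ((ψ a : Circ → ℂ) x) ∂haarAddCircle) j k
  simp only [ContinuousMap.coe_mk] at h1
  rw [h1] at h2
  rw [conjOp]
  simp only [← fourierPhi_neg] at h2
  exact h2

lemma conj_magnusG (hχ : IsCutoff χ) (γ₀ τ₀ M : ℝ) (ω : Freq ν) (ℓ : 𝕀 ν) :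
    conj (magnusG χ γ₀ τ₀ M ω (-ℓ)) = magnusG χ γ₀ τ₀ M ω ℓ := by
  have h1 : dot ω (-ℓ) = -dot ω ℓ := by simp [dot]
  rw [magnusG, magnusG, h1, absZ_neg, neg_div, hχ.even]
  simp

lemma adj_magnusY (hχ : IsCutoff χ) (γ₀ τ₀ M : ℝ) (ω : Freq ν) :
    adj (magnusY ψ lam v χ γ₀ τ₀ M ω) = magnusY ψ lam v χ γ₀ τ₀ M ω := by
  funext ℓ j k
  rw [adj, magnusY_eq, magnusY_eq, map_mul, conj_magnusG hχ]
  congr 1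
  exact congrFun (congrFun (congrFun adj_drivingOp ℓ) j) k

lemma conjOp_magnusY (h : EB) (hv : IsDriving S v) (hχ : IsCutoff χ) (γ₀ τ₀ M : ℝ) (ω : Freq ν) :
    conjOp ψ (magnusY ψ lam v χ γ₀ τ₀ M ω) = magnusY ψ lam v χ γ₀ τ₀ M ω := by
  funext ℓ
  have e : magnusY ψ lam v χ γ₀ τ₀ M ω (-ℓ) = magnusG χ γ₀ τ₀ M ω (-ℓ) • drivingOp ψ lam v (-ℓ) := rfl
  rw [conjOp, e, conjMat_smul, conj_magnusG hχ]
  exact congrArg _ (congrFun (conjOp_drivingOp h hv) ℓ)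

lemma conjOp_scale (h : EB) (F : ℝ → ℝ → ℝ) (A : Op ν) : conjOp ψ (fun ℓ a b => (F (lam a) (lam b) : ℂ) * A ℓ a b) =
      fun ℓ j k => (F (lam j) (lam k) : ℂ) * conjOp ψ A ℓ j k := by
  funext ℓ j k
  exact conjMat_scale h F (A (-ℓ)) j k

lemma isHam_magnusV (h : EB) (hv : IsDriving S v) (hχ : IsCutoff χ)
    {γ₀ τ₀ M : ℝ} {ω : Freq ν} (f₁ : dn₀ (magnusY ψ lam v χ γ₀ τ₀ M ω) ≠ ⊤)
    (f₂ : dn₀ (fun ℓ j k => (lam j : ℂ) * magnusY ψ lam v χ γ₀ τ₀ M ω ℓ j k) ≠ ⊤) :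
    (magnusV ψ lam v χ γ₀ τ₀ M ω).IsHam ψ := by
  set Y := magnusY ψ lam v χ γ₀ τ₀ M ω with hY
  have aY : adj Y = Y := adj_magnusY hχ γ₀ τ₀ M ω
  have cY : conjOp ψ Y = Y := conjOp_magnusY h hv hχ γ₀ τ₀ M ω
  have aY' : ∀ ℓ j k, conj (Y (-ℓ) k j) = Y ℓ j k := fun ℓ j k =>
    congrFun (congrFun (congrFun aY ℓ) j) k
  have aS : adj (sandwich lam Y) = sandwich lam Y := by
    rw [sandwich_eq, adj_opMul, aY]
    funext ℓ j k
    simp only [opMul, adj, map_mul, conj_ofReal, aY']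
    exact tsum_congr fun a => by ring
  have cS : conjOp ψ (sandwich lam Y) = sandwich lam Y := by
    rw [sandwich_eq, conjOp_opMul h.conjStable f₁ f₂, cY, conjOp_scale h (fun x _ => x) Y, cY]
  have ed : (magnusV ψ lam v χ γ₀ τ₀ M ω).d =
      Complex.I • (fun ℓ j k => ((lam k - lam j : ℝ) : ℂ) * Y ℓ j k) + (2 : ℂ) • sandwich lam Y := by
    funext ℓ j k
    simp only [magnusV, Pi.add_apply, Pi.smul_apply, smul_eq_mul, ← hY, mul_assoc]
  have eo : (magnusV ψ lam v χ γ₀ τ₀ M ω).o = (-Complex.I) • (fun ℓ j k => ((lam k + lam j : ℝ) : ℂ) * Y ℓ j k) +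
        (2 : ℂ) • sandwich lam Y := by
    funext ℓ j k
    simp only [magnusV, Pi.add_apply, Pi.smul_apply, smul_eq_mul, ← hY, mul_assoc]
  rw [isHam_iff, ed, eo]
  constructor
  · rw [adj_add, adj_smul, adj_smul, aS]
    congr 1
    · funext ℓ j k
      simp only [adj, Pi.smul_apply, smul_eq_mul, map_mul, conj_ofReal, aY', conj_I]
      push_cast; ring
    · rw [Complex.conj_ofNat]
  · rw [adj_add, adj_smul, adj_smul, aS, conjOp_add, conjOp_smul, conjOp_smul, cS,
      conjOp_scale h (fun x y => y + x) Y, cY]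
    congr 2
    funext ℓ j k
    simp only [adj, map_mul, conj_ofReal, aY']
    push_cast; ring

end MagnusHam

lemma wnorm_le_of_kernel {r : ℝ} (hr : 0 ≤ r) (hr' : r ≤ sZero ν) {A : ℝ≥0∞} {f g : 𝕁 ν → ℝ≥0∞} {k : ℤ → ℤ → ℝ≥0∞}
    (hk : ∀ y x, k y x ≤ A * bw (-(sZero ν + 2)) (|x| - |y|))
    (hf : ∀ ℓ y, f (ℓ, y) ≤ ∑' x, k y x * g (ℓ, x)) :
    wnorm r f ≤ A * (ofReal (2 ^ (sZero ν : ℝ)) * bwSum 2) * wnorm r g := by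
  set B := A * ofReal (2 ^ (sZero ν : ℝ)) with hB
  set C := A * (ofReal (2 ^ (sZero ν : ℝ)) * bwSum 2) with hC
  have pw : ∀ (ℓ : 𝕀 ν) (x y : ℤ), wt r (ℓ, y) ≤ ofReal (2 ^ (sZero ν : ℝ)) * (wt r (ℓ, x) * bw r (|x| - |y|)) := by
    intro ℓ x y
    have h1 : br2 ℓ y ≤ 2 * (br2 ℓ x * br (|x| - |y| : ℤ)) := by
      have e1 := one_le_br2 ℓ x
      have e2 := one_le_br ((|x| - |y| : ℤ) : ℝ)
      have e3 := absZ_le_br2 ℓ x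
      have e4 : |(y : ℝ)| ≤ |(x : ℝ)| + |((|x| - |y| : ℤ) : ℝ)| := by
        push_cast
        have := neg_abs_le (|(x : ℝ)| - |(y : ℝ)|)
        linarith
      have e5 := (abs_le_br (x : ℝ)).trans (br_le_br2 ℓ x)
      have e6 := abs_le_br ((|x| - |y| : ℤ) : ℝ)
      refine max_le (by nlinarith) (max_le (by nlinarith) (by nlinarith))
    have p1 := br2_pos ℓ x
    have p2 := br_pos ((|x| - |y| : ℤ) : ℝ)
    rw [wt, wt, bw, ← ofReal_mul (by positivity), ← ofReal_mul (by positivity)]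
    refine ofReal_le_ofReal ?_
    calc _ ≤ (2 * (br2 ℓ x * br (|x| - |y| : ℤ))) ^ r :=
          rpow_le_rpow (br2_pos _ _).le h1 hr
      _ = 2 ^ r * (br2 ℓ x ^ r * br (|x| - |y| : ℤ) ^ r) := by
          rw [mul_rpow (by norm_num) (by positivity), mul_rpow p1.le p2.le]
      _ ≤ _ := by
          gcongr
          norm_num
  have bound : ∀ ℓ y, wt r (ℓ, y) * f (ℓ, y) ≤ ∑' x : ℤ, B * bw (-2) (|x| - |y|) * (wt r (ℓ, x) * g (ℓ, x)) := by
    intro ℓ y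
    calc _ ≤ wt r (ℓ, y) * ∑' x, k y x * g (ℓ, x) := mul_le_mul' le_rfl (hf ℓ y)
      _ = ∑' x, wt r (ℓ, y) * (k y x * g (ℓ, x)) := ENNReal.tsum_mul_left.symm
      _ ≤ _ := tsum_le_tsum fun x => by
          calc _ ≤ ofReal (2 ^ (sZero ν : ℝ)) * (wt r (ℓ, x) * bw r (|x| - |y|)) *
                (A * bw (-(sZero ν + 2)) (|x| - |y|) * g (ℓ, x)) :=
                mul_le_mul' (pw ℓ x y) (mul_le_mul' (hk y x) le_rfl)
            _ = B * (bw r (|x| - |y|) * bw (-(sZero ν + 2)) (|x| - |y|)) * (wt r (ℓ, x) * g (ℓ, x)) := by rw [hB]; ring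
            _ ≤ _ := by
                rw [bw_mul]
                exact mul_le_mul' (mul_le_mul' le_rfl (bw_mono (by linarith) _)) le_rfl
  have fib : ∀ ℓ, l2 (fun y => wt r (ℓ, y) * f (ℓ, y)) ≤ C * l2 fun x => wt r (ℓ, x) * g (ℓ, x) := by
    intro ℓ
    refine (l2_mono (bound ℓ)).trans (l2_schur (fun y x => B * bw (-2) (|x| - |y|)) C ?_ ?_ _)
    · intro y
      rw [ENNReal.tsum_mul_left, hC, ← mul_assoc]
      exact mul_le_mul' le_rfl (tsum_bw_abs_le 2 y)
    · intro x
      rw [ENNReal.tsum_mul_left, hC, ← mul_assoc]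
      refine mul_le_mul' le_rfl (le_of_eq_of_le (tsum_congr fun y => ?_) (tsum_bw_abs_le 2 x))
      rw [bw, bw, ← neg_sub, Int.cast_neg, br_neg]
  rw [wnorm, l2_le_iff, mul_pow, wnorm, l2_sq, tsum_prod', tsum_prod', ← ENNReal.tsum_mul_left]
  refine tsum_le_tsum fun ℓ => ?_
  have := pow_le_pow_left' (fib ℓ) 2
  rwa [mul_pow, l2_sq, l2_sq] at this

lemma sobNorm_eq_wnorm (r : ℝ) (u : L2 ν) : sobNorm r u = wnorm r fun a => ‖fourierCoeff (u a.1 : Circ → ℂ) a.2‖ₑ := by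
  rw [sobNorm, wnorm, l2]
  congr 1
  refine tsum_congr fun a => ?_
  rw [mul_pow, wt_sq]; rfl

/-- The Sobolev norms may be computed in the eigenfunction basis. -/
lemma IsEigenbasis.exists_sobNorm_equiv (h : EB) (hq : SmoothPot) (ν : ℕ) :
    ∃ E : ℝ≥0∞, E ≠ ⊤ ∧ ∀ r : ℝ, 0 ≤ r → r ≤ sZero ν → ∀ u : L2 ν,
      sobNorm r u ≤ E * psiNorm ψ r u ∧ psiNorm ψ r u ≤ E * sobNorm r u := by
  obtain ⟨A, hA, hloc⟩ := h.exists_localised hq (sZero ν + 2)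
  refine ⟨A * (ofReal (2 ^ (sZero ν : ℝ)) * bwSum 2), mul_ne_top hA
    (mul_ne_top ofReal_ne_top (bwSum_ne_top (by norm_num))), fun r hr hr' u => ?_⟩
  rw [sobNorm_eq_wnorm]
  constructor
  · refine wnorm_le_of_kernel hr hr' (k := fun a j => ‖fourierCoeff (ψ j : Circ → ℂ) a‖ₑ) (fun a j => ?_) fun ℓ a => ?_
    · refine (hloc j a).trans_eq ?_
      rw [bw, bw, ← neg_sub |j|, Int.cast_neg, br_neg]
    · have h1 := ψ.hasSum_inner_mul_inner (fourierBasis (T := 2 * pi) a) (u ℓ)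
      rw [← repr_apply_apply, fourierBasis_repr] at h1
      simp only
      rw [← h1.tsum_eq]
      refine enorm_tsum_le_tsum_enorm.trans (tsum_le_tsum fun j => ?_)
      rw [enorm_mul, ← repr_apply_apply, fourierBasis_repr, ← repr_apply_apply]
      rfl
  · refine wnorm_le_of_kernel hr hr' (k := fun j a => ‖fourierCoeff (ψ j : Circ → ℂ) a‖ₑ)
      (fun j a => hloc j a) fun ℓ j => ?_
    simp only [coef]
    rw [repr_apply_apply]
    exact enorm_inner_le_tsum _ _

lemma opNorm_le_of_psiNorm2 {E : ℝ≥0∞} {r : ℝ}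
    (hE : ∀ u : L2 ν, sobNorm r u ≤ E * psiNorm ψ r u ∧ psiNorm ψ r u ≤ E * sobNorm r u)
    {T : 𝔏 ν} {c : ℝ≥0∞}
    (h : ∀ u, psiNorm2 ψ r (T u) ≤ c * psiNorm2 ψ r u) : opNorm r T ≤ 2 * E ^ 2 * c := by
  refine sInf_le fun u _ => ?_
  have h1 : ∀ u : L2 ν × L2 ν, sobNorm2 r u ≤ sobNorm r u.1 + sobNorm r u.2 := fun u => by
    rw [sobNorm2, rpow_half_le_iff, add_sq]
    exact add_le_add le_self_add le_rfl
  have h2 : ∀ u : L2 ν × L2 ν, sobNorm r u.1 + sobNorm r u.2 ≤ 2 * sobNorm2 r u := fun u => by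
    have e : ∀ x y : ℝ≥0∞, x ≤ (x ^ 2 + y ^ 2) ^ (1 / 2 : ℝ) := fun x y => by
      calc x = (x ^ 2) ^ (1 / 2 : ℝ) := (sq_rpow_half x).symm
        _ ≤ _ := ENNReal.rpow_le_rpow le_self_add (by norm_num)
    rw [two_mul]
    refine add_le_add (e _ _) ?_
    rw [sobNorm2, add_comm]
    exact e _ _
  calc sobNorm2 r (T u) ≤ E * psiNorm2 ψ r (T u) := by
        refine (h1 _).trans ?_
        rw [psiNorm2, mul_add]
        exact add_le_add (hE _).1 (hE _).1
    _ ≤ E * (c * (E * (2 * sobNorm2 r u))) := by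
        refine mul_le_mul' le_rfl ((h u).trans (mul_le_mul' le_rfl ?_))
        refine le_trans ?_ (mul_le_mul' le_rfl (h2 u))
        rw [psiNorm2, mul_add]
        exact add_le_add (hE _).2 (hE _).2
    _ = _ := by ring


/-- The algebra of `φ`-dependent operators. -/
def phiAlg (ν : ℕ) : Subalgebra ℂ (𝔏 ν) where
  carrier := {W | IsPhiDependent W}
  mul_mem' := fun {A B} hA hB m u u' h => hA m (B u) (B u') (hB m u u' h)
  add_mem' := fun {A B} hA hB m u u' h ℓ => by
    have h1 := hA m u u' h ℓ
    have h2 := hB m u u' h ℓ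
    simp only [add_apply, fst_add, snd_add, lp.coeFn_add, Pi.add_apply]
    exact ⟨congrArg₂ _ h1.1 h2.1, congrArg₂ _ h1.2 h2.2⟩
  algebraMap_mem' := fun c m u u' h ℓ => by
    simp only [Algebra.algebraMap_eq_smul_one, smul_apply, smul_fst, smul_snd, lp.coeFn_smul, Pi.smul_apply]
    exact ⟨congrArg _ (h ℓ).1, congrArg _ (h ℓ).2⟩

lemma isClosed_phiAlg : IsClosed (phiAlg ν : Set (𝔏 ν)) := by
  have e : (phiAlg ν : Set (𝔏 ν)) = ⋂ m, ⋂ u : L2 ν × L2 ν,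
      ⋂ u' : L2 ν × L2 ν, ⋂ _ : ∀ ℓ, u'.1 ℓ = u.1 (ℓ - m) ∧ u'.2 ℓ = u.2 (ℓ - m), ⋂ ℓ,
      {W | (W u').1 ℓ = (W u).1 (ℓ - m) ∧ (W u').2 ℓ = (W u).2 (ℓ - m)} := by
    ext W
    simp only [Set.mem_iInter]
    exact Iff.rfl
  have c : ∀ ℓ, Continuous fun u : L2 ν => u ℓ := fun ℓ =>
    (lp.evalCLM ℂ (fun _ : 𝕀 ν => L2x) 2 ℓ).continuous
  have a : ∀ u : L2 ν × L2 ν, Continuous fun W : 𝔏 ν => W u :=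
    fun u => (ContinuousLinearMap.apply ℂ (L2 ν × L2 ν) u).continuous
  rw [e]
  refine isClosed_iInter fun m => isClosed_iInter fun u => isClosed_iInter fun u' =>
    isClosed_iInter fun _ => isClosed_iInter fun ℓ => IsClosed.inter ?_ ?_
  · exact isClosed_eq ((c _).comp (continuous_fst.comp (a _))) ((c _).comp (continuous_fst.comp (a _)))
  · exact isClosed_eq ((c _).comp (continuous_snd.comp (a _))) ((c _).comp (continuous_snd.comp (a _)))

lemma toCLM_shift {A : Op ν} (hA : dn₀ A ≠ ⊤) {m : 𝕀 ν} {u u' : L2 ν}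
    (h : ∀ ℓ, u' ℓ = u (ℓ - m)) (ℓ : 𝕀 ν) : toCLM ψ A u' ℓ = toCLM ψ A u (ℓ - m) := by
  refine ψ.repr.injective (lp.ext (funext fun j => ?_))
  have h1 := realizes_toCLM ψ hA u' ℓ j
  have h2 := realizes_toCLM ψ hA u (ℓ - m) j
  rw [← ((Equiv.addRight m).prodCongr (Equiv.refl ℤ)).hasSum_iff] at h1
  refine h1.unique ?_
  convert h2 using 2 with a
  simp only [Function.comp_apply, Equiv.prodCongr_apply, Prod.map, Equiv.coe_addRight,
    Equiv.refl_apply, coef, h, add_sub_cancel_right, sub_sub, add_comm m]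
  rfl

lemma toCLM_mem_phiAlg (hψ : CS) {A : OpMat ν} (hA : Fin0 A) : A.toCLM ψ ∈ phiAlg ν := by
  intro m u u' h ℓ
  have c := fun {A : Op ν} (h : dn₀ A ≠ ⊤) => decayNorm_conjOp_ne_top hψ h
  have h1 := fun ℓ => (h ℓ).1
  have h2 := fun ℓ => (h ℓ).2
  simp only [OpMat.toCLM_apply, lp.coeFn_add, lp.coeFn_neg, Pi.add_apply, Pi.neg_apply]
  rw [toCLM_shift hA.1 h1, toCLM_shift hA.2 h2, toCLM_shift (c hA.1) h2, toCLM_shift (c hA.2) h1]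
  exact ⟨rfl, rfl⟩

lemma exp_mem_phiAlg {T : 𝔏 ν} (h : T ∈ phiAlg ν) : exp T ∈ phiAlg ν := by
  have h1 := hasSum_divPow T
  rw [← h1.tsum_eq]
  exact tsum_mem isClosed_phiAlg fun n => (phiAlg ν).smul_mem (pow_mem h n) _

section Bounds
variable {r : ℝ}

lemma psiNorm2_smul_le (c : ℂ) (u : L2 ν × L2 ν) : psiNorm2 ψ r (c • u) ≤ ‖c‖ₑ * psiNorm2 ψ r u := by
  have : ∀ u : L2 ν, psiNorm ψ r (c • u) = ‖c‖ₑ * psiNorm ψ r u := fun u => by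
    simp only [psiNorm, wnorm, coef_smul, enorm_mul, ← l2_const_mul]
    congr 1; funext a; ring
  rw [psiNorm2, psiNorm2, smul_fst, smul_snd, this, this, mul_add]

lemma psiNorm2_add_le (u v : L2 ν × L2 ν) : psiNorm2 ψ r (u + v) ≤ psiNorm2 ψ r u + psiNorm2 ψ r v :=
  (add_le_add (psiNorm_add_le r _ _) (psiNorm_add_le r _ _)).trans_eq (by rw [psiNorm2, psiNorm2]; ring)

lemma lowerSemicontinuous_psiNorm2 : LowerSemicontinuous (psiNorm2 ψ r : L2 ν × L2 ν → ℝ≥0∞) := by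
  have h : LowerSemicontinuous (psiNorm ψ r : L2 ν → ℝ≥0∞) := by
    refine Continuous.comp_lowerSemicontinuous (g := fun x : ℝ≥0∞ => x ^ (1 / 2 : ℝ))
      continuous_rpow_const ?_ (ENNReal.monotone_rpow_of_nonneg (by norm_num))
    refine lowerSemicontinuous_tsum fun a => Continuous.lowerSemicontinuous ?_
    exact (ENNReal.continuous_pow 2).comp ((ENNReal.continuous_const_mul (wt_ne_top _ _)).comp
      (continuous_enorm.comp (continuous_coef a.1 a.2)))
  exact (h.comp continuous_fst).add (h.comp continuous_snd)

lemma csub_psiNorm2 : CSub (psiNorm2 ψ r : L2 ν × L2 ν → ℝ≥0∞) :=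
  csub_of_lowerSemicontinuous (by simpa using psiNorm2_smul_le (ψ := ψ) (r := r) 0 (0 : L2 ν × L2 ν))
    psiNorm2_add_le lowerSemicontinuous_psiNorm2

/-- `T` is bounded by `c` in the Sobolev norm of order `r`. -/
def SBdd (ψ : 𝔹) (r c : ℝ) (T : 𝔏 ν) : Prop :=
  ∀ u, psiNorm2 ψ r (T u) ≤ ofReal c * psiNorm2 ψ r u

variable {c c' : ℝ} {S T : 𝔏 ν}

namespace SBdd

lemma mono (h : SBdd ψ r c T) (hc : c ≤ c') : SBdd ψ r c' T := fun u =>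
  (h u).trans (mul_le_mul' (ofReal_le_ofReal hc) le_rfl)

lemma one : SBdd ψ r 1 (1 : 𝔏 ν) := fun u => by simp

lemma add (h : SBdd ψ r c S) (h' : SBdd ψ r c' T) (hc : 0 ≤ c) (hc' : 0 ≤ c') : SBdd ψ r (c + c') (S + T) := fun u => by
  rw [ofReal_add hc hc', add_mul, add_apply]
  exact (psiNorm2_add_le _ _).trans (add_le_add (h u) (h' u))

lemma mul (h : SBdd ψ r c S) (h' : SBdd ψ r c' T) (hc : 0 ≤ c) : SBdd ψ r (c * c') (S * T) :=
  fun u => by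
  rw [ofReal_mul hc, mul_assoc]
  exact (h _).trans (mul_le_mul' le_rfl (h' u))

lemma smul (h : SBdd ψ r c T) {z : ℂ} (hz : ‖z‖ ≤ 1) : SBdd ψ r c (z • T) := fun u =>
  (psiNorm2_smul_le z (T u)).trans ((mul_le_of_le_one_left' (by
    rwa [← ofReal_norm, ofReal_le_one])).trans (h u))

lemma of_tendsto {F : ℕ → 𝔏 ν} (hF : Tendsto F atTop (nhds T)) (h : ∀ᶠ n in atTop, SBdd ψ r c (F n)) :
    SBdd ψ r c T := fun u => by
  have h1 : Tendsto (fun n => F n u) atTop (nhds (T u)) :=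
    ((ContinuousLinearMap.apply ℂ (L2 ν × L2 ν) u).continuous.tendsto T).comp hF
  have h2 := (lowerSemicontinuous_psiNorm2 (ν := ν) (ψ := ψ) (r := r)).isClosed_preimage (ofReal c * psiNorm2 ψ r u)
  exact h2.mem_of_tendsto h1 (h.mono fun n hn => hn u)

lemma exp_sub_one (h : SBdd ψ r c T) (hc : 0 ≤ c) (hc' : c ≤ 1 / 2) : SBdd ψ r (2 * c) (exp T - 1) := fun u => by
  have h1 := (hasSum_nat_add_iff' 1).2 (hasSum_divPow T)
  simp only [Finset.sum_range_one, divPow, pow_zero, Nat.factorial_zero, Nat.cast_one, inv_one, one_smul] at h1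
  have h2 := h1.mapL (ContinuousLinearMap.apply ℂ (L2 ν × L2 ν) u)
  refine (csub_psiNorm2 _ _ _ h2).trans ?_
  have hp : ∀ n, SBdd ψ r (c ^ n) (T ^ n) := fun n => by
    induction n with
    | zero => simpa using one
    | succ n ih => rw [pow_succ, pow_succ]; exact ih.mul h (pow_nonneg hc n)
  have h3 : ∀ n : ℕ, SBdd ψ r (c * (1 / 2) ^ n) (((n + 1).factorial : ℂ)⁻¹ • T ^ (n + 1)) := fun n =>
    ((hp (n + 1)).smul (by
      rw [norm_inv, Complex.norm_natCast]
      exact inv_le_one_of_one_le₀ (by exact_mod_cast Nat.factorial_pos _))).mono (by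
      rw [pow_succ']
      exact mul_le_mul_of_nonneg_left (pow_le_pow_left₀ hc hc' n) hc)
  refine (tsum_le_tsum fun n => h3 n u).trans ?_
  rw [ENNReal.tsum_mul_right]
  refine mul_le_mul' (le_of_eq ?_) le_rfl
  rw [← ofReal_tsum_of_nonneg (fun n => by positivity)
    (summable_geometric_two.mul_left c), tsum_mul_left, tsum_geometric_two, mul_comm]

lemma norm_le (h : SBdd ψ 0 c T) (hc : 0 ≤ c) : ‖T‖ ≤ 2 * c := by
  have := enorm_clm_le_of_psiNorm2 h
  rw [← ofReal_norm] at this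
  generalize ‖T‖ = x at this ⊢
  rwa [← ofReal_ofNat, ← ofReal_mul (by norm_num), ofReal_le_ofReal_iff (by positivity)] at this

end SBdd

/-- A sequence `F 0 = 1` whose factors `F (p + 1) F(p)⁻¹` or `F(p)⁻¹ F (p + 1)` are geometrically
close to `1`. -/
structure NearOne (ψ : 𝔹) (d : ℕ → ℝ)
    (F : ℕ → 𝔏 ν) : Prop where
  nonneg : ∀ p, 0 ≤ d p
  half : ∀ p, d (p + 1) ≤ 1 / 2 * d p
  small : d 0 ≤ 1 / 8
  zero : F 0 = 1
  step : ∀ p, ∃ D, (∀ r : ℝ, 0 ≤ r → r ≤ sZero ν → SBdd ψ r (2 * d p) D) ∧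
    (F (p + 1) = F p + F p * D ∨ F (p + 1) = F p + D * F p)

namespace NearOne
variable {d : ℕ → ℝ} {F : ℕ → 𝔏 ν} (h : NearOne ψ d F)
include h

lemma le_geom (p : ℕ) : d p ≤ d 0 * (1 / 2) ^ p := by
  induction p with
  | zero => simp
  | succ p ih => rw [pow_succ]; linarith [h.half p]

lemma le_small (p : ℕ) : d p ≤ 1 / 8 :=
  (h.le_geom p).trans ((mul_le_of_le_one_right (h.nonneg 0) (pow_le_one₀ (by norm_num) (by norm_num))).trans h.small)

lemma bdd (hr : 0 ≤ r) (hr' : r ≤ sZero ν) (p : ℕ) : SBdd ψ r (2 - 8 * d p) (F p) := by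
  induction p with
  | zero => rw [h.zero]; exact SBdd.one.mono (by linarith [h.small])
  | succ p ih =>
    obtain ⟨D, hD, hF⟩ := h.step p
    have hD := hD r hr hr'
    have h1 := h.nonneg p
    have h2 := h.le_small p
    have h3 : 0 ≤ 2 - 8 * d p := by linarith
    have h4 : (2 - 8 * d p) + (2 - 8 * d p) * (2 * d p) ≤ 2 - 8 * d (p + 1) := by
      nlinarith [h.half p]
    rcases hF with hF | hF
    · rw [hF]
      exact (ih.add (ih.mul hD h3) h3 (by positivity)).mono h4
    · rw [hF]
      exact (ih.add (hD.mul ih (by positivity)) h3 (by positivity)).mono (by linarith)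

lemma bdd_succ_sub (hr : 0 ≤ r) (hr' : r ≤ sZero ν) (p : ℕ) : SBdd ψ r (4 * d p) (F (p + 1) - F p) := by
  obtain ⟨D, hD, hF⟩ := h.step p
  have hD := hD r hr hr'
  have h1 := h.nonneg p
  have hb := (h.bdd hr hr' p).mono (c' := 2) (by linarith)
  rcases hF with hF | hF
  · rw [hF, add_sub_cancel_left]
    exact (hb.mul hD (by norm_num)).mono (by linarith)
  · rw [hF, add_sub_cancel_left]
    exact (hD.mul hb (by positivity)).mono (by linarith)

lemma bdd_sub (hr : 0 ≤ r) (hr' : r ≤ sZero ν) (p k : ℕ) : SBdd ψ r (8 * d p) (F (p + k) - F p) := by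
  have : SBdd ψ r (8 * d p - 8 * d (p + k)) (F (p + k) - F p) ∧ d (p + k) ≤ d p := by
    induction k with
    | zero => exact ⟨fun u => by simpa using psiNorm2_smul_le (ψ := ψ) (r := r) 0 u, le_rfl⟩
    | succ k ih =>
      have h1 := h.half (p + k)
      have h2 := h.nonneg (p + k)
      refine ⟨?_, ?_⟩
      · have := (h.bdd_succ_sub hr hr' (p + k)).add ih.1 (by positivity) (by linarith [ih.2])
        rw [sub_add_sub_cancel] at this
        exact this.mono (by rw [← add_assoc]; linarith)
      · rw [← add_assoc]; linarith [ih.2]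
  exact this.1.mono (by linarith [h.nonneg (p + k)])

lemma exists_limit : ∃ W, Tendsto F atTop (nhds W) := by
  refine cauchySeq_tendsto_of_complete (cauchySeq_of_le_geometric (1 / 2) (8 * d 0) (by norm_num) fun p => ?_)
  rw [dist_comm, dist_eq_norm]
  refine ((h.bdd_succ_sub le_rfl (cast_nonneg _) p).norm_le (by linarith [h.nonneg p])).trans ?_
  linarith [h.le_geom p]

variable {W : 𝔏 ν} (hW : Tendsto F atTop (nhds W))
include hW

lemma bdd_limit (hr : 0 ≤ r) (hr' : r ≤ sZero ν) : SBdd ψ r 2 W :=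
  .of_tendsto hW (.of_forall fun p => (h.bdd hr hr' p).mono (by linarith [h.nonneg p]))

lemma bdd_limit_sub (hr : 0 ≤ r) (hr' : r ≤ sZero ν) (p : ℕ) : SBdd ψ r (8 * d p) (W - F p) := by
  refine .of_tendsto (hW.sub_const (F p)) ((Filter.eventually_ge_atTop p).mono fun q hq => ?_)
  obtain ⟨k, rfl⟩ := Nat.exists_eq_add_of_le hq
  exact h.bdd_sub hr hr' p k

end NearOne
end Bounds

section Flow
variable {X : ℕ → OpMat ν}

lemma flow_mul_flowInv (p : ℕ) : flow ψ X p * flowInv ψ X p = 1 ∧ flowInv ψ X p * flow ψ X p = 1 := by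
  induction p with
  | zero => exact ⟨mul_one 1, mul_one 1⟩
  | succ p ih =>
    have h1 := exp_neg_mul_exp (Complex.I • (X p).toCLM ψ)
    have h2 := exp_neg_mul_exp (-(Complex.I • (X p).toCLM ψ))
    rw [neg_neg] at h2
    rw [flow, flowInv]
    constructor
    · rw [mul_assoc, ← mul_assoc (exp _), h2, one_mul, ih.1]
    · rw [mul_assoc, ← mul_assoc (flowInv ψ X p), ih.2, one_mul, h1]

lemma flow_mem_phiAlg (hψ : CS) (hX : ∀ p, Fin0 (X p)) (p : ℕ) : flow ψ X p ∈ phiAlg ν := by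
  induction p with
  | zero => exact one_mem _
  | succ p ih =>
    exact mul_mem ih (exp_mem_phiAlg ((phiAlg ν).smul_mem (toCLM_mem_phiAlg hψ (hX p)) _))

variable {d : ℕ → ℝ} (h0 : ∀ p, 0 ≤ d p) (hh : ∀ p, d (p + 1) ≤ 1 / 2 * d p) (hd : d 0 ≤ 1 / 8)
  (hX : ∀ p, ∀ r : ℝ, 0 ≤ r → r ≤ sZero ν → SBdd ψ r (d p) ((X p).toCLM ψ))
include h0 hh hd hX

lemma nearOne_flow : NearOne ψ d (flow ψ X) ∧ NearOne ψ d (flowInv ψ X) := by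
  have hs : ∀ p, d p ≤ 1 / 8 := fun p => by
    induction p with
    | zero => exact hd
    | succ p ih => linarith [hh p, h0 p]
  refine ⟨⟨h0, hh, hd, rfl, fun p => ⟨_, fun r hr hr' => SBdd.exp_sub_one
    ((hX p r hr hr').smul (z := Complex.I) (by simp)) (h0 p) (by linarith [hs p]), .inl ?_⟩⟩,
    ⟨h0, hh, hd, rfl, fun p => ⟨_, fun r hr hr' => SBdd.exp_sub_one
    ((hX p r hr hr').smul (z := -Complex.I) (by simp)) (h0 p) (by linarith [hs p]), .inr ?_⟩⟩⟩
  · rw [flow, mul_sub, mul_one, add_sub_cancel]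
  · rw [flowInv, sub_mul, one_mul, add_sub_cancel]
    congr 2
    exact (neg_smul Complex.I ((X p).toCLM ψ)).symm

/-- The limit of the flows. -/
lemma exists_flow_limit : ∃ W : (L2 ν × L2 ν) ≃L[ℂ] (L2 ν × L2 ν), Tendsto (flow ψ X) atTop (nhds (W : 𝔏 ν)) ∧
    Tendsto (flowInv ψ X) atTop (nhds (W.symm : 𝔏 ν)) := by
  obtain ⟨hf, hi⟩ := nearOne_flow h0 hh hd hX
  obtain ⟨A, hA⟩ := hf.exists_limit
  obtain ⟨B, hB⟩ := hi.exists_limit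
  have h1 : A * B = 1 := tendsto_nhds_unique (hA.mul hB)
    (by simpa only [(flow_mul_flowInv _).1] using tendsto_const_nhds)
  have h2 : B * A = 1 := tendsto_nhds_unique (hB.mul hA)
    (by simpa only [(flow_mul_flowInv _).2] using tendsto_const_nhds)
  exact ⟨ContinuousLinearEquiv.equivOfInverse A B (fun u => DFunLike.congr_fun h2 u)
    (fun u => DFunLike.congr_fun h1 u), hA, hB⟩

end Flow

lemma sbdd_toCLM (hψ : CS) {r : ℝ} (hr : 0 ≤ r) (hr' : r ≤ sZero ν) {A : OpMat ν} {a : ℝ} (hd : dn₀ A.d ≤ ofReal a)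
    (ho : dn₀ A.o ≤ ofReal a) :
    SBdd ψ r (18 * (actConst ν).toReal * a) (A.toCLM ψ) := fun u => by
  refine (psiNorm2_toCLM_le hψ hr hr' ⟨ne_top_of_le_ne_top ofReal_ne_top hd,
    ne_top_of_le_ne_top ofReal_ne_top ho⟩ u).trans (mul_le_mul' ?_ le_rfl)
  refine (mul_le_mul' le_rfl (add_le_add hd ho)).trans (le_of_eq ?_)
  rw [ofReal_mul (by positivity), ofReal_mul (by norm_num), ofReal_toReal (actConst_ne_top ν), ← mul_two,
    show ofReal 18 = 9 * 2 by rw [ofReal_ofNat]; norm_num]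
  ring

lemma le_geom_of_half {a : ℕ → ℝ} (h : ∀ p, a (p + 1) ≤ 1 / 2 * a p) (p i : ℕ) : a (p + i) ≤ a p * (1 / 2) ^ i := by
  induction i with
  | zero => simp
  | succ i ih => rw [pow_succ, ← add_assoc]; linarith [h (p + i)]

lemma tendsto_zero_of_half {a : ℕ → ℝ} (h0 : ∀ p, 0 ≤ a p) (h : ∀ p, a (p + 1) ≤ 1 / 2 * a p) :
    Tendsto a atTop (nhds 0) := by
  refine squeeze_zero h0 (fun p => by simpa using le_geom_of_half h 0 p) ?_
  simpa using (tendsto_pow_atTop_nhds_zero_of_lt_one (r := (1 / 2 : ℝ)) (by norm_num) (by norm_num)).const_mul (a 0)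

lemma tsum_ofReal_le_of_half {a : ℕ → ℝ} (h0 : ∀ p, 0 ≤ a p) (h : ∀ p, a (p + 1) ≤ 1 / 2 * a p)
    (p : ℕ) : ∑' i, ofReal (a (p + i)) ≤ ofReal (2 * a p) := by
  refine (tsum_le_tsum fun i => ofReal_le_ofReal (le_geom_of_half h p i)).trans ?_
  rw [← ofReal_tsum_of_nonneg (fun n => mul_nonneg (h0 p) (by positivity))
    (summable_geometric_two.mul_left _), tsum_mul_left, tsum_geometric_two, mul_comm]

lemma Conjugates.comp {ω : Freq ν} {Φ Φ' V V' V'' : 𝔏 ν}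
    {H H' H'' : Mat} (h : Conjugates ψ ω Φ H V H' V') (h' : Conjugates ψ ω Φ' H' V' H'' V'') :
    Conjugates ψ ω (Φ * Φ') H V H'' V'' := fun u f => (h (Φ' u) (Φ' f)).trans (h' u f)

variable (ψ lam γ τ α M V₀) in
/-- The limit of the normal forms. -/
def kamHinf (ω : Freq ν) : Mat := diagMat lam + ∑' p, avgBlk (𝓥 p ω)

local notation "𝓗∞" => kamHinf ψ lam γ τ α M V₀

lemma enorm_avgBlk_le (V : OpMat ν) (ℓ : 𝕀 ν) (j k : ℤ) : ‖(if ℓ = 0 then avgBlk V else 0) j k‖ₑ ≤ ‖V.d ℓ j k‖ₑ := by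
  by_cases h : ℓ = 0
  · rw [if_pos h, avgBlk, h]; split_ifs <;> simp
  · rw [if_neg h]; simp

namespace SmallData
variable (h : SmallData ψ γ τ α M e b₁ C V₀)
include h

lemma size_half (p : ℕ) : lowSize τ (p + 1) * e ≤ 1 / 2 * (lowSize τ p * e) := by
  have := mul_le_mul_of_nonneg_right (lowSize_succ_le h.τ_pos p) h.e_nonneg
  linarith

lemma lowSize_mul_nonneg (p : ℕ) : 0 ≤ lowSize τ p * e := mul_nonneg (lowSize_pos τ p).le h.e_nonneg

variable {ω : Freq ν} (hω : ω ∈ annulus ν M)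
include hω

lemma decayNorm_kamV_le (p : ℕ) : dn₀ (𝓥 p ω).d ≤ ofReal (lowSize τ p * e) ∧ dn₀ (𝓥 p ω).o ≤ ofReal (lowSize τ p * e) :=
  ⟨(decayNorm_entry_le hω true).trans (h.stepInv lam p).low, (decayNorm_entry_le hω false).trans (h.stepInv lam p).low⟩

lemma hasSum_avgBlk (p : ℕ) : HasSum (fun i => avgBlk (𝓥 (p + i) ω)) (𝓗∞ ω - 𝓗 p ω) := by
  have hs : Summable fun i => avgBlk (𝓥 i ω) := by
    refine Pi.summable.2 fun j => Pi.summable.2 fun k => Summable.of_norm_bounded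
      ((summable_geometric_two).mul_left (lowSize τ 0 * e)) fun i => ?_
    refine le_trans ?_ (by simpa using le_geom_of_half (a := fun p => lowSize τ p * e) h.size_half 0 i)
    rw [← ofReal_le_ofReal_iff (h.lowSize_mul_nonneg i), ofReal_norm]
    refine le_trans ?_ (h.decayNorm_kamV_le (lam := lam) hω i).1
    exact (by simpa using enorm_avgBlk_le (𝓥 i ω) 0 j k : _ ≤ ‖(𝓥 i ω).d 0 j k‖ₑ).trans
      (enorm_le_decayNorm (cast_nonneg _) _ 0 j k)
  have e : ∀ p, 𝓗 p ω = diagMat lam + ∑ i ∈ range p, avgBlk (𝓥 i ω) := fun p => by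
    induction p with
    | zero => rw [kamH_zero]; simp
    | succ p ih => rw [kamH_succ, ih, sum_range_succ, add_assoc]
  rw [e, kamHinf, add_sub_add_left_eq_sub]
  simp only [add_comm p]
  exact (hasSum_nat_add_iff' p).2 hs.hasSum

lemma tendsto_kamH (j k : ℤ) : Tendsto (fun p => 𝓗 p ω j k) atTop (nhds (𝓗∞ ω j k)) := by
  have h1 := (h.hasSum_avgBlk (lam := lam) hω 0).tendsto_sum_nat
  have h2 := ((tendsto_pi_nhds.1 (tendsto_pi_nhds.1 h1 j) k)).add_const (𝓗 0 ω j k)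
  have e : ∀ p, 𝓗 p ω = 𝓗 0 ω + ∑ i ∈ range p, avgBlk (𝓥 (0 + i) ω) := fun p => by
    induction p with
    | zero => simp
    | succ p ih => rw [kamH_succ, ih, sum_range_succ, add_assoc, zero_add]
  refine (h2.congr fun p => ?_).trans_eq (by simp)
  rw [e p, Pi.add_apply, Pi.add_apply, add_comm]

lemma kamHinf_blockDiag {j k : ℤ} (hjk : j.natAbs ≠ k.natAbs) : 𝓗∞ ω j k = 0 :=
  tendsto_nhds_unique (h.tendsto_kamH hω j k) (by simpa only [kamH_blockDiag _ ω hjk] using tendsto_const_nhds)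

lemma kamHinf_hermitian (n : ℕ) : (block (𝓗∞ ω) n).IsHermitian := by
  ext j k
  refine tendsto_nhds_unique ((continuous_conj.tendsto _).comp
    (h.tendsto_kamH hω (k : ℤ) j)) ((h.tendsto_kamH hω (j : ℤ) k).congr fun p => ?_)
  exact (congrFun (congrFun ((h.stepInv lam p).herm ω hω n) j) k).symm

/-- The difference between the limit and the `p`-th normal form, as an operator. -/
lemma exists_kamHinf_sub (p : ℕ) : ∃ D : OpMat ν, dn₀ D.d ≤ ofReal (2 * (lowSize τ p * e)) ∧ D.o = 0 ∧
    (∀ j k : ℤ, j.natAbs = k.natAbs → 𝓗∞ ω j k = 𝓗 p ω j k + D.d 0 j k) := by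
  refine ⟨⟨fun ℓ => if ℓ = 0 then 𝓗∞ ω - 𝓗 p ω else 0, 0⟩, ?_, rfl, fun j k _ => by simp⟩
  have hs : HasSum (fun i ℓ => if ℓ = (0 : 𝕀 ν) then avgBlk (𝓥 (p + i) ω) else 0)
      (fun ℓ => if ℓ = 0 then 𝓗∞ ω - 𝓗 p ω else 0) := Pi.hasSum.2 fun ℓ => by
    by_cases hℓ : ℓ = 0
    · simpa only [if_pos hℓ] using h.hasSum_avgBlk hω p
    · simpa only [if_neg hℓ] using hasSum_zero
  refine (csub_decayNorm _ _ _ _ hs).trans ((tsum_le_tsum fun i => ?_).trans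
    (tsum_ofReal_le_of_half h.lowSize_mul_nonneg h.size_half p))
  refine le_trans ?_ (h.decayNorm_kamV_le (lam := lam) hω (p + i)).1
  simpa using decayNorm_le_of_entry (s := sZero ν) (c := 1) (B := (𝓥 (p + i) ω).d)
    fun ℓ j k => by simpa using enorm_avgBlk_le (𝓥 (p + i) ω) ℓ j k

omit hω in
variable (lam) in
lemma lipNorm_kamHinf_le (p n : ℕ) : ofReal (KAM.br n ^ α) * lA (hsBlock n) (fun ω => 𝓗∞ ω - 𝓗 p ω) ≤
      ofReal (2 * (lowSize τ p * e)) := by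
  refine (mul_le_mul' le_rfl ((csub_hsBlock n).lipNorm_hasSum fun ω hω => h.hasSum_avgBlk hω p)).trans ?_
  rw [← ENNReal.tsum_mul_left]
  refine (tsum_le_tsum fun i => ?_).trans (tsum_ofReal_le_of_half h.lowSize_mul_nonneg h.size_half p)
  exact (lipNorm_avgBlk_le (cast_nonneg (sZero ν)) _ n).trans (h.stepInv lam (p + i)).low

end SmallData

lemma GInvBound.of_close {ω : Freq ν} {H H' : Mat} {ε : ℤ} (hε : |ε| ≤ 1) {ℓ : 𝕀 ν} {n m : ℕ}
    {c c' b : ℝ} (h : GInvBound ω H ε ℓ n m c) (hc : c ≤ c') (hc' : 0 ≤ c')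
    (hn : ‖block H n - block H' n‖ ≤ b) (hm : ‖block H m - block H' m‖ ≤ b)
    (hb : c' * (2 * b) ≤ 1 / 2) : GInvBound ω H' ε ℓ n m (2 * c') := by
  have key : ∀ X, ‖X‖ ≤ 2 * c' * ‖gOp ω H' ε ℓ n m X‖ := fun X => by
    have h1 := h.2 X
    rw [hs_eq_norm, hs_eq_norm] at h1
    have h2 : ‖gOp ω H ε ℓ n m X - gOp ω H' ε ℓ n m X‖ ≤ 2 * b * ‖X‖ := by
      rw [gOp_eq_syl, gOp_eq_syl]
      refine (norm_syl_sub_le _ _ _ _ _ _ X).trans (mul_le_mul_of_nonneg_right ?_ (norm_nonneg X))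
      rw [sub_self, abs_zero, ← smul_sub, norm_smul, norm_intCast]
      have h3 : |(ε : ℝ)| ≤ 1 := by exact_mod_cast hε
      have := mul_le_mul h3 hm (norm_nonneg _) zero_le_one
      linarith
    have h3 := norm_le_norm_add_norm_sub' (gOp ω H ε ℓ n m X) (gOp ω H' ε ℓ n m X)
    have h4 := mul_le_mul hc (h3.trans (add_le_add_right h2 _)) (norm_nonneg _) hc'
    have h5 := mul_le_mul_of_nonneg_right hb (norm_nonneg X)
    nlinarith
  refine ⟨?_, fun X => by rw [hs_eq_norm, hs_eq_norm]; exact key X⟩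
  have e : gOp ω H' ε ℓ n m = syl (dot ω ℓ) (block H' n) ((ε : ℂ) • block H' m) :=
    funext fun X => gOp_eq_syl ω H' ε ℓ n m X
  have hi : Injective (gOp ω H' ε ℓ n m) := by
    rw [e]
    refine (injective_iff_map_eq_zero _).2 fun X hX => norm_le_zero_iff.1 ?_
    have := key X
    rwa [e, hX, norm_zero, mul_zero] at this
  refine ⟨hi, ?_⟩
  rw [e] at hi ⊢
  exact LinearMap.injective_iff_surjective.1 hi

lemma SmallData.omegaInf_subset (h : SD) (hC : 8 ≤ C) (p : ℕ) :
    omegaInf γ₀ τ₀ γ τ α M 𝓗∞ ⊆ omegaSeq γ₀ τ₀ γ τ α M 16 𝓗 p := by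
  induction p with
  | zero => exact fun ω hω => hω.1
  | succ p ih =>
    intro ω hω
    refine ⟨ih hω, fun ε ℓ n m hI hℓ => ?_⟩
    have hN : 1 ≤ 𝐍 p := by linarith [sixteen_le_scale p]
    have hMγ : 0 < M ^ α := rpow_pos_of_pos h.M_pos α
    have hγ := h.γ_pos
    have h1 : 1 ≤ KAM.br ((n : ℝ) + ε * m) ^ α :=
      one_le_rpow (le_max_left _ _) h.α_pos.le
    have hb : ∀ n : ℕ, ‖block (𝓗∞ ω) n - block (𝓗 p ω) n‖ ≤ 2 * (lowSize τ p * e) := fun n => by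
      have h2 := (mul_le_mul' le_rfl (le_lipNorm (hsBlock n) (fun ω => 𝓗∞ ω - 𝓗 p ω)
        hω.1.1)).trans (h.lipNorm_kamHinf_le lam p n)
      rw [hsBlock_eq_enorm, rblk_sub, ← ofReal_norm] at h2
      rw [← ofReal_le_ofReal_iff (by linarith [h.lowSize_mul_nonneg p])]
      refine le_trans (le_mul_of_one_le_left' ?_) h2
      rw [one_le_ofReal]
      exact one_le_rpow (le_max_left _ _) h.α_pos.le
    have := GInvBound.of_close (H' := 𝓗 p ω) (c' := 𝐍 p ^ τ / γ *
      (M ^ α / KAM.br ((n : ℝ) + ε * m) ^ α)) (b := 2 * (lowSize τ p * e))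
      (by rcases hI with rfl | ⟨rfl, -⟩ <;> simp) (hω.2 ε ℓ n m hI) ?_ (by positivity)
      (hb n) (hb m) ?_
    · rw [show 2 * 𝐍 p ^ τ / γ * (M ^ α / KAM.br ((n : ℝ) + ε * m) ^ α) =
        2 * (𝐍 p ^ τ / γ * (M ^ α / KAM.br ((n : ℝ) + ε * m) ^ α)) by ring]
      exact this
    · refine mul_le_mul_of_nonneg_right (div_le_div_of_nonneg_right ?_ hγ.le) (by positivity)
      exact rpow_le_rpow (by rw [KAM.br]; positivity) (max_le hN (by rwa [abs_of_nonneg (absZ_nonneg ℓ)])) h.τ_pos.le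
    · have h3 : M ^ α / KAM.br ((n : ℝ) + ε * m) ^ α ≤ M ^ α := div_le_self hMγ.le h1
      have h4 : 𝐍 p ^ τ * lowSize τ p ≤ ratio τ p :=
        mul_le_mul_of_nonneg_right (rpow_le_rpow_of_exponent_le hN (by linarith [h.τ_pos])) (lowSize_pos τ p).le
      have h5 := h.const_ratio_le p
      have h6 := mul_le_mul_of_nonneg_right h4 h.size_nonneg
      have h7 := mul_nonneg (ratio_pos τ p).le h.size_nonneg
      have h8 := mul_le_mul_of_nonneg_right hC h7
      calc _ ≤ 𝐍 p ^ τ / γ * M ^ α * (2 * (2 * (lowSize τ p * e))) :=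
            mul_le_mul_of_nonneg_right (mul_le_mul_of_nonneg_left h3 (by positivity))
              (by linarith [h.lowSize_mul_nonneg p])
        _ = 4 * (𝐍 p ^ τ * lowSize τ p * (M ^ α / γ * e)) := by ring
        _ ≤ _ := by linarith

lemma tendsto_toCLM_zero (hψ : CS) {A : ℕ → OpMat ν} {a : ℕ → ℝ} (h0 : ∀ p, 0 ≤ a p) (ha : Tendsto a atTop (nhds 0))
    (hd : ∀ p, dn₀ (A p).d ≤ ofReal (a p))
    (ho : ∀ p, dn₀ (A p).o ≤ ofReal (a p)) :
    Tendsto (fun p => (A p).toCLM ψ) atTop (nhds 0) := by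
  refine squeeze_zero_norm (fun p => (sbdd_toCLM hψ le_rfl (cast_nonneg _) (hd p) (ho p)).norm_le
    (mul_nonneg (by positivity) (h0 p))) ?_
  simpa using (ha.const_mul (18 * (actConst ν).toReal)).const_mul 2

lemma SmallData.conjugates_limit (h : SD) {ω : Freq ν} (hω : ω ∈ annulus ν M) {P Q : ℕ → 𝔏 ν}
    (hc : ∀ p, Conjugates ψ ω (P p) (diagMat lam) ((V₀ ω).toCLM ψ) (𝓗 p ω) ((𝓥 p ω).toCLM ψ))
    (hPQ : ∀ p, P p * Q p = 1) {W W' : 𝔏 ν} (hW : W' * W = 1)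
    (hP : Tendsto P atTop (nhds W)) (hQ : Tendsto Q atTop (nhds W')) :
    Conjugates ψ ω W (diagMat lam) ((V₀ ω).toCLM ψ) (𝓗∞ ω) 0 := by
  choose D hDd hDo hD using h.exists_kamHinf_sub (lam := lam) hω
  have z0 : Tendsto (fun p => 2 * (lowSize τ p * e)) atTop (nhds 0) := by
    simpa using (tendsto_zero_of_half h.lowSize_mul_nonneg h.size_half).const_mul 2
  have fD : ∀ p, Fin0 (D p) := fun p => ⟨ne_top_of_le_ne_top ofReal_ne_top (hDd p), by
    rw [hDo, decayNorm_zero]; exact ENNReal.zero_ne_top⟩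
  have hA : Tendsto (fun p => (diagPart (D p)).toCLM ψ) atTop (nhds 0) := by
    refine tendsto_toCLM_zero h.conjStable (fun p => by linarith [h.lowSize_mul_nonneg p]) z0
      (fun p => le_trans ?_ (hDd p)) fun p => ?_
    · refine (decayNorm_le_of_entry (c := 1) fun ℓ j k => ?_).trans_eq (one_mul _)
      rw [one_mul, diagPart]
      dsimp only
      split_ifs <;> simp
    · rw [diagPart, decayNorm_zero]; exact zero_le
  have hV : Tendsto (fun p => (𝓥 p ω).toCLM ψ) atTop (nhds 0) :=
    tendsto_toCLM_zero h.conjStable h.lowSize_mul_nonneg (tendsto_zero_of_half h.lowSize_mul_nonneg h.size_half)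
      (fun p => (h.decayNorm_kamV_le hω p).1) fun p => (h.decayNorm_kamV_le hω p).2
  have ap : ∀ {F : ℕ → 𝔏 ν} {T} {x : ℕ → L2 ν × L2 ν} {y}, Tendsto F atTop (nhds T) → Tendsto x atTop (nhds y) →
      Tendsto (fun p => F p (x p)) atTop (nhds (T y)) := fun hF hx =>
    (isBoundedBilinearMap_apply.continuous.tendsto (_, _)).comp (hF.prodMk_nhds hx)
  intro u f
  rw [isImage_iff_mem, isImage_iff_mem, zero_apply, sub_zero]
  constructor
  · intro hu
    have hW' : ∀ u, W' (W u) = u := fun u => DFunLike.congr_fun hW u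
    have q : ∀ u, Tendsto (fun p => Q p (W u)) atTop (nhds u) := fun u => by
      simpa only [hW'] using ap hQ (tendsto_const_nhds (x := W u))
    have hm : ∀ p, (Q p (W u), Q p (W f) - (𝓥 p ω).toCLM ψ (Q p (W u)) +
        (diagPart (D p)).toCLM ψ (Q p (W u))) ∈ relSub ψ ω (𝓗∞ ω) := fun p => by
      have hP' : ∀ u, P p (Q p u) = u := fun u => DFunLike.congr_fun (hPQ p) u
      rw [mem_relSub_succ h.conjStable (fD p) (hD p), add_sub_cancel_right, ← isImage_iff_mem,
        ← hc p, hP', hP', isImage_iff_mem]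
      exact hu
    have lim := (q u).prodMk_nhds (((q f).sub (ap hV (q u))).add (ap hA (q u)))
    simp only [zero_apply, sub_zero, add_zero] at lim
    exact (isClosed_relSub _).mem_of_tendsto lim (.of_forall hm)
  · intro hu
    have hm : ∀ p, (P p u, P p (f - (diagPart (D p)).toCLM ψ u + (𝓥 p ω).toCLM ψ u) -
        (V₀ ω).toCLM ψ (P p u)) ∈ relSub ψ ω (diagMat lam) := fun p => by
      rw [← isImage_iff_mem, hc p, isImage_iff_mem, add_sub_cancel_right, ← mem_relSub_succ h.conjStable (fD p) (hD p)]
      exact hu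
    have hc : ∀ u : L2 ν × L2 ν, Tendsto (fun _ : ℕ => u) atTop (nhds u) :=
      fun u => tendsto_const_nhds
    have lim := (ap hP (hc u)).prodMk_nhds ((ap hP (((hc f).sub (ap hA (hc u))).add
      (ap hV (hc u)))).sub (ap (F := fun _ => (V₀ ω).toCLM ψ) tendsto_const_nhds
      (ap hP (hc u))))
    simp only [zero_apply, sub_zero, add_zero] at lim
    exact (isClosed_relSub _).mem_of_tendsto lim (.of_forall hm)


/-- The off-diagonal entry of a block, `0` if the block is a singleton. -/
def offDiag (A : Mat) (n : ℕ) : ℂ := if n = 0 then 0 else A n (-n)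

/-- The eigenvalues of a self-adjoint block: the smaller one for `s = -1` and the larger one
for `s = 1`. -/
def eig (s : ℝ) (A : Mat) (n : ℕ) : ℝ :=
  ((A n n).re + (A (-n) (-n)).re) / 2 + s * ‖(⟨((A n n).re - (A (-n) (-n)).re) / 2, ‖offDiag A n‖⟩ : ℂ)‖

lemma eig_le (A : Mat) (n : ℕ) : eig (-1) A n ≤ eig 1 A n := by
  rw [eig, eig]
  linarith [norm_nonneg (⟨((A n n).re - (A (-n) (-n)).re) / 2, ‖offDiag A n‖⟩ : ℂ)]

lemma enorm_eig_sub_le {s : ℝ} (hs : |s| ≤ 1) (A B : Mat) (n : ℕ) :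
    ‖eig s A n - eig s B n‖ₑ ≤ 3 * hsBlock n (A - B) := by
  have hb : ∀ j ∈ blk n, ∀ k ∈ blk n, ‖(A - B) j k‖ₑ ≤ hsBlock n (A - B) := fun j hj k hk => by
    have := ENNReal.rpow_le_rpow (enorm_sq_le_hsSq (A - B) hj hk) (by norm_num : (0 : ℝ) ≤ 1 / 2)
    rwa [← rpow_natCast, ← ENNReal.rpow_mul, Nat.cast_ofNat, mul_one_div_cancel two_ne_zero, ENNReal.rpow_one] at this
  have p : (n : ℤ) ∈ blk n := mem_blk.2 (by simp)
  have m : -(n : ℤ) ∈ blk n := mem_blk.2 (by simp)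
  have key : |eig s A n - eig s B n| ≤ ‖(A - B) n n‖ + ‖(A - B) (-n) (-n)‖ + ‖(A - B) n (-n)‖ := by
    have o : ‖offDiag A n - offDiag B n‖ ≤ ‖(A - B) n (-n)‖ := by
      rw [offDiag, offDiag]; split_ifs <;> simp
    have ho := (abs_norm_sub_norm_le (offDiag A n) (offDiag B n)).trans o
    have h1 := abs_re_le_norm ((A - B) n n)
    have h2 := abs_re_le_norm ((A - B) (-n) (-n))
    simp only [Pi.sub_apply, sub_re] at h1 h2
    set z : ℂ := ⟨((A n n).re - (A (-n) (-n)).re) / 2, ‖offDiag A n‖⟩ with hz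
    set w : ℂ := ⟨((B n n).re - (B (-n) (-n)).re) / 2, ‖offDiag B n‖⟩ with hw
    have h3 := (abs_norm_sub_norm_le z w).trans (Complex.norm_le_abs_re_add_abs_im _)
    have h4 : (z - w).re = ((A n n).re - (B n n).re) / 2 - ((A (-n) (-n)).re - (B (-n) (-n)).re) / 2 := by
      rw [hz, hw, sub_re]; ring
    have h5 : (z - w).im = ‖offDiag A n‖ - ‖offDiag B n‖ := rfl
    have h6 : |s * (‖z‖ - ‖w‖)| ≤ |‖z‖ - ‖w‖| := by
      rw [abs_mul]; exact mul_le_of_le_one_left (abs_nonneg _) hs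
    rw [h4, h5] at h3
    have h7 := abs_sub (((A n n).re - (B n n).re) / 2) (((A (-n) (-n)).re - (B (-n) (-n)).re) / 2)
    have h8 := abs_add_le (((A n n).re - (B n n).re) / 2) (((A (-n) (-n)).re - (B (-n) (-n)).re) / 2)
    have h9 : eig s A n - eig s B n = (((A n n).re - (B n n).re) / 2 +
        ((A (-n) (-n)).re - (B (-n) (-n)).re) / 2) + s * (‖z‖ - ‖w‖) := by
      rw [eig, eig]; ring
    rw [h9]
    refine (abs_add_le _ _).trans ?_
    rw [abs_div, abs_div, abs_two] at h7 h8
    simp only [Pi.sub_apply] at *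
    linarith
  have e : ∀ j k : ℤ, ofReal ‖(A - B) j k‖ = ‖(A - B) j k‖ₑ := fun j k => ofReal_norm _
  rw [← ofReal_norm, norm_eq_abs]
  refine (ofReal_le_ofReal key).trans ?_
  rw [ofReal_add (by positivity) (norm_nonneg _), ofReal_add (norm_nonneg _) (norm_nonneg _), e, e, e]
  refine (add_le_add (add_le_add (hb _ p _ p) (hb _ m _ m)) (hb _ p _ m)).trans_eq ?_
  ring

lemma eig_diagMat (lam : ℤ → ℝ) (n : ℕ) : eig (-1) (diagMat lam) n = min (lam n) (lam (-n)) ∧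
    eig 1 (diagMat lam) n = max (lam n) (lam (-n)) := by
  have ho : offDiag (diagMat lam) n = 0 := by
    rw [offDiag, diagMat]
    split_ifs with h1 h2
    · rfl
    · omega
    · rfl
  have e : ∀ s, eig s (diagMat lam) n = (lam n + lam (-n)) / 2 + s * |(lam n - lam (-n)) / 2| := fun s => by
    rw [eig, ho, norm_zero]
    simp only [diagMat, if_true, ofReal_re]
    rw [show (⟨(lam n - lam (-n)) / 2, 0⟩ : ℂ) = (((lam n - lam (-n)) / 2 : ℝ) : ℂ) from rfl, norm_real, norm_eq_abs]
  rw [e, e, abs_div, abs_two]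
  rcases le_total (lam n) (lam (-n)) with h | h
  · rw [min_eq_left h, max_eq_right h, abs_of_nonpos (by linarith)]
    constructor <;> ring
  · rw [min_eq_right h, max_eq_left h, abs_of_nonneg (by linarith)]
    constructor <;> ring

lemma mem_spectrum_block (A : Mat) (n : ℕ) (z : ℂ) : z ∈ spectrum ℂ (block A n) ↔
    (if n = 0 then z - A 0 0 else (z - A n n) * (z - A (-n) (-n)) - A n (-n) * A (-n) n) = 0 := by
  rw [spectrum.mem_iff, Matrix.isUnit_iff_isUnit_det, isUnit_iff_ne_zero, not_not, Algebra.algebraMap_eq_smul_one]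
  split_ifs with hn
  · subst hn
    let u : Unique (blk 0) := ⟨⟨⟨0, by simp [blk]⟩⟩, fun a => Subtype.ext (by
      have := a.2
      simpa [blk] using this)⟩
    rw [Matrix.det_unique]
    simp only [Matrix.sub_apply, Matrix.smul_apply, one_apply_eq, smul_eq_mul, mul_one]
    exact Iff.rfl
  · have hne : (n : ℤ) ≠ -n := by omega
    let f : Fin 2 → blk n := ![⟨n, mem_blk.2 (by simp)⟩, ⟨-n, mem_blk.2 (by simp)⟩]
    have hf : Bijective f := by
      refine ⟨fun i j h => ?_, fun a => ?_⟩
      · fin_cases i <;> fin_cases j <;> simp [f, Subtype.ext_iff] at h ⊢ <;> omega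
      · rcases Int.natAbs_eq (a : ℤ) with h | h
        · exact ⟨0, Subtype.ext (by rw [h, mem_blk.1 a.2]; rfl)⟩
        · exact ⟨1, Subtype.ext (by rw [h, mem_blk.1 a.2]; rfl)⟩
    rw [← Matrix.det_submatrix_equiv_self (Equiv.ofBijective f hf), Matrix.det_fin_two]
    have h01 : (⟨n, mem_blk.2 (by simp)⟩ : blk n) ≠ ⟨-n, mem_blk.2 (by simp)⟩ := fun h =>
      hne (congrArg Subtype.val h)
    simp only [Matrix.submatrix_apply, Equiv.ofBijective_apply, Matrix.sub_apply, Matrix.smul_apply,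
      f, Matrix.cons_val_zero, Matrix.cons_val_one, one_apply_eq, smul_eq_mul, mul_one,
      one_apply_ne h01, one_apply_ne h01.symm, mul_zero, zero_sub, neg_mul_neg]
    exact Iff.rfl

lemma spectrum_block {A : Mat} {n : ℕ} (h : (block A n).IsHermitian) :
    spectrum ℂ (block A n) = {(eig (-1) A n : ℂ), (eig 1 A n : ℂ)} := by
  have hc : ∀ j ∈ blk n, ∀ k ∈ blk n, conj (A k j) = A j k := fun j hj k hk =>
    congrFun (congrFun h ⟨j, hj⟩) ⟨k, hk⟩
  have p : (n : ℤ) ∈ blk n := mem_blk.2 (by simp)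
  have m : -(n : ℤ) ∈ blk n := mem_blk.2 (by simp)
  ext z
  rw [mem_spectrum_block, Set.mem_insert_iff, Set.mem_singleton_iff, ← sub_eq_zero (b := (eig _ A n : ℂ)),
    ← sub_eq_zero (b := (eig 1 A n : ℂ)), ← mul_eq_zero]
  have ea := conj_eq_iff_re.1 (hc _ p _ p)
  have ed := conj_eq_iff_re.1 (hc _ m _ m)
  set R := ‖(⟨((A n n).re - (A (-n) (-n)).re) / 2, ‖offDiag A n‖⟩ : ℂ)‖ with hR
  have hR2 : R ^ 2 = (((A n n).re - (A (-n) (-n)).re) / 2) ^ 2 + ‖offDiag A n‖ ^ 2 := by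
    rw [hR, Complex.sq_norm, Complex.normSq_mk]; ring
  have e : (z - (eig (-1) A n : ℂ)) * (z - (eig 1 A n : ℂ)) =
      (z - A n n) * (z - A (-n) (-n)) - (‖offDiag A n‖ ^ 2 : ℝ) := by
    have : ((R ^ 2 : ℝ) : ℂ) = _ := congrArg _ hR2
    rw [eig, eig, ← hR, ← ea, ← ed]
    push_cast at this ⊢
    simp only [ofReal_re]
    linear_combination -this
  rw [e]
  split_ifs with hn
  · subst hn
    simp [offDiag]
  · rw [offDiag, if_neg hn, ← normSq_eq_norm_sq, ← mul_conj, hc _ m _ p]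


namespace NearOne
variable {d : ℕ → ℝ} {F : ℕ → 𝔏 ν} (h : NearOne ψ d F)
  {W : 𝔏 ν} (hW : Tendsto F atTop (nhds W))
  {E : ℝ≥0∞} {r : ℝ} (hr : 0 ≤ r) (hr' : r ≤ sZero ν)
  (hE : ∀ u : L2 ν, sobNorm r u ≤ E * psiNorm ψ r u ∧ psiNorm ψ r u ≤ E * sobNorm r u)
include h hr hr' hE

lemma opNorm_lt_top (hE' : E ≠ ⊤) (p : ℕ) : opNorm r (F p) < ⊤ :=
  (opNorm_le_of_psiNorm2 hE (h.bdd hr hr' p)).trans_lt (by finiteness)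

include hW

lemma opNorm_limit_lt_top (hE' : E ≠ ⊤) : opNorm r W < ⊤ :=
  (opNorm_le_of_psiNorm2 hE (h.bdd_limit hW hr hr')).trans_lt (by finiteness)

lemma opNorm_limit_sub_le (hE' : E ≠ ⊤) (p : ℕ) : opNorm r (W - F p) ≤ ofReal (16 * E.toReal ^ 2 * d p) := by
  refine (opNorm_le_of_psiNorm2 hE (h.bdd_limit_sub hW hr hr' p)).trans_eq ?_
  rw [show 16 * E.toReal ^ 2 * d p = 2 * E.toReal ^ 2 * (8 * d p) by ring,
    ofReal_mul (p := 2 * E.toReal ^ 2) (by positivity),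
    ofReal_mul (p := 2) (by norm_num), ofReal_pow toReal_nonneg, ofReal_toReal hE', ofReal_ofNat]

end NearOne

/-- The size of the `p`-th generator. -/
def flowSize (ν : ℕ) (γ τ α M e : ℝ) (p : ℕ) : ℝ :=
  1800 * (actConst ν).toReal * termCount α * (ratio τ p * (M ^ α / γ * e))

namespace SmallData
variable (h : SmallData ψ γ τ α M e b₁ C V₀)
include h

lemma flowSize_nonneg (p : ℕ) : 0 ≤ flowSize ν γ τ α M e p :=
  mul_nonneg (mul_nonneg (by positivity) (termCount_nonneg α)) (mul_nonneg (ratio_pos τ p).le h.size_nonneg)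

lemma flowSize_half (p : ℕ) : flowSize ν γ τ α M e (p + 1) ≤ 1 / 2 * flowSize ν γ τ α M e p := by
  have h1 := mul_le_mul_of_nonneg_left (mul_le_mul_of_nonneg_right (ratio_succ_le_half h.τ_pos p)
    h.size_nonneg) (mul_nonneg (by positivity : 0 ≤ 1800 * (actConst ν).toReal) (termCount_nonneg α))
  rw [flowSize, flowSize]
  linarith

lemma flowSize_zero_le (hC : 14400 * (actConst ν).toReal * termCount α ≤ C) : flowSize ν γ τ α M e 0 ≤ 1 / 8 := by
  have h1 := mul_le_mul_of_nonneg_right hC (mul_nonneg (ratio_pos τ 0).le h.size_nonneg)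
  rw [flowSize]
  linarith [h.const_ratio_le 0]

section Flow
variable {ω : Freq ν} (hω : ω ∈ annulus ν M)
include hω

variable (lam) in
lemma sbdd_kamX (p : ℕ) (r : ℝ) (hr : 0 ≤ r) (hr' : r ≤ sZero ν) :
    SBdd ψ r (flowSize ν γ τ α M e p) ((𝓧 p ω).toCLM ψ) := by
  have h1 := fun δ => (decayNorm_entry_le (s := sZero ν) hω δ).trans (h.matNorm_kamX_le lam p)
  refine (sbdd_toCLM h.conjStable hr hr' (h1 true) (h1 false)).mono (le_of_eq ?_)
  rw [flowSize]; ring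

variable (hC : 14400 * (actConst ν).toReal * termCount α ≤ C)
include hC

variable (lam) in
lemma nearOne_flow : NearOne ψ (flowSize ν γ τ α M e) (flow ψ fun i => 𝓧 i ω) ∧
    NearOne ψ (flowSize ν γ τ α M e) (flowInv ψ fun i => 𝓧 i ω) :=
  KAM.nearOne_flow h.flowSize_nonneg h.flowSize_half (h.flowSize_zero_le hC) (h.sbdd_kamX lam hω)

variable (lam) in
lemma exists_flow_limit : ∃ W : (L2 ν × L2 ν) ≃L[ℂ] (L2 ν × L2 ν), Tendsto (flow ψ fun i => 𝓧 i ω) atTop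
      (nhds (W : 𝔏 ν)) ∧
    Tendsto (flowInv ψ fun i => 𝓧 i ω) atTop (nhds (W.symm : 𝔏 ν)) :=
  KAM.exists_flow_limit h.flowSize_nonneg h.flowSize_half (h.flowSize_zero_le hC) (h.sbdd_kamX lam hω)

end Flow

lemma isPhiDependent_limit {ω : Freq ν} (hω : ω ∈ annulus ν M) {W : 𝔏 ν}
    (hW : Tendsto (flow ψ fun i => 𝓧 i ω) atTop (nhds W)) : IsPhiDependent W :=
  isClosed_phiAlg.mem_of_tendsto hW (.of_forall (flow_mem_phiAlg h.conjStable fun i =>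
    fin0_of_matNorm (ne_top_of_le_ne_top ofReal_ne_top (h.matNorm_kamX_le lam i)) hω))

lemma conjugates_flow_limit (hC : 8 ≤ C) {K : ℝ} (hk : IsKAMIteration ψ lam γ₀ τ₀ γ τ α M 16 K V₀ 𝓗 𝓥 𝓧) {ω : Freq ν}
    (hω : ω ∈ omegaInf γ₀ τ₀ γ τ α M 𝓗∞) {W : (L2 ν × L2 ν) ≃L[ℂ] (L2 ν × L2 ν)}
    (hW : Tendsto (flow ψ fun i => 𝓧 i ω) atTop (nhds (W : 𝔏 ν)))
    (hW' : Tendsto (flowInv ψ fun i => 𝓧 i ω) atTop (nhds (W.symm : 𝔏 ν))) :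
    Conjugates ψ ω (W : 𝔏 ν) (diagMat lam) ((V₀ ω).toCLM ψ) (𝓗∞ ω) 0 := by
  refine h.conjugates_limit hω.1.1 (fun p => ?_) (fun p => (flow_mul_flowInv p).1)
    (ContinuousLinearMap.ext fun u => W.symm_apply_apply u) hW hW'
  induction p with
  | zero => rw [kamH_zero, kamV_zero]; exact fun u f => Iff.rfl
  | succ p ih => exact ih.comp (hk.conjugation p ω (h.omegaInf_subset hC (p + 1) hω))

variable (lam) in
lemma lipNorm_eig_le {s : ℝ} (hs : |s| ≤ 1) (n : ℕ) : ofReal (KAM.br n ^ α) * lA (fun x : ℝ => ‖x‖ₑ)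
      (fun ω => eig s (𝓗∞ ω) n - eig s (diagMat lam) n) ≤ ofReal (6 * e) := by
  have h1 : lA (fun x : ℝ => ‖x‖ₑ) (fun ω => eig s (𝓗∞ ω) n - eig s (diagMat lam) n) ≤
      3 * lA (hsBlock n) (fun ω => 𝓗∞ ω - 𝓗 0 ω) := by
    refine lipNorm_le_mul 3 (fun ω _ => ?_) fun ω₁ _ ω₂ _ => ?_
    · rw [kamH_zero]; exact enorm_eig_sub_le hs _ _ n
    · rw [kamH_zero, kamH_zero, sub_sub_sub_cancel_right, sub_sub_sub_cancel_right]
      exact enorm_eig_sub_le hs _ _ n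
  refine (mul_le_mul' le_rfl h1).trans ?_
  rw [mul_left_comm]
  refine (mul_le_mul' le_rfl (h.lipNorm_kamHinf_le lam 0 n)).trans_eq ?_
  rw [lowSize_zero, one_mul, ← ofReal_ofNat, ← ofReal_mul (by norm_num)]
  ring_nf

lemma eig_pos {c : ℝ} (hc : 6 * e < c) (hlam : ∀ j, c ≤ lam j) {ω : Freq ν}
    (hω : ω ∈ annulus ν M) (n : ℕ) : 0 < eig (-1) (𝓗∞ ω) n := by
  have h1 := (mul_le_mul' le_rfl (le_lipNorm (fun x : ℝ => ‖x‖ₑ)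
    (fun ω => eig (-1) (𝓗∞ ω) n - eig (-1) (diagMat lam) n) hω)).trans
    (h.lipNorm_eig_le lam (s := -1) (by norm_num) n)
  have h2 := (le_mul_of_one_le_left' (one_le_ofReal.2 (one_le_rpow (le_max_left 1 |(n : ℝ)|) h.α_pos.le))).trans h1
  rw [← ofReal_norm, ofReal_le_ofReal_iff (by linarith [h.e_nonneg]), norm_eq_abs, (eig_diagMat lam n).1] at h2
  linarith [(abs_le.1 h2).1, le_min (hlam n) (hlam (-n))]

end SmallData

lemma toReal_le_of_bound {m L : ℝ≥0∞} {κ : ℝ} (hL : L ≠ ⊤) (hκ : 0 < κ)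
    (h : m ≤ L * (ofReal (κ + κ ^ 2) + ofReal (κ + κ ^ 2) ^ 2))
    (h1 : m.toReal ≤ 1) : m.toReal ≤ (6 * L.toReal + 1) * κ := by
  have hL0 : 0 ≤ L.toReal := toReal_nonneg
  rcases le_total κ 1 with hk | hk
  · have h2 := toReal_mono (by finiteness) h
    rw [← ofReal_pow (by positivity), ← ofReal_add (by positivity) (by positivity),
      toReal_mul, ENNReal.toReal_ofReal (by positivity)] at h2
    have h3 : κ + κ ^ 2 ≤ 2 * κ := by nlinarith
    have h4 : κ + κ ^ 2 + (κ + κ ^ 2) ^ 2 ≤ 6 * κ := by nlinarith [sq_nonneg κ]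
    have h5 := mul_le_mul_of_nonneg_left h4 hL0
    linarith
  · nlinarith [mul_nonneg hL0 hκ.le]


end KAM

end

open KAM in
theorem theorem5p6 (ν : ℕ) (hν : 1 ≤ ν) (τ : ℝ) (hτ : 0 < τ) (α : ℝ) (hα : α ∈ Set.Ioo (0 : ℝ) 1) :
    ∃ N₀ : ℕ, 1 < N₀ ∧
    ∀ τ₀ : ℝ, (ν : ℝ) - 1 < τ₀ →
    ∃ σ : ℝ, 0 < σ ∧
    ∀ (q : Circ → ℝ), ContDiff ℝ ((⊤ : ℕ∞) : WithTop ℕ∞) (fun x : ℝ => q (x : Circ)) →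
    ∀ (ψ : HilbertBasis ℤ ℂ L2x) (lam : ℤ → ℝ), IsEigenbasis q ψ lam →
    ∃ C : ℝ, 0 < C ∧
    ∀ (S : ℝ), sZero ν + σ ≤ S →
    ∀ (v : (Fin ν → Circ) → Circ → ℝ), IsDriving S v →
    ∀ (χ : ℝ → ℝ), IsCutoff χ →
    ∃ K : ℝ, 0 < K ∧
    ∀ M γ γ₀ : ℝ, 1 ≤ M → γ ∈ Set.Ioo (0 : ℝ) 1 → γ₀ ∈ Set.Ioo (0 : ℝ) 1 →
    -- the smallness condition
    ENNReal.ofReal (C * (N₀ : ℝ) ^ (2 * τ + 2 + rho τ) * (M ^ α / γ)) *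
        matNorm (annulus ν M) (γ / M ^ α) (sZero ν + beta τ) α 0
          (magnusV ψ lam v χ γ₀ τ₀ M) ≤ 1 →
    ∃ (H : ℕ → Freq ν → Mat) (V X : ℕ → Freq ν → OpMat ν) (Hinf : Freq ν → Mat)
      (Winf : Freq ν → ((L2 ν × L2 ν) ≃L[ℂ] (L2 ν × L2 ν))) (em ep : ℕ → Freq ν → ℝ),
      IsKAMIteration ψ lam γ₀ τ₀ γ τ α M N₀ K (magnusV ψ lam v χ γ₀ τ₀ M) H V X ∧
      -- convergence of the transformations and of their inverses
      (∀ ω ∈ annulus ν M, ∀ p,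
        (flow ψ (fun i => X i ω) p).comp (flowInv ψ (fun i => X i ω) p) =
            ContinuousLinearMap.id ℂ _ ∧
        (flowInv ψ (fun i => X i ω) p).comp (flow ψ (fun i => X i ω) p) =
            ContinuousLinearMap.id ℂ _) ∧
      (∀ ω ∈ annulus ν M, ∀ r ∈ Set.Icc (0 : ℝ) (sZero ν),
        opNorm r (Winf ω : (L2 ν × L2 ν) →L[ℂ] (L2 ν × L2 ν)) < ⊤ ∧
        opNorm r ((Winf ω).symm : (L2 ν × L2 ν) →L[ℂ] (L2 ν × L2 ν)) < ⊤ ∧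
        (∀ p, opNorm r (flow ψ (fun i => X i ω) p) < ⊤ ∧
          opNorm r (flowInv ψ (fun i => X i ω) p) < ⊤) ∧
        Filter.Tendsto (fun p => opNorm r
          ((Winf ω : (L2 ν × L2 ν) →L[ℂ] (L2 ν × L2 ν)) - flow ψ (fun i => X i ω) p))
          Filter.atTop (nhds 0) ∧
        ∀ p : ℕ,
          opNorm r ((Winf ω : (L2 ν × L2 ν) →L[ℂ] (L2 ν × L2 ν)) - flow ψ (fun i => X i ω) p) ≤
            ENNReal.ofReal (K * (M ^ α / γ) * (γ₀ * M)⁻¹ * scale N₀ p ^ (2 * τ + 1) *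
              scale N₀ ((p : ℤ) - 1) ^ (-rho τ)) ∧
          opNorm r (((Winf ω).symm : (L2 ν × L2 ν) →L[ℂ] (L2 ν × L2 ν)) -
              flowInv ψ (fun i => X i ω) p) ≤
            ENNReal.ofReal (K * (M ^ α / γ) * (γ₀ * M)⁻¹ * scale N₀ p ^ (2 * τ + 1) *
              scale N₀ ((p : ℤ) - 1) ^ (-rho τ))) ∧
      (∀ ω ∈ annulus ν M,
        IsPhiDependent (Winf ω : (L2 ν × L2 ν) →L[ℂ] (L2 ν × L2 ν))) ∧
      -- the final blocks
      (∀ ω ∈ annulus ν M, ∀ j k : ℤ, j.natAbs ≠ k.natAbs → Hinf ω j k = 0) ∧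
      (∀ ω ∈ annulus ν M, ∀ n, (block (Hinf ω) n).IsHermitian) ∧
      (∀ p n : ℕ, ENNReal.ofReal (br n ^ α) *
        lipNorm (annulus ν M) (γ / M ^ α) (hsBlock n) (fun ω => Hinf ω - H p ω) ≤
          ENNReal.ofReal (K * (γ₀ * M)⁻¹ * scale N₀ ((p : ℤ) - 1) ^ (-rho τ))) ∧
      -- reducibility on the set of non-resonant frequencies
      (∀ p, omegaInf γ₀ τ₀ γ τ α M Hinf ⊆ omegaSeq γ₀ τ₀ γ τ α M N₀ H p) ∧
      (∀ ω ∈ omegaInf γ₀ τ₀ γ τ α M Hinf,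
        Conjugates ψ ω (Winf ω : (L2 ν × L2 ν) →L[ℂ] (L2 ν × L2 ν))
          (diagMat lam) ((magnusV ψ lam v χ γ₀ τ₀ M ω).toCLM ψ) (Hinf ω) 0) ∧
      -- eigenvalues of the final blocks
      (∀ ω ∈ annulus ν M, ∀ n, 0 < em n ω ∧ em n ω ≤ ep n ω ∧
        spectrum ℂ (block (Hinf ω) n) = {(em n ω : ℂ), (ep n ω : ℂ)}) ∧
      (∀ n : ℕ,
        ENNReal.ofReal (br n ^ α) * lipNorm (annulus ν M) (γ / M ^ α) (fun x : ℝ => ‖x‖ₑ)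
          (fun ω => em n ω - min (lam n) (lam (-n))) ≤ ENNReal.ofReal (K * (γ₀ * M)⁻¹) ∧
        ENNReal.ofReal (br n ^ α) * lipNorm (annulus ν M) (γ / M ^ α) (fun x : ℝ => ‖x‖ₑ)
          (fun ω => ep n ω - max (lam n) (lam (-n))) ≤ ENNReal.ofReal (K * (γ₀ * M)⁻¹)) := by
  refine ⟨16, by norm_num, fun τ₀ hτ₀ => ?_⟩
  have hβ : 0 < beta τ := by rw [beta, rho]; linarith
  have hτ₀' : 0 ≤ τ₀ := by have : (1 : ℝ) ≤ ν := by exact_mod_cast hν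
                           linarith
  refine ⟨2 * (sZero ν + beta τ + 2 * τ₀ + ν + 6) + 4, by positivity, fun q hq ψ lam h => ?_⟩
  obtain ⟨c, hc, -, hlam, -⟩ := h.exists_lam_bounds
  have hlam : ∀ j, c ≤ lam j := fun j =>
    (le_mul_of_one_le_right hc.le (le_max_left _ _)).trans (hlam j)
  obtain ⟨E, hE, hequiv⟩ := h.exists_sobNorm_equiv hq ν
  set b₁ := (brConst ν α (sZero ν + beta τ)).toReal with hb₁
  have ht : 0 < termCount α := zero_lt_one.trans_le (one_le_termCount α)
  set a := (actConst ν).toReal with ha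
  have hb0 : 0 ≤ b₁ := ENNReal.toReal_nonneg
  have ha0 : 0 ≤ a := ENNReal.toReal_nonneg
  set C := 2 * (800 * b₁ * termCount α) + 4 + (4 + 14400 * a * termCount α + 7 / c) with hC
  have hC1 : 0 ≤ 800 * b₁ * termCount α := by positivity
  have hC2 : 0 ≤ 14400 * a * termCount α := by positivity
  have hC3 : 0 < 7 / c := by positivity
  refine ⟨C, by positivity, fun S hS v hv χ hχ => ?_⟩
  obtain ⟨L, hL, hbd⟩ := exists_matNorm_magnusV_le h hq hv hχ hτ₀'
    (le_add_of_nonneg_right hβ.le : (sZero ν : ℝ) ≤ sZero ν + beta τ)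
    (by linarith [Nat.cast_nonneg (α := ℝ) (sZero ν)]) hα.1.le hα.2.le
  have hL0 : 0 ≤ L.toReal := ENNReal.toReal_nonneg
  set K := 100 * termCount α + (6 + 28800 * E.toReal ^ 2 * a * termCount α) * (6 * L.toReal + 1)
    with hK
  refine ⟨K, by positivity, fun M γ γ₀ hM hγ hγ₀ hsmall => ?_⟩
  have hM0 : 0 < M := zero_lt_one.trans_le hM
  have hMα : 1 ≤ M ^ α := Real.one_le_rpow hM hα.1.le
  have hκ : 0 < γ₀ * M := mul_pos hγ₀.1 hM0
  obtain ⟨hV, hY⟩ := hbd (annulus ν M) (γ / M ^ α)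
    ((div_le_one (by positivity)).2 (hγ.2.le.trans hMα)) γ₀ M hκ
  set m := matNorm (annulus ν M) (γ / M ^ α) (sZero ν + beta τ) α 0
    (magnusV ψ lam v χ γ₀ τ₀ M) with hm
  have hmt : m ≠ ⊤ := ne_top_of_le_ne_top (by finiteness) hV
  have he0 : 0 ≤ m.toReal := ENNReal.toReal_nonneg
  have hMγ : 1 ≤ M ^ α / γ := (one_le_div hγ.1).2 (hγ.2.le.trans hMα)
  have hd : SmallData ψ γ τ α M m.toReal b₁ C (magnusV ψ lam v χ γ₀ τ₀ M) :=
    { conjStable := h.conjStable, τ_pos := hτ, α_pos := hα.1, γ_pos := hγ.1, M_pos := hM0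
      ham := fun ω hω => isHam_magnusV h hv hχ (hY ω hω).1 (hY ω hω).2
      e_nonneg := he0, norm := (ENNReal.ofReal_toReal hmt).ge, b_nonneg := hb0
      br := (ENNReal.ofReal_toReal (brConst_ne_top _ _ _)).ge
      const := by linarith
      small := by
        have := ENNReal.toReal_mono ENNReal.one_ne_top hsmall
        rw [ENNReal.toReal_mul, ENNReal.toReal_ofReal (by positivity), ENNReal.toReal_one] at this
        rwa [← mul_assoc] }
  have hCe : C * m.toReal ≤ 1 := by
    have h1 := hd.const_mul_le (x := 1) (Real.one_le_rpow (by norm_num) (by rw [rho]; linarith))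
    have h2 := mul_le_mul_of_nonneg_left (le_mul_of_one_le_left he0 hMγ) hd.C_pos.le
    linarith
  have hec : 6 * m.toReal < c := by
    have h1 := mul_le_mul_of_nonneg_right (by linarith : 7 / c ≤ C) he0
    have h2 : 7 / c * m.toReal ≤ 1 := h1.trans hCe
    rw [div_mul_eq_mul_div, div_le_one hc] at h2
    linarith
  have heκ : m.toReal ≤ (6 * L.toReal + 1) * (γ₀ * M)⁻¹ := by
    refine toReal_le_of_bound hL (by positivity) hV ?_
    have := mul_le_mul_of_nonneg_right (by linarith : 1 ≤ C) he0
    linarith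
  have hKe : ∀ x, 0 ≤ x → x ≤ 6 → x * m.toReal ≤ K * (γ₀ * M)⁻¹ := fun x hx hx6 => by
    have h1 := mul_le_mul hx6 heκ he0 (by norm_num)
    have h2 : 0 ≤ (100 * termCount α + 28800 * E.toReal ^ 2 * a * termCount α *
      (6 * L.toReal + 1)) * (γ₀ * M)⁻¹ := by positivity
    rw [hK]
    linarith
  have hk := hd.isKAMIteration lam (γ₀ := γ₀) (τ₀ := τ₀) (K := K)
    (ENNReal.ofReal_toReal hmt).symm (hKe 2 (by norm_num) (by norm_num))
    (le_add_of_nonneg_right (by positivity))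
  have hflow : ∀ p, ENNReal.ofReal (16 * E.toReal ^ 2 * flowSize ν γ τ α M m.toReal p) ≤
      ENNReal.ofReal (K * (M ^ α / γ) * (γ₀ * M)⁻¹ * scale 16 p ^ (2 * τ + 1) *
        scale 16 ((p : ℤ) - 1) ^ (-rho τ)) := fun p => by
    refine ENNReal.ofReal_le_ofReal ?_
    have hr := ratio_pos τ p
    have h1 : 28800 * E.toReal ^ 2 * a * termCount α * m.toReal ≤ K * (γ₀ * M)⁻¹ := by
      have h1 := mul_le_mul_of_nonneg_left heκ
        (by positivity : 0 ≤ 28800 * E.toReal ^ 2 * a * termCount α)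
      have h2 : 0 ≤ (100 * termCount α + 6 * (6 * L.toReal + 1)) * (γ₀ * M)⁻¹ := by positivity
      rw [hK]
      linarith
    have h2 := mul_le_mul_of_nonneg_right h1
      (by positivity : 0 ≤ M ^ α / γ * ratio τ p)
    rw [flowSize]
    rw [ratio] at h2 ⊢
    linarith
  have hCa : 14400 * a * termCount α ≤ C := by linarith
  classical
  have hlim : ∀ ω, ∃ W : (L2 ν × L2 ν) ≃L[ℂ] (L2 ν × L2 ν), ω ∈ annulus ν M → _ := fun ω =>
    if hω : ω ∈ annulus ν M then
      let ⟨W, hW⟩ := hd.exists_flow_limit lam hω hCa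
      ⟨W, fun _ => hW⟩
    else ⟨.refl ℂ _, fun h => absurd h hω⟩
  choose W hW using hlim
  have ez : ∀ p, 2 * (lowSize τ p * m.toReal) ≤
      K * (γ₀ * M)⁻¹ * scale 16 ((p : ℤ) - 1) ^ (-rho τ) := fun p => by
    have := mul_le_mul_of_nonneg_right (hKe 2 (by norm_num) (by norm_num)) (lowSize_pos τ p).le
    rw [lowSize] at this ⊢
    linarith
  refine ⟨_, _, _, kamHinf ψ lam γ τ α M (magnusV ψ lam v χ γ₀ τ₀ M), W,
    fun n ω => eig (-1) (kamHinf ψ lam γ τ α M (magnusV ψ lam v χ γ₀ τ₀ M) ω) n,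
    fun n ω => eig 1 (kamHinf ψ lam γ τ α M (magnusV ψ lam v χ γ₀ τ₀ M) ω) n, hk,
    fun ω _ p => flow_mul_flowInv p, fun ω hω r hr => ?_,
    fun ω hω => hd.isPhiDependent_limit hω (hW ω hω).1,
    fun ω hω j k => hd.kamHinf_blockDiag hω, fun ω hω => hd.kamHinf_hermitian hω,
    fun p n => (hd.lipNorm_kamHinf_le lam p n).trans (ENNReal.ofReal_le_ofReal (ez p)),
    hd.omegaInf_subset (by linarith),
    fun ω hω => hd.conjugates_flow_limit (by linarith) hk hω (hW ω hω.1.1).1 (hW ω hω.1.1).2,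
    fun ω hω n => ⟨hd.eig_pos hec hlam hω n, eig_le _ n,
      spectrum_block (hd.kamHinf_hermitian hω n)⟩, fun n => ?_⟩
  · obtain ⟨n₁, n₂⟩ := hd.nearOne_flow lam hω hCa
    have hequiv := hequiv r hr.1 hr.2
    have b₁ := n₁.opNorm_limit_sub_le (hW ω hω).1 hr.1 hr.2 hequiv hE
    have b₂ := n₂.opNorm_limit_sub_le (hW ω hω).2 hr.1 hr.2 hequiv hE
    refine ⟨n₁.opNorm_limit_lt_top (hW ω hω).1 hr.1 hr.2 hequiv hE,
      n₂.opNorm_limit_lt_top (hW ω hω).2 hr.1 hr.2 hequiv hE,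
      fun p => ⟨n₁.opNorm_lt_top hr.1 hr.2 hequiv hE p, n₂.opNorm_lt_top hr.1 hr.2 hequiv hE p⟩,
      tendsto_of_tendsto_of_tendsto_of_le_of_le tendsto_const_nhds ?_ (fun _ => zero_le) b₁,
      fun p => ⟨(b₁ p).trans (hflow p), (b₂ p).trans (hflow p)⟩⟩
    have := ENNReal.tendsto_ofReal ((tendsto_zero_of_half hd.flowSize_nonneg
      hd.flowSize_half).const_mul (16 * E.toReal ^ 2))
    rwa [mul_zero, ENNReal.ofReal_zero] at this
  · have h6 := ENNReal.ofReal_le_ofReal (hKe 6 (by norm_num) le_rfl)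
    have h₁ := (hd.lipNorm_eig_le lam (s := -1) (by norm_num) n).trans h6
    have h₂ := (hd.lipNorm_eig_le lam (s := 1) (by norm_num) n).trans h6
    rw [(eig_diagMat lam n).1] at h₁
    rw [(eig_diagMat lam n).2] at h₂
    exact ⟨h₁, h₂⟩
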